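/- **Notation.** Let $\langle x\rangle=(1+|x|^2)^{1/2}$. For $f\in\mathcal S'(\mathbb R^N,E)$ ($E$ a finite-dimensional complex normed space) and $0\neq g\in\mathcal S(\mathbb R^N)$, let $V_gf(x,\xi)=\langle f,M_\xi T_xg\rangle$, where $(M_\xi T_xg)(y)=e^{2\pi i y\cdot\xi}g(y-x)$ and $\langle\cdot,\cdot\rangle$ extends $\int f\,\overline{g}$. For $1\le p,q\le\infty$ and $r,s\in\mathbb R$ put $$\|f\|_{M^{p,q}_{r,s}}=\Big\|\langle\xi\rangle^{s}\,\big\|\langle x\rangle^{r}V_gf(x,\xi)\big\|_{L^p(dx)}\Big\|_{L^q(d\xi)},\qquad \|f\|_{W^{p,q}_{r,s}}=\Big\|\langle x\rangle^{s}\,\big\|\langle \xi\rangle^{r}V_gf(x,\xi)\big\|_{L^p(d\xi)}\Big\|_{L^q(dx)}.$$ $M^{p,q}_{r,s}(\mathbb R^N,E)$ and $W^{p,q}_{r,s}(\mathbb R^N,E)$ are the spaces of $f\in\mathcal S'(\mathbb R^N,E)$ with finite norm, and $\mathcal M^{p,q}_{r,s}(\mathbb R^N,E)$, $\mathcal W^{p,q}_{r,s}(\mathbb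 R^N,E)$ are the closures of $\mathcal S(\mathbb R^N,E)$ in them. A map $t\mapsto\sigma(t,\cdot)\in M^{\infty,1}_{0,\kappa}(\mathbb R^{N},E)$ on $[0,T]$ is *continuous for the narrow convergence* if it is weakly continuous into $\mathcal S'(\mathbb R^{N},E)$ and there are a nonzero window $g\in\mathcal S(\mathbb R^{N})$ and a function $h$ with $\langle\cdot\rangle^{\kappa}h\in L^1(\mathbb R^{N})$ such that, for all $t\in[0,T]$, $\sup_{z}|V_g\sigma(t,\cdot)(z,\zeta)|_E\le h(\zeta)$ for a.e. $\zeta$. For $\sigma\in\mathcal S'(\mathbb R^{2d},\mathbb C^{n\times n})$, the Weyl operator $\sigma^{\mathrm w}:\mathcal S(\mathbb R^d,\mathbb C^n)\to\mathcal S'(\mathbb R^d,\mathbb C^n)$ is defined weakly by $$\langle\sigma^{\mathrm w}f,\varphi\rangle=\int_{\mathbb R^{2d}}\sigma(x,\xi)\,W(f,\varphi)(x,\xi)\,dx\,d\xi,\qquad W(f,\varphi)(x,\xi)=\int_{\mathbb R^d}e^{-2\pi i y\cdot\xi}f(x+\tfrac y2)\overline{\varphi(x-\tfrac y2)}\,dy,\quad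 \varphi\in\mathcal S(\mathbb R^d).$$ Let $m\ge0$, let $\alpha_0,\dots,\alpha_d\in\mathbb C^{n\times n}$ be Hermitian matrices with $\alpha_i\alpha_j+\alpha_j\alpha_i=2\delta_{ij}I_n$, and let $\mathcal D_m=2\pi m\alpha_0-i\sum_{j=1}^d\alpha_j\partial_j$. **Theorem.** Let $1\le p,q\le\infty$, $\gamma\ge0$ and $r,s\in\mathbb R$ with $|r|+|s|\le\gamma$, and let $X$ be either $\mathcal M^{p,q}_{r,s}(\mathbb R^d,\mathbb C^n)$ or $\mathcal W^{p,q}_{r,s}(\mathbb R^d,\mathbb C^n)$, normed by means of any fixed nonzero window. Let $T>0$ and let $[0,T]\ni t\mapsto\sigma(t,\cdot)\in M^{\infty,1}_{0,2\gamma}(\mathbb R^{2d},\mathbb C^{n\times n})$ be continuous for the narrow convergence. Then, for each $t\in[0,T]$, $\sigma(t,\cdot)^{\mathrm w}$ extends to a bounded operator $V(t)$ on $X$, and for every $\psi_0\in X$ there is a unique $\psi\in C([0,T],X)$ with $$i\partial_t\psi(t)=(\mathcal D_m+V(t))\psi(t)\quad(0\le t\le T),\qquad \psi(0)=\psi_0,$$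 where the equation holds in $\mathcal S'(\mathbb R^d,\mathbb C^n)$, tested against each $\varphi\in\mathcal S(\mathbb R^d)$. The propagator $U(t):\psi_0\mapsto\psi(t)$ is a bounded linear operator on $X$, with $\sup_{0\le t\le T}\|U(t)\|_{X\to X}<\infty$. It is the sum of the Dyson–Phillips series $U(t)=\sum_{k\ge0}U_k(t)$, which converges in operator norm on $X$ uniformly in $t\in[0,T]$; here $U_0(t)=e^{-it\mathcal D_m}$ is the Fourier multiplier with symbol $\exp\big[-2\pi it\big(m\alpha_0+\sum_{j=1}^d\xi_j\alpha_j\big)\big]$, and the $U_k(t)$ are bounded operators on $X$ with $U_{k+1}(t)f=-i\int_0^tU_0(t-\tau)V(\tau)U_k(\tau)f\,d\tau$ for $f\in X$ (the integral being taken in $\mathcal S'$, i.e. after pairing with test functions). -/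

import Mathlib

open MeasureTheory Filter Topology Set
open scoped SchwartzMap ENNReal NNReal LineDeriv ComplexConjugate

noncomputable section

namespace DiracTF

/-- The Japanese bracket `⟨x⟩ = (1 + |x|²)^{1/2}`. -/
def bracket {V : Type*} [NormedAddCommGroup V] (x : V) : ℝ := Real.sqrt (1 + ‖x‖ ^ 2)

section TimeFrequency

variable {V : Type*} [NormedAddCommGroup V] [InnerProductSpace ℝ V]

/-- The character `y ↦ e^{-2πi y·ξ}`. -/
def character (ξ y : V) : ℂ :=
  Complex.exp (-(2 * Real.pi * Complex.I * (inner ℝ y ξ : ℝ)))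

theorem character_hasTemperateGrowth (ξ : V) :
    (character ξ).HasTemperateGrowth := by
  have key : (fun t : ℝ =>
      Complex.exp ((-(2 * Real.pi * Complex.I)) * (t : ℂ))).HasTemperateGrowth := by
    have hd : ∀ k : ℕ, iteratedDeriv k
        (fun t : ℝ => Complex.exp ((-(2 * Real.pi * Complex.I)) * (t : ℂ))) =
        fun t : ℝ => (-(2 * Real.pi * Complex.I)) ^ k *
          Complex.exp ((-(2 * Real.pi * Complex.I)) * (t : ℂ)) := by
      intro k
      induction k with
      | zero => simp
      | succ k ih =>
        rw [iteratedDeriv_succ, ih]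
        funext t
        have h1 : HasDerivAt (fun t : ℝ => (-(2 * Real.pi * Complex.I)) * (t : ℂ))
            (-(2 * Real.pi * Complex.I)) t := by
          simpa using (Complex.ofRealCLM.hasDerivAt (x := t)).const_mul (-(2 * Real.pi * Complex.I))
        rw [((h1.cexp).const_mul _).deriv]
        ring
    refine ⟨?_, fun k => ⟨0, (2 * Real.pi) ^ k, fun t => ?_⟩⟩
    · exact (contDiff_const.mul Complex.ofRealCLM.contDiff).cexp
    · rw [norm_iteratedFDeriv_eq_norm_iteratedDeriv, hd]
      have h2 : ‖Complex.exp ((-(2 * Real.pi * Complex.I)) * (t : ℂ))‖ = 1 := by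
        rw [Complex.norm_exp]
        simp
      rw [norm_mul, h2]
      simp [abs_of_pos Real.pi_pos]
  have h := key.comp (Function.hasTemperateGrowth_inner_left ξ)
  convert h using 1
  funext y
  simp [character]

/-- The Schwartz function `y ↦ conj ((M_ξ T_x g)(y)) = e^{-2πi y·ξ} conj (g (y - x))`. -/
def conjAtom (g : 𝓢(V, ℂ)) (x ξ : V) : 𝓢(V, ℂ) :=
  SchwartzMap.smulLeftCLM ℂ (character ξ)
    (SchwartzMap.postcompCLM (𝕜 := ℝ) (Complex.conjCLE : ℂ →L[ℝ] ℂ)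
      (SchwartzMap.compSubConstCLM ℝ x g))

theorem conjAtom_apply (g : 𝓢(V, ℂ)) (x ξ y : V) :
    conjAtom g x ξ y = character ξ y * conj (g (y - x)) := by
  simp [conjAtom, SchwartzMap.smulLeftCLM_apply_apply (character_hasTemperateGrowth ξ)]

variable {F : Type*} [NormedAddCommGroup F] [NormedSpace ℂ F]

/-- The short-time Fourier transform `V_g f (x, ξ) = ⟨f, M_ξ T_x g⟩` of a vector-valued tempered
distribution. Mathlib's pairing between `𝓢'` and `𝓢` is bilinear, so the conjugate
of the time-frequency shift of `g` is inserted. -/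
def stft (g : 𝓢(V, ℂ)) (f : 𝓢'(V, F)) (x ξ : V) : F := f (conjAtom g x ξ)

variable [FiniteDimensional ℝ V] [MeasurableSpace V] [BorelSpace V]

/-- The weighted mixed norm
`‖ ⟨v⟩^s ‖ ⟨u⟩^r G(u, v) ‖_{L^p(du)} ‖_{L^q(dv)}`, with values in `[0, ∞]`. -/
def mixedNorm (p q : ℝ≥0∞) (r s : ℝ) (G : V → V → F) : ℝ≥0∞ :=
  eLpNorm (fun v : V => ENNReal.ofReal (bracket v ^ s) *
    eLpNorm (fun u : V => bracket u ^ r * ‖G u v‖) p volume) q volume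

/-- The norm of the modulation space `M^{p,q}_{r,s}`, computed with the window `g`. -/
def modulationNorm (p q : ℝ≥0∞) (r s : ℝ) (g : 𝓢(V, ℂ)) (f : 𝓢'(V, F)) : ℝ≥0∞ :=
  mixedNorm p q r s (fun x ξ => stft g f x ξ)

/-- The norm of the Wiener amalgam space `W^{p,q}_{r,s}`, computed with the window `g`:
the inner `L^p_r` norm is in the frequency, the outer `L^q_s` norm in the position. -/
def amalgamNorm (p q : ℝ≥0∞) (r s : ℝ) (g : 𝓢(V, ℂ)) (f : 𝓢'(V, F)) : ℝ≥0∞ :=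
  mixedNorm p q r s (fun ξ x => stft g f x ξ)

/-- Membership in the modulation space `M^{p,q}_{r,s}`. -/
def MemModulation (p q : ℝ≥0∞) (r s : ℝ) (f : 𝓢'(V, F)) : Prop :=
  ∃ g : 𝓢(V, ℂ), g ≠ 0 ∧ modulationNorm p q r s g f < ∞

/-- Continuity for the narrow convergence in `M^{∞,1}_{0,κ}` of a map `σ` on the set `Ω`. The
topology on `𝓢'` is that of pointwise convergence on test functions. -/
structure NarrowlyContinuousOn (κ : ℝ) (σ : ℝ → 𝓢'(V, F)) (Ω : Set ℝ) : Prop where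
  mem : ∀ ν ∈ Ω, MemModulation ∞ 1 0 κ (σ ν)
  continuousOn : ContinuousOn σ Ω
  dominated : ∃ h : V → ℝ, Integrable (fun ζ => bracket ζ ^ κ * h ζ) ∧
    ∃ g : 𝓢(V, ℂ), g ≠ 0 ∧ ∀ ν ∈ Ω, ∀ᵐ ζ : V, ∀ z : V, ‖stft g (σ ν) z ζ‖ ≤ h ζ

/-- The closure of the Schwartz class with respect to the norm `N`. -/
def schwartzClosure [CompleteSpace F] (N : 𝓢'(V, F) → ℝ≥0∞) : Set 𝓢'(V, F) :=
  {f | N f < ∞ ∧ ∀ ε : ℝ≥0∞, 0 < ε → ∃ φ : 𝓢(V, F), N (f - (φ : 𝓢'(V, F))) < ε}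

/-- `A` restricts to a bounded linear operator on the space `X` normed by `N`. -/
structure IsBoundedOn (N : 𝓢'(V, F) → ℝ≥0∞) (X : Set 𝓢'(V, F))
    (A : 𝓢'(V, F) → 𝓢'(V, F)) : Prop where
  mapsTo : MapsTo A X X
  map_add : ∀ f ∈ X, ∀ g ∈ X, A (f + g) = A f + A g
  map_smul : ∀ c : ℂ, ∀ f ∈ X, A (c • f) = c • A f
  bound : ∃ C : ℝ≥0, ∀ f ∈ X, N (A f) ≤ C * N f

/-- `ψ` restricted to `[0, T]` belongs to `C([0, T], X)`, where `X` is normed by `N`. -/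
structure IsContinuousCurve (N : 𝓢'(V, F) → ℝ≥0∞) (X : Set 𝓢'(V, F)) (T : ℝ)
    (ψ : ℝ → 𝓢'(V, F)) : Prop where
  mem : ∀ t ∈ Icc 0 T, ψ t ∈ X
  tendsto : ∀ t₀ ∈ Icc 0 T, Tendsto (fun t => N (ψ t - ψ t₀)) (𝓝[Icc 0 T] t₀) (𝓝 0)

end TimeFrequency

/-- The configuration space `ℝ^d`. -/
abbrev Pos (d : ℕ) := EuclideanSpace ℝ (Fin d)

/-- The phase space `ℝ^{2d} = ℝ^d × ℝ^d`, with the Euclidean structure. -/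
abbrev Phase (d : ℕ) := WithLp 2 (Pos d × Pos d)

/-- The space `ℂ^n`, with the Hermitian structure. -/
abbrev Spinor (n : ℕ) := EuclideanSpace ℂ (Fin n)

/-- The space `ℂ^{n × n}` of matrices, regarded as operators on `ℂ^n`. -/
abbrev SpinorOp (n : ℕ) := Spinor n →L[ℂ] Spinor n

section Weyl

variable {d n : ℕ}

/-- The cross-Wigner distribution
`W(a, b)(x, ξ) = ∫ e^{-2πi y·ξ} a(x + y/2) conj (b(x - y/2)) dy` of scalar functions. -/
def wigner (a b : Pos d → ℂ) (z : Phase d) : ℂ :=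
  ∫ y : Pos d, character z.snd y *
    (a (z.fst + (1 / 2 : ℝ) • y) * conj (b (z.fst - (1 / 2 : ℝ) • y)))

/-- `u = σ^w f`: the Weyl transform with distributional symbol `σ`, applied to the Schwartz
function `f`, is the distribution `u`. By definition
`⟨σ^w f, φ⟩ = ∫ σ(z) W(f, φ)(z) dz` for every scalar test function `φ`; here
`W(f, φ)` is the `ℂ^n`-valued Wigner distribution, with components `W(f_j, φ)`, which are Schwartz
functions. In Mathlib's bilinear pairing `u φ = ⟨u, conj φ⟩`. -/
def IsWeylTransform (σ : 𝓢'(Phase d, SpinorOp n)) (f : 𝓢(Pos d, Spinor n))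
    (u : 𝓢'(Pos d, Spinor n)) : Prop :=
  ∀ φ : 𝓢(Pos d, ℂ), ∃ Φ : Fin n → 𝓢(Phase d, ℂ),
    (∀ j z, Φ j z = wigner (fun y => f y j) (fun y => conj (φ y)) z) ∧
    u φ = ∑ j, σ (Φ j) (EuclideanSpace.single j 1)

/-- `A` is the bounded operator on `X` that extends the Weyl operator `σ^w` from the Schwartz
class. -/
structure IsWeylOperatorOn (N : 𝓢'(Pos d, Spinor n) → ℝ≥0∞) (X : Set 𝓢'(Pos d, Spinor n))
    (σ : 𝓢'(Phase d, SpinorOp n)) (A : 𝓢'(Pos d, Spinor n) → 𝓢'(Pos d, Spinor n)) : Prop where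
  bounded : IsBoundedOn N X A
  extends_weyl : ∀ f : 𝓢(Pos d, Spinor n), IsWeylTransform σ f (A (f : 𝓢'(Pos d, Spinor n)))

end Weyl

section Dirac

variable {d n : ℕ}

/-- Dirac matrices: Hermitian `n × n` matrices `α_0, …, α_d` with
`α_i α_j + α_j α_i = 2 δ_{ij} I_n`. -/
structure IsDiracMatrices (α : Fin (d + 1) → Matrix (Fin n) (Fin n) ℂ) : Prop where
  hermitian : ∀ i, (α i).IsHermitian
  anticomm : ∀ i j, α i * α j + α j * α i = if i = j then 2 else 0

/-- The pointwise action of a constant matrix on a `ℂ^n`-valued distribution. -/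
def matAct (A : Matrix (Fin n) (Fin n) ℂ) (f : 𝓢'(Pos d, Spinor n)) : 𝓢'(Pos d, Spinor n) :=
  PointwiseConvergenceCLM.postcomp 𝓢(Pos d, ℂ) (Matrix.toEuclideanCLM (𝕜 := ℂ) A) f

/-- The Dirac operator `D_m = 2πm α_0 - i ∑_j α_j ∂_j` on tempered distributions. -/
def diracOp (m : ℝ) (α : Fin (d + 1) → Matrix (Fin n) (Fin n) ℂ) (f : 𝓢'(Pos d, Spinor n)) :
    𝓢'(Pos d, Spinor n) :=
  (2 * Real.pi * m : ℂ) • matAct (α 0) f -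
    Complex.I • ∑ j : Fin d, matAct (α j.succ) (∂_{(EuclideanSpace.single j (1 : ℝ) : Pos d)} f)

/-- The matrix symbol `exp(-2πi t (m α_0 + ∑_j ξ_j α_j))` of the free Dirac propagator. -/
def freeSymbol (m : ℝ) (α : Fin (d + 1) → Matrix (Fin n) (Fin n) ℂ) (t : ℝ) (ξ : Pos d) :
    Matrix (Fin n) (Fin n) ℂ :=
  NormedSpace.exp ((-(2 * Real.pi * Complex.I * t) : ℂ) •
    ((m : ℂ) • α 0 + ∑ j : Fin d, (ξ j : ℂ) • α j.succ))

/-- The free Dirac propagator `e^{-itD_m}`, the Fourier multiplier with symbol `freeSymbol m α t`,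
written out over the matrix entries of the symbol. -/
def freePropagator (m : ℝ) (α : Fin (d + 1) → Matrix (Fin n) (Fin n) ℂ) (t : ℝ)
    (f : 𝓢'(Pos d, Spinor n)) : 𝓢'(Pos d, Spinor n) :=
  ∑ k, ∑ j, matAct (Matrix.single k j 1)
    (TemperedDistribution.fourierMultiplierCLM (Spinor n) (fun ξ => freeSymbol m α t ξ k j) f)

/-- `ψ ∈ C([0, T], X)` is a solution of `i ∂_t ψ = (D_m + V(t)) ψ`, `ψ(0) = ψ₀`, where the
equation holds in the sense of tempered distributions for each `t ∈ [0, T]`. -/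
structure IsSolution (m : ℝ) (α : Fin (d + 1) → Matrix (Fin n) (Fin n) ℂ)
    (N : 𝓢'(Pos d, Spinor n) → ℝ≥0∞) (X : Set 𝓢'(Pos d, Spinor n)) (T : ℝ)
    (V : ℝ → 𝓢'(Pos d, Spinor n) → 𝓢'(Pos d, Spinor n)) (ψ₀ : 𝓢'(Pos d, Spinor n))
    (ψ : ℝ → 𝓢'(Pos d, Spinor n)) : Prop where
  curve : IsContinuousCurve N X T ψ
  initial : ψ 0 = ψ₀
  equation : ∀ t ∈ Icc 0 T, ∀ φ : 𝓢(Pos d, ℂ), ∃ w : Spinor n,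
    HasDerivWithinAt (fun τ => ψ τ φ) w (Icc 0 T) t ∧
    Complex.I • w = (diracOp m α (ψ t) + V t (ψ t)) φ

/-- `D 0, D 1, …` are the terms of the Dyson–Phillips series: bounded operators on `X` with
`D_0(t) = e^{-itD_m}` and `D_{k+1}(t) ψ = -i ∫_0^t e^{-i(t-τ)D_m} V(τ) D_k(τ) ψ dτ`, the integral
being evaluated on test functions. -/
structure IsDysonPhillips (m : ℝ) (α : Fin (d + 1) → Matrix (Fin n) (Fin n) ℂ)
    (N : 𝓢'(Pos d, Spinor n) → ℝ≥0∞) (X : Set 𝓢'(Pos d, Spinor n)) (T : ℝ)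
    (V : ℝ → 𝓢'(Pos d, Spinor n) → 𝓢'(Pos d, Spinor n))
    (D : ℕ → ℝ → 𝓢'(Pos d, Spinor n) → 𝓢'(Pos d, Spinor n)) : Prop where
  bounded : ∀ k, ∀ t ∈ Icc 0 T, IsBoundedOn N X (D k t)
  zero : ∀ t ∈ Icc 0 T, ∀ f ∈ X, D 0 t f = freePropagator m α t f
  succ : ∀ k, ∀ t ∈ Icc 0 T, ∀ f ∈ X, ∀ φ : 𝓢(Pos d, ℂ),
    IntervalIntegrable (fun τ => freePropagator m α (t - τ) (V τ (D k τ f)) φ) volume 0 t ∧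
    D (k + 1) t f φ =
      -(Complex.I • ∫ τ in (0 : ℝ)..t, freePropagator m α (t - τ) (V τ (D k τ f)) φ)

end Dirac

end DiracTF

end

open DiracTF

/-! The short-time Fourier transform turns operators into matrices indexed by phase space. By the
inversion formula `integral_coef_smul_stft`, the transform of `A f` at `z` is an integral of the
transform of `f` at `w` against the matrix of `A` between time-frequency shifts of the window. If
this matrix is dominated by a convolution kernel `H(z - w)`, then `A` is bounded for every solid
norm of the transform that obeys Young's inequality with the weight `((1 + |x|)(1 + |ξ|))^γ` on `H`.
The mixed norms obey it, by Minkowski's inequality and the moderateness of `⟨·⟩^r` and `⟨·⟩^s` for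
`|r|, |s| ≤ γ`. Modulation and amalgam norms differ only by an exchange of the two variables, so one
abstract notion, `SolidNorm`, covers both.

Both operators of the equation have such matrices. For the Weyl operator, the Wigner distribution of
two Gaussian atoms is again a Gaussian atom on the doubled space (`wignerB_atom`). The matrix entry
is therefore, up to a constant and a phase, the short-time Fourier transform of the symbol at the
midpoint of `w` and `z` and at the frequency `J(z - w)`, with `J` symplectic. Narrow continuity
bounds it by a function of `z - w`, uniformly in time, and `(1 + |x|)(1 + |ξ|) ≤ 2⟨(x, ξ)⟩²`
explains the weight `2γ`. For the free propagator, the symbol is the exponential of a skew-adjoint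
matrix affine in `ξ`. Its derivatives are bounded uniformly in `ξ` and locally uniformly in time
(`exists_norm_iteratedFDeriv_exp_le`), so the multiplier merely replaces the window of an atom by
one from a bounded set, and its matrix decays rapidly off the diagonal.

Domination uniform in time, together with weak continuity in time, gives strong continuity on
Schwartz functions by dominated convergence in a weighted `L^1` space. Density extends it to the
closure of the Schwartz class, which is a Banach space because the norms have the Fatou property.

On this Banach space the interaction-picture potential `W(t) = U₀(-t) V(t) U₀(t)` is bounded and
strongly continuous, and the Dyson series of `i y' = W y` converges with terms of size `(C T)^k /
k!`. A product rule for the pairing with test functions shows that `U₀(t) y(t)` solves the Dirac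
equation. Conversely, for any solution `ψ` the curve `U₀(-t) ψ(t)` solves the interaction equation
weakly; the derivative is continuous, hence strong, and Gronwall's inequality gives uniqueness. -/

open MeasureTheory Filter Topology Set
open scoped SchwartzMap ENNReal NNReal LineDeriv ComplexConjugate FourierTransform

noncomputable section

namespace DiracTF

set_option linter.unusedSectionVars false

/-! ### Schwartz norms and integrals of families of Schwartz functions -/

section

section SchwartzNorms

variable {V : Type*} [NormedAddCommGroup V] [NormedSpace ℝ V]
  {W : Type*} [NormedAddCommGroup W] [NormedSpace ℝ W]
  {F : Type*} [NormedAddCommGroup F] [NormedSpace ℂ F]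
  {G : Type*} [NormedAddCommGroup G] [NormedSpace ℂ G]

/-- An increasing sequence of seminorms that defines the topology of the Schwartz space. -/
def schwartzNorm (V F : Type*) [NormedAddCommGroup V] [NormedSpace ℝ V] [NormedAddCommGroup F]
    [NormedSpace ℂ F] (K : ℕ) : Seminorm ℂ 𝓢(V, F) :=
  (Finset.Iic (K, K)).sup (schwartzSeminormFamily ℂ V F)

theorem schwartzNorm_mono {K L : ℕ} (h : K ≤ L) (φ : 𝓢(V, F)) :
    schwartzNorm V F K φ ≤ schwartzNorm V F L φ := by
  have : schwartzNorm V F K ≤ schwartzNorm V F L :=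
    Finset.sup_mono (Finset.Iic_subset_Iic.2 ⟨h, h⟩)
  exact this φ

theorem seminorm_le_schwartzNorm {K k l : ℕ} (hk : k ≤ K) (hl : l ≤ K) (φ : 𝓢(V, F)) :
    SchwartzMap.seminorm ℂ k l φ ≤ schwartzNorm V F K φ := by
  have : schwartzSeminormFamily ℂ V F (k, l) ≤ schwartzNorm V F K :=
    Finset.le_sup (f := schwartzSeminormFamily ℂ V F) (Finset.mem_Iic.2 ⟨hk, hl⟩)
  exact this φ

theorem one_add_pow_mul_le_schwartzNorm {K k l : ℕ} (hk : k ≤ K) (hl : l ≤ K) (φ : 𝓢(V, F))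
    (y : V) : (1 + ‖y‖) ^ k * ‖iteratedFDeriv ℝ l φ y‖ ≤ 2 ^ K * schwartzNorm V F K φ :=
  SchwartzMap.one_add_le_sup_seminorm_apply (𝕜 := ℂ) (m := (K, K)) hk hl φ y

theorem one_add_pow_mul_norm_le {K k : ℕ} (hk : k ≤ K) (φ : 𝓢(V, F)) (y : V) :
    (1 + ‖y‖) ^ k * ‖φ y‖ ≤ 2 ^ K * schwartzNorm V F K φ := by
  simpa using one_add_pow_mul_le_schwartzNorm hk (Nat.zero_le K) φ y

theorem norm_le_schwartzNorm (K : ℕ) (φ : 𝓢(V, F)) (y : V) :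
    ‖φ y‖ ≤ schwartzNorm V F K φ :=
  (SchwartzMap.norm_le_seminorm ℂ φ y).trans
    (seminorm_le_schwartzNorm (Nat.zero_le K) (Nat.zero_le K) φ)

theorem schwartzNorm_le {K : ℕ} {M : ℝ} (hM : 0 ≤ M) (φ : 𝓢(V, F))
    (h : ∀ k ≤ K, ∀ l ≤ K, ∀ y, ‖y‖ ^ k * ‖iteratedFDeriv ℝ l φ y‖ ≤ M) :
    schwartzNorm V F K φ ≤ M := by
  refine Seminorm.finset_sup_apply_le hM fun i hi => ?_
  obtain ⟨h1, h2⟩ := Prod.mk_le_mk.1 (Finset.mem_Iic.1 hi)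
  exact SchwartzMap.seminorm_le_bound ℂ _ _ _ hM (h _ h1 _ h2)

theorem continuous_schwartzNorm (K : ℕ) : Continuous (schwartzNorm V F K) := by
  apply Seminorm.continuous_of_le (q := ∑ i ∈ Finset.Iic (K, K), schwartzSeminormFamily ℂ V F i)
  · have : ⇑(∑ i ∈ Finset.Iic (K, K), schwartzSeminormFamily ℂ V F i) =
        fun x => ∑ i ∈ Finset.Iic (K, K), schwartzSeminormFamily ℂ V F i x := by
      ext x
      exact map_sum (⟨⟨fun p : Seminorm ℂ 𝓢(V, F) => p x, rfl⟩, fun _ _ => rfl⟩ :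
        Seminorm ℂ 𝓢(V, F) →+ ℝ) _ _
    rw [this]
    exact continuous_finsetSum _ fun i _ => (schwartz_withSeminorms ℂ V F).continuous_seminorm i
  · exact Seminorm.finset_sup_le_sum _ _

theorem sup_le_schwartzNorm (s : Finset (ℕ × ℕ)) :
    ∃ K, s.sup (schwartzSeminormFamily ℂ V F) ≤ schwartzNorm V F K := by
  refine ⟨s.sup (fun i => max i.1 i.2), Finset.sup_le fun i hi => ?_⟩
  refine Finset.le_sup (f := schwartzSeminormFamily ℂ V F) (Finset.mem_Iic.2 ?_)
  have := Finset.le_sup (f := fun i : ℕ × ℕ => max i.1 i.2) hi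
  exact ⟨(le_max_left _ _).trans this, (le_max_right _ _).trans this⟩

/-- Because the norms increase with the index, the finite family provided by continuity collapses to
a single index. This yields the finite order of a distribution and the finite loss of a continuous
operator. -/
theorem exists_schwartzNorm_bound (q : Seminorm ℂ 𝓢(V, F)) (hq : Continuous q) :
    ∃ K : ℕ, ∃ C : ℝ, 0 ≤ C ∧ ∀ φ, q φ ≤ C * schwartzNorm V F K φ := by
  obtain ⟨s, C, -, h⟩ := Seminorm.bound_of_continuous (schwartz_withSeminorms ℂ V F) q hq
  obtain ⟨K, hK⟩ := sup_le_schwartzNorm (V := V) (F := F) s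
  refine ⟨K, C, C.2, fun φ => (h φ).trans ?_⟩
  exact mul_le_mul_of_nonneg_left (hK φ) C.2

theorem exists_bound_apply (f : 𝓢'(V, F)) :
    ∃ K : ℕ, ∃ C : ℝ, 0 ≤ C ∧ ∀ φ, ‖f φ‖ ≤ C * schwartzNorm V ℂ K φ := by
  let q : Seminorm ℂ 𝓢(V, ℂ) := (normSeminorm ℂ F).comp (f : 𝓢(V, ℂ) →ₗ[ℂ] F)
  exact exists_schwartzNorm_bound q (continuous_norm.comp (f : 𝓢(V, ℂ) →L[ℂ] F).continuous)

theorem exists_bound_clm (A : 𝓢(V, F) →L[ℂ] 𝓢(W, G)) (L : ℕ) :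
    ∃ K : ℕ, ∃ C : ℝ, 0 ≤ C ∧ ∀ φ, schwartzNorm W G L (A φ) ≤ C * schwartzNorm V F K φ := by
  let q : Seminorm ℂ 𝓢(V, F) := (schwartzNorm W G L).comp (A : 𝓢(V, F) →ₗ[ℂ] 𝓢(W, G))
  exact exists_schwartzNorm_bound q ((continuous_schwartzNorm L).comp A.continuous)

theorem tendsto_schwartz_iff {ι : Type*} {l : Filter ι} {c : ι → 𝓢(V, F)} {φ : 𝓢(V, F)} :
    Tendsto c l (𝓝 φ) ↔ ∀ K, Tendsto (fun i => schwartzNorm V F K (c i - φ)) l (𝓝 0) := by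
  constructor
  · intro h K
    have := ((continuous_schwartzNorm (V := V) (F := F) K).tendsto 0).comp
      (by simpa using h.sub_const φ : Tendsto (fun i => c i - φ) l (𝓝 0))
    rw [map_zero] at this
    exact this
  · intro h
    rw [(schwartz_withSeminorms ℂ V F).tendsto_nhds]
    intro i ε hε
    filter_upwards [(h (max i.1 i.2)).eventually (gt_mem_nhds hε)] with j hj
    exact (seminorm_le_schwartzNorm (le_max_left _ _) (le_max_right _ _) _).trans_lt hj

theorem continuous_schwartz_of {X : Type*} [TopologicalSpace X] {c : X → 𝓢(V, F)}
    (h : ∀ x₀ K, Tendsto (fun x => schwartzNorm V F K (c x - c x₀)) (𝓝 x₀) (𝓝 0)) :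
    Continuous c :=
  continuous_iff_continuousAt.2 fun x₀ => tendsto_schwartz_iff.2 (h x₀)

/-- The space of `l`-linear forms in which the `l`-th derivative takes its values. -/
def Jet (V : Type*) [NormedAddCommGroup V] [NormedSpace ℝ V] (l : ℕ) : Type _ := V [×l]→L[ℝ] ℂ

instance (l : ℕ) : NormedAddCommGroup (Jet V l) :=
  inferInstanceAs (NormedAddCommGroup (V [×l]→L[ℝ] ℂ))

instance (l : ℕ) : NormedSpace ℝ (Jet V l) := inferInstanceAs (NormedSpace ℝ (V [×l]→L[ℝ] ℂ))

instance (l : ℕ) : NormedSpace ℂ (Jet V l) := inferInstanceAs (NormedSpace ℂ (V [×l]→L[ℝ] ℂ))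

instance (l : ℕ) : CompleteSpace (Jet V l) := inferInstanceAs (CompleteSpace (V [×l]→L[ℝ] ℂ))

/-- The `l`-th derivative of a Schwartz function. -/
def jet (l : ℕ) (φ : 𝓢(V, ℂ)) (y : V) : Jet V l := iteratedFDeriv ℝ l φ y

theorem norm_jet (l : ℕ) (φ : 𝓢(V, ℂ)) (y : V) : ‖jet l φ y‖ = ‖iteratedFDeriv ℝ l φ y‖ := rfl

theorem continuous_jet (l : ℕ) (φ : 𝓢(V, ℂ)) : Continuous (jet l φ) :=
  (φ.smooth l).continuous_iteratedFDeriv (by exact_mod_cast le_rfl)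

theorem jet_add (l : ℕ) (φ χ : 𝓢(V, ℂ)) (y : V) : jet l (φ + χ) y = jet l φ y + jet l χ y :=
  iteratedFDeriv_add_apply ((φ.smooth l).contDiffAt) ((χ.smooth l).contDiffAt)

theorem jet_smul (l : ℕ) (a : ℂ) (φ : 𝓢(V, ℂ)) (y : V) : jet l (a • φ) y = a • jet l φ y :=
  iteratedFDeriv_const_smul_apply ((φ.smooth l).contDiffAt)

/-- The weighted iterated derivative of a Schwartz function, as a bounded continuous function. -/
def weightedDerivBCF (k l : ℕ) (φ : 𝓢(V, ℂ)) : BoundedContinuousFunction V (Jet V l) :=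
  BoundedContinuousFunction.ofNormedAddCommGroup
    (fun y => ‖y‖ ^ k • jet l φ y)
    ((continuous_norm.pow k).smul (continuous_jet l φ))
    (SchwartzMap.seminorm ℂ k l φ) fun y => by
      rw [norm_smul, norm_pow, norm_norm]
      exact SchwartzMap.le_seminorm ℂ k l φ y

@[simp]
theorem weightedDerivBCF_apply (k l : ℕ) (φ : 𝓢(V, ℂ)) (y : V) :
    weightedDerivBCF k l φ y = ‖y‖ ^ k • jet l φ y := rfl

theorem norm_weightedDerivBCF_le (k l : ℕ) (φ : 𝓢(V, ℂ)) :
    ‖weightedDerivBCF k l φ‖ ≤ SchwartzMap.seminorm ℂ k l φ := by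
  refine (BoundedContinuousFunction.norm_le (by positivity)).2 fun y => ?_
  rw [weightedDerivBCF_apply, norm_smul, norm_pow, norm_norm]
  exact SchwartzMap.le_seminorm ℂ k l φ y

theorem le_norm_weightedDerivBCF (k l : ℕ) (φ : 𝓢(V, ℂ)) :
    SchwartzMap.seminorm ℂ k l φ ≤ ‖weightedDerivBCF k l φ‖ := by
  refine SchwartzMap.seminorm_le_bound ℂ _ _ _ (norm_nonneg _) fun y => ?_
  have := (weightedDerivBCF k l φ).norm_coe_le_norm y
  rwa [weightedDerivBCF_apply, norm_smul, norm_pow, norm_norm] at this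

/-- `weightedDerivBCF` as a continuous linear map. -/
def weightedDerivCLM (k l : ℕ) : 𝓢(V, ℂ) →L[ℂ] BoundedContinuousFunction V (Jet V l) :=
  SchwartzMap.mkCLMtoNormedSpace (σ := RingHom.id ℂ) (weightedDerivBCF k l)
    (fun f g => by
      ext y : 1
      rw [BoundedContinuousFunction.add_apply]
      simp only [weightedDerivBCF_apply, jet_add, smul_add])
    (fun a f => by
      ext y : 1
      rw [BoundedContinuousFunction.smul_apply]
      simp only [weightedDerivBCF_apply, jet_smul, RingHom.id_apply]
      rw [smul_comm])
    ⟨{(k, l)}, 1, zero_le_one, fun f => by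
      simpa using norm_weightedDerivBCF_le k l f⟩

theorem weightedDerivCLM_apply (k l : ℕ) (φ : 𝓢(V, ℂ)) :
    weightedDerivCLM k l φ = weightedDerivBCF k l φ := rfl

theorem differentiable_jet (l : ℕ) (φ : 𝓢(V, ℂ)) : Differentiable ℝ (jet l φ) :=
  (φ.smooth (l + 1 : ℕ)).differentiable_iteratedFDeriv (by exact_mod_cast Nat.lt_succ_self l)

theorem norm_fderiv_jet_le (l : ℕ) (φ : 𝓢(V, ℂ)) (y : V) :
    ‖fderiv ℝ (jet l φ) y‖ ≤ SchwartzMap.seminorm ℂ 0 (l + 1) φ := by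
  have h : ‖fderiv ℝ (jet l φ) y‖ = ‖iteratedFDeriv ℝ (l + 1) φ y‖ := norm_fderiv_iteratedFDeriv
  rw [h]
  exact SchwartzMap.norm_iteratedFDeriv_le_seminorm ℂ φ (l + 1) y

/-- The derivative of `jet l φ` at a point, as a continuous linear function of `φ`. -/
def fderivJetCLM (l : ℕ) (y : V) : 𝓢(V, ℂ) →L[ℂ] (V →L[ℝ] Jet V l) :=
  SchwartzMap.mkCLMtoNormedSpace (σ := RingHom.id ℂ) (fun φ => fderiv ℝ (jet l φ) y)
    (fun f g => by
      have : jet l (f + g) = jet l f + jet l g := funext fun y => jet_add l f g y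
      rw [this, fderiv_add (differentiable_jet l f y) (differentiable_jet l g y)])
    (fun a f => by
      have : jet l (a • f) = a • jet l f := funext fun y => jet_smul l a f y
      rw [this, fderiv_const_smul (differentiable_jet l f y), RingHom.id_apply])
    ⟨{(0, l + 1)}, 1, zero_le_one, fun f => by
      simpa using norm_fderiv_jet_le l f y⟩

end SchwartzNorms

section SchwartzIntegral

variable {V : Type*} [NormedAddCommGroup V] [NormedSpace ℝ V]
  {F : Type*} [NormedAddCommGroup F] [NormedSpace ℂ F]
  {Ω : Type*} [TopologicalSpace Ω] [MeasurableSpace Ω] [OpensMeasurableSpace Ω]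
  [SecondCountableTopology Ω] {ν : Measure Ω} {c : Ω → 𝓢(V, ℂ)}

theorem integrable_seminorm (hc : Continuous c)
    (hint : ∀ K, ∃ b : Ω → ℝ, Integrable b ν ∧ ∀ w, schwartzNorm V ℂ K (c w) ≤ b w) (k l : ℕ) :
    Integrable (fun w => SchwartzMap.seminorm ℂ k l (c w)) ν := by
  obtain ⟨b, hb, h⟩ := hint (max k l)
  refine hb.mono' (((schwartz_withSeminorms ℂ V ℂ).continuous_seminorm (k, l)).comp
    hc).aestronglyMeasurable (ae_of_all _ fun w => ?_)
  rw [Real.norm_of_nonneg (by positivity)]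
  exact (seminorm_le_schwartzNorm (le_max_left _ _) (le_max_right _ _) _).trans (h w)

theorem integrable_weightedDeriv (hc : Continuous c)
    (hint : ∀ K, ∃ b : Ω → ℝ, Integrable b ν ∧ ∀ w, schwartzNorm V ℂ K (c w) ≤ b w) (k l : ℕ) :
    Integrable (fun w => weightedDerivCLM k l (c w)) ν :=
  (integrable_seminorm hc hint k l).mono'
    ((weightedDerivCLM k l).continuous.comp hc).aestronglyMeasurable
    (ae_of_all _ fun w => norm_weightedDerivBCF_le k l (c w))

theorem continuous_jet_apply (hc : Continuous c) (l : ℕ) (y : V) :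
    Continuous fun w => jet l (c w) y := by
  have h := (BoundedContinuousFunction.evalCLM ℝ (β := Jet V l) y).continuous.comp
    ((weightedDerivCLM (V := V) 0 l).continuous.comp hc)
  refine h.congr fun w => ?_
  rw [Function.comp_apply, Function.comp_apply, BoundedContinuousFunction.evalCLM_apply,
    weightedDerivCLM_apply, weightedDerivBCF_apply, pow_zero, one_smul]

theorem integrable_jet_apply (hc : Continuous c)
    (hint : ∀ K, ∃ b : Ω → ℝ, Integrable b ν ∧ ∀ w, schwartzNorm V ℂ K (c w) ≤ b w)
    (l : ℕ) (y : V) : Integrable (fun w => jet l (c w) y) ν :=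
  (integrable_seminorm hc hint 0 l).mono'
    (continuous_jet_apply hc l y).aestronglyMeasurable
    (ae_of_all _ fun w => SchwartzMap.norm_iteratedFDeriv_le_seminorm ℂ (c w) l y)

theorem integrable_fderiv_jet_apply (hc : Continuous c)
    (hint : ∀ K, ∃ b : Ω → ℝ, Integrable b ν ∧ ∀ w, schwartzNorm V ℂ K (c w) ≤ b w)
    (l : ℕ) (y : V) : Integrable (fun w => fderiv ℝ (jet l (c w)) y) ν :=
  (integrable_seminorm hc hint 0 (l + 1)).mono'
    ((fderivJetCLM l y).continuous.comp hc).aestronglyMeasurable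
    (ae_of_all _ fun w => norm_fderiv_jet_le l (c w) y)

/-- Differentiation under the integral sign: the derivative of the `l`-jet is dominated, uniformly
in the point, by the seminorm of order `l + 1`, which is integrable along the family like all the
others. -/
theorem hasFDerivAt_integral_jet (hc : Continuous c)
    (hint : ∀ K, ∃ b : Ω → ℝ, Integrable b ν ∧ ∀ w, schwartzNorm V ℂ K (c w) ≤ b w)
    (l : ℕ) (y : V) :
    HasFDerivAt (fun y => ∫ w, jet l (c w) y ∂ν) (∫ w, fderiv ℝ (jet l (c w)) y ∂ν) y := by
  refine hasFDerivAt_integral_of_dominated_of_fderiv_le (s := univ)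
    (F' := fun y w => fderiv ℝ (jet l (c w)) y) univ_mem
    (bound := fun w => SchwartzMap.seminorm ℂ 0 (l + 1) (c w)) ?_ ?_ ?_ ?_ ?_ ?_
  · exact Eventually.of_forall fun y => (continuous_jet_apply hc l y).aestronglyMeasurable
  · exact integrable_jet_apply hc hint l y
  · exact (integrable_fderiv_jet_apply hc hint l y).aestronglyMeasurable
  · exact ae_of_all _ fun w x _ => norm_fderiv_jet_le l (c w) x
  · exact integrable_seminorm hc hint 0 (l + 1)
  · exact ae_of_all _ fun w x _ => (differentiable_jet l (c w) x).hasFDerivAt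

theorem integral_jet_apply (hc : Continuous c)
    (hint : ∀ K, ∃ b : Ω → ℝ, Integrable b ν ∧ ∀ w, schwartzNorm V ℂ K (c w) ≤ b w)
    (l : ℕ) (y : V) (m : Fin l → V) :
    (show V [×l]→L[ℝ] ℂ from ∫ w, jet l (c w) y ∂ν) m =
      ∫ w, iteratedFDeriv ℝ l (c w) y m ∂ν :=
  ContinuousMultilinearMap.integral_apply (integrable_jet_apply hc hint l y) m

theorem iteratedFDeriv_integral (hc : Continuous c)
    (hint : ∀ K, ∃ b : Ω → ℝ, Integrable b ν ∧ ∀ w, schwartzNorm V ℂ K (c w) ≤ b w) (l : ℕ) :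
    iteratedFDeriv ℝ l (fun y => ∫ w, c w y ∂ν) = fun y => ∫ w, jet l (c w) y ∂ν := by
  induction l with
  | zero =>
    ext y m
    refine Eq.trans ?_ (integral_jet_apply hc hint 0 y m).symm
    simp
  | succ l ih =>
    ext y m
    refine Eq.trans ?_ (integral_jet_apply hc hint (l + 1) y m).symm
    rw [iteratedFDeriv_succ_apply_left, ih]
    have h1 := (hasFDerivAt_integral_jet hc hint l y).fderiv
    have h2 : (∫ w, fderiv ℝ (jet l (c w)) y ∂ν) (m 0) =
        ∫ w, fderiv ℝ (jet l (c w)) y (m 0) ∂ν :=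
      ContinuousLinearMap.integral_apply (integrable_fderiv_jet_apply hc hint l y) (m 0)
    have h3 : fderiv ℝ (fun y => ∫ w, jet l (c w) y ∂ν) y (m 0) =
        ∫ w, fderiv ℝ (jet l (c w)) y (m 0) ∂ν := by rw [h1, h2]
    have h4 : (show V [×l]→L[ℝ] ℂ from ∫ w, fderiv ℝ (jet l (c w)) y (m 0) ∂ν) (Fin.tail m) =
        ∫ w, (show V [×l]→L[ℝ] ℂ from fderiv ℝ (jet l (c w)) y (m 0)) (Fin.tail m) ∂ν :=
      ContinuousMultilinearMap.integral_apply
        ((integrable_fderiv_jet_apply hc hint l y).apply_continuousLinearMap _) _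
    refine Eq.trans (congrArg (fun L : V [×l]→L[ℝ] ℂ => L (Fin.tail m)) h3) (h4.trans ?_)
    refine integral_congr_ae (ae_of_all _ fun w => ?_)
    exact (iteratedFDeriv_succ_apply_left m).symm

/-- The integral of a continuous family of Schwartz functions with integrable seminorms. -/
def schwartzIntegral (hc : Continuous c)
    (hint : ∀ K, ∃ b : Ω → ℝ, Integrable b ν ∧ ∀ w, schwartzNorm V ℂ K (c w) ≤ b w) :
    𝓢(V, ℂ) where
  toFun y := ∫ w, c w y ∂ν
  smooth' := by
    refine contDiff_of_differentiable_iteratedFDeriv fun l _ => ?_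
    rw [iteratedFDeriv_integral hc hint l]
    exact fun y => (hasFDerivAt_integral_jet hc hint l y).differentiableAt
  decay' k l := by
    refine ⟨∫ w, SchwartzMap.seminorm ℂ k l (c w) ∂ν, fun y => ?_⟩
    rw [iteratedFDeriv_integral hc hint l]
    have h1 : ‖y‖ ^ k * ‖∫ w, jet l (c w) y ∂ν‖ = ‖∫ w, ‖y‖ ^ k • jet l (c w) y ∂ν‖ := by
      rw [integral_smul, norm_smul, norm_pow, norm_norm]
    refine h1.le.trans (norm_integral_le_of_norm_le (integrable_seminorm hc hint k l)
      (ae_of_all _ fun w => ?_))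
    rw [norm_smul, norm_pow, norm_norm]
    exact SchwartzMap.le_seminorm ℂ k l (c w) y

theorem schwartzIntegral_apply (hc : Continuous c)
    (hint : ∀ K, ∃ b : Ω → ℝ, Integrable b ν ∧ ∀ w, schwartzNorm V ℂ K (c w) ≤ b w) (y : V) :
    schwartzIntegral hc hint y = ∫ w, c w y ∂ν := rfl

/-- The pointwise integral agrees with the Bochner integral in a Banach space of bounded continuous
functions, as evaluation at each point shows. Norm estimates and the action of functionals are
transferred through this identity. -/
theorem weightedDerivCLM_schwartzIntegral (hc : Continuous c)
    (hint : ∀ K, ∃ b : Ω → ℝ, Integrable b ν ∧ ∀ w, schwartzNorm V ℂ K (c w) ≤ b w) (k l : ℕ) :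
    weightedDerivCLM k l (schwartzIntegral hc hint) = ∫ w, weightedDerivCLM k l (c w) ∂ν := by
  ext y : 1
  have h := (BoundedContinuousFunction.evalCLM ℝ y
    (β := Jet V l)).integral_comp_comm (integrable_weightedDeriv hc hint k l)
  have h' : jet l (schwartzIntegral hc hint) y = ∫ w, jet l (c w) y ∂ν :=
    congrFun (iteratedFDeriv_integral hc hint l) y
  rw [BoundedContinuousFunction.evalCLM_apply] at h
  rw [← h, weightedDerivCLM_apply, weightedDerivBCF_apply]
  rw [h', ← integral_smul]
  rfl

theorem seminorm_schwartzIntegral_le (hc : Continuous c)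
    (hint : ∀ K, ∃ b : Ω → ℝ, Integrable b ν ∧ ∀ w, schwartzNorm V ℂ K (c w) ≤ b w)
    {K : ℕ} {b : Ω → ℝ} (hb : Integrable b ν) (h : ∀ w, schwartzNorm V ℂ K (c w) ≤ b w) :
    schwartzNorm V ℂ K (schwartzIntegral hc hint) ≤ ∫ w, b w ∂ν := by
  have hb0 : ∀ w, 0 ≤ b w := fun w => (apply_nonneg _ _).trans (h w)
  refine Seminorm.finset_sup_apply_le (integral_nonneg hb0) fun i hi => ?_
  obtain ⟨h1, h2⟩ := Prod.mk_le_mk.1 (Finset.mem_Iic.1 hi)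
  refine (le_norm_weightedDerivBCF _ _ _).trans ?_
  rw [← weightedDerivCLM_apply, weightedDerivCLM_schwartzIntegral]
  refine norm_integral_le_of_norm_le hb (ae_of_all _ fun w => ?_)
  exact (norm_weightedDerivBCF_le _ _ _).trans ((seminorm_le_schwartzNorm h1 h2 _).trans (h w))

theorem integrable_apply_family (hc : Continuous c)
    (hint : ∀ K, ∃ b : Ω → ℝ, Integrable b ν ∧ ∀ w, schwartzNorm V ℂ K (c w) ≤ b w)
    (f : 𝓢'(V, F)) : Integrable (fun w => f (c w)) ν := by
  obtain ⟨K, C, hC, hf⟩ := exists_bound_apply f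
  obtain ⟨b, hb, h⟩ := hint K
  refine (hb.const_mul C).mono' ((f : 𝓢(V, ℂ) →L[ℂ] F).continuous.comp hc).aestronglyMeasurable
    (ae_of_all _ fun w => (hf _).trans (mul_le_mul_of_nonneg_left (h w) hC))

/-- A continuous linear functional on the Schwartz space factors through a Banach space of
weighted derivatives. -/
theorem exists_factorization (f : 𝓢(V, ℂ) →L[ℂ] ℂ) :
    ∃ (K : ℕ) (g : ((i : Fin (K + 1) × Fin (K + 1)) →
        BoundedContinuousFunction V (Jet V (i.2 : ℕ))) →L[ℂ] ℂ),
      ∀ φ, f φ = g (fun i => weightedDerivCLM (i.1 : ℕ) (i.2 : ℕ) φ) := by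
  obtain ⟨K, C, hC, hf⟩ := exists_bound_apply (ContinuousLinearMap.toPointwiseConvergenceCLM _ _ _
      _ f)
  let J : 𝓢(V, ℂ) →L[ℂ] ((i : Fin (K + 1) × Fin (K + 1)) →
        BoundedContinuousFunction V (Jet V (i.2 : ℕ))) :=
    ContinuousLinearMap.pi fun i => weightedDerivCLM (i.1 : ℕ) (i.2 : ℕ)
  have hJ : ∀ φ, ‖f φ‖ ≤ C * ‖J φ‖ := by
    intro φ
    refine (hf φ).trans (mul_le_mul_of_nonneg_left ?_ hC)
    refine Seminorm.finset_sup_apply_le (norm_nonneg _) fun i hi => ?_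
    obtain ⟨h1, h2⟩ := Prod.mk_le_mk.1 (Finset.mem_Iic.1 hi)
    refine (le_norm_weightedDerivBCF _ _ _).trans ?_
    exact norm_le_pi_norm (J φ) (⟨i.1, Nat.lt_succ_of_le h1⟩, ⟨i.2, Nat.lt_succ_of_le h2⟩)
  -- By `hJ` the functional vanishes on the kernel of `J`, so it descends to a bounded functional on
  -- the range of `J`, which Hahn–Banach extends to the whole product.
  have hker : LinearMap.ker J.toLinearMap ≤ LinearMap.ker f.toLinearMap := by
    intro φ hφ
    have h0 : J φ = 0 := hφ
    have := hJ φ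
    rw [h0, norm_zero, mul_zero] at this
    exact norm_le_zero_iff.1 this
  obtain ⟨f0, hf0⟩ : ∃ f0 : (LinearMap.range J.toLinearMap) →ₗ[ℂ] ℂ,
      ∀ φ, f0 ⟨J φ, LinearMap.mem_range_self _ φ⟩ = f φ := by
    let e := J.toLinearMap.quotKerEquivRange
    refine ⟨((LinearMap.ker J.toLinearMap).liftQ f.toLinearMap hker) ∘ₗ e.symm.toLinearMap,
      fun φ => ?_⟩
    have : e.symm ⟨J φ, LinearMap.mem_range_self _ φ⟩ = Submodule.Quotient.mk φ := by
      rw [LinearEquiv.symm_apply_eq]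
      rfl
    simp only [LinearMap.comp_apply, LinearEquiv.coe_coe]
    rw [this]
    rfl
  obtain ⟨g, hg, -⟩ := exists_extension_norm_eq (𝕜 := ℂ) (LinearMap.range J.toLinearMap)
    (f0.mkContinuous C (by
      rintro ⟨_, φ, rfl⟩
      have := hf0 φ
      simp only [ContinuousLinearMap.coe_coe] at this ⊢
      rw [this]
      exact hJ φ))
  refine ⟨K, g, fun φ => ?_⟩
  rw [← hf0 φ]
  exact (hg ⟨J φ, LinearMap.mem_range_self _ φ⟩).symm

/-- Tempered distributions commute with integrals of Schwartz functions. -/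
theorem apply_schwartzIntegral [CompleteSpace F] (hc : Continuous c)
    (hint : ∀ K, ∃ b : Ω → ℝ, Integrable b ν ∧ ∀ w, schwartzNorm V ℂ K (c w) ≤ b w)
    (f : 𝓢'(V, F)) : f (schwartzIntegral hc hint) = ∫ w, f (c w) ∂ν := by
  -- The Schwartz space is not normed, so the Bochner integral is formed elsewhere: functionals on
  -- `F` reduce the claim to scalar distributions, and these factor through a Banach space in which
  -- integrals commute with continuous linear maps.
  rw [SeparatingDual.eq_iff_forall_dual_eq (R := ℂ)]
  intro ℓ
  rw [← ℓ.integral_comp_comm (integrable_apply_family hc hint f)]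
  obtain ⟨K, g, hg⟩ := exists_factorization (V := V) (ℓ ∘L (f : 𝓢(V, ℂ) →L[ℂ] F))
  have hg' : ∀ φ, ℓ (f φ) = g (fun i => weightedDerivCLM (i.1 : ℕ) (i.2 : ℕ) φ) := hg
  have hI : Integrable (fun w => fun i : Fin (K + 1) × Fin (K + 1) =>
      weightedDerivCLM (i.1 : ℕ) (i.2 : ℕ) (c w)) ν :=
    Integrable.of_eval fun i => integrable_weightedDeriv hc hint _ _
  simp only [hg']
  rw [g.integral_comp_comm hI]
  congr 1
  ext1 i
  rw [weightedDerivCLM_schwartzIntegral]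
  exact (eval_integral (f := fun (w : Ω) (i : Fin (K + 1) × Fin (K + 1)) =>
    weightedDerivCLM (i.1 : ℕ) (i.2 : ℕ) (c w)) (fun i => integrable_weightedDeriv hc hint _ _)
      i).symm

end SchwartzIntegral

end

/-! ### Translations, modulations and the Fourier transform -/

section

section Shifts

variable {V : Type*} [NormedAddCommGroup V] [InnerProductSpace ℝ V]

theorem one_add_norm_le_mul (x y : V) : 1 + ‖x‖ ≤ (1 + ‖y‖) * (1 + ‖x - y‖) := by
  have h : ‖x‖ ≤ ‖y‖ + ‖x - y‖ := by simpa using norm_add_le y (x - y)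
  nlinarith [norm_nonneg y, norm_nonneg (x - y), mul_nonneg (norm_nonneg y) (norm_nonneg (x - y))]

/-- Translation of a Schwartz function. -/
def translate (a : V) (φ : 𝓢(V, ℂ)) : 𝓢(V, ℂ) := SchwartzMap.compSubConstCLM ℂ a φ

@[simp]
theorem translate_apply (a : V) (φ : 𝓢(V, ℂ)) (y : V) : translate a φ y = φ (y - a) := rfl

theorem translate_sub (a : V) (φ χ : 𝓢(V, ℂ)) :
    translate a (φ - χ) = translate a φ - translate a χ := by
  ext y
  simp

theorem translate_translate (a b : V) (φ : 𝓢(V, ℂ)) :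
    translate a (translate b φ) = translate (a + b) φ := by
  ext y
  simp [sub_sub]

theorem jet_translate (l : ℕ) (a : V) (φ : 𝓢(V, ℂ)) (y : V) :
    jet l (translate a φ) y = jet l φ (y - a) := by
  have : (⇑(translate a φ) : V → ℂ) = fun y => φ (y - a) := rfl
  rw [jet, this, iteratedFDeriv_comp_sub]
  rfl

theorem schwartzNorm_translate_le (K : ℕ) (a : V) (φ : 𝓢(V, ℂ)) :
    schwartzNorm V ℂ K (translate a φ) ≤ 2 ^ K * (1 + ‖a‖) ^ K * schwartzNorm V ℂ K φ := by
  refine schwartzNorm_le (by positivity) _ fun k hk l hl y => ?_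
  have h1 := one_add_pow_mul_le_schwartzNorm hk hl φ (y - a)
  rw [← norm_jet, jet_translate]
  calc ‖y‖ ^ k * ‖jet l φ (y - a)‖
      ≤ ((1 + ‖a‖) * (1 + ‖y - a‖)) ^ k * ‖jet l φ (y - a)‖ := by
        gcongr
        exact (le_add_of_nonneg_left zero_le_one).trans (one_add_norm_le_mul y a)
    _ = (1 + ‖a‖) ^ k * ((1 + ‖y - a‖) ^ k * ‖jet l φ (y - a)‖) := by
        rw [mul_pow, mul_assoc]
    _ ≤ (1 + ‖a‖) ^ K * (2 ^ K * schwartzNorm V ℂ K φ) := by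
        refine mul_le_mul ?_ h1 (by positivity) (by positivity)
        exact pow_le_pow_right₀ (by simp) hk
    _ = _ := by ring

/-- The mean value inequality on the segment from `y` to `y - a` accounts for the extra derivative
on the right. For `z` on this segment `1 + ‖y‖ ≤ (1 + ‖z‖)(1 + ‖a‖)`, so the weight at `y` can be
moved to `z`. -/
theorem schwartzNorm_translate_sub_le (K : ℕ) (a : V) (φ : 𝓢(V, ℂ)) :
    schwartzNorm V ℂ K (translate a φ - φ) ≤
      ‖a‖ * (2 ^ (K + 1) * (1 + ‖a‖) ^ K * schwartzNorm V ℂ (K + 1) φ) := by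
  refine schwartzNorm_le (by positivity) _ fun k hk l hl y => ?_
  set S := schwartzNorm V ℂ (K + 1) φ with hS
  have hsub : jet l (translate a φ - φ) y = jet l φ (y - a) - jet l φ y := by
    have h := jet_add l (translate a φ) ((-1 : ℂ) • φ) y
    rw [jet_smul, jet_translate] at h
    rw [sub_eq_add_neg, ← neg_one_smul ℂ φ, h, neg_one_smul, ← sub_eq_add_neg]
  rw [← norm_jet, hsub]
  have hbound : ∀ z ∈ segment ℝ y (y - a),
      ‖fderiv ℝ (jet l φ) z‖ ≤ (1 + ‖a‖) ^ k * (2 ^ (K + 1) * S) / (1 + ‖y‖) ^ k := by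
    intro z hz
    have hz' : ‖y - z‖ ≤ ‖a‖ := by
      obtain ⟨θ, hθ, rfl⟩ := (segment_eq_image' ℝ y (y - a) ▸ hz :)
      have : y - (y + θ • (y - a - y)) = θ • a := by
        rw [sub_sub_cancel_left, smul_neg]; abel
      rw [this, norm_smul, Real.norm_of_nonneg hθ.1]
      exact mul_le_of_le_one_left (norm_nonneg a) hθ.2
    have h1 := one_add_pow_mul_le_schwartzNorm (hk.trans (Nat.le_succ K))
      (Nat.succ_le_succ hl) φ z
    have h2 : ‖fderiv ℝ (jet l φ) z‖ = ‖iteratedFDeriv ℝ (l + 1) φ z‖ := norm_fderiv_iteratedFDeriv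
    rw [le_div_iff₀ (by positivity), h2]
    calc ‖iteratedFDeriv ℝ (l + 1) φ z‖ * (1 + ‖y‖) ^ k
        ≤ ‖iteratedFDeriv ℝ (l + 1) φ z‖ * ((1 + ‖z‖) * (1 + ‖a‖)) ^ k := by
          gcongr
          refine (one_add_norm_le_mul y z).trans ?_
          gcongr
      _ = (1 + ‖a‖) ^ k * ((1 + ‖z‖) ^ k * ‖iteratedFDeriv ℝ (l + 1) φ z‖) := by
          rw [mul_pow]; ring
      _ ≤ _ := by gcongr
  have hmv := (convex_segment y (y - a)).norm_image_sub_le_of_norm_fderiv_le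
    (fun z _ => differentiable_jet l φ z) hbound (left_mem_segment ℝ y (y - a))
    (right_mem_segment ℝ y (y - a))
  have ha : ‖y - a - y‖ = ‖a‖ := by rw [sub_sub_cancel_left, norm_neg]
  rw [ha] at hmv
  calc ‖y‖ ^ k * ‖jet l φ (y - a) - jet l φ y‖
      ≤ (1 + ‖y‖) ^ k * ((1 + ‖a‖) ^ k * (2 ^ (K + 1) * S) / (1 + ‖y‖) ^ k * ‖a‖) := by
        gcongr
        simp
    _ = ‖a‖ * (2 ^ (K + 1) * (1 + ‖a‖) ^ k * S) := by
        field_simp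
    _ ≤ _ := by
        gcongr
        · simp

theorem continuous_translate {X : Type*} [TopologicalSpace X] {a : X → V} {c : X → 𝓢(V, ℂ)}
    (ha : Continuous a) (hc : Continuous c) : Continuous fun x => translate (a x) (c x) := by
  refine continuous_schwartz_of fun x₀ K => ?_
  have h1 : Tendsto (fun x => 2 ^ K * (1 + ‖a x‖) ^ K * schwartzNorm V ℂ K (c x - c x₀)) (𝓝 x₀)
      (𝓝 (2 ^ K * (1 + ‖a x₀‖) ^ K * 0)) := by
    refine Tendsto.mul ?_ (tendsto_schwartz_iff.1 (hc.tendsto x₀) K)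
    exact ((continuous_const.mul ((continuous_const.add ha.norm).pow K)).tendsto x₀)
  have h2 : Tendsto (fun x => 2 ^ K * (1 + ‖a x₀‖) ^ K * (‖a x - a x₀‖ * (2 ^ (K + 1) *
      (1 + ‖a x - a x₀‖) ^ K * schwartzNorm V ℂ (K + 1) (c x₀)))) (𝓝 x₀) (𝓝 0) := by
    have : Continuous fun x => 2 ^ K * (1 + ‖a x₀‖) ^ K * (‖a x - a x₀‖ * (2 ^ (K + 1) *
      (1 + ‖a x - a x₀‖) ^ K * schwartzNorm V ℂ (K + 1) (c x₀))) := by fun_prop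
    simpa using this.tendsto x₀
  have h3 := h1.add h2
  rw [mul_zero, zero_add] at h3
  refine squeeze_zero (fun x => apply_nonneg _ _) (fun x => ?_) h3
  -- The change of the function and the change of the shift are separated. The first is controlled
  -- by the polynomial bound for translations, the second by the mean value estimate for the fixed
  -- function `c x₀`.
  have hd : translate (a x) (c x) - translate (a x₀) (c x₀) =
      translate (a x) (c x - c x₀) +
        translate (a x₀) (translate (a x - a x₀) (c x₀) - c x₀) := by
    rw [translate_sub, translate_sub, translate_translate, add_sub_cancel]
    abel
  rw [hd]
  refine (map_add_le_add _ _ _).trans (add_le_add (schwartzNorm_translate_le K _ _) ?_)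
  refine (schwartzNorm_translate_le K _ _).trans ?_
  gcongr
  exact schwartzNorm_translate_sub_le K _ _

/-- Multiplication of a Schwartz function by the character `y ↦ e^{-2πi y·ξ}`. -/
def modulate (ξ : V) (φ : 𝓢(V, ℂ)) : 𝓢(V, ℂ) := SchwartzMap.smulLeftCLM ℂ (character ξ) φ

@[simp]
theorem modulate_apply (ξ : V) (φ : 𝓢(V, ℂ)) (y : V) :
    modulate ξ φ y = character ξ y * φ y := by
  simp [modulate, SchwartzMap.smulLeftCLM_apply_apply (character_hasTemperateGrowth ξ)]

@[simp]
theorem norm_character (ξ y : V) : ‖character ξ y‖ = 1 := by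
  rw [character, Complex.norm_exp]
  simp

theorem character_add_left (ξ η y : V) :
    character (ξ + η) y = character ξ y * character η y := by
  rw [character, character, character, ← Complex.exp_add, inner_add_right]
  congr 1
  push_cast
  ring

theorem character_add_right (ξ x y : V) :
    character ξ (x + y) = character ξ x * character ξ y := by
  rw [character, character, character, ← Complex.exp_add, inner_add_left]
  congr 1
  push_cast
  ring

theorem character_neg_left (ξ y : V) : character (-ξ) y = conj (character ξ y) := by
  rw [character, character, ← Complex.exp_conj, inner_neg_right]
  congr 1
  simp [map_ofNat (starRingEnd ℂ) 2]

theorem character_comm (ξ y : V) : character ξ y = character y ξ := by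
  rw [character, character, real_inner_comm]

theorem continuous_character : Continuous fun p : V × V => character p.1 p.2 := by
  unfold character
  fun_prop

/-- The complex conjugate of a Schwartz function. -/
def conjS (g : 𝓢(V, ℂ)) : 𝓢(V, ℂ) :=
  SchwartzMap.postcompCLM (𝕜 := ℝ) (Complex.conjCLE : ℂ →L[ℝ] ℂ) g

@[simp]
theorem conjS_apply (g : 𝓢(V, ℂ)) (y : V) : conjS g y = conj (g y) := by
  simp [conjS]

@[simp]
theorem conjS_conjS (g : 𝓢(V, ℂ)) : conjS (conjS g) = g := by
  ext y
  simp

theorem conjAtom_eq (g : 𝓢(V, ℂ)) (x ξ : V) :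
    conjAtom g x ξ = modulate ξ (translate x (conjS g)) := by
  ext y
  simp [conjAtom_apply]

theorem conj_conjAtom (g : 𝓢(V, ℂ)) (x ξ y : V) :
    conj (conjAtom g x ξ y) = conjAtom (conjS g) x (-ξ) y := by
  simp [conjAtom_apply, character_neg_left]

variable [FiniteDimensional ℝ V] [MeasurableSpace V] [BorelSpace V]

theorem fourier_apply_eq {F : Type*} [NormedAddCommGroup F] [NormedSpace ℂ F] (φ : 𝓢(V, F))
    (ξ : V) : 𝓕 φ ξ = ∫ y, character ξ y • φ y := by
  rw [SchwartzMap.fourier_coe, Real.fourier_eq']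
  refine integral_congr_ae (ae_of_all _ fun y => ?_)
  simp only [character]
  congr 2
  push_cast
  ring

theorem fourierInv_apply_eq (φ : 𝓢(V, ℂ)) (ξ : V) :
    𝓕⁻ φ ξ = ∫ y, conj (character ξ y) * φ y := by
  rw [SchwartzMap.fourierInv_coe, Real.fourierInv_eq']
  refine integral_congr_ae (ae_of_all _ fun y => ?_)
  simp only [smul_eq_mul]
  rw [← character_neg_left, character, inner_neg_right]
  congr 2
  push_cast
  ring

theorem fourierInv_translate (a : V) (φ : 𝓢(V, ℂ)) (η : V) :
    𝓕⁻ (translate a φ) η = conj (character η a) * 𝓕⁻ φ η := by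
  rw [fourierInv_apply_eq, fourierInv_apply_eq, ← integral_const_mul,
    ← integral_add_right_eq_self _ a]
  refine integral_congr_ae (ae_of_all _ fun y => ?_)
  simp only [translate_apply, add_sub_cancel_right, character_add_right, map_mul]
  ring

theorem fourier_translate (a : V) (φ : 𝓢(V, ℂ)) : 𝓕 (translate a φ) = modulate a (𝓕 φ) := by
  ext η
  rw [modulate_apply, fourier_apply_eq, fourier_apply_eq, ← smul_eq_mul, ← integral_smul,
    ← integral_add_right_eq_self _ a]
  refine integral_congr_ae (ae_of_all _ fun y => ?_)
  simp only [translate_apply, add_sub_cancel_right, character_add_right, smul_eq_mul,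
    character_comm a η]
  ring

/-- Conjugation by the Fourier transform turns modulations into translations, and through it
continuity and seminorm bounds for modulations are inherited from those for translations. -/
theorem modulate_eq_fourier (a : V) (φ : 𝓢(V, ℂ)) :
    modulate a φ = 𝓕 (translate a (𝓕⁻ φ)) := by
  rw [fourier_translate, FourierTransform.fourier_fourierInv_eq]

theorem continuous_modulate {X : Type*} [TopologicalSpace X] {a : X → V} {c : X → 𝓢(V, ℂ)}
    (ha : Continuous a) (hc : Continuous c) : Continuous fun x => modulate (a x) (c x) := by
  simp only [modulate_eq_fourier]
  exact (FourierTransform.continuous_fourier (E := 𝓢(V, ℂ)) (F := 𝓢(V, ℂ))).comp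
    (continuous_translate ha ((FourierTransform.continuous_fourierInv (E := 𝓢(V, ℂ))
      (F := 𝓢(V, ℂ))).comp hc))

theorem exists_schwartzNorm_modulate_le (L : ℕ) : ∃ (K : ℕ) (C : ℝ), 0 ≤ C ∧
    ∀ (a : V) (φ : 𝓢(V, ℂ)),
      schwartzNorm V ℂ L (modulate a φ) ≤ C * (1 + ‖a‖) ^ K * schwartzNorm V ℂ K φ := by
  obtain ⟨K₁, C₁, hC₁, h₁⟩ := exists_bound_clm (FourierTransform.fourierCLM ℂ 𝓢(V, ℂ)) L
  obtain ⟨K₂, C₂, hC₂, h₂⟩ := exists_bound_clm (FourierTransform.fourierInvCLM ℂ 𝓢(V, ℂ)) K₁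
  refine ⟨max K₁ K₂, C₁ * (2 ^ K₁ * C₂), by positivity, fun a φ => ?_⟩
  rw [modulate_eq_fourier]
  refine (h₁ _).trans ?_
  calc C₁ * schwartzNorm V ℂ K₁ (translate a (𝓕⁻ φ))
      ≤ C₁ * (2 ^ K₁ * (1 + ‖a‖) ^ K₁ * (C₂ * schwartzNorm V ℂ K₂ φ)) := by
        gcongr
        exact (schwartzNorm_translate_le _ _ _).trans (by gcongr; exact h₂ φ)
    _ ≤ C₁ * (2 ^ K₁ * (1 + ‖a‖) ^ (max K₁ K₂) * (C₂ * schwartzNorm V ℂ (max K₁ K₂) φ)) := by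
        gcongr
        · simp
        · exact le_max_left _ _
        · exact schwartzNorm_mono (le_max_right _ _) φ
    _ = _ := by ring

/-- The weight `(1 + |x|)(1 + |ξ|)` on the phase space. -/
def tfWeight (z : V × V) : ℝ := (1 + ‖z.1‖) * (1 + ‖z.2‖)

theorem one_le_tfWeight (z : V × V) : 1 ≤ tfWeight z :=
  one_le_mul_of_one_le_of_one_le (by simp) (by simp)

end Shifts

end

/-! ### Decay and inversion of the short-time Fourier transform -/

section

section Decay

variable {V : Type*} [NormedAddCommGroup V] [InnerProductSpace ℝ V]
  [FiniteDimensional ℝ V] [MeasurableSpace V] [BorelSpace V]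
  {F : Type*} [NormedAddCommGroup F] [NormedSpace ℂ F]

theorem tfWeight_pos (z : V × V) : 0 < tfWeight z := zero_lt_one.trans_le (one_le_tfWeight z)

theorem tfWeight_le_mul (z w : V × V) : tfWeight z ≤ tfWeight w * tfWeight (z - w) := by
  unfold tfWeight
  calc (1 + ‖z.1‖) * (1 + ‖z.2‖)
      ≤ ((1 + ‖w.1‖) * (1 + ‖z.1 - w.1‖)) * ((1 + ‖w.2‖) * (1 + ‖z.2 - w.2‖)) :=
        mul_le_mul (one_add_norm_le_mul _ _) (one_add_norm_le_mul _ _) (by positivity)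
          (by positivity)
    _ = _ := by simp only [Prod.fst_sub, Prod.snd_sub]; ring

theorem tfWeight_neg (z : V × V) : tfWeight (-z) = tfWeight z := by simp [tfWeight]

theorem tfWeight_neg_snd (x ξ : V) : tfWeight (x, -ξ) = tfWeight (x, ξ) := by simp [tfWeight]

theorem continuous_tfWeight : Continuous (tfWeight : V × V → ℝ) := by
  unfold tfWeight
  fun_prop

/-- The rapidly decreasing function `((1 + |x|)(1 + |ξ|))^{-K}` on the phase space. -/
def tfDecay (K : ℕ) (z : V × V) : ℝ := (tfWeight z ^ K)⁻¹

theorem tfDecay_pos (K : ℕ) (z : V × V) : 0 < tfDecay K z :=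
  inv_pos.2 (pow_pos (tfWeight_pos z) K)

theorem continuous_tfDecay (K : ℕ) : Continuous (tfDecay K : V × V → ℝ) :=
  (continuous_tfWeight.pow K).inv₀ fun z => (pow_pos (tfWeight_pos z) K).ne'

theorem tfDecay_neg (K : ℕ) (z : V × V) : tfDecay K (-z) = tfDecay K z := by
  rw [tfDecay, tfWeight_neg, tfDecay]

theorem tfDecay_add (K L : ℕ) (z : V × V) : tfDecay (K + L) z = tfDecay K z * tfDecay L z := by
  simp [tfDecay, pow_add, mul_comm]

theorem tfWeight_pow_mul_tfDecay (K L : ℕ) (z : V × V) :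
    tfWeight z ^ K * tfDecay (K + L) z = tfDecay L z := by
  rw [tfDecay_add, ← mul_assoc, tfDecay, mul_inv_cancel₀ (pow_pos (tfWeight_pos z) K).ne', one_mul]

variable (V) in
/-- An exponent `D` for which `(1 + |y|)^{-D}` is integrable. -/
def intPow : ℕ := (volume : Measure V).integrablePower

theorem integrable_one_add_norm_inv : Integrable fun y : V => ((1 + ‖y‖) ^ intPow V)⁻¹ := by
  have h := Measure.integrable_pow_neg_integrablePower (volume : Measure V)
  refine h.congr (ae_of_all _ fun y => ?_)
  simp only [intPow]
  rw [Real.rpow_neg (by positivity), Real.rpow_natCast]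

theorem integrable_tfDecay : Integrable (tfDecay (intPow V) : V × V → ℝ) := by
  have h := (integrable_one_add_norm_inv (V := V)).mul_prod (integrable_one_add_norm_inv (V := V))
  refine h.congr (ae_of_all _ fun z => ?_)
  simp [tfDecay, tfWeight, mul_pow, mul_comm]

/-- The inequality `(1 + ‖x‖)^K ≤ (1 + ‖y‖)^K (1 + ‖y - x‖)^K` distributes the weight: the fixed
function `a` absorbs the second factor, `b` the first. The further `intPow V` powers taken from `b`
make the integral converge. -/
theorem exists_integral_mul_le (a : 𝓢(V, ℂ)) (K : ℕ) : ∃ C : ℝ, 0 ≤ C ∧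
    ∀ (b : 𝓢(V, F)) (x : V), ∫ y, ‖a (y - x)‖ * ‖b y‖ ≤
      C * schwartzNorm V F (K + intPow V) b * ((1 + ‖x‖) ^ K)⁻¹ := by
  set D := intPow V
  set I := ∫ y : V, ((1 + ‖y‖) ^ D)⁻¹
  set A := 2 ^ K * schwartzNorm V ℂ K a
  have hI : 0 ≤ I := integral_nonneg fun y => by positivity
  refine ⟨A * 2 ^ (K + D) * I, by positivity, fun b x => ?_⟩
  set B := schwartzNorm V F (K + D) b
  have hpt : ∀ y, ‖a (y - x)‖ * ‖b y‖ ≤ (A * (2 ^ (K + D) * B) * ((1 + ‖x‖) ^ K)⁻¹) *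
      ((1 + ‖y‖) ^ D)⁻¹ := by
    intro y
    have h1 : (1 + ‖y - x‖) ^ K * ‖a (y - x)‖ ≤ A := one_add_pow_mul_norm_le le_rfl a (y - x)
    have h2 : (1 + ‖y‖) ^ (K + D) * ‖b y‖ ≤ 2 ^ (K + D) * B := one_add_pow_mul_norm_le le_rfl b y
    have h3 : (1 + ‖x‖) ^ K ≤ (1 + ‖y‖) ^ K * (1 + ‖y - x‖) ^ K := by
      rw [← mul_pow]
      gcongr
      have := one_add_norm_le_mul x y
      rwa [norm_sub_rev x y] at this
    rw [mul_assoc, ← mul_inv, ← div_eq_mul_inv, le_div_iff₀ (by positivity)]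
    calc ‖a (y - x)‖ * ‖b y‖ * ((1 + ‖x‖) ^ K * (1 + ‖y‖) ^ D)
        ≤ ‖a (y - x)‖ * ‖b y‖ * (((1 + ‖y‖) ^ K * (1 + ‖y - x‖) ^ K) * (1 + ‖y‖) ^ D) := by
          gcongr
      _ = ((1 + ‖y - x‖) ^ K * ‖a (y - x)‖) * ((1 + ‖y‖) ^ (K + D) * ‖b y‖) := by ring
      _ ≤ A * (2 ^ (K + D) * B) := by gcongr
  calc ∫ y, ‖a (y - x)‖ * ‖b y‖
      ≤ ∫ y, (A * (2 ^ (K + D) * B) * ((1 + ‖x‖) ^ K)⁻¹) * ((1 + ‖y‖) ^ D)⁻¹ :=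
        integral_mono_of_nonneg (ae_of_all _ fun y => by positivity)
          (integrable_one_add_norm_inv.const_mul _) (ae_of_all _ hpt)
    _ = _ := by rw [integral_const_mul]; ring

theorem stft_coe (g : 𝓢(V, ℂ)) (b : 𝓢(V, F)) (x ξ : V) :
    stft g (b : 𝓢'(V, F)) x ξ = ∫ y, conjAtom g x ξ y • b y :=
  SchwartzMap.coe_apply b _

theorem norm_conjAtom_apply (g : 𝓢(V, ℂ)) (x ξ y : V) : ‖conjAtom g x ξ y‖ = ‖g (y - x)‖ := by
  simp [conjAtom_apply]

theorem exists_norm_stft_le_fst (g : 𝓢(V, ℂ)) (K : ℕ) : ∃ C : ℝ, 0 ≤ C ∧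
    ∀ (b : 𝓢(V, F)) (x ξ : V), ‖stft g (b : 𝓢'(V, F)) x ξ‖ ≤
      C * schwartzNorm V F (K + intPow V) b * ((1 + ‖x‖) ^ K)⁻¹ := by
  obtain ⟨C, hC, h⟩ := exists_integral_mul_le (F := F) g K
  refine ⟨C, hC, fun b x ξ => le_trans ?_ (h b x)⟩
  rw [stft_coe]
  refine (norm_integral_le_integral_norm _).trans (le_of_eq ?_)
  simp only [norm_smul, norm_conjAtom_apply]

theorem conjAtom_eq_fourier (g : 𝓢(V, ℂ)) (x ξ : V) :
    conjAtom g x ξ = 𝓕 (translate ξ (𝓕⁻ (translate x (conjS g)))) := by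
  rw [conjAtom_eq, modulate_eq_fourier]

/-- The atom is a Fourier transform of a translate by `ξ`. Moving the Fourier transform onto `b`
makes decay in the frequency an instance of the estimate that gives decay in the position. -/
theorem exists_norm_stft_le_snd [CompleteSpace F] (g : 𝓢(V, ℂ)) (K : ℕ) :
    ∃ (L : ℕ) (C : ℝ), 0 ≤ C ∧
    ∀ (b : 𝓢(V, F)) (x ξ : V), ‖stft g (b : 𝓢'(V, F)) x ξ‖ ≤
      C * schwartzNorm V F L b * ((1 + ‖ξ‖) ^ K)⁻¹ := by
  obtain ⟨C, hC, h⟩ := exists_integral_mul_le (F := F) (𝓕⁻ (conjS g)) K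
  obtain ⟨L, C', hC', h'⟩ := exists_bound_clm (FourierTransform.fourierCLM ℂ 𝓢(V, F)) (K + intPow V)
  refine ⟨L, C * C', by positivity, fun b x ξ => ?_⟩
  have h1 : ‖stft g (b : 𝓢'(V, F)) x ξ‖ ≤ ∫ y, ‖𝓕⁻ (conjS g) (y - ξ)‖ * ‖𝓕 b y‖ := by
    rw [stft_coe, conjAtom_eq_fourier, SchwartzMap.integral_fourier_smul_eq]
    refine (norm_integral_le_integral_norm _).trans (le_of_eq ?_)
    simp only [norm_smul, translate_apply, fourierInv_translate, norm_mul, RCLike.norm_conj,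
      norm_character, one_mul]
  refine (h1.trans (h (𝓕 b) ξ)).trans ?_
  have h2 : schwartzNorm V F (K + intPow V) (𝓕 b) ≤ C' * schwartzNorm V F L b := h' b
  rw [mul_assoc C C']
  gcongr

/-- The short-time Fourier transform of a Schwartz function is rapidly decreasing. -/
theorem exists_norm_stft_le [CompleteSpace F] (g : 𝓢(V, ℂ)) (K : ℕ) :
    ∃ (L : ℕ) (C : ℝ), 0 ≤ C ∧
    ∀ (b : 𝓢(V, F)) (z : V × V), ‖stft g (b : 𝓢'(V, F)) z.1 z.2‖ ≤
      C * schwartzNorm V F L b * tfDecay K z := by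
  obtain ⟨C₁, hC₁, h₁⟩ := exists_norm_stft_le_fst (F := F) g (2 * K)
  obtain ⟨L, C₂, hC₂, h₂⟩ := exists_norm_stft_le_snd (F := F) g (2 * K)
  set L' := max (2 * K + intPow V) L
  refine ⟨L', C₁ + C₂, by positivity, fun b z => ?_⟩
  set t := ‖stft g (b : 𝓢'(V, F)) z.1 z.2‖
  set M := (C₁ + C₂) * schwartzNorm V F L' b
  have hM : 0 ≤ M := by positivity
  have e1 : t ≤ M * ((1 + ‖z.1‖) ^ (2 * K))⁻¹ := by
    refine (h₁ b z.1 z.2).trans (mul_le_mul_of_nonneg_right ?_ (by positivity))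
    exact mul_le_mul (le_add_of_nonneg_right hC₂) (schwartzNorm_mono (le_max_left _ _) b)
      (by positivity) (by positivity)
  have e2 : t ≤ M * ((1 + ‖z.2‖) ^ (2 * K))⁻¹ := by
    refine (h₂ b z.1 z.2).trans (mul_le_mul_of_nonneg_right ?_ (by positivity))
    exact mul_le_mul (le_add_of_nonneg_left hC₁) (schwartzNorm_mono (le_max_right _ _) b)
      (by positivity) (by positivity)
  -- The one-variable bounds carry the exponent `2 * K`; their geometric mean has exponent `K` in
  -- both variables at once.
  refine abs_le_of_sq_le_sq' ?_ (by have := tfDecay_pos K z; positivity) |>.2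
  calc t ^ 2 = t * t := sq t
    _ ≤ (M * ((1 + ‖z.1‖) ^ (2 * K))⁻¹) * (M * ((1 + ‖z.2‖) ^ (2 * K))⁻¹) :=
        mul_le_mul e1 e2 (norm_nonneg _) (by positivity)
    _ = (M * tfDecay K z) ^ 2 := by
        rw [mul_comm 2 K, pow_mul, pow_mul]
        simp only [tfDecay, tfWeight, mul_pow, inv_pow, mul_inv]
        ring

theorem continuous_conjAtom (g : 𝓢(V, ℂ)) : Continuous fun z : V × V => conjAtom g z.1 z.2 := by
  simp only [conjAtom_eq]
  exact continuous_modulate continuous_snd (continuous_translate continuous_fst continuous_const)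

theorem continuous_stft (g : 𝓢(V, ℂ)) (f : 𝓢'(V, F)) :
    Continuous fun z : V × V => stft g f z.1 z.2 :=
  (f : 𝓢(V, ℂ) →L[ℂ] F).continuous.comp (continuous_conjAtom g)

theorem exists_schwartzNorm_conjAtom_le (g : 𝓢(V, ℂ)) (L : ℕ) : ∃ (K : ℕ) (C : ℝ), 0 ≤ C ∧
    ∀ z : V × V, schwartzNorm V ℂ L (conjAtom g z.1 z.2) ≤ C * tfWeight z ^ K := by
  obtain ⟨K, C, hC, h⟩ := exists_schwartzNorm_modulate_le (V := V) L
  refine ⟨K, C * (2 ^ K * schwartzNorm V ℂ K (conjS g)), by positivity, fun z => ?_⟩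
  rw [conjAtom_eq]
  calc _ ≤ C * (1 + ‖z.2‖) ^ K * (2 ^ K * (1 + ‖z.1‖) ^ K * schwartzNorm V ℂ K (conjS g)) := by
        refine (h _ _).trans ?_
        gcongr
        exact schwartzNorm_translate_le _ _ _
    _ = _ := by simp only [tfWeight, mul_pow]; ring

/-- The pairing `∫ φ(y) (M_ξ T_x g)(y) dy`. -/
def coef (g φ : 𝓢(V, ℂ)) (z : V × V) : ℂ := stft (conjS g) (φ : 𝓢'(V, ℂ)) z.1 (-z.2)

theorem coef_eq (g φ : 𝓢(V, ℂ)) (z : V × V) :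
    coef g φ z = ∫ y, conj (conjAtom g z.1 z.2 y) * φ y := by
  rw [coef, stft_coe]
  simp only [conj_conjAtom, smul_eq_mul]

theorem exists_norm_coef_le (g : 𝓢(V, ℂ)) (K : ℕ) : ∃ (L : ℕ) (C : ℝ), 0 ≤ C ∧
    ∀ (φ : 𝓢(V, ℂ)) (z : V × V), ‖coef g φ z‖ ≤ C * schwartzNorm V ℂ L φ * tfDecay K z := by
  obtain ⟨L, C, hC, h⟩ := exists_norm_stft_le (F := ℂ) (conjS g) K
  refine ⟨L, C, hC, fun φ z => (h φ (z.1, -z.2)).trans (le_of_eq ?_)⟩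
  rw [tfDecay, tfWeight_neg_snd, tfDecay]

theorem continuous_coef (g φ : 𝓢(V, ℂ)) : Continuous (coef g φ) := by
  have := (continuous_stft (conjS g) (φ : 𝓢'(V, ℂ))).comp
    (continuous_fst.prodMk continuous_snd.neg : Continuous fun z : V × V => (z.1, -z.2))
  exact this

/-- The squared `L²` norm of a window. -/
def windowMass (g : 𝓢(V, ℂ)) : ℂ := ∫ y, conj (g y) * g y

theorem windowMass_ne_zero {g : 𝓢(V, ℂ)} (hg : g ≠ 0) : windowMass g ≠ 0 := by
  obtain ⟨y₀, hy₀⟩ : ∃ y, g y ≠ 0 := by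
    by_contra! h
    exact hg (SchwartzMap.ext fun y => by simpa using h y)
  have h1 : windowMass g = ((∫ y, ‖g y‖ ^ 2 : ℝ) : ℂ) := by
    rw [windowMass, ← integral_complex_ofReal]
    refine integral_congr_ae (ae_of_all _ fun y => ?_)
    simp [Complex.conj_mul']
  have h2 : 0 < ∫ y, ‖g y‖ ^ 2 := by
    refine integral_pos_of_integrable_nonneg_nonzero (g.continuous.norm.pow 2) ?_
      (fun y => by positivity) (x := y₀) (by simpa using hy₀)
    exact (g.memLp 2).integrable_norm_pow (by norm_num)
  rw [h1]
  exact_mod_cast h2.ne'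

theorem integrable_coef_mul_conjAtom (g φ : 𝓢(V, ℂ)) (y : V) :
    Integrable fun z : V × V => coef g φ z * conjAtom g z.1 z.2 y := by
  obtain ⟨L, C, hC, h⟩ := exists_norm_coef_le g (intPow V)
  refine (integrable_tfDecay.const_mul (C * schwartzNorm V ℂ L φ * schwartzNorm V ℂ 0 g)).mono' ?_
    (ae_of_all _ fun z => ?_)
  · refine ((continuous_coef g φ).mul ?_).aestronglyMeasurable
    simp only [conjAtom_apply]
    exact (continuous_character.comp (continuous_snd.prodMk continuous_const)).mul
      (Complex.continuous_conj.comp (g.continuous.comp (continuous_const.sub continuous_fst)))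
  · rw [norm_mul, norm_conjAtom_apply]
    calc _ ≤ (C * schwartzNorm V ℂ L φ * tfDecay (intPow V) z) * schwartzNorm V ℂ 0 g :=
          mul_le_mul (h φ z) (norm_le_schwartzNorm 0 g _) (norm_nonneg _)
            (mul_nonneg (by positivity) (tfDecay_pos _ z).le)
      _ = _ := by ring

/-- Inversion formula for the short-time Fourier transform of Schwartz functions. -/
theorem integral_coef_mul_conjAtom (g φ : 𝓢(V, ℂ)) (y : V) :
    ∫ z : V × V, coef g φ z * conjAtom g z.1 z.2 y = windowMass g * φ y := by
  have hint := integrable_coef_mul_conjAtom g φ y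
  rw [Measure.volume_eq_prod] at hint ⊢
  rw [integral_prod _ hint]
  have hin : ∀ x : V, ∫ ξ, coef g φ (x, ξ) * conjAtom g x ξ y =
      φ y * (conj (g (y - x)) * g (y - x)) := by
    intro x
    -- At fixed `x` the coefficients, as functions of `ξ`, are the inverse Fourier transform of `φ ·
    -- g(· - x)`. The integral over `ξ` is thus Fourier inversion at `y`, and the remaining integral
    -- over `x` produces the mass of the window.
    set h : 𝓢(V, ℂ) := SchwartzMap.pairing (ContinuousLinearMap.mul ℂ ℂ) φ (translate x g)
    have hc : ∀ ξ, coef g φ (x, ξ) = 𝓕⁻ h ξ := by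
      intro ξ
      rw [coef_eq, fourierInv_apply_eq]
      refine integral_congr_ae (ae_of_all _ fun y => ?_)
      simp only [h, conjAtom_apply, map_mul, Complex.conj_conj, SchwartzMap.pairing_apply_apply,
        ContinuousLinearMap.mul_apply', translate_apply]
      ring
    have hF : 𝓕 (𝓕⁻ h) y = h y := by rw [FourierTransform.fourier_fourierInv_eq]
    rw [fourier_apply_eq] at hF
    calc ∫ ξ, coef g φ (x, ξ) * conjAtom g x ξ y
        = ∫ ξ, conj (g (y - x)) * (character y ξ • 𝓕⁻ h ξ) := by
          refine integral_congr_ae (ae_of_all _ fun ξ => ?_)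
          simp only [hc, conjAtom_apply, smul_eq_mul, character_comm y ξ]
          ring
      _ = conj (g (y - x)) * h y := by rw [integral_const_mul, hF]
      _ = _ := by
          simp only [h, SchwartzMap.pairing_apply_apply, ContinuousLinearMap.mul_apply',
            translate_apply]
          ring
  simp only [hin]
  rw [integral_const_mul, integral_sub_left_eq_self (fun u => conj (g u) * g u) volume y,
    windowMass, mul_comm]

/-- The Schwartz norms of the atoms grow polynomially while the coefficients decay to every order,
so `K'` powers of the decay pay for the growth. The synthesis integral therefore converges in the
Schwartz space. -/
theorem exists_schwartzNorm_coef_smul_le (g : 𝓢(V, ℂ)) (K L : ℕ) :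
    ∃ (M : ℕ) (C : ℝ), 0 ≤ C ∧ ∀ (φ : 𝓢(V, ℂ)) (z : V × V),
      schwartzNorm V ℂ K (coef g φ z • conjAtom g z.1 z.2) ≤
        C * schwartzNorm V ℂ M φ * tfDecay L z := by
  obtain ⟨K', C', hC', h'⟩ := exists_schwartzNorm_conjAtom_le g K
  obtain ⟨M, C, hC, h⟩ := exists_norm_coef_le g (K' + L)
  refine ⟨M, C * C', by positivity, fun φ z => ?_⟩
  rw [map_smul_eq_mul]
  have := (tfDecay_pos (K' + L) z).le
  have := tfWeight_pos z
  calc _ ≤ (C * schwartzNorm V ℂ M φ * tfDecay (K' + L) z) * (C' * tfWeight z ^ K') :=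
        mul_le_mul (h φ z) (h' z) (by positivity) (by positivity)
    _ = C * C' * schwartzNorm V ℂ M φ * (tfWeight z ^ K' * tfDecay (K' + L) z) := by ring
    _ = _ := by rw [tfWeight_pow_mul_tfDecay]

theorem continuous_coef_smul (g φ : 𝓢(V, ℂ)) :
    Continuous fun z : V × V => coef g φ z • conjAtom g z.1 z.2 :=
  (continuous_coef g φ).smul (continuous_conjAtom g)

theorem coef_smul_bound (g φ : 𝓢(V, ℂ)) (K : ℕ) : ∃ b : V × V → ℝ, Integrable b ∧
    ∀ z, schwartzNorm V ℂ K (coef g φ z • conjAtom g z.1 z.2) ≤ b z := by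
  obtain ⟨M, C, -, h⟩ := exists_schwartzNorm_coef_smul_le g K (intPow V)
  exact ⟨_, integrable_tfDecay.const_mul _, h φ⟩

/-- Inversion formula for the short-time Fourier transform of tempered distributions. -/
theorem integral_coef_smul_stft [CompleteSpace F] (g φ : 𝓢(V, ℂ)) (f : 𝓢'(V, F)) :
    ∫ z : V × V, coef g φ z • stft g f z.1 z.2 = windowMass g • f φ := by
  have h := apply_schwartzIntegral (continuous_coef_smul g φ) (coef_smul_bound g φ) f
  have h' : schwartzIntegral (continuous_coef_smul g φ) (coef_smul_bound g φ) =
      windowMass g • φ := by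
    ext y
    rw [schwartzIntegral_apply]
    exact integral_coef_mul_conjAtom g φ y
  rw [h', map_smul] at h
  rw [h]
  refine integral_congr_ae (ae_of_all _ fun z => ?_)
  simp only [map_smul]
  rfl

/-- Covariance: after a translation of the integration variable by `z.1`, the product of the two
shifted windows becomes the one for the shift `w - z`, up to a unimodular factor that does not
depend on the variable. -/
theorem conjAtom_conjAtom_shift (g γ : 𝓢(V, ℂ)) (z w : V × V) :
    ‖coef g (conjAtom γ z.1 z.2) w‖ = ‖coef g (conjS γ) (w - z)‖ := by
  rw [coef_eq, coef_eq, ← integral_add_right_eq_self _ z.1]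
  have h : ∀ y, conj (conjAtom g w.1 w.2 (y + z.1)) * conjAtom γ z.1 z.2 (y + z.1) =
      (conj (character (w.2 - z.2) z.1)) *
        (conj (conjAtom g (w - z).1 (w - z).2 y) * conjS γ y) := by
    intro y
    simp only [conjAtom_apply, map_mul, Complex.conj_conj, conjS_apply, Prod.fst_sub, Prod.snd_sub,
      add_sub_cancel_right, character_add_right]
    rw [sub_eq_add_neg w.2, character_add_left, character_add_left, character_neg_left,
      character_neg_left, show y + z.1 - w.1 = y - (w.1 - z.1) by abel]
    simp only [map_mul, Complex.conj_conj]
    ring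
  simp only [h]
  rw [integral_const_mul, norm_mul, RCLike.norm_conj, norm_character, one_mul]

/-- Almost diagonality of the Gabor matrix between two windows. -/
theorem exists_norm_coef_conjAtom_le (g γ : 𝓢(V, ℂ)) (K : ℕ) : ∃ C : ℝ, 0 ≤ C ∧
    ∀ z w : V × V, ‖coef g (conjAtom γ z.1 z.2) w‖ ≤ C * tfDecay K (z - w) := by
  obtain ⟨L, C, hC, h⟩ := exists_norm_coef_le g K
  refine ⟨C * schwartzNorm V ℂ L (conjS γ), by positivity, fun z w => ?_⟩
  rw [conjAtom_conjAtom_shift, ← tfDecay_neg, neg_sub]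
  exact h _ _

end Decay

end

/-! ### Minkowski, Fatou and Hölder inequalities for extended nonnegative functions -/

section

section Minkowski

variable {α β : Type*} [MeasurableSpace α] [MeasurableSpace β] {μ : Measure α} {ν : Measure β}
  [SFinite μ] [SFinite ν]

theorem ENNReal_rpow_neg_mul_rpow_le {P : ℝ} (hP : 1 < P) (k : ℝ≥0∞) :
    k ^ (-(P - 1)) * k ^ P ≤ k := by
  rcases eq_or_ne k 0 with rfl | h0
  · rw [show (0 : ℝ≥0∞) ^ P = 0 from ENNReal.zero_rpow_of_pos (by linarith), mul_zero]
  rcases eq_or_ne k ∞ with rfl | h1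
  · exact le_top
  rw [← ENNReal.rpow_add _ _ h0 h1]
  simp

/-- Minkowski's integral inequality. -/
theorem eLpNorm_lintegral_le {F : α → β → ℝ≥0∞} (hF : Measurable (Function.uncurry F))
    {p : ℝ≥0∞} (hp : 1 ≤ p) {κ : β → ℝ≥0∞} (hκ : Measurable κ)
    (h : ∀ y, eLpNorm (fun x => F x y) p μ ≤ κ y) :
    eLpNorm (fun x => ∫⁻ y, F x y ∂ν) p μ ≤ ∫⁻ y, κ y ∂ν := by
  have hFx : ∀ x, Measurable (F x) := fun x => hF.comp measurable_prodMk_left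
  have hFy : ∀ y, Measurable fun x => F x y := fun y => hF.comp measurable_prodMk_right
  rcases eq_or_ne p ∞ with rfl | hptop
  · simp only [eLpNorm_exponent_top] at h ⊢
    have h1 : ∀ᵐ y ∂ν, ∀ᵐ x ∂μ, F x y ≤ κ y := ae_of_all _ fun y => by
      filter_upwards [ae_le_eLpNormEssSup (μ := μ) (f := fun x => F x y)] with x hx
      exact (by simpa using hx : F x y ≤ _).trans (h y)
    have h2 : ∀ᵐ x ∂μ, ∀ᵐ y ∂ν, F x y ≤ κ y := by
      refine (Measure.ae_ae_comm ?_).2 h1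
      exact measurableSet_le hF (hκ.comp measurable_snd)
    refine eLpNormEssSup_le_of_ae_enorm_bound ?_
    filter_upwards [h2] with x hx
    exact lintegral_mono_ae hx
  have hp0 : p ≠ 0 := (zero_lt_one.trans_le hp).ne'
  rcases eq_or_lt_of_le hp with rfl | hp1
  · simp only [eLpNorm_one_eq_lintegral_enorm, enorm_eq_self] at h ⊢
    rw [lintegral_lintegral_swap hF.aemeasurable]
    exact lintegral_mono h
  set P := p.toReal with hPdef
  have hP : 1 < P := by
    rw [hPdef, ← ENNReal.toReal_one]
    exact (ENNReal.toReal_lt_toReal ENNReal.one_ne_top hptop).2 hp1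
  have hP0 : 0 < P := by linarith
  rcases eq_or_ne (∫⁻ y, κ y ∂ν) ∞ with hI | hI
  · rw [hI]; exact le_top
  set I := ∫⁻ y, κ y ∂ν
  have hF' : ∀ y, ∫⁻ x, F x y ^ P ∂μ ≤ κ y ^ P := by
    intro y
    have := h y
    rw [eLpNorm_eq_lintegral_rpow_enorm_toReal hp0 hptop] at this
    simp only [enorm_eq_self] at this
    rwa [one_div, ENNReal.rpow_inv_le_iff hP0] at this
  -- Negative powers of `κ` are harmless only where `κ ≠ 0`. Where `κ` vanishes, so does `F` almost
  -- everywhere: first in `x` for each `y`, then, exchanging the quantifiers, in `y` for almost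
  -- every `x`.
  have hzero : ∀ᵐ x ∂μ, ∀ᵐ y ∂ν, κ y = 0 → F x y = 0 := by
    refine (Measure.ae_ae_comm ?_).2 (ae_of_all _ fun y => ?_)
    · have e : {x : α × β | κ x.2 = 0 → F x.1 x.2 = 0} =
          {x | κ x.2 = 0}ᶜ ∪ {x | Function.uncurry F x = 0} := by
        ext x
        simp only [Set.mem_ofPred_eq, mem_union, mem_compl_iff, Function.uncurry]
        tauto
      rw [e]
      exact ((hκ.comp measurable_snd) (measurableSet_singleton 0)).compl.union
        (hF (measurableSet_singleton 0))
    · by_cases hy : κ y = 0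
      · have h1 := hF' y
        rw [hy, ENNReal.zero_rpow_of_pos hP0, nonpos_iff_eq_zero,
          lintegral_eq_zero_iff ((hFy y).pow_const P)] at h1
        filter_upwards [h1] with x hx _
        simpa [hP0, hP0.not_gt] using hx
      · exact ae_of_all _ fun x h0 => absurd h0 hy
  have hfin : ∀ᵐ y ∂ν, κ y < ∞ := ae_lt_top hκ hI
  have hconj : P.HolderConjugate (P / (P - 1)) := Real.HolderConjugate.conjExponent hP
  set Q := P / (P - 1)
  have hQ0 : 0 < Q := hconj.symm.pos
  have hPQ : P / Q = P - 1 := by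
    simp only [Q]
    field_simp
  -- Hölder's inequality for the splitting `F = (κ^(-1/Q) F) · κ^(1/Q)` bounds the power of the
  -- inner integral by an expression linear in `F ^ P`. Integration in `x` then only needs `∫ F ^ P
  -- ≤ κ ^ P`, and no duality argument is required.
  have key : ∀ᵐ x ∂μ, (∫⁻ y, F x y ∂ν) ^ P ≤
      I ^ (P - 1) * ∫⁻ y, κ y ^ (-(P - 1)) * F x y ^ P ∂ν := by
    filter_upwards [hzero] with x hx
    have h1 : ∫⁻ y, F x y ∂ν ≤
        ∫⁻ y, ((fun y => κ y ^ (-(1 / Q)) * F x y) * fun y => κ y ^ (1 / Q)) y ∂ν := by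
      refine lintegral_mono_ae ?_
      filter_upwards [hx, hfin] with y hy hy'
      by_cases h0 : κ y = 0
      · simp [hy h0]
      · simp only [Pi.mul_apply]
        rw [mul_right_comm, ← ENNReal.rpow_add _ _ h0 hy'.ne]
        simp
    have h2 := ENNReal.lintegral_mul_le_Lp_mul_Lq ν hconj
      (f := fun y => κ y ^ (-(1 / Q)) * F x y) (g := fun y => κ y ^ (1 / Q))
      ((hκ.pow_const _).mul (hFx x)).aemeasurable (hκ.pow_const _).aemeasurable
    have h3 : ∀ y, (κ y ^ (1 / Q)) ^ Q = κ y := fun y => by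
      rw [← ENNReal.rpow_mul, one_div, inv_mul_cancel₀ hQ0.ne', ENNReal.rpow_one]
    have h4 : ∀ y, (κ y ^ (-(1 / Q)) * F x y) ^ P = κ y ^ (-(P - 1)) * F x y ^ P := fun y => by
      rw [ENNReal.mul_rpow_of_nonneg _ _ hP0.le, ← ENNReal.rpow_mul]
      congr 2
      rw [← hPQ]
      ring
    simp only [h3, h4] at h2
    refine (ENNReal.rpow_le_rpow (h1.trans h2) hP0.le).trans (le_of_eq ?_)
    rw [ENNReal.mul_rpow_of_nonneg _ _ hP0.le, ← ENNReal.rpow_mul, ← ENNReal.rpow_mul,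
      one_div_mul_cancel hP0.ne', ENNReal.rpow_one, mul_comm]
    congr 2
    rw [← hPQ]
    ring
  rw [eLpNorm_eq_lintegral_rpow_enorm_toReal hp0 hptop]
  simp only [enorm_eq_self]
  rw [one_div, ENNReal.rpow_inv_le_iff hP0]
  calc ∫⁻ x, (∫⁻ y, F x y ∂ν) ^ P ∂μ
      ≤ ∫⁻ x, I ^ (P - 1) * ∫⁻ y, κ y ^ (-(P - 1)) * F x y ^ P ∂ν ∂μ := lintegral_mono_ae key
    _ = I ^ (P - 1) * ∫⁻ x, ∫⁻ y, κ y ^ (-(P - 1)) * F x y ^ P ∂ν ∂μ := by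
        refine lintegral_const_mul' _ _ (ENNReal.rpow_ne_top_of_nonneg (by linarith) hI)
    _ = I ^ (P - 1) * ∫⁻ y, ∫⁻ x, κ y ^ (-(P - 1)) * F x y ^ P ∂μ ∂ν := by
        rw [lintegral_lintegral_swap]
        exact (((hκ.comp measurable_snd).pow_const _).mul (hF.pow_const _)).aemeasurable
    _ ≤ I ^ (P - 1) * ∫⁻ y, κ y ∂ν := by
        gcongr with y
        rw [lintegral_const_mul _ ((hFy y).pow_const P)]
        exact (mul_le_mul_right (hF' y) _).trans (ENNReal_rpow_neg_mul_rpow_le hP _)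
    _ = I ^ P := by
        rcases eq_or_ne I 0 with h0 | h0
        · have : ∫⁻ y, κ y ∂ν = 0 := h0
          rw [this, mul_zero, h0, ENNReal.zero_rpow_of_pos hP0]
        · change I ^ (P - 1) * I = I ^ P
          nth_rewrite 2 [← ENNReal.rpow_one I]
          rw [← ENNReal.rpow_add _ _ h0 hI]
          simp

/-- Fatou's lemma for the `L^p` norm of nonnegative functions. -/
theorem eLpNorm_le_of_le_liminf {ψ : α → ℝ≥0∞} {ψ' : ℕ → α → ℝ≥0∞} (hm : ∀ k, Measurable (ψ' k))
    (hl : ∀ x, ψ x ≤ liminf (fun k => ψ' k x) atTop) {p : ℝ≥0∞} (hp : 1 ≤ p) {c : ℝ≥0∞}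
    (hc : ∀ k, eLpNorm (ψ' k) p μ ≤ c) : eLpNorm ψ p μ ≤ c := by
  rcases eq_or_ne p ∞ with rfl | hptop
  · simp only [eLpNorm_exponent_top] at hc ⊢
    refine eLpNormEssSup_le_of_ae_enorm_bound ?_
    have : ∀ᵐ x ∂μ, ∀ k, ψ' k x ≤ c := by
      rw [ae_all_iff]
      intro k
      filter_upwards [ae_le_eLpNormEssSup (μ := μ) (f := ψ' k)] with x hx
      exact (by simpa using hx : ψ' k x ≤ _).trans (hc k)
    filter_upwards [this] with x hx
    refine (hl x).trans ?_
    refine (liminf_le_liminf (Eventually.of_forall hx)).trans ?_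
    simp
  have hp0 : p ≠ 0 := (zero_lt_one.trans_le hp).ne'
  have hP0 : 0 < p.toReal := ENNReal.toReal_pos hp0 hptop
  rw [eLpNorm_eq_lintegral_rpow_enorm_toReal hp0 hptop, one_div, ENNReal.rpow_inv_le_iff hP0]
  simp only [enorm_eq_self]
  have h1 : ∀ k, ∫⁻ x, ψ' k x ^ p.toReal ∂μ ≤ c ^ p.toReal := by
    intro k
    have := hc k
    rw [eLpNorm_eq_lintegral_rpow_enorm_toReal hp0 hptop, one_div,
      ENNReal.rpow_inv_le_iff hP0] at this
    simpa only [enorm_eq_self] using this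
  calc ∫⁻ x, ψ x ^ p.toReal ∂μ ≤ ∫⁻ x, liminf (fun k => ψ' k x ^ p.toReal) atTop ∂μ := by
        refine lintegral_mono fun x => ?_
        have := (ENNReal.orderIsoRpow p.toReal hP0).liminf_apply (f := atTop)
          (u := fun k => ψ' k x)
        simp only [ENNReal.orderIsoRpow_apply] at this
        rw [← this]
        exact ENNReal.rpow_le_rpow (hl x) hP0.le
    _ ≤ liminf (fun k => ∫⁻ x, ψ' k x ^ p.toReal ∂μ) atTop :=
        lintegral_liminf_le fun k => (hm k).pow_const _
    _ ≤ c ^ p.toReal := by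
        refine (liminf_le_liminf (Eventually.of_forall h1)).trans ?_
        simp

theorem eLpNorm_le_liminf {ψ : α → ℝ≥0∞} {ψ' : ℕ → α → ℝ≥0∞} (hm : ∀ k, Measurable (ψ' k))
    (hl : ∀ x, Tendsto (fun k => ψ' k x) atTop (𝓝 (ψ x))) {p : ℝ≥0∞} (hp : 1 ≤ p) :
    eLpNorm ψ p μ ≤ liminf (fun k => eLpNorm (ψ' k) p μ) atTop := by
  refine le_of_forall_gt fun c hc => ?_
  obtain ⟨c', hc', hcc⟩ := exists_between hc
  -- A level above the lower limit bounds the norms along a subsequence. The pointwise limit is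
  -- unchanged along it, and Fatou's lemma with a uniform bound applies.
  have hfr : ∃ᶠ k in atTop, eLpNorm (ψ' k) p μ < c' :=
    frequently_lt_of_liminf_lt (by isBoundedDefault) hc'
  obtain ⟨θ, hθ, hθ'⟩ := Filter.extraction_of_frequently_atTop hfr
  refine lt_of_le_of_lt (eLpNorm_le_of_le_liminf (fun k => hm (θ k)) (fun x => ?_) hp
    fun k => (hθ' k).le) hcc
  exact ((hl x).comp hθ.tendsto_atTop).liminf_eq.ge

theorem eLpNorm_const_mul_le (c : ℝ≥0∞) {ψ : α → ℝ≥0∞} (hψ : Measurable ψ) {p : ℝ≥0∞}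
    (hp : 1 ≤ p) : eLpNorm (fun x => c * ψ x) p μ ≤ c * eLpNorm ψ p μ := by
  rcases eq_or_ne p ∞ with rfl | hptop
  · simp only [eLpNorm_exponent_top]
    refine eLpNormEssSup_le_of_ae_enorm_bound ?_
    filter_upwards [ae_le_eLpNormEssSup (μ := μ) (f := ψ)] with x hx
    exact mul_le_mul_right hx c
  have hp0 : p ≠ 0 := (zero_lt_one.trans_le hp).ne'
  have hP0 : 0 < p.toReal := ENNReal.toReal_pos hp0 hptop
  rw [eLpNorm_eq_lintegral_rpow_enorm_toReal hp0 hptop,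
    eLpNorm_eq_lintegral_rpow_enorm_toReal hp0 hptop]
  simp only [enorm_eq_self, ENNReal.mul_rpow_of_nonneg _ _ hP0.le]
  rw [lintegral_const_mul _ (hψ.pow_const _), ENNReal.mul_rpow_of_nonneg _ _ (by positivity),
    ← ENNReal.rpow_mul, mul_one_div_cancel hP0.ne', ENNReal.rpow_one]

theorem eLpNorm_lt_top_of_le_one {ψ : α → ℝ≥0∞} (h1 : ∀ x, ψ x ≤ 1) (hint : ∫⁻ x, ψ x ∂μ < ∞)
    {p : ℝ≥0∞} (hp : 1 ≤ p) : eLpNorm ψ p μ < ∞ := by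
  rcases eq_or_ne p ∞ with rfl | hptop
  · rw [eLpNorm_exponent_top]
    exact (eLpNormEssSup_le_of_ae_enorm_bound (C := 1) (ae_of_all _ h1)).trans_lt
      ENNReal.one_lt_top
  have hp0 : p ≠ 0 := (zero_lt_one.trans_le hp).ne'
  have hP0 : 0 < p.toReal := ENNReal.toReal_pos hp0 hptop
  have hP1 : 1 ≤ p.toReal := by
    rw [← ENNReal.toReal_one]
    exact (ENNReal.toReal_le_toReal ENNReal.one_ne_top hptop).2 hp
  rw [eLpNorm_eq_lintegral_rpow_enorm_toReal hp0 hptop]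
  refine ENNReal.rpow_lt_top_of_nonneg (by positivity) (ne_of_lt (lt_of_le_of_lt ?_ hint))
  refine lintegral_mono fun x => ?_
  simpa using ENNReal.rpow_le_rpow_of_exponent_ge (h1 x) hP1

/-- Hölder's inequality against a bounded integrable weight. -/
theorem lintegral_mul_le_eLpNorm {w : α → ℝ≥0∞} (hw : Measurable w) (hw1 : ∀ x, w x ≤ 1)
    (hint : ∫⁻ x, w x ∂μ < ∞) {p : ℝ≥0∞} (hp : 1 ≤ p) : ∃ C : ℝ≥0∞, C ≠ ∞ ∧
    ∀ ψ : α → ℝ≥0∞, Measurable ψ → ∫⁻ x, w x * ψ x ∂μ ≤ C * eLpNorm ψ p μ := by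
  -- For the finite measure `w μ` the `L^1` norm is at most the `L^p` norm times a power of the
  -- total mass; since `w ≤ 1`, the latter norm is at most the one for `μ`.
  set ν' := μ.withDensity w
  have hu : ν' univ = ∫⁻ x, w x ∂μ := by simp [ν']
  refine ⟨ν' univ ^ (1 / (1 : ℝ≥0∞).toReal - 1 / p.toReal), ?_, fun ψ hψ => ?_⟩
  · refine ENNReal.rpow_ne_top_of_nonneg ?_ (hu ▸ hint.ne)
    simp only [ENNReal.toReal_one, div_one, sub_nonneg]
    rcases eq_or_ne p ∞ with rfl | hptop
    · simp
    · have : 1 ≤ p.toReal := by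
        rw [← ENNReal.toReal_one]
        exact (ENNReal.toReal_le_toReal ENNReal.one_ne_top hptop).2 hp
      exact div_le_one_of_le₀ this (by positivity)
  · have h1 := eLpNorm_le_eLpNorm_mul_rpow_measure_univ (μ := ν') hp hψ.aestronglyMeasurable
    rw [eLpNorm_one_eq_lintegral_enorm] at h1
    simp only [enorm_eq_self] at h1
    rw [lintegral_withDensity_eq_lintegral_mul _ hw hψ] at h1
    refine h1.trans ?_
    rw [mul_comm]
    have hle : ν' ≤ μ := calc
      ν' ≤ μ.withDensity 1 := withDensity_mono (ae_of_all _ hw1)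
      _ = μ := withDensity_one
    gcongr

end Minkowski

end

/-! ### Weighted mixed norms on phase space -/

section

section SolidNorm

variable {V : Type*} [NormedAddCommGroup V] [InnerProductSpace ℝ V]

theorem one_le_bracket (x : V) : 1 ≤ bracket x := by
  rw [bracket, Real.one_le_sqrt]
  nlinarith [norm_nonneg x]

theorem bracket_pos (x : V) : 0 < bracket x := zero_lt_one.trans_le (one_le_bracket x)

theorem bracket_zero : bracket (0 : V) = 1 := by simp [bracket]

theorem continuous_bracket : Continuous (bracket : V → ℝ) := by
  unfold bracket
  fun_prop

theorem bracket_le_mul (x y : V) : bracket x ≤ (1 + ‖x - y‖) * bracket y := by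
  have h1 : bracket x ≤ bracket y + ‖x - y‖ := by
    have hy : ‖y‖ ≤ bracket y := Real.le_sqrt_of_sq_le (by linarith)
    have hy2 : bracket y ^ 2 = 1 + ‖y‖ ^ 2 := Real.sq_sqrt (by positivity)
    have hx : ‖x‖ ≤ ‖y‖ + ‖x - y‖ := by
      simpa using norm_add_le y (x - y)
    refine Real.sqrt_le_iff.2 ⟨by linarith [bracket_pos y, norm_nonneg (x - y)], ?_⟩
    nlinarith [norm_nonneg x, norm_nonneg (x - y), norm_nonneg y, bracket_pos y]
  nlinarith [one_le_bracket y, norm_nonneg (x - y)]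

/-- For `r ≥ 0` this is a power of `bracket_le_mul`; for `r ≤ 0` that inequality is used with `x`
and `y` exchanged and then inverted. This moderateness of the weight is what makes Young's
inequality hold. -/
theorem bracket_rpow_le {r γ : ℝ} (hr : |r| ≤ γ) (x y : V) :
    bracket x ^ r ≤ (1 + ‖x - y‖) ^ γ * bracket y ^ r := by
  have hx := bracket_pos x
  have hy := bracket_pos y
  have h1 : (1 : ℝ) ≤ 1 + ‖x - y‖ := by simp
  have h2 : (1 + ‖x - y‖) ^ |r| ≤ (1 + ‖x - y‖) ^ γ := Real.rpow_le_rpow_of_exponent_le h1 hr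
  refine le_trans ?_ (mul_le_mul_of_nonneg_right h2 (by positivity))
  rcases le_total 0 r with h0 | h0
  · rw [abs_of_nonneg h0, ← Real.mul_rpow (by positivity) hy.le]
    exact Real.rpow_le_rpow hx.le (bracket_le_mul x y) h0
  · rw [abs_of_nonpos h0]
    have h3 : bracket y ^ (-r) ≤ (1 + ‖x - y‖) ^ (-r) * bracket x ^ (-r) := by
      rw [← Real.mul_rpow (by positivity) hx.le]
      refine Real.rpow_le_rpow hy.le ?_ (by linarith)
      rw [norm_sub_rev]
      exact bracket_le_mul y x
    rw [Real.rpow_neg hy.le, Real.rpow_neg hx.le] at h3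
    have hy' : 0 < bracket y ^ r := by positivity
    have hx' : 0 < bracket x ^ r := by positivity
    rw [inv_le_iff_one_le_mul₀ hy', mul_assoc, mul_comm, mul_assoc] at h3
    have h4 := mul_le_mul_of_nonneg_left h3 hx'.le
    field_simp at h4
    linarith

variable [FiniteDimensional ℝ V] [MeasurableSpace V] [BorelSpace V]

/-- The bracket weight, with values in `[0, ∞]`. -/
def wt (r : ℝ) (x : V) : ℝ≥0∞ := ENNReal.ofReal (bracket x ^ r)

theorem measurable_wt (r : ℝ) : Measurable (wt r : V → ℝ≥0∞) := by
  refine ENNReal.measurable_ofReal.comp (Continuous.measurable ?_)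
  exact continuous_bracket.rpow_const fun x => Or.inl (bracket_pos x).ne'

theorem wt_le {r γ : ℝ} (hr : |r| ≤ γ) (x y : V) :
    wt r x ≤ ENNReal.ofReal ((1 + ‖x - y‖) ^ γ) * wt r y := by
  unfold wt
  rw [← ENNReal.ofReal_mul (by positivity)]
  exact ENNReal.ofReal_le_ofReal (bracket_rpow_le hr x y)

theorem eLpNorm_wt_translate_le {r γ : ℝ} (hr : |r| ≤ γ) {ψ : V → ℝ≥0∞} (hψ : Measurable ψ)
    (a : V) {p : ℝ≥0∞} (hp : 1 ≤ p) :
    eLpNorm (fun u => wt r u * ψ (u - a)) p volume ≤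
      ENNReal.ofReal ((1 + ‖a‖) ^ γ) * eLpNorm (fun u => wt r u * ψ u) p volume := by
  have hm : Measurable fun u => wt r u * ψ u := (measurable_wt r).mul hψ
  have h1 : eLpNorm (fun u => wt r (u - a) * ψ (u - a)) p volume =
      eLpNorm (fun u => wt r u * ψ u) p volume :=
    eLpNorm_comp_measurePreserving (g := fun u => wt r u * ψ u) hm.aestronglyMeasurable
      (measurePreserving_sub_right volume a)
  rw [← h1]
  refine le_trans (eLpNorm_mono_enorm fun u => ?_) (eLpNorm_const_mul_le _
    (hm.comp (measurable_sub_const a)) hp)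
  simp only [enorm_eq_self, Function.comp]
  rw [← mul_assoc]
  gcongr
  have := wt_le hr u (u - a)
  rwa [sub_sub_cancel] at this

theorem measurable_eLpNorm_slice {φ : V × V → ℝ≥0∞} (hφ : Measurable φ) {p : ℝ≥0∞} (hp : 1 ≤ p) :
    Measurable fun v => eLpNorm (fun u => φ (u, v)) p volume := by
  rcases eq_or_ne p ∞ with rfl | hptop
  · simp only [eLpNorm_exponent_top]
    refine measurable_of_Iic fun a => ?_
    -- A sublevel set of the essential supremum consists of those `v` whose slice exceeds `a` only
    -- on a null set, and the measure of a slice depends measurably on `v`.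
    have e : (fun v => eLpNormEssSup (fun u => φ (u, v)) volume) ⁻¹' Iic a =
        {v | volume ((fun u => (u, v)) ⁻¹' (φ ⁻¹' Ioi a)) = 0} := by
      ext v
      simp only [mem_preimage, mem_Iic, Set.mem_ofPred_eq]
      constructor
      · intro h
        rw [measure_eq_zero_iff_ae_notMem]
        filter_upwards [ae_le_eLpNormEssSup (μ := volume) (f := fun u => φ (u, v))] with u hu
        simp only [mem_preimage, mem_Ioi, not_lt]
        exact (by simpa using hu : φ (u, v) ≤ _).trans h
      · intro h
        refine eLpNormEssSup_le_of_ae_enorm_bound ?_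
        rw [measure_eq_zero_iff_ae_notMem] at h
        filter_upwards [h] with u hu
        simpa using hu
    rw [e]
    exact (measurable_measure_prodMk_right (hφ measurableSet_Ioi)) (measurableSet_singleton 0)
  have hp0 : p ≠ 0 := (zero_lt_one.trans_le hp).ne'
  simp only [eLpNorm_eq_lintegral_rpow_enorm_toReal hp0 hptop, enorm_eq_self]
  exact (Measurable.lintegral_prod_left' (f := fun z => φ z ^ p.toReal)
    (hφ.pow_const _)).pow_const _

/-- The weighted mixed norm of a nonnegative function on `V × V`. -/
def mixedFun (p q : ℝ≥0∞) (r s : ℝ) (φ : V × V → ℝ≥0∞) : ℝ≥0∞ :=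
  eLpNorm (fun v => wt s v * eLpNorm (fun u => wt r u * φ (u, v)) p volume) q volume

/-- The properties of the norms on nonnegative functions on phase space that are used: solidity,
subadditivity, a Young inequality with respect to `tfWeight ^ γ`, the Fatou property, and
comparison with rapidly decaying functions. -/
structure SolidNorm (γ : ℝ) (M : (V × V → ℝ≥0∞) → ℝ≥0∞) : Prop where
  mono : ∀ φ ψ, (∀ z, φ z ≤ ψ z) → M φ ≤ M ψ
  add : ∀ φ ψ, Measurable φ → Measurable ψ → M (fun z => φ z + ψ z) ≤ M φ + M ψ
  smul : ∀ (c : ℝ≥0∞) φ, Measurable φ → M (fun z => c * φ z) ≤ c * M φ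
  conv : ∀ H φ, Measurable H → Measurable φ →
    M (H ⋆ₗ φ) ≤ (∫⁻ w, H w * ENNReal.ofReal (tfWeight w ^ γ)) * M φ
  fatou : ∀ (φ : ℕ → V × V → ℝ≥0∞) (ψ : V × V → ℝ≥0∞) (c : ℝ≥0∞), (∀ k, Measurable (φ k)) →
    (∀ z, Tendsto (fun k => φ k z) atTop (𝓝 (ψ z))) → (∀ k, M (φ k) ≤ c) → M ψ ≤ c
  pairing : ∃ K : ℕ, ∃ C : ℝ≥0∞, C ≠ ∞ ∧ ∀ φ, Measurable φ →
    ∫⁻ z, ENNReal.ofReal (tfDecay K z) * φ z ≤ C * M φ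
  decay : ∃ K : ℕ, M (fun z => ENNReal.ofReal (tfDecay K z)) < ∞

variable {p q : ℝ≥0∞} {r s γ : ℝ}

theorem measurable_slice_wt (hp : 1 ≤ p) (r : ℝ) {φ : V × V → ℝ≥0∞} (hφ : Measurable φ) :
    Measurable fun v => eLpNorm (fun u => wt r u * φ (u, v)) p volume :=
  measurable_eLpNorm_slice (φ := fun z => wt r z.1 * φ z)
    (((measurable_wt r).comp measurable_fst).mul hφ) hp

theorem mixedFun_mono (φ ψ : V × V → ℝ≥0∞) (h : ∀ z, φ z ≤ ψ z) :
    mixedFun p q r s φ ≤ mixedFun p q r s ψ := by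
  refine eLpNorm_mono_enorm fun v => ?_
  simp only [enorm_eq_self]
  gcongr
  refine eLpNorm_mono_enorm fun u => ?_
  simp only [enorm_eq_self]
  gcongr
  exact h _

/-- A convolution is a superposition of translates, to which Minkowski's inequality is applied once
in each variable. Translation by `w` costs `(1 + ‖w.1‖)^γ` in the inner norm and `(1 + ‖w.2‖)^γ` in
the outer one, together `tfWeight w ^ γ`. -/
theorem mixedFun_conv_le (hp : 1 ≤ p) (hq : 1 ≤ q) (hr : |r| ≤ γ) (hs : |s| ≤ γ)
    (H φ : V × V → ℝ≥0∞) (hH : Measurable H) (hφ : Measurable φ) :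
    mixedFun p q r s (H ⋆ₗ φ) ≤
      (∫⁻ w, H w * ENNReal.ofReal (tfWeight w ^ γ)) * mixedFun p q r s φ := by
  set In : V → ℝ≥0∞ := fun v => eLpNorm (fun u => wt r u * φ (u, v)) p volume with hIn
  have hInm : Measurable In := measurable_slice_wt hp r hφ
  have hφs : ∀ v, Measurable fun u => φ (u, v) := fun v => hφ.comp measurable_prodMk_right
  have hγm : Measurable fun a : V => ENNReal.ofReal ((1 + ‖a‖) ^ γ) := by fun_prop
  have inner : ∀ v, eLpNorm (fun u => wt r u * (H ⋆ₗ φ) (u, v)) p volume ≤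
      ∫⁻ w : V × V, H w * ENNReal.ofReal ((1 + ‖w.1‖) ^ γ) * In (v - w.2) := by
    intro v
    have e : (fun u => wt r u * (H ⋆ₗ φ) (u, v)) =
        fun u => ∫⁻ w : V × V, H w * (wt r u * φ (u - w.1, v - w.2)) := by
      funext u
      rw [lconvolution_def, ← lintegral_const_mul]
      · refine lintegral_congr fun w => ?_
        rw [show -w + (u, v) = (u - w.1, v - w.2) by ext <;> simp [sub_eq_neg_add]]
        ring
      · fun_prop
    rw [e]
    refine eLpNorm_lintegral_le (F := fun u w => H w * (wt r u * φ (u - w.1, v - w.2))) ?_ hp ?_ ?_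
    · refine (hH.comp measurable_snd).mul (((measurable_wt r).comp measurable_fst).mul
        (hφ.comp ?_))
      fun_prop
    · exact (hH.mul (hγm.comp measurable_fst)).mul (hInm.comp (by fun_prop))
    · intro w
      refine (eLpNorm_const_mul_le _ ?_ hp).trans ?_
      · exact (measurable_wt r).mul ((hφs _).comp (measurable_sub_const _))
      · rw [mul_assoc]
        gcongr
        exact eLpNorm_wt_translate_le hr (hφs (v - w.2)) w.1 hp
  have outer : mixedFun p q r s (H ⋆ₗ φ) ≤
      eLpNorm (fun v => ∫⁻ w : V × V, H w * ENNReal.ofReal ((1 + ‖w.1‖) ^ γ) *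
        (wt s v * In (v - w.2))) q volume := by
    refine eLpNorm_mono_enorm fun v => ?_
    simp only [enorm_eq_self]
    refine (mul_le_mul_right (inner v) _).trans (le_of_eq ?_)
    rw [← lintegral_const_mul]
    · refine lintegral_congr fun w => ?_
      ring
    · exact (hH.mul (hγm.comp measurable_fst)).mul (hInm.comp (by fun_prop))
  refine outer.trans ?_
  have hlast : ∀ w : V × V, eLpNorm (fun v => H w * ENNReal.ofReal ((1 + ‖w.1‖) ^ γ) *
        (wt s v * In (v - w.2))) q volume ≤
      H w * ENNReal.ofReal (tfWeight w ^ γ) * mixedFun p q r s φ := by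
    intro w
    refine (eLpNorm_const_mul_le _ ((measurable_wt s).mul
      (hInm.comp (measurable_sub_const _))) hq).trans ?_
    refine (mul_le_mul_right (eLpNorm_wt_translate_le hs hInm w.2 hq) _).trans (le_of_eq ?_)
    rw [tfWeight, Real.mul_rpow (by positivity) (by positivity),
      ENNReal.ofReal_mul (by positivity)]
    simp only [mixedFun, hIn]
    ring
  have hWm : Measurable fun w : V × V => H w * ENNReal.ofReal (tfWeight w ^ γ) := by
    refine hH.mul ?_
    unfold tfWeight
    fun_prop
  refine (eLpNorm_lintegral_le (F := fun v w => H w * ENNReal.ofReal ((1 + ‖w.1‖) ^ γ) *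
        (wt s v * In (v - w.2))) ?_ hq (hWm.mul_const _) hlast).trans (le_of_eq ?_)
  · refine Measurable.mul ?_ (((measurable_wt s).comp measurable_fst).mul (hInm.comp ?_))
    · exact (hH.mul (hγm.comp measurable_fst)).comp measurable_snd
    · fun_prop
  · exact lintegral_mul_const _ hWm

theorem lintegral_decay_mul_le (hp : 1 ≤ p) (r : ℝ) : ∃ K₀ : ℕ, ∀ K ≥ K₀,
    ∃ C : ℝ≥0∞, C ≠ ∞ ∧ ∀ ψ : V → ℝ≥0∞, Measurable ψ →
      ∫⁻ u, ENNReal.ofReal (((1 + ‖u‖) ^ K)⁻¹) * ψ u ≤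
        C * eLpNorm (fun u => wt r u * ψ u) p volume := by
  -- The part `intPow V` leaves an integrable weight for Hölder's inequality, and `⌈|r|⌉₊` pays for
  -- the division by `⟨u⟩^r`.
  refine ⟨intPow V + ⌈|r|⌉₊, fun K hK => ?_⟩
  obtain ⟨C, hC, h⟩ := lintegral_mul_le_eLpNorm (μ := (volume : Measure V))
    (w := fun u => ENNReal.ofReal (((1 + ‖u‖) ^ intPow V)⁻¹)) (by fun_prop)
    (fun u => by
      rw [ENNReal.ofReal_le_one]
      exact inv_le_one_of_one_le₀ (one_le_pow₀ (by simp)))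
    (integrable_one_add_norm_inv.lintegral_lt_top) hp
  refine ⟨C, hC, fun ψ hψ => le_trans (lintegral_mono fun u => ?_)
    (h (fun u => wt r u * ψ u) ((measurable_wt r).mul hψ))⟩
  rw [← mul_assoc]
  gcongr
  rw [wt, ← ENNReal.ofReal_mul (by positivity)]
  refine ENNReal.ofReal_le_ofReal ?_
  have h1 := bracket_rpow_le (le_refl |r|) (0 : V) u
  rw [bracket_zero, Real.one_rpow, zero_sub, norm_neg] at h1
  have h3 : (1 : ℝ) ≤ 1 + ‖u‖ := by simp
  have h2 : (1 + ‖u‖) ^ |r| ≤ (1 + ‖u‖) ^ ⌈|r|⌉₊ := by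
    rw [← Real.rpow_natCast]
    exact Real.rpow_le_rpow_of_exponent_le h3 (Nat.le_ceil _)
  have hb : 0 < bracket u ^ r := Real.rpow_pos_of_pos (bracket_pos u) r
  calc ((1 + ‖u‖) ^ K)⁻¹ ≤ ((1 + ‖u‖) ^ (intPow V + ⌈|r|⌉₊))⁻¹ :=
        inv_anti₀ (by positivity) (pow_le_pow_right₀ h3 hK)
    _ = ((1 + ‖u‖) ^ intPow V)⁻¹ * ((1 + ‖u‖) ^ ⌈|r|⌉₊)⁻¹ := by rw [pow_add, mul_inv]
    _ ≤ _ := by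
      gcongr
      rw [inv_le_iff_one_le_mul₀ (by positivity)]
      nlinarith

theorem eLpNorm_wt_decay_lt_top (hp : 1 ≤ p) (r : ℝ) : ∃ K₀ : ℕ, ∀ K ≥ K₀,
    eLpNorm (fun u : V => wt r u * ENNReal.ofReal (((1 + ‖u‖) ^ K)⁻¹)) p volume < ∞ := by
  refine ⟨intPow V + ⌈|r|⌉₊, fun K hK => ?_⟩
  refine lt_of_le_of_lt (eLpNorm_mono_enorm fun u => ?_) (eLpNorm_lt_top_of_le_one
    (ψ := fun u : V => ENNReal.ofReal (((1 + ‖u‖) ^ intPow V)⁻¹)) (fun u => ?_)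
    integrable_one_add_norm_inv.lintegral_lt_top hp)
  · simp only [enorm_eq_self]
    rw [wt, ← ENNReal.ofReal_mul (Real.rpow_nonneg (bracket_pos u).le r)]
    refine ENNReal.ofReal_le_ofReal ?_
    have h1 := bracket_rpow_le (le_refl |r|) u (0 : V)
    rw [bracket_zero, Real.one_rpow, sub_zero, mul_one] at h1
    have h3 : (1 : ℝ) ≤ 1 + ‖u‖ := by simp
    have h2 : (1 + ‖u‖) ^ |r| ≤ (1 + ‖u‖) ^ ⌈|r|⌉₊ := by
      rw [← Real.rpow_natCast]
      exact Real.rpow_le_rpow_of_exponent_le h3 (Nat.le_ceil _)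
    calc bracket u ^ r * ((1 + ‖u‖) ^ K)⁻¹
        ≤ (1 + ‖u‖) ^ ⌈|r|⌉₊ * ((1 + ‖u‖) ^ (intPow V + ⌈|r|⌉₊))⁻¹ :=
          mul_le_mul (h1.trans h2) (inv_anti₀ (by positivity) (pow_le_pow_right₀ h3 hK))
            (by positivity) (by positivity)
      _ = ((1 + ‖u‖) ^ intPow V)⁻¹ := by
        rw [pow_add]
        field_simp
  · rw [ENNReal.ofReal_le_one]
    exact inv_le_one_of_one_le₀ (one_le_pow₀ (by simp))

theorem ofReal_tfDecay (K : ℕ) (z : V × V) : ENNReal.ofReal (tfDecay K z) =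
    ENNReal.ofReal (((1 + ‖z.2‖) ^ K)⁻¹) * ENNReal.ofReal (((1 + ‖z.1‖) ^ K)⁻¹) := by
  rw [← ENNReal.ofReal_mul (by positivity), tfDecay, tfWeight, mul_pow, mul_inv, mul_comm]

theorem mixedFun_add_le (hp : 1 ≤ p) (hq : 1 ≤ q) (φ ψ : V × V → ℝ≥0∞) (hφ : Measurable φ)
    (hψ : Measurable ψ) :
    mixedFun p q r s (fun z => φ z + ψ z) ≤ mixedFun p q r s φ + mixedFun p q r s ψ := by
  have hφs : ∀ v, Measurable fun u => wt r u * φ (u, v) := fun v =>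
    (measurable_wt r).mul (hφ.comp measurable_prodMk_right)
  have hψs : ∀ v, Measurable fun u => wt r u * ψ (u, v) := fun v =>
    (measurable_wt r).mul (hψ.comp measurable_prodMk_right)
  have h1 := eLpNorm_add_le (p := q) (μ := volume)
    (f := fun v => wt s v * eLpNorm (fun u => wt r u * φ (u, v)) p volume)
    (g := fun v => wt s v * eLpNorm (fun u => wt r u * ψ (u, v)) p volume)
    ((measurable_wt s).mul (measurable_slice_wt hp r hφ)).aestronglyMeasurable
    ((measurable_wt s).mul (measurable_slice_wt hp r hψ)).aestronglyMeasurable hq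
  refine le_trans ?_ h1
  refine eLpNorm_mono_enorm fun v => ?_
  simp only [enorm_eq_self, Pi.add_apply, ← mul_add]
  gcongr
  have h2 := eLpNorm_add_le (p := p) (μ := volume) (hφs v).aestronglyMeasurable
    (hψs v).aestronglyMeasurable hp
  refine le_trans (le_of_eq ?_) h2
  congr 1
  funext u
  exact mul_add _ _ _

theorem mixedFun_smul_le (hp : 1 ≤ p) (hq : 1 ≤ q) (c : ℝ≥0∞) (φ : V × V → ℝ≥0∞)
    (hφ : Measurable φ) : mixedFun p q r s (fun z => c * φ z) ≤ c * mixedFun p q r s φ := by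
  refine le_trans (eLpNorm_mono_enorm fun v => ?_) (eLpNorm_const_mul_le c
    ((measurable_wt s).mul (measurable_slice_wt hp r hφ)) hq)
  simp only [enorm_eq_self, Pi.mul_apply]
  rw [mul_left_comm]
  gcongr
  refine le_trans (eLpNorm_mono_enorm fun u => ?_) (eLpNorm_const_mul_le c
    ((measurable_wt r).mul (hφ.comp measurable_prodMk_right)) hp)
  simp only [enorm_eq_self, Pi.mul_apply, Function.comp]
  rw [mul_left_comm]

theorem mixedFun_fatou (hp : 1 ≤ p) (hq : 1 ≤ q) (φ : ℕ → V × V → ℝ≥0∞) (ψ : V × V → ℝ≥0∞)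
    (c : ℝ≥0∞) (hm : ∀ k, Measurable (φ k))
    (hl : ∀ z, Tendsto (fun k => φ k z) atTop (𝓝 (ψ z)))
    (hc : ∀ k, mixedFun p q r s (φ k) ≤ c) : mixedFun p q r s ψ ≤ c := by
  refine eLpNorm_le_of_le_liminf (fun k => (measurable_wt s).mul
    (measurable_slice_wt hp r (hm k))) (fun v => ?_) hq hc
  have h1 : eLpNorm (fun u => wt r u * ψ (u, v)) p volume ≤
      liminf (fun k => eLpNorm (fun u => wt r u * φ k (u, v)) p volume) atTop :=
    eLpNorm_le_liminf (fun k => (measurable_wt r).mul ((hm k).comp measurable_prodMk_right))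
      (fun u => ENNReal.Tendsto.const_mul (hl (u, v)) (Or.inr ENNReal.ofReal_ne_top)) hp
  calc wt s v * eLpNorm (fun u => wt r u * ψ (u, v)) p volume
      ≤ wt s v * liminf (fun k => eLpNorm (fun u => wt r u * φ k (u, v)) p volume) atTop := by
        gcongr
    _ = liminf (fun k => wt s v * eLpNorm (fun u => wt r u * φ k (u, v)) p volume) atTop :=
      (ENNReal.liminf_const_mul_of_ne_top ENNReal.ofReal_ne_top).symm

/-- The decaying weight is a product of functions of one variable, so the one-variable estimate
applies first to the inner and then to the outer norm, with the larger of the two exponents. -/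
theorem mixedFun_pairing (hp : 1 ≤ p) (hq : 1 ≤ q) (r s : ℝ) :
    ∃ K : ℕ, ∃ C : ℝ≥0∞, C ≠ ∞ ∧ ∀ φ : V × V → ℝ≥0∞, Measurable φ →
      ∫⁻ z, ENNReal.ofReal (tfDecay K z) * φ z ≤ C * mixedFun p q r s φ := by
  obtain ⟨K₁, h₁⟩ := lintegral_decay_mul_le (V := V) hp r
  obtain ⟨K₂, h₂⟩ := lintegral_decay_mul_le (V := V) hq s
  obtain ⟨C₁, hC₁, h₁⟩ := h₁ (max K₁ K₂) (le_max_left _ _)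
  obtain ⟨C₂, hC₂, h₂⟩ := h₂ (max K₁ K₂) (le_max_right _ _)
  refine ⟨max K₁ K₂, C₁ * C₂, ENNReal.mul_ne_top hC₁ hC₂, fun φ hφ => ?_⟩
  set K := max K₁ K₂
  have hφs : ∀ v, Measurable fun u => φ (u, v) := fun v => hφ.comp measurable_prodMk_right
  have hdm : Measurable fun z : V × V => ENNReal.ofReal (tfDecay K z) * φ z :=
    (ENNReal.measurable_ofReal.comp (continuous_tfDecay K).measurable).mul hφ
  rw [Measure.volume_eq_prod, lintegral_prod_symm _ hdm.aemeasurable]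
  calc ∫⁻ v, ∫⁻ u, ENNReal.ofReal (tfDecay K (u, v)) * φ (u, v)
      = ∫⁻ v, ENNReal.ofReal (((1 + ‖v‖) ^ K)⁻¹) *
          ∫⁻ u, ENNReal.ofReal (((1 + ‖u‖) ^ K)⁻¹) * φ (u, v) := by
        refine lintegral_congr fun v => ?_
        rw [← lintegral_const_mul' _ _ ENNReal.ofReal_ne_top]
        refine lintegral_congr fun u => ?_
        rw [ofReal_tfDecay, mul_assoc]
    _ ≤ ∫⁻ v, C₁ * (ENNReal.ofReal (((1 + ‖v‖) ^ K)⁻¹) *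
          eLpNorm (fun u => wt r u * φ (u, v)) p volume) := by
        refine lintegral_mono fun v => ?_
        rw [mul_left_comm]
        gcongr
        exact h₁ _ (hφs v)
    _ = C₁ * ∫⁻ v, (ENNReal.ofReal (((1 + ‖v‖) ^ K)⁻¹) *
          eLpNorm (fun u => wt r u * φ (u, v)) p volume) := lintegral_const_mul' _ _ hC₁
    _ ≤ C₁ * C₂ * mixedFun p q r s φ := by
        rw [mul_assoc]
        gcongr
        exact h₂ _ (measurable_slice_wt hp r hφ)

theorem mixedFun_decay (hp : 1 ≤ p) (hq : 1 ≤ q) (r s : ℝ) :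
    ∃ K : ℕ, mixedFun p q r s (fun z : V × V => ENNReal.ofReal (tfDecay K z)) < ∞ := by
  obtain ⟨K₁, h₁⟩ := eLpNorm_wt_decay_lt_top (V := V) hp r
  obtain ⟨K₂, h₂⟩ := eLpNorm_wt_decay_lt_top (V := V) hq s
  have h₁ := h₁ (max K₁ K₂) (le_max_left _ _)
  have h₂ := h₂ (max K₁ K₂) (le_max_right _ _)
  refine ⟨max K₁ K₂, ?_⟩
  set K := max K₁ K₂
  set c := eLpNorm (fun u : V => wt r u * ENNReal.ofReal (((1 + ‖u‖) ^ K)⁻¹)) p volume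
  have hm : ∀ r : ℝ, Measurable fun u : V => wt r u * ENNReal.ofReal (((1 + ‖u‖) ^ K)⁻¹) :=
    fun r => (measurable_wt r).mul (by fun_prop)
  refine lt_of_le_of_lt (le_trans (eLpNorm_mono_enorm fun v => ?_)
    (eLpNorm_const_mul_le c (hm s) hq)) (ENNReal.mul_lt_top h₁ h₂)
  simp only [enorm_eq_self]
  rw [mul_left_comm]
  gcongr
  rw [mul_comm]
  refine le_trans (eLpNorm_mono_enorm fun u => ?_) (eLpNorm_const_mul_le
    (ENNReal.ofReal (((1 + ‖v‖) ^ K)⁻¹)) (hm r) hp)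
  simp only [enorm_eq_self]
  rw [ofReal_tfDecay, mul_left_comm]

theorem solidNorm_mixedFun (hp : 1 ≤ p) (hq : 1 ≤ q) (hr : |r| ≤ γ) (hs : |s| ≤ γ) :
    SolidNorm γ (mixedFun p q r s : (V × V → ℝ≥0∞) → ℝ≥0∞) where
  mono := mixedFun_mono
  add := mixedFun_add_le hp hq
  smul := mixedFun_smul_le hp hq
  conv := mixedFun_conv_le hp hq hr hs
  fatou := mixedFun_fatou hp hq
  pairing := mixedFun_pairing hp hq r s
  decay := mixedFun_decay hp hq r s

theorem lintegral_swap_prod (f : V × V → ℝ≥0∞) (hf : Measurable f) :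
    ∫⁻ z : V × V, f z.swap = ∫⁻ z, f z := by
  rw [Measure.volume_eq_prod]
  exact Measure.measurePreserving_swap.lintegral_comp hf

theorem tfWeight_swap (z : V × V) : tfWeight z.swap = tfWeight z := by
  simp [tfWeight, mul_comm]

theorem lconvolution_comp_swap (H φ : V × V → ℝ≥0∞) (hH : Measurable H) (hφ : Measurable φ) :
    (fun z : V × V => (H ⋆ₗ φ) z.swap) = (fun z => H z.swap) ⋆ₗ fun z => φ z.swap := by
  funext z
  exact (lintegral_swap_prod (fun y => H y * φ (-y + z.swap)) (by fun_prop)).symm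

/-- The exchange of position and frequency preserves the measure, convolutions and `tfWeight`, so
each property is transported. The amalgam norms thereby need no estimates of their own. -/
theorem SolidNorm.swap {M : (V × V → ℝ≥0∞) → ℝ≥0∞} (hM : SolidNorm γ M) :
    SolidNorm γ fun φ : V × V → ℝ≥0∞ => M fun z => φ z.swap where
  mono φ ψ h := hM.mono _ _ fun z => h z.swap
  add φ ψ hφ hψ := hM.add _ _ (hφ.comp measurable_swap) (hψ.comp measurable_swap)
  smul c φ hφ := hM.smul c _ (hφ.comp measurable_swap)
  conv H φ hH hφ := by
    rw [lconvolution_comp_swap H φ hH hφ]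
    refine (hM.conv _ _ (hH.comp measurable_swap) (hφ.comp measurable_swap)).trans (le_of_eq ?_)
    congr 1
    have hm : Measurable fun w : V × V => H w * ENNReal.ofReal (tfWeight w ^ γ) := by
      refine hH.mul ?_
      unfold tfWeight
      fun_prop
    rw [← lintegral_swap_prod _ hm]
    simp only [tfWeight_swap, Function.comp]
  fatou φ ψ c hm hl hc := hM.fatou _ _ c (fun k => (hm k).comp measurable_swap)
    (fun z => hl z.swap) hc
  pairing := by
    obtain ⟨K, C, hC, h⟩ := hM.pairing
    refine ⟨K, C, hC, fun φ hφ => le_trans (le_of_eq ?_) (h _ (hφ.comp measurable_swap))⟩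
    rw [← lintegral_swap_prod (fun z => ENNReal.ofReal (tfDecay K z) * φ z)
      ((ENNReal.measurable_ofReal.comp (continuous_tfDecay K).measurable).mul hφ)]
    simp only [tfDecay, tfWeight_swap]
  decay := by
    obtain ⟨K, h⟩ := hM.decay
    refine ⟨K, ?_⟩
    simpa only [tfDecay, tfWeight_swap] using h

variable {F : Type*} [NormedAddCommGroup F] [NormedSpace ℂ F]

theorem mixedNorm_eq (G : V → V → F) :
    mixedNorm p q r s G = mixedFun p q r s fun z => ‖G z.1 z.2‖ₑ := by
  unfold mixedNorm mixedFun
  congr 1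
  funext v
  congr 1
  refine eLpNorm_congr_enorm_ae (ae_of_all _ fun u => ?_)
  rw [enorm_mul, enorm_norm, wt, enorm_eq_self, Real.enorm_eq_ofReal
    (Real.rpow_nonneg (bracket_pos u).le r)]

theorem modulationNorm_eq (g : 𝓢(V, ℂ)) (f : 𝓢'(V, F)) :
    modulationNorm p q r s g f = mixedFun p q r s fun z => ‖stft g f z.1 z.2‖ₑ :=
  mixedNorm_eq _

theorem amalgamNorm_eq (g : 𝓢(V, ℂ)) (f : 𝓢'(V, F)) :
    amalgamNorm p q r s g f = mixedFun p q r s fun z => ‖stft g f z.swap.1 z.swap.2‖ₑ :=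
  mixedNorm_eq _

end SolidNorm

end

/-! ### The closure of the Schwartz class as a Banach space -/

section

variable {V : Type*} [NormedAddCommGroup V] [InnerProductSpace ℝ V] [FiniteDimensional ℝ V]
  [MeasurableSpace V] [BorelSpace V]
  {F : Type*} [NormedAddCommGroup F] [NormedSpace ℂ F]

theorem continuous_of_schwartzNorm_bound {G H : Type*} [NormedAddCommGroup G] [NormedSpace ℂ G]
    [NormedAddCommGroup H] [NormedSpace ℂ H] (ℓ : 𝓢(V, G) →ₗ[ℂ] H) {L : ℕ} {C : ℝ}
    (h : ∀ φ, ‖ℓ φ‖ ≤ C * schwartzNorm V G L φ) : Continuous ℓ := by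
  refine continuous_of_continuousAt_zero ℓ ?_
  rw [ContinuousAt, map_zero]
  refine squeeze_zero_norm h ?_
  have := ((continuous_schwartzNorm (V := V) (F := G) L).tendsto 0).const_mul C
  simpa using this

/-- A linear form on the Schwartz space that is bounded by a Schwartz norm, as a distribution. -/
def distributionOfBound (ℓ : 𝓢(V, ℂ) →ₗ[ℂ] F)
    (h : ∃ (L : ℕ) (C : ℝ), ∀ φ, ‖ℓ φ‖ ≤ C * schwartzNorm V ℂ L φ) : 𝓢'(V, F) :=
  ContinuousLinearMap.toPointwiseConvergenceCLM _ _ _ _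
    { ℓ with
      cont := by
        obtain ⟨L, C, h⟩ := h
        exact continuous_of_schwartzNorm_bound ℓ h }

variable [CompleteSpace F]

/-- The properties of a norm on tempered distributions that make the closure of the Schwartz class
a Banach space between `𝓢` and `𝓢'`. -/
class AdmissibleNorm (N : 𝓢'(V, F) → ℝ≥0∞) : Prop where
  add_le : ∀ f h, N (f + h) ≤ N f + N h
  smul_eq : ∀ (c : ℂ) f, N (c • f) = ‖c‖ₑ * N f
  eval_le : ∃ (L : ℕ) (C : ℝ), 0 ≤ C ∧ ∀ f φ, N f ≠ ∞ →
    ‖f φ‖ ≤ C * schwartzNorm V ℂ L φ * (N f).toReal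
  schwartz_le : ∃ (L : ℕ) (C : ℝ), 0 ≤ C ∧ ∀ b : 𝓢(V, F),
    N (b : 𝓢'(V, F)) ≤ ENNReal.ofReal (C * schwartzNorm V F L b)
  fatou : ∀ (f : ℕ → 𝓢'(V, F)) (h : 𝓢'(V, F)) (c : ℝ≥0∞),
    (∀ φ, Tendsto (fun k => f k φ) atTop (𝓝 (h φ))) → (∀ k, N (f k) ≤ c) → N h ≤ c

section Space

variable (N : 𝓢'(V, F) → ℝ≥0∞) [hN : AdmissibleNorm N]

theorem norm_zero_eq : N 0 = 0 := by
  have := hN.smul_eq 0 0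
  simpa using this

/-- The closure of the Schwartz class, as a subspace of `𝓢'`. -/
def closureSubmodule : Submodule ℂ 𝓢'(V, F) where
  carrier := schwartzClosure N
  zero_mem' := ⟨by simp [norm_zero_eq N], fun ε hε => ⟨0, by simpa [norm_zero_eq N] using hε⟩⟩
  add_mem' := by
    rintro f h ⟨hf, hf'⟩ ⟨hh, hh'⟩
    refine ⟨(hN.add_le f h).trans_lt (ENNReal.add_lt_top.2 ⟨hf, hh⟩), fun ε hε => ?_⟩
    obtain ⟨a, ha⟩ := hf' (ε / 2) (ENNReal.half_pos hε.ne')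
    obtain ⟨b, hb⟩ := hh' (ε / 2) (ENNReal.half_pos hε.ne')
    refine ⟨a + b, ?_⟩
    rw [map_add, add_sub_add_comm]
    refine (hN.add_le _ _).trans_lt ?_
    rw [← ENNReal.add_halves ε]
    exact ENNReal.add_lt_add ha hb
  smul_mem' := by
    rintro c f ⟨hf, hf'⟩
    refine ⟨by rw [hN.smul_eq]; exact ENNReal.mul_lt_top enorm_lt_top hf, fun ε hε => ?_⟩
    rcases eq_or_ne c 0 with rfl | hc
    · exact ⟨0, by simpa [norm_zero_eq N] using hε⟩
    have hc0 : ‖c‖ₑ ≠ 0 := by simpa using hc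
    obtain ⟨a, ha⟩ := hf' (ε / ‖c‖ₑ) (ENNReal.div_pos hε.ne' enorm_ne_top)
    refine ⟨c • a, ?_⟩
    rw [map_smul, ← smul_sub, hN.smul_eq]
    rw [ENNReal.lt_div_iff_mul_lt (Or.inl hc0) (Or.inl enorm_ne_top)] at ha
    rwa [mul_comm]

/-- The closure of the Schwartz class, as a Banach space. -/
def ClosureSpace : Type _ := closureSubmodule N

instance : AddCommGroup (ClosureSpace N) := inferInstanceAs (AddCommGroup (closureSubmodule N))

instance : Module ℂ (ClosureSpace N) := inferInstanceAs (Module ℂ (closureSubmodule N))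

instance : Norm (ClosureSpace N) := ⟨fun x => (N x.1).toReal⟩

variable {N}

theorem ClosureSpace.norm_def (x : ClosureSpace N) : ‖x‖ = (N x.1).toReal := rfl

theorem ClosureSpace.lt_top (x : ClosureSpace N) : N x.1 < ∞ := x.2.1

theorem ClosureSpace.ofReal_norm (x : ClosureSpace N) : ENNReal.ofReal ‖x‖ = N x.1 :=
  ENNReal.ofReal_toReal x.lt_top.ne

variable (N) in
/-- The inclusion into the space of distributions. -/
def incl : ClosureSpace N →ₗ[ℂ] 𝓢'(V, F) := (closureSubmodule N).subtype

theorem incl_apply (x : ClosureSpace N) : incl N x = x.1 := rfl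

theorem incl_injective : Function.Injective (incl N) := Subtype.val_injective

theorem incl_mem (x : ClosureSpace N) : incl N x ∈ schwartzClosure N := x.2

/-- An element of the closure of the Schwartz class. -/
def toClosure (f : 𝓢'(V, F)) (hf : f ∈ schwartzClosure N) : ClosureSpace N := ⟨f, hf⟩

theorem incl_toClosure (f : 𝓢'(V, F)) (hf : f ∈ schwartzClosure N) :
    incl N (toClosure f hf) = f := rfl

theorem toClosure_incl (x : ClosureSpace N) : toClosure (incl N x) (incl_mem x) = x := rfl

theorem eq_zero_of_norm_eq_zero {f : 𝓢'(V, F)} (h : N f = 0) : f = 0 := by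
  obtain ⟨L, C, _, hC⟩ := hN.eval_le
  ext φ
  have := hC f φ (by simp [h])
  simp only [h, ENNReal.toReal_zero, mul_zero] at this
  simpa using this

theorem normedSpaceCore : NormedSpace.Core ℂ (ClosureSpace N) where
  norm_nonneg x := ENNReal.toReal_nonneg
  norm_smul c x := by
    change (N (c • x.1)).toReal = ‖c‖ * (N x.1).toReal
    rw [hN.smul_eq, ENNReal.toReal_mul, toReal_enorm]
  norm_triangle x y := by
    change (N (x.1 + y.1)).toReal ≤ (N x.1).toReal + (N y.1).toReal
    rw [← ENNReal.toReal_add x.lt_top.ne y.lt_top.ne]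
    exact ENNReal.toReal_mono (ENNReal.add_ne_top.2 ⟨x.lt_top.ne, y.lt_top.ne⟩)
      (hN.add_le x.1 y.1)
  norm_eq_zero_iff x := by
    refine ⟨fun h => Subtype.ext ?_, ?_⟩
    · refine eq_zero_of_norm_eq_zero (N := N) ?_
      have h : (N x.1).toReal = 0 := h
      rw [ENNReal.toReal_eq_zero_iff] at h
      exact h.resolve_right x.lt_top.ne
    · rintro rfl
      change (N 0).toReal = 0
      simp [norm_zero_eq N]

instance : NormedAddCommGroup (ClosureSpace N) := NormedAddCommGroup.ofCore normedSpaceCore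

instance : NormedSpace ℂ (ClosureSpace N) := NormedSpace.ofCore normedSpaceCore

instance : NormedSpace ℝ (ClosureSpace N) := NormedSpace.restrictScalars ℝ ℂ (ClosureSpace N)

instance : IsScalarTower ℝ ℂ (ClosureSpace N) := RestrictScalars.isScalarTower ℝ ℂ (ClosureSpace N)

theorem ClosureSpace.dist_eq (x y : ClosureSpace N) : dist x y = (N (x.1 - y.1)).toReal :=
  _root_.dist_eq_norm x y

variable (N) in
theorem exists_eval_bound : ∃ (L : ℕ) (C : ℝ), 0 ≤ C ∧ ∀ (x : ClosureSpace N) φ,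
    ‖incl N x φ‖ ≤ C * schwartzNorm V ℂ L φ * ‖x‖ := by
  obtain ⟨L, C, hC, h⟩ := hN.eval_le
  exact ⟨L, C, hC, fun x φ => h x.1 φ x.lt_top.ne⟩

variable (N) in
/-- Evaluation at a test function, as a continuous linear map. -/
def evalCLM (φ : 𝓢(V, ℂ)) : ClosureSpace N →L[ℂ] F :=
  LinearMap.mkContinuousOfExistsBound
    { toFun := fun x => incl N x φ
      map_add' := fun x y => by rw [map_add]; rfl
      map_smul' := fun c x => by rw [map_smul]; rfl } (by
    obtain ⟨L, C, hC, h⟩ := exists_eval_bound N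
    exact ⟨_, fun x => h x φ⟩)

theorem evalCLM_apply (φ : 𝓢(V, ℂ)) (x : ClosureSpace N) : evalCLM N φ x = incl N x φ := rfl

theorem schwartzNorm_coe_lt_top (b : 𝓢(V, F)) : N (b : 𝓢'(V, F)) < ∞ := by
  obtain ⟨L, C, _, h⟩ := hN.schwartz_le
  exact (h b).trans_lt ENNReal.ofReal_lt_top

theorem coe_mem_schwartzClosure (b : 𝓢(V, F)) : (b : 𝓢'(V, F)) ∈ schwartzClosure N :=
  ⟨schwartzNorm_coe_lt_top b, fun ε hε => ⟨b, by simpa [norm_zero_eq N] using hε⟩⟩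

variable (N) in
/-- The inclusion of the Schwartz space. -/
def ofSchwartz : 𝓢(V, F) →ₗ[ℂ] ClosureSpace N where
  toFun b := ⟨(b : 𝓢'(V, F)), coe_mem_schwartzClosure b⟩
  map_add' a b := Subtype.ext (map_add _ a b)
  map_smul' c b := Subtype.ext (map_smul _ c b)

theorem incl_ofSchwartz (b : 𝓢(V, F)) : incl N (ofSchwartz N b) = (b : 𝓢'(V, F)) := rfl

variable (N) in
theorem exists_norm_ofSchwartz_le : ∃ (L : ℕ) (C : ℝ), 0 ≤ C ∧ ∀ b : 𝓢(V, F),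
    ‖ofSchwartz N b‖ ≤ C * schwartzNorm V F L b := by
  obtain ⟨L, C, hC, h⟩ := hN.schwartz_le
  exact ⟨L, C, hC, fun b => ENNReal.toReal_le_of_le_ofReal
    (mul_nonneg hC (apply_nonneg _ _)) (h b)⟩

theorem continuous_ofSchwartz : Continuous (ofSchwartz N) := by
  obtain ⟨L, C, hC, h⟩ := exists_norm_ofSchwartz_le N
  exact continuous_of_schwartzNorm_bound _ h

theorem denseRange_ofSchwartz : DenseRange (ofSchwartz N) := by
  rw [DenseRange, Metric.dense_iff]
  intro x r hr
  obtain ⟨b, hb⟩ := x.2.2 (ENNReal.ofReal r) (ENNReal.ofReal_pos.2 hr)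
  refine ⟨ofSchwartz N b, ?_, b, rfl⟩
  rw [Metric.mem_ball, dist_comm, ClosureSpace.dist_eq]
  exact (ENNReal.toReal_lt_of_lt_ofReal hb)

/-- Evaluations are continuous, so a Cauchy sequence converges on every test function, and their
uniform bound makes the limit a distribution. The Fatou property applied to the differences `x (k +
K) - x m` upgrades this to convergence in norm, and approximability by Schwartz functions passes to
the limit. -/
instance : CompleteSpace (ClosureSpace N) := by
  refine Metric.complete_of_cauchySeq_tendsto fun x hx => ?_
  have hev : ∀ φ, ∃ l, Tendsto (fun k => incl N (x k) φ) atTop (𝓝 l) := fun φ =>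
    cauchySeq_tendsto_of_complete ((evalCLM N φ).lipschitz.uniformContinuous.comp_cauchySeq hx)
  choose ℓ hℓ using hev
  obtain ⟨R, hR⟩ := hx.norm_bddAbove
  have hR : ∀ k, ‖x k‖ ≤ R := fun k => hR ⟨k, rfl⟩
  obtain ⟨L, C, hC, h⟩ := exists_eval_bound N
  let f : 𝓢'(V, F) := distributionOfBound
    { toFun := ℓ
      map_add' := fun a b => tendsto_nhds_unique (hℓ (a + b)) (by
        simpa using (hℓ a).add (hℓ b))
      map_smul' := fun c a => tendsto_nhds_unique (hℓ (c • a)) (by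
        simpa using (hℓ a).const_smul c) }
    ⟨L, C * R, fun φ => by
      refine le_of_tendsto (hℓ φ).norm (Eventually.of_forall fun k => (h (x k) φ).trans ?_)
      rw [mul_right_comm]
      have := apply_nonneg (schwartzNorm V ℂ L) φ
      gcongr
      exact hR k⟩
  have hf : ∀ φ, f φ = ℓ φ := fun φ => rfl
  have key : ∀ ε > 0, ∃ K, ∀ m ≥ K, N (f - (x m).1) ≤ ENNReal.ofReal ε := by
    intro ε hε
    obtain ⟨K, hK⟩ := Metric.cauchySeq_iff.1 hx ε hε
    refine ⟨K, fun m hm => hN.fatou (fun k => (x (k + K)).1 - (x m).1) _ _ (fun φ => ?_) fun k =>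
        ?_⟩
    · exact (((tendsto_add_atTop_iff_nat K).2 (hℓ φ)).sub_const ((x m).1 φ))
    · have h1 := (hK (k + K) (by omega) m hm).le
      rw [ClosureSpace.dist_eq] at h1
      have h2 : N ((x (k + K)).1 - (x m).1) < ∞ := (x (k + K) - x m).lt_top
      rw [← ENNReal.ofReal_toReal h2.ne]
      exact ENNReal.ofReal_le_ofReal h1
  have hmem : f ∈ schwartzClosure N := by
    refine ⟨?_, fun ε hε => ?_⟩
    · obtain ⟨K, hK⟩ := key 1 one_pos
      have h1 := hN.add_le (f - (x K).1) (x K).1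
      rw [sub_add_cancel] at h1
      exact h1.trans_lt (ENNReal.add_lt_top.2
        ⟨(hK K le_rfl).trans_lt ENNReal.ofReal_lt_top, (x K).lt_top⟩)
    · obtain ⟨δ, hδ0, hδ⟩ := ENNReal.lt_iff_exists_real_btwn.1 (ENNReal.half_pos hε.ne')
      have hδ0 : 0 < δ := by simpa using hδ.1
      obtain ⟨K, hK⟩ := key δ hδ0
      obtain ⟨b, hb⟩ := (x K).2.2 (ε / 2) (ENNReal.half_pos hε.ne')
      refine ⟨b, ?_⟩
      have h1 := hN.add_le (f - (x K).1) ((x K).1 - b)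
      rw [sub_add_sub_cancel] at h1
      refine h1.trans_lt ?_
      rw [← ENNReal.add_halves ε]
      exact ENNReal.add_lt_add ((hK K le_rfl).trans_lt hδ.2) hb
  refine ⟨toClosure f hmem, Metric.tendsto_atTop.2 fun ε hε => ?_⟩
  obtain ⟨K, hK⟩ := key (ε / 2) (half_pos hε)
  refine ⟨K, fun m hm => ?_⟩
  rw [dist_comm, ClosureSpace.dist_eq]
  exact (ENNReal.toReal_le_of_le_ofReal (by positivity) (hK m hm)).trans_lt (by linarith)

end Space

end

/-! ### Change of window and phase-space estimates for distributions -/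

section

variable {V : Type*} [NormedAddCommGroup V] [InnerProductSpace ℝ V] [FiniteDimensional ℝ V]
  [MeasurableSpace V] [BorelSpace V]
  {F : Type*} [NormedAddCommGroup F] [NormedSpace ℂ F]

instance : (volume : Measure (V × V)).IsAddHaarMeasure :=
  inferInstanceAs (((volume : Measure V).prod (volume : Measure V)).IsAddHaarMeasure)

instance : (volume : Measure (V × V)).IsNegInvariant :=
  Measure.IsAddHaarMeasure.isNegInvariant_of_innerRegular _

/-- The modulus of the short-time Fourier transform, with values in `[0, ∞]`. -/
def stftE (g : 𝓢(V, ℂ)) (f : 𝓢'(V, F)) (z : V × V) : ℝ≥0∞ := ‖stft g f z.1 z.2‖ₑ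

theorem measurable_stftE (g : 𝓢(V, ℂ)) (f : 𝓢'(V, F)) : Measurable (stftE g f) :=
  (continuous_stft g f).enorm.measurable

/-- Polynomial decay on phase space, with values in `[0, ∞]`. -/
def decayE (K : ℕ) (z : V × V) : ℝ≥0∞ := ENNReal.ofReal (tfDecay K z)

theorem measurable_decayE (K : ℕ) : Measurable (decayE K : V × V → ℝ≥0∞) :=
  ENNReal.measurable_ofReal.comp (continuous_tfDecay K).measurable

/-- The weight `tfWeight ^ γ`, with values in `[0, ∞]`. -/
def weightE (γ : ℝ) (z : V × V) : ℝ≥0∞ := ENNReal.ofReal (tfWeight z ^ γ)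

theorem measurable_weightE (γ : ℝ) : Measurable (weightE γ : V × V → ℝ≥0∞) := by
  unfold weightE tfWeight
  fun_prop

theorem weightE_le_mul {γ : ℝ} (hγ : 0 ≤ γ) (z w : V × V) :
    weightE γ z ≤ weightE γ w * weightE γ (z - w) := by
  unfold weightE
  rw [← ENNReal.ofReal_mul (Real.rpow_nonneg (tfWeight_pos w).le γ),
    ← Real.mul_rpow (tfWeight_pos _).le (tfWeight_pos _).le]
  exact ENNReal.ofReal_le_ofReal (Real.rpow_le_rpow (tfWeight_pos _).le (tfWeight_le_mul z w) hγ)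

variable (V) in
theorem exists_lintegral_decayE_lt_top (γ : ℝ) :
    ∃ K : ℕ, ∫⁻ z : V × V, decayE K z * weightE γ z < ∞ := by
  refine ⟨⌈γ⌉₊ + intPow V, lt_of_le_of_lt (lintegral_mono fun z => ?_)
    (integrable_tfDecay (V := V)).lintegral_lt_top⟩
  simp only [decayE, weightE]
  rw [← ENNReal.ofReal_mul (tfDecay_pos _ z).le]
  refine ENNReal.ofReal_le_ofReal ?_
  rw [← tfWeight_pow_mul_tfDecay ⌈γ⌉₊ (intPow V) z, mul_comm]
  gcongr
  · exact (tfDecay_pos _ z).le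
  rw [← Real.rpow_natCast]
  exact Real.rpow_le_rpow_of_exponent_le (one_le_tfWeight z) (Nat.le_ceil γ)

/-- Submultiplicativity of the weight makes the weighted `L^1` space a convolution algebra, so that
dominating kernels can be composed. -/
theorem lintegral_conv_weightE_le {γ : ℝ} (hγ : 0 ≤ γ) {H φ : V × V → ℝ≥0∞} (hH : Measurable H)
    (hφ : Measurable φ) : ∫⁻ z, (H ⋆ₗ φ) z * weightE γ z ≤
      (∫⁻ z, H z * weightE γ z) * ∫⁻ z, φ z * weightE γ z := by
  have hw := measurable_weightE (V := V) γ
  calc ∫⁻ z, (H ⋆ₗ φ) z * weightE γ z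
      = ∫⁻ z, ∫⁻ y, H y * φ (-y + z) * weightE γ z := by
        refine lintegral_congr fun z => ?_
        rw [lconvolution_def, lintegral_mul_const]
        fun_prop
    _ = ∫⁻ y, ∫⁻ z, H y * φ (-y + z) * weightE γ z := by
        rw [lintegral_lintegral_swap]
        fun_prop
    _ = ∫⁻ y, ∫⁻ z, H y * φ z * weightE γ (y + z) := by
        refine lintegral_congr fun y => ?_
        rw [← lintegral_add_left_eq_self _ y]
        simp
    _ ≤ ∫⁻ y, ∫⁻ z, (H y * weightE γ y) * (φ z * weightE γ z) := by
        refine lintegral_mono fun y => lintegral_mono fun z => ?_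
        have := weightE_le_mul hγ (y + z) y
        rw [add_sub_cancel_left] at this
        calc H y * φ z * weightE γ (y + z) ≤ H y * φ z * (weightE γ y * weightE γ z) := by gcongr
          _ = _ := by ring
    _ = _ := by
        rw [← lintegral_mul_const _ (by fun_prop)]
        refine lintegral_congr fun y => ?_
        rw [lintegral_const_mul _ (by fun_prop)]

theorem lconvolution_const_mul (c : ℝ≥0∞) {H φ : V × V → ℝ≥0∞} (hH : Measurable H)
    (hφ : Measurable φ) (z : V × V) : ((fun w => c * H w) ⋆ₗ φ) z = c * (H ⋆ₗ φ) z := by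
  rw [lconvolution_def, lconvolution_def, ← lintegral_const_mul _ (by fun_prop)]
  simp only [mul_assoc]

section Bounds

variable [CompleteSpace F]

/-- Change of window, uniformly with respect to the new window. -/
theorem exists_stftE_le_conv_uniform {g : 𝓢(V, ℂ)} (hg : g ≠ 0) (K : ℕ) :
    ∃ (L : ℕ) (C : ℝ≥0∞), C ≠ ∞ ∧ ∀ (γ : 𝓢(V, ℂ)) (f : 𝓢'(V, F)) z,
      stftE γ f z ≤ C * ENNReal.ofReal (schwartzNorm V ℂ L (conjS γ)) *
        (decayE K ⋆ₗ stftE g f) z := by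
  obtain ⟨L, C, hC, h⟩ := exists_norm_coef_le g K
  have hm := windowMass_ne_zero hg
  have hm' : ‖windowMass g‖ₑ ≠ 0 := by simpa using hm
  refine ⟨L, ‖windowMass g‖ₑ⁻¹ * ENNReal.ofReal C,
    ENNReal.mul_ne_top (ENNReal.inv_ne_top.2 hm') ENNReal.ofReal_ne_top, fun γ f z => ?_⟩
  have hs : 0 ≤ schwartzNorm V ℂ L (conjS γ) := apply_nonneg _ _
  rw [mul_assoc _ (ENNReal.ofReal C), ← ENNReal.ofReal_mul hC]
  have h1 : ‖windowMass g‖ₑ * stftE γ f z ≤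
      ENNReal.ofReal (C * schwartzNorm V ℂ L (conjS γ)) * (decayE K ⋆ₗ stftE g f) z := by
    -- Inversion expands the atom of the new window into atoms of `g`. By covariance the moduli of
    -- the coefficients depend on differences only, so a convolution results, and the new window
    -- enters through a single Schwartz norm.
    have e := integral_coef_smul_stft g (conjAtom γ z.1 z.2) f
    rw [stftE, stft, ← enorm_smul, ← e]
    refine (enorm_integral_le_lintegral_enorm _).trans ?_
    rw [lconvolution_comm, lconvolution_def, ← lintegral_const_mul' _ _ ENNReal.ofReal_ne_top]
    refine lintegral_mono fun w => ?_
    rw [enorm_smul, mul_comm (stftE g f w), ← mul_assoc]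
    refine mul_le_mul_left ?_ _
    rw [decayE, ← ENNReal.ofReal_mul (by positivity), ← ofReal_norm, neg_add_eq_sub,
      conjAtom_conjAtom_shift, ← tfDecay_neg, neg_sub]
    exact ENNReal.ofReal_le_ofReal (h _ _)
  calc stftE γ f z = ‖windowMass g‖ₑ⁻¹ * (‖windowMass g‖ₑ * stftE γ f z) := by
        rw [← mul_assoc, ENNReal.inv_mul_cancel hm' enorm_ne_top, one_mul]
    _ ≤ _ := by
        rw [mul_assoc]
        gcongr

/-- Change of window. -/
theorem exists_stftE_le_conv {g : 𝓢(V, ℂ)} (hg : g ≠ 0) (γ : 𝓢(V, ℂ)) (K : ℕ) :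
    ∃ C : ℝ≥0∞, C ≠ ∞ ∧ ∀ (f : 𝓢'(V, F)) z,
      stftE γ f z ≤ C * (decayE K ⋆ₗ stftE g f) z := by
  obtain ⟨L, C, hC, h⟩ := exists_stftE_le_conv_uniform (F := F) hg K
  exact ⟨_, ENNReal.mul_ne_top hC ENNReal.ofReal_ne_top, h γ⟩

/-- The norm of a distribution that is given by the solid norm `M` of its short-time Fourier
transform. -/
def solidTF (M : (V × V → ℝ≥0∞) → ℝ≥0∞) (g : 𝓢(V, ℂ)) (f : 𝓢'(V, F)) : ℝ≥0∞ := M (stftE g f)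

variable {γ : ℝ} {M : (V × V → ℝ≥0∞) → ℝ≥0∞}

/-- Young's inequality is applied to the kernel `decayE K`, with `K` so large that this kernel is
integrable against the weight. Used in both directions, it shows that all nonzero windows give
equivalent norms. -/
theorem SolidNorm.exists_change_window (hM : SolidNorm γ M) {g : 𝓢(V, ℂ)} (hg : g ≠ 0)
    (g' : 𝓢(V, ℂ)) : ∃ C : ℝ≥0∞, C ≠ ∞ ∧ ∀ f : 𝓢'(V, F), solidTF M g' f ≤ C * solidTF M g f := by
  obtain ⟨K, hK⟩ := exists_lintegral_decayE_lt_top V γ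
  obtain ⟨C, hC, h⟩ := exists_stftE_le_conv (F := F) hg g' K
  refine ⟨C * ∫⁻ z : V × V, decayE K z * weightE γ z, ENNReal.mul_ne_top hC hK.ne, fun f => ?_⟩
  refine (hM.mono _ _ (h f)).trans ((hM.smul C _ (measurable_lconvolution _
    (measurable_decayE K) (measurable_stftE g f))).trans ?_)
  rw [mul_assoc]
  gcongr
  exact hM.conv _ _ (measurable_decayE K) (measurable_stftE g f)

/-- Inversion writes `f φ` as a pairing of transforms, so the bound of `M` against rapidly decaying
functions makes evaluations continuous. Conversely, the transform of a Schwartz function decays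
rapidly, which bounds its norm. The Fatou property is inherited because weak convergence of
distributions entails pointwise convergence of their transforms. -/
theorem SolidNorm.admissible (hM : SolidNorm γ M) {g : 𝓢(V, ℂ)} (hg : g ≠ 0) :
    AdmissibleNorm (solidTF M g : 𝓢'(V, F) → ℝ≥0∞) where
  add_le f h := (hM.mono _ _ fun z => enorm_add_le _ _).trans
    (hM.add _ _ (measurable_stftE g f) (measurable_stftE g h))
  smul_eq c f := by
    have h1 : ∀ (c : ℂ) (f : 𝓢'(V, F)), solidTF M g (c • f) ≤ ‖c‖ₑ * solidTF M g f := by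
      intro c f
      refine (hM.mono _ _ fun z => ?_).trans (hM.smul ‖c‖ₑ _ (measurable_stftE g f))
      exact (enorm_smul c (stft g f z.1 z.2)).le
    refine le_antisymm (h1 c f) ?_
    -- The reverse inequality is the direct one for the scalar `c⁻¹` and the distribution `c • f`.
    rcases eq_or_ne c 0 with rfl | hc
    · simp
    · have h2 := h1 c⁻¹ (c • f)
      rw [smul_smul, inv_mul_cancel₀ hc, one_smul, enorm_inv hc] at h2
      calc ‖c‖ₑ * solidTF M g f ≤ ‖c‖ₑ * (‖c‖ₑ⁻¹ * solidTF M g (c • f)) := by gcongr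
        _ = _ := by
          rw [← mul_assoc, ENNReal.mul_inv_cancel (by simpa using hc) enorm_ne_top, one_mul]
  eval_le := by
    obtain ⟨K, C₁, hC₁, h₁⟩ := hM.pairing
    obtain ⟨L, C, hC, h⟩ := exists_norm_coef_le g K
    have hm := windowMass_ne_zero hg
    refine ⟨L, ‖windowMass g‖⁻¹ * (C * C₁.toReal), by positivity, fun f φ hf => ?_⟩
    have hs : 0 ≤ schwartzNorm V ℂ L φ := apply_nonneg _ _
    have h1 : ‖windowMass g • f φ‖ₑ ≤
        ENNReal.ofReal (C * schwartzNorm V ℂ L φ) * (C₁ * solidTF M g f) := by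
      rw [← integral_coef_smul_stft g φ f]
      refine (enorm_integral_le_lintegral_enorm _).trans ?_
      refine le_trans ?_ (mul_le_mul_right (h₁ _ (measurable_stftE g f)) _)
      rw [← lintegral_const_mul' _ _ ENNReal.ofReal_ne_top]
      refine lintegral_mono fun w => ?_
      rw [enorm_smul, ← mul_assoc]
      refine mul_le_mul_left ?_ _
      rw [← ENNReal.ofReal_mul (by positivity), ← ofReal_norm]
      exact ENNReal.ofReal_le_ofReal (h φ w)
    have h2 := ENNReal.toReal_mono (ENNReal.mul_ne_top ENNReal.ofReal_ne_top
      (ENNReal.mul_ne_top hC₁ hf)) h1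
    rw [toReal_enorm, norm_smul, ENNReal.toReal_mul, ENNReal.toReal_mul,
      ENNReal.toReal_ofReal (by positivity)] at h2
    have hm' : 0 < ‖windowMass g‖ := norm_pos_iff.2 hm
    rw [← mul_le_mul_iff_right₀ hm']
    refine h2.trans (le_of_eq ?_)
    field_simp
  schwartz_le := by
    obtain ⟨K, hK⟩ := hM.decay
    obtain ⟨L, C, hC, h⟩ := exists_norm_stft_le (F := F) g K
    refine ⟨L, C * (M fun z => ENNReal.ofReal (tfDecay K z)).toReal, by positivity, fun b => ?_⟩
    have hs : 0 ≤ schwartzNorm V F L b := apply_nonneg _ _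
    calc solidTF M g (b : 𝓢'(V, F))
        ≤ M fun z => ENNReal.ofReal (C * schwartzNorm V F L b) * decayE K z := by
          refine hM.mono _ _ fun z => ?_
          rw [decayE, ← ENNReal.ofReal_mul (by positivity), stftE, ← ofReal_norm]
          exact ENNReal.ofReal_le_ofReal (h b z)
      _ ≤ ENNReal.ofReal (C * schwartzNorm V F L b) * M (decayE K) :=
        hM.smul _ _ (measurable_decayE K)
      _ = _ := by
        rw [mul_right_comm, ENNReal.ofReal_mul (by positivity : 0 ≤ C * schwartzNorm V F L b),
          ENNReal.ofReal_toReal hK.ne]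
        rfl
  fatou f h c hl hc := hM.fatou _ _ c (fun k => measurable_stftE g (f k))
    (fun z => (hl (conjAtom g z.1 z.2)).enorm) hc

/-- The estimates that compare a norm on distributions with convolution inequalities for the
short-time Fourier transform with respect to an arbitrary window. -/
structure TFBounds (γ : ℝ) (N : 𝓢'(V, F) → ℝ≥0∞) : Prop where
  conv : ∀ g : 𝓢(V, ℂ), g ≠ 0 → ∃ C : ℝ≥0∞, C ≠ ∞ ∧ ∀ H : V × V → ℝ≥0∞, Measurable H →
    ∀ f u : 𝓢'(V, F), (∀ z, stftE g u z ≤ (H ⋆ₗ stftE g f) z) →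
      N u ≤ C * (∫⁻ z, H z * weightE γ z) * N f
  l1 : ∀ g : 𝓢(V, ℂ), g ≠ 0 → ∃ C : ℝ≥0∞, C ≠ ∞ ∧ ∀ u : 𝓢'(V, F),
    N u ≤ C * ∫⁻ z, stftE g u z * weightE γ z

/-- For `conv` the window is changed to `g'`, where Young's inequality applies, and then changed
back. For `l1` the roles in the reproducing inequality are exchanged: the transform of `u` serves as
the kernel, and `decayE K`, which has finite norm, is the function it is convolved with. -/
theorem SolidNorm.tfBounds (hM : SolidNorm γ M) {g : 𝓢(V, ℂ)} (hg : g ≠ 0) :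
    TFBounds γ (solidTF M g : 𝓢'(V, F) → ℝ≥0∞) where
  conv g' hg' := by
    obtain ⟨C₁, hC₁, h₁⟩ := hM.exists_change_window (F := F) hg' g
    obtain ⟨C₂, hC₂, h₂⟩ := hM.exists_change_window (F := F) hg g'
    refine ⟨C₁ * C₂, ENNReal.mul_ne_top hC₁ hC₂, fun H hH f u h => ?_⟩
    calc solidTF M g u ≤ C₁ * solidTF M g' u := h₁ u
      _ ≤ C₁ * ((∫⁻ z, H z * weightE γ z) * solidTF M g' f) := by
        gcongr
        exact (hM.mono _ _ h).trans (hM.conv H _ hH (measurable_stftE g' f))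
      _ ≤ C₁ * ((∫⁻ z, H z * weightE γ z) * (C₂ * solidTF M g f)) := by
        gcongr
        exact h₂ f
      _ = _ := by ring
  l1 g' hg' := by
    obtain ⟨C₁, hC₁, h₁⟩ := hM.exists_change_window (F := F) hg' g
    obtain ⟨K, hK⟩ := hM.decay
    obtain ⟨C, hC, h⟩ := exists_stftE_le_conv (F := F) hg' g' K
    refine ⟨C₁ * (C * M (decayE K)), ENNReal.mul_ne_top hC₁ (ENNReal.mul_ne_top hC hK.ne),
      fun u => ?_⟩
    have hu := measurable_stftE g' u
    calc solidTF M g u ≤ C₁ * solidTF M g' u := h₁ u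
      _ ≤ C₁ * M (fun z => C * (stftE g' u ⋆ₗ decayE K) z) := by
        gcongr
        refine hM.mono _ _ fun z => ?_
        rw [lconvolution_comm]
        exact h u z
      _ ≤ C₁ * (C * ((∫⁻ z, stftE g' u z * weightE γ z) * M (decayE K))) := by
        gcongr
        refine (hM.smul C _ (measurable_lconvolution _ hu (measurable_decayE K))).trans ?_
        gcongr
        exact hM.conv _ _ hu (measurable_decayE K)
      _ = _ := by ring

end Bounds

section Tensor

/-- The Schwartz function `y ↦ φ y • v`. -/
def tensor (φ : 𝓢(V, ℂ)) (v : F) : 𝓢(V, F) :=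
  SchwartzMap.postcompCLM (𝕜 := ℂ) (ContinuousLinearMap.toSpanSingleton ℂ v) φ

theorem tensor_apply (φ : 𝓢(V, ℂ)) (v : F) (y : V) : tensor φ v y = φ y • v := by
  simp [tensor]

theorem schwartzNorm_tensor_le (K : ℕ) (φ : 𝓢(V, ℂ)) (v : F) :
    schwartzNorm V F K (tensor φ v) ≤ ‖v‖ * schwartzNorm V ℂ K φ := by
  refine schwartzNorm_le (by positivity) _ fun k hk l hl y => ?_
  have h1 := ((ContinuousLinearMap.toSpanSingleton ℂ v).restrictScalars
      ℝ).norm_iteratedFDeriv_comp_left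
    (f := φ) (x := y) (n := l) (φ.smooth l).contDiffAt le_rfl
  have h2 : ‖(ContinuousLinearMap.toSpanSingleton ℂ v).restrictScalars ℝ‖ ≤ ‖v‖ := by
    rw [ContinuousLinearMap.norm_restrictScalars, ContinuousLinearMap.norm_toSpanSingleton]
  have h3 := seminorm_le_schwartzNorm hk hl φ
  have h4 := SchwartzMap.le_seminorm ℂ k l φ y
  calc ‖y‖ ^ k * ‖iteratedFDeriv ℝ l (tensor φ v) y‖
      ≤ ‖y‖ ^ k * (‖v‖ * ‖iteratedFDeriv ℝ l φ y‖) := by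
        gcongr
        refine h1.trans ?_
        gcongr
    _ = ‖v‖ * (‖y‖ ^ k * ‖iteratedFDeriv ℝ l φ y‖) := by ring
    _ ≤ _ := by
        gcongr
        exact h4.trans h3

theorem continuous_tensor {X : Type*} [TopologicalSpace X] {c : X → 𝓢(V, ℂ)} {v : X → F}
    (hc : Continuous c) (hv : Continuous v) : Continuous fun x => tensor (c x) (v x) := by
  refine continuous_schwartz_of fun x₀ K => ?_
  have h1 := (tendsto_schwartz_iff.1 (hc.tendsto x₀) K).mul (hv.norm.tendsto x₀)
  have h2 := ((tendsto_iff_norm_sub_tendsto_zero.1 (hv.tendsto x₀)).mul_const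
    (schwartzNorm V ℂ K (c x₀)))
  rw [zero_mul] at h1 h2
  have h3 := h1.add h2
  rw [add_zero] at h3
  refine squeeze_zero (fun x => apply_nonneg _ _) (fun x => ?_) h3
  have e : tensor (c x) (v x) - tensor (c x₀) (v x₀) =
      tensor (c x - c x₀) (v x) + tensor (c x₀) (v x - v x₀) := by
    ext y
    simp only [sub_apply, add_apply, tensor_apply, sub_smul, smul_sub]
    abel
  rw [e]
  refine (map_add_le_add _ _ _).trans (add_le_add ?_ (schwartzNorm_tensor_le K _ _))
  rw [mul_comm]
  exact schwartzNorm_tensor_le K _ _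

variable [CompleteSpace F]

theorem coe_tensor_apply (φ : 𝓢(V, ℂ)) (v : F) (χ : 𝓢(V, ℂ)) :
    ((tensor φ v : 𝓢(V, F)) : 𝓢'(V, F)) χ = (φ : 𝓢'(V, ℂ)) χ • v := by
  rw [SchwartzMap.coe_apply, SchwartzMap.coe_apply, ← integral_smul_const]
  simp only [tensor_apply, smul_smul, smul_eq_mul]

theorem stftE_tensor (g φ : 𝓢(V, ℂ)) (v : F) (z : V × V) :
    stftE g ((tensor φ v : 𝓢(V, F)) : 𝓢'(V, F)) z = stftE g (φ : 𝓢'(V, ℂ)) z * ‖v‖ₑ := by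
  rw [stftE, stft, coe_tensor_apply, enorm_smul]
  rfl

/-- The time-frequency shift of the window. -/
def atom (g : 𝓢(V, ℂ)) (z : V × V) : 𝓢(V, ℂ) := conjAtom (conjS g) z.1 (-z.2)

theorem atom_apply (g : 𝓢(V, ℂ)) (z : V × V) (y : V) :
    atom g z y = conj (conjAtom g z.1 z.2 y) := (conj_conjAtom g z.1 z.2 y).symm

theorem continuous_atom (g : 𝓢(V, ℂ)) : Continuous (atom g) :=
  (continuous_conjAtom (conjS g)).comp
    (continuous_fst.prodMk continuous_snd.neg : Continuous fun z : V × V => (z.1, -z.2))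

theorem coe_atom_apply (g φ : 𝓢(V, ℂ)) (z : V × V) :
    (atom g z : 𝓢'(V, ℂ)) φ = coef g φ z := by
  rw [SchwartzMap.coe_apply, coef_eq]
  simp only [atom_apply, smul_eq_mul, mul_comm]

theorem stft_atom (g γ : 𝓢(V, ℂ)) (w z : V × V) :
    stft γ (atom g w : 𝓢'(V, ℂ)) z.1 z.2 = coef g (conjAtom γ z.1 z.2) w :=
  coe_atom_apply g _ w

/-- By almost diagonality the transform of the atom at `w` decays in `z - w`, while the weight at
`z` is at most the product of the weights at `w` and at `z - w`. -/
theorem exists_lintegral_stftE_atom_le {γ : ℝ} (hγ : 0 ≤ γ) (g : 𝓢(V, ℂ)) : ∃ C : ℝ≥0∞, C ≠ ∞ ∧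
    ∀ w, ∫⁻ z, stftE g (atom g w : 𝓢'(V, ℂ)) z * weightE γ z ≤ C * weightE γ w := by
  obtain ⟨K, hK⟩ := exists_lintegral_decayE_lt_top V γ
  obtain ⟨C, hC, h⟩ := exists_norm_coef_conjAtom_le g g K
  refine ⟨ENNReal.ofReal C * ∫⁻ z : V × V, decayE K z * weightE γ z,
    ENNReal.mul_ne_top ENNReal.ofReal_ne_top hK.ne, fun w => ?_⟩
  calc ∫⁻ z, stftE g (atom g w : 𝓢'(V, ℂ)) z * weightE γ z
      ≤ ∫⁻ z, ENNReal.ofReal C * weightE γ w * (decayE K (z - w) * weightE γ (z - w)) := by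
        refine lintegral_mono fun z => ?_
        have h1 : stftE g (atom g w : 𝓢'(V, ℂ)) z ≤ ENNReal.ofReal C * decayE K (z - w) := by
          rw [stftE, stft_atom, decayE, ← ENNReal.ofReal_mul hC, ← ofReal_norm]
          exact ENNReal.ofReal_le_ofReal (h z w)
        refine (mul_le_mul' h1 (weightE_le_mul hγ z w)).trans (le_of_eq ?_)
        ring
    _ = ENNReal.ofReal C * weightE γ w * ∫⁻ z : V × V, decayE K (z - w) * weightE γ (z - w) :=
        lintegral_const_mul' _ _ (ENNReal.mul_ne_top ENNReal.ofReal_ne_top ENNReal.ofReal_ne_top)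
    _ = _ := by
        rw [lintegral_sub_right_eq_self (fun z : V × V => decayE K z * weightE γ z) w]
        ring

variable {γ : ℝ} {N : 𝓢'(V, F) → ℝ≥0∞} [hN : AdmissibleNorm N]

/-- A distribution whose short-time Fourier transform is integrable against `tfWeight ^ γ` belongs
to the closure of the Schwartz class. -/
theorem TFBounds.mem_schwartzClosure (hγ : 0 ≤ γ) (hB : TFBounds γ N) {g : 𝓢(V, ℂ)} (hg : g ≠ 0)
    {u : 𝓢'(V, F)} (hu : ∫⁻ z, stftE g u z * weightE γ z < ∞) : u ∈ schwartzClosure N := by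
  obtain ⟨C₁, hC₁, h₁⟩ := hB.l1 g hg
  obtain ⟨C₂, hC₂, h₂⟩ := exists_lintegral_stftE_atom_le hγ g
  -- The inversion formula is read as a Bochner integral in the Banach space. The integrand is a
  -- continuous family of Schwartz functions with norm at most a constant times the transform of `u`
  -- times the weight, hence integrable; evaluation at test functions identifies the integral with a
  -- multiple of `u`.
  set c : V × V → ClosureSpace N := fun w => ofSchwartz N (tensor (atom g w) (stft g u w.1 w.2))
  have hc : Continuous c :=
    continuous_ofSchwartz.comp (continuous_tensor (continuous_atom g) (continuous_stft g u))
  have hle : ∀ w, ‖c w‖ₑ ≤ C₁ * C₂ * (stftE g u w * weightE γ w) := by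
    intro w
    rw [← ofReal_norm, ClosureSpace.ofReal_norm]
    refine (h₁ _).trans ?_
    change C₁ * ∫⁻ z, stftE g ((tensor (atom g w) (stft g u w.1 w.2) : 𝓢(V, F)) : 𝓢'(V, F)) z *
      weightE γ z ≤ _
    simp only [stftE_tensor]
    calc C₁ * ∫⁻ z, stftE g (atom g w : 𝓢'(V, ℂ)) z * ‖stft g u w.1 w.2‖ₑ * weightE γ z
        = C₁ * ((∫⁻ z, stftE g (atom g w : 𝓢'(V, ℂ)) z * weightE γ z) *
            ‖stft g u w.1 w.2‖ₑ) := by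
          rw [← lintegral_mul_const' _ _ enorm_ne_top]
          simp only [mul_right_comm]
      _ ≤ C₁ * (C₂ * weightE γ w * ‖stft g u w.1 w.2‖ₑ) := by
          gcongr
          exact h₂ w
      _ = _ := by
          rw [stftE]
          ring
  have hint : Integrable c := by
    refine ⟨hc.aestronglyMeasurable, ?_⟩
    refine lt_of_le_of_lt (lintegral_mono hle) ?_
    rw [lintegral_const_mul' _ _ (ENNReal.mul_ne_top hC₁ hC₂)]
    exact ENNReal.mul_lt_top (ENNReal.mul_lt_top hC₁.lt_top hC₂.lt_top) hu
  have hm := windowMass_ne_zero hg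
  have key : incl N ((windowMass g)⁻¹ • ∫ w, c w) = u := by
    ext φ
    rw [← evalCLM_apply, map_smul, ← ContinuousLinearMap.integral_comp_comm _ hint]
    have e : ∀ w, evalCLM N φ (c w) = coef g φ w • stft g u w.1 w.2 := by
      intro w
      rw [evalCLM_apply, incl_ofSchwartz, coe_tensor_apply, coe_atom_apply]
    simp only [e, integral_coef_smul_stft, smul_smul, inv_mul_cancel₀ hm, one_smul]
  rw [← key]
  exact incl_mem _

end Tensor

end

/-! ### Gaussian windows and the Wigner distribution of Gaussian atoms -/

section

section Gaussian

variable {V : Type*} [NormedAddCommGroup V] [InnerProductSpace ℝ V]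

theorem one_add_pow_le_exp {a : ℝ} (ha : 0 < a) (M : ℕ) : ∃ C : ℝ, 0 ≤ C ∧
    ∀ t : ℝ, 0 ≤ t → (1 + t) ^ M * Real.exp (-a * t ^ 2) ≤ C := by
  set c := 1 + 1 / (4 * a)
  refine ⟨M.factorial * Real.exp c, by positivity, fun t ht => ?_⟩
  -- The constant `c` makes a completed square nonnegative and reduces the claim to `s ^ M ≤ M! exp
  -- s`.
  have h1 : 1 + t ≤ a * t ^ 2 + c := by
    have : a * t ^ 2 + c - (1 + t) = (2 * a * t - 1) ^ 2 / (4 * a) := by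
      simp only [c]
      field_simp
      ring
    have h2 : 0 ≤ (2 * a * t - 1) ^ 2 / (4 * a) := by positivity
    linarith
  have h2 := Real.pow_div_factorial_le_exp (x := a * t ^ 2 + c) (by positivity) M
  rw [div_le_iff₀ (by positivity)] at h2
  calc (1 + t) ^ M * Real.exp (-a * t ^ 2)
      ≤ (Real.exp (a * t ^ 2 + c) * M.factorial) * Real.exp (-a * t ^ 2) := by
        gcongr
        exact (pow_le_pow_left₀ (by positivity) h1 M).trans h2
    _ = _ := by
        rw [mul_right_comm, ← Real.exp_add, mul_comm]
        congr 2
        ring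

theorem exists_gaussian_decay {a : ℝ} (ha : 0 < a) (k n : ℕ) : ∃ C : ℝ, ∀ x : V,
    ‖x‖ ^ k * ‖iteratedFDeriv ℝ n (fun x : V => Real.exp (-a * ‖x‖ ^ 2)) x‖ ≤ C := by
  have hf : Function.HasTemperateGrowth fun x : V => -a * ‖x‖ ^ 2 :=
    (Function.HasTemperateGrowth.const (-a)).mul (by fun_prop)
  obtain ⟨m, A, hA, h⟩ := hf.norm_iteratedFDeriv_le_uniform n
  obtain ⟨B, hB, hB'⟩ := one_add_pow_le_exp ha (k + m * n)
  refine ⟨n.factorial * (A + 1) ^ n * B, fun x => ?_⟩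
  have h1 : (1 : ℝ) ≤ 1 + ‖x‖ := by simp
  -- Faà di Bruno's bound: all derivatives of `exp` equal `exp`, and those of the quadratic exponent
  -- grow polynomially. The constant is `A + 1` so that the base is at least one and hence at most
  -- its `i`-th power.
  have h2 := norm_iteratedFDeriv_comp_le (𝕜 := ℝ) (g := Real.exp) (n := n) Real.contDiff_exp hf.1
    (by exact_mod_cast le_top) x (C := Real.exp (-a * ‖x‖ ^ 2)) (D := (A + 1) * (1 + ‖x‖) ^ m)
    (fun i _ => by
      rw [norm_iteratedFDeriv_eq_norm_iteratedDeriv, iteratedDeriv_eq_iterate, Real.iter_deriv_exp,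
        Real.norm_of_nonneg (Real.exp_pos _).le])
    (fun i hi hin => by
      refine (h i hin x).trans (le_trans ?_ (le_self_pow₀ ?_ (by omega)))
      · gcongr
        linarith
      · exact one_le_mul_of_one_le_of_one_le (by linarith) (one_le_pow₀ h1))
  calc ‖x‖ ^ k * ‖iteratedFDeriv ℝ n (fun x : V => Real.exp (-a * ‖x‖ ^ 2)) x‖
      ≤ (1 + ‖x‖) ^ k * (n.factorial * Real.exp (-a * ‖x‖ ^ 2) *
        ((A + 1) * (1 + ‖x‖) ^ m) ^ n) := by
        gcongr
        · linarith
        · exact h2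
    _ = n.factorial * (A + 1) ^ n * ((1 + ‖x‖) ^ (k + m * n) * Real.exp (-a * ‖x‖ ^ 2)) := by
        rw [mul_pow, pow_add, pow_mul]
        ring
    _ ≤ _ := by
        gcongr
        exact hB' _ (norm_nonneg x)

/-- The Gaussian `x ↦ exp (-a |x|²)`. -/
def gaussianS (a : ℝ) (ha : 0 < a) : 𝓢(V, ℂ) :=
  SchwartzMap.postcompCLM (𝕜 := ℝ) Complex.ofRealCLM
    { toFun := fun x : V => Real.exp (-a * ‖x‖ ^ 2)
      smooth' := by
        have hf : Function.HasTemperateGrowth fun x : V => -a * ‖x‖ ^ 2 :=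
          (Function.HasTemperateGrowth.const (-a)).mul (by fun_prop)
        exact Real.contDiff_exp.comp hf.1
      decay' := exists_gaussian_decay ha }

theorem gaussianS_apply (a : ℝ) (ha : 0 < a) (x : V) :
    gaussianS a ha x = Complex.exp (-a * ‖x‖ ^ 2 : ℝ) := by
  change ((Real.exp (-a * ‖x‖ ^ 2) : ℝ) : ℂ) = _
  rw [Complex.ofReal_exp]

theorem gaussianS_ne_zero (a : ℝ) (ha : 0 < a) : (gaussianS a ha : 𝓢(V, ℂ)) ≠ 0 := by
  intro h
  have := congrArg (fun f : 𝓢(V, ℂ) => f 0) h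
  simp [gaussianS_apply] at this

end Gaussian

section Wigner

variable {d : ℕ}

/-- The standard Gaussian window. -/
def stdWindow (d : ℕ) : 𝓢(Pos d, ℂ) := gaussianS Real.pi Real.pi_pos

theorem stdWindow_ne_zero : stdWindow d ≠ 0 := gaussianS_ne_zero _ _

/-- The Gaussian window on phase space. -/
def phaseWindow (d : ℕ) : 𝓢(Phase d, ℂ) := gaussianS (2 * Real.pi) (by positivity)

/-- The bilinear form of the Wigner distribution. -/
def wignerB (a b : 𝓢(Pos d, ℂ)) (Z : Phase d) : ℂ :=
  ∫ y : Pos d, character Z.snd y * (a (Z.fst + (1 / 2 : ℝ) • y) * b (Z.fst - (1 / 2 : ℝ) • y))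

theorem wigner_conj (a b : 𝓢(Pos d, ℂ)) (Z : Phase d) :
    wigner a (fun y => conj (b y)) Z = wignerB a b Z := by
  simp [wigner, wignerB]

/-- The normalising constant in the Wigner distribution of Gaussians. -/
def wignerConst (d : ℕ) : ℂ :=
  (Real.pi / ((Real.pi / 2 : ℝ) : ℂ)) ^ (Module.finrank ℝ (Pos d) / 2 : ℂ)

/-- The centre of the Wigner distribution of two Gaussian atoms. -/
def midPoint (w z : Pos d × Pos d) : Phase d :=
  WithLp.toLp 2 ((1 / 2 : ℝ) • (w.1 + z.1), (1 / 2 : ℝ) • (w.2 + z.2))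

/-- The frequency of the Wigner distribution of two Gaussian atoms. -/
def symplDiff (w z : Pos d × Pos d) : Phase d := WithLp.toLp 2 (z.2 - w.2, w.1 - z.1)

/-- The Wigner distribution of two Gaussian atoms. -/
def wignerAtom (p : (Pos d × Pos d) × (Pos d × Pos d)) : 𝓢(Phase d, ℂ) :=
  (wignerConst d * character ((1 / 2 : ℝ) • (p.1.2 + p.2.2)) (p.2.1 - p.1.1)) •
    conjAtom (phaseWindow d) (midPoint p.1 p.2) (symplDiff p.1 p.2)

/-- After a shift of the variable by `u - x` the parallelogram law splits the quadratic exponent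
into `2‖m‖²` and `‖y‖² / 2`, and what remains is the Fourier transform of a Gaussian. Because of
this closed form, pairing a symbol with the Wigner distribution of two atoms gives, up to a constant
and a phase, a value of the short-time Fourier transform of the symbol. -/
theorem wignerB_atom (w z : Pos d × Pos d) (Z : Phase d) :
    wignerB (atom (stdWindow d) w) (conjAtom (stdWindow d) z.1 z.2) Z = wignerAtom (w, z) Z := by
  obtain ⟨u, ω⟩ := w
  obtain ⟨x, ξ⟩ := z
  set X := Z.fst with hX
  set Ξ := Z.snd with hΞ
  set m := X - (1 / 2 : ℝ) • (u + x) with hm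
  set ν := Ξ - (1 / 2 : ℝ) • (ω + ξ) with hν
  have hreal : ∀ y : Pos d, ‖X + (1 / 2 : ℝ) • (y + (u - x)) - u‖ ^ 2 +
      ‖X - (1 / 2 : ℝ) • (y + (u - x)) - x‖ ^ 2 = 2 * ‖m‖ ^ 2 + (1 / 2) * ‖y‖ ^ 2 := by
    intro y
    have e1 : X + (1 / 2 : ℝ) • (y + (u - x)) - u = m + (1 / 2 : ℝ) • y := by
      rw [hm]; module
    have e2 : X - (1 / 2 : ℝ) • (y + (u - x)) - x = m - (1 / 2 : ℝ) • y := by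
      rw [hm]; module
    rw [e1, e2]
    have := parallelogram_law_with_norm ℝ m ((1 / 2 : ℝ) • y)
    rw [norm_smul] at this
    norm_num at this
    nlinarith [this]
  have key : ∀ y : Pos d, character Ξ (y + (u - x)) *
      (atom (stdWindow d) (u, ω) (X + (1 / 2 : ℝ) • (y + (u - x))) *
        conjAtom (stdWindow d) x ξ (X - (1 / 2 : ℝ) • (y + (u - x)))) =
      Complex.exp (-(2 * Real.pi * ‖m‖ ^ 2 : ℝ) +
        2 * Real.pi * Complex.I * ((inner ℝ X (ω - ξ) - inner ℝ (u - x) ν : ℝ) : ℂ)) *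
      Complex.exp (-((Real.pi / 2 : ℝ) : ℂ) * ‖y‖ ^ 2 +
        -(2 * Real.pi * Complex.I) * (inner ℝ ν y : ℝ)) := by
    intro y
    rw [atom_apply, conjAtom_apply, conjAtom_apply]
    simp only [stdWindow, gaussianS_apply, character, map_mul, Complex.conj_conj,
      ← Complex.exp_conj]
    simp only [← Complex.exp_add]
    congr 1
    have hr := congrArg (fun t : ℝ => (t : ℂ)) (hreal y)
    simp only [map_neg, map_mul, Complex.conj_ofReal, Complex.conj_I, map_ofNat]
    have hi : -(inner ℝ (y + (u - x)) Ξ : ℝ) + inner ℝ (X + (1 / 2 : ℝ) • (y + (u - x))) ω -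
        inner ℝ (X - (1 / 2 : ℝ) • (y + (u - x))) ξ =
        (inner ℝ X (ω - ξ) - inner ℝ (u - x) ν) - (inner ℝ ν y : ℝ) := by
      rw [hν, real_inner_comm y]
      simp only [inner_add_left, inner_sub_left, inner_add_right, inner_sub_right,
        inner_smul_left, inner_smul_right, RCLike.conj_to_real]
      ring
    have hi' := congrArg (fun t : ℝ => (t : ℂ)) hi
    push_cast at hr hi' ⊢
    linear_combination (2 * Real.pi * Complex.I) * hi' - Real.pi * hr
  rw [wignerB, ← integral_add_right_eq_self _ (u - x)]
  simp only [← hX, ← hΞ, key]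
  rw [integral_const_mul, GaussianFourier.integral_cexp_neg_mul_sq_norm_add
    (by simpa using Real.pi_pos)]
  rw [wignerAtom, smul_apply, conjAtom_apply, smul_eq_mul, phaseWindow,
    gaussianS_apply, ← Complex.exp_conj]
  have hn : ‖Z - midPoint (u, ω) (x, ξ)‖ ^ 2 = ‖m‖ ^ 2 + ‖ν‖ ^ 2 := by
    rw [WithLp.prod_norm_sq_eq_of_L2]
    rfl
  have hin : (inner ℝ Z (symplDiff (u, ω) (x, ξ)) : ℝ) =
      inner ℝ X (ξ - ω) + inner ℝ Ξ (u - x) := rfl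
  rw [hn]
  simp only [character, hin]
  rw [← wignerConst, mul_assoc (wignerConst d), mul_left_comm]
  simp only [← Complex.exp_add]
  congr 2
  have hp : (Real.pi : ℂ) ≠ 0 := by exact_mod_cast Real.pi_ne_zero
  have hi : (inner ℝ X (ω - ξ) - inner ℝ (u - x) ν : ℝ) =
      -(inner ℝ (x - u) ((1 / 2 : ℝ) • (ω + ξ)) + (inner ℝ X (ξ - ω) + inner ℝ Ξ (u - x))) := by
    rw [hν, real_inner_comm (u - x) Ξ]
    simp only [inner_sub_left, inner_add_right, inner_sub_right, inner_smul_right]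
    ring
  rw [hi]
  simp only [Complex.conj_ofReal]
  push_cast
  field_simp
  ring_nf
  simp only [Complex.I_sq]
  ring

end Wigner

end

/-! ### The Wigner distribution as a Schwartz function -/

section

section Synthesis

variable {V : Type*} [NormedAddCommGroup V] [InnerProductSpace ℝ V] [FiniteDimensional ℝ V]
  [MeasurableSpace V] [BorelSpace V]
  {F : Type*} [NormedAddCommGroup F] [NormedSpace ℂ F]

theorem windowMass_conjS (g : 𝓢(V, ℂ)) : windowMass (conjS g) = windowMass g := by
  simp [windowMass, conjS_apply, mul_comm]

variable (V) in
theorem measurePreserving_neg_snd :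
    MeasurePreserving (fun z : V × V => (z.1, -z.2)) volume volume :=
  (MeasurePreserving.id _).prod (Measure.measurePreserving_neg _)

theorem continuous_conjAtom_comp {X : Type*} [TopologicalSpace X] (g : 𝓢(V, ℂ)) {x ξ : X → V}
    (hx : Continuous x) (hξ : Continuous ξ) : Continuous fun p => conjAtom g (x p) (ξ p) :=
  (continuous_conjAtom g).comp (hx.prodMk hξ)

/-- This is inversion for the conjugate window with the frequency reflected; it expands the test
function into the atoms themselves instead of their conjugates. -/
theorem integral_stft_smul_atom [CompleteSpace F] (g a : 𝓢(V, ℂ)) (f : 𝓢'(V, F)) :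
    ∫ w : V × V, stft g (a : 𝓢'(V, ℂ)) w.1 w.2 • f (atom g w) = windowMass g • f a := by
  have h := integral_coef_smul_stft (conjS g) a f
  rw [windowMass_conjS] at h
  rw [← h]
  have hme : MeasurableEmbedding fun z : V × V => (z.1, -z.2) :=
    (MeasurableEquiv.prodCongr (MeasurableEquiv.refl V) (MeasurableEquiv.neg V)).measurableEmbedding
  rw [← (measurePreserving_neg_snd V).integral_comp hme]
  refine integral_congr_ae (ae_of_all _ fun z => ?_)
  simp only [coef, conjS_conjS, atom, stft, neg_neg]

end Synthesis

section WignerSchwartz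

variable {d : ℕ}

theorem integrable_comp_half (a : 𝓢(Pos d, ℂ)) (X : Pos d) {c : ℝ} (hc : c ≠ 0) :
    Integrable fun y : Pos d => a (X + c • y) := by
  have h1 : Integrable fun y : Pos d => a (X + y) := a.integrable.comp_add_left X
  exact h1.comp_smul hc

theorem integrable_wigner (a b : 𝓢(Pos d, ℂ)) (Z : Phase d) :
    Integrable fun y : Pos d => character Z.snd y *
      (a (Z.fst + (1 / 2 : ℝ) • y) * b (Z.fst - (1 / 2 : ℝ) • y)) := by
  refine ((integrable_comp_half a Z.fst (c := 1 / 2) (by norm_num)).norm.mul_const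
    (schwartzNorm (Pos d) ℂ 0 b)).mono' ?_ (ae_of_all _ fun y => ?_)
  · have : Continuous fun y : Pos d => character Z.snd y :=
      continuous_character.comp (continuous_const.prodMk continuous_id)
    exact (this.mul ((a.continuous.comp (by fun_prop)).mul
      (b.continuous.comp (by fun_prop)))).aestronglyMeasurable
  · rw [norm_mul, norm_mul, norm_character, one_mul]
    gcongr
    exact norm_le_schwartzNorm 0 b _

theorem norm_wignerB_le_right (a b : 𝓢(Pos d, ℂ)) (Z : Phase d) :
    ‖wignerB a b Z‖ ≤ (∫ y : Pos d, ‖a (Z.fst + (1 / 2 : ℝ) • y)‖) *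
      schwartzNorm (Pos d) ℂ 0 b := by
  rw [wignerB, ← integral_mul_const]
  refine norm_integral_le_of_norm_le ((integrable_comp_half a Z.fst (by norm_num)).norm.mul_const _)
    (ae_of_all _ fun y => ?_)
  rw [norm_mul, norm_mul, norm_character, one_mul]
  gcongr
  exact norm_le_schwartzNorm 0 b _

theorem norm_wignerB_le_left (a b : 𝓢(Pos d, ℂ)) (Z : Phase d) :
    ‖wignerB a b Z‖ ≤ (∫ y : Pos d, ‖b (Z.fst + (-(1 / 2) : ℝ) • y)‖) *
      schwartzNorm (Pos d) ℂ 0 a := by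
  rw [wignerB, ← integral_mul_const]
  refine norm_integral_le_of_norm_le ((integrable_comp_half b Z.fst (by norm_num)).norm.mul_const _)
    (ae_of_all _ fun y => ?_)
  rw [norm_mul, norm_mul, norm_character, one_mul, mul_comm, neg_smul, ← sub_eq_add_neg]
  gcongr
  exact norm_le_schwartzNorm 0 a _

theorem wignerB_add_right (a b b' : 𝓢(Pos d, ℂ)) (Z : Phase d) :
    wignerB a (b + b') Z = wignerB a b Z + wignerB a b' Z := by
  rw [wignerB, wignerB, wignerB, ← integral_add (integrable_wigner a b Z)
    (integrable_wigner a b' Z)]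
  simp only [add_apply, mul_add]

theorem wignerB_smul_right (a b : 𝓢(Pos d, ℂ)) (c : ℂ) (Z : Phase d) :
    wignerB a (c • b) Z = c * wignerB a b Z := by
  rw [wignerB, wignerB, ← integral_const_mul]
  refine integral_congr_ae (ae_of_all _ fun y => ?_)
  simp only [smul_apply, smul_eq_mul]
  ring

theorem wignerB_add_left (a a' b : 𝓢(Pos d, ℂ)) (Z : Phase d) :
    wignerB (a + a') b Z = wignerB a b Z + wignerB a' b Z := by
  rw [wignerB, wignerB, wignerB, ← integral_add (integrable_wigner a b Z)
    (integrable_wigner a' b Z)]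
  simp only [add_apply, mul_add, add_mul]

theorem wignerB_smul_left (a b : 𝓢(Pos d, ℂ)) (c : ℂ) (Z : Phase d) :
    wignerB (c • a) b Z = c * wignerB a b Z := by
  rw [wignerB, wignerB, ← integral_const_mul]
  refine integral_congr_ae (ae_of_all _ fun y => ?_)
  simp only [smul_apply, smul_eq_mul]
  ring

/-- The Wigner distribution at a point, as a distribution in the second argument. -/
def wignerRight (a : 𝓢(Pos d, ℂ)) (Z : Phase d) : 𝓢'(Pos d, ℂ) :=
  distributionOfBound
    { toFun := fun b => wignerB a b Z
      map_add' := fun b b' => wignerB_add_right a b b' Z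
      map_smul' := fun c b => wignerB_smul_right a b c Z }
    ⟨0, _, fun b => norm_wignerB_le_right a b Z⟩

theorem wignerRight_apply (a b : 𝓢(Pos d, ℂ)) (Z : Phase d) :
    wignerRight a Z b = wignerB a b Z := rfl

/-- The Wigner distribution at a point, as a distribution in the first argument. -/
def wignerLeft (b : 𝓢(Pos d, ℂ)) (Z : Phase d) : 𝓢'(Pos d, ℂ) :=
  distributionOfBound
    { toFun := fun a => wignerB a b Z
      map_add' := fun a a' => wignerB_add_left a a' b Z
      map_smul' := fun c a => wignerB_smul_left a b c Z }
    ⟨0, _, fun a => norm_wignerB_le_left a b Z⟩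

theorem wignerLeft_apply (a b : 𝓢(Pos d, ℂ)) (Z : Phase d) :
    wignerLeft b Z a = wignerB a b Z := rfl

theorem continuous_midPoint : Continuous fun p : (Pos d × Pos d) × (Pos d × Pos d) =>
    midPoint p.1 p.2 := by
  unfold midPoint
  fun_prop

theorem continuous_symplDiff : Continuous fun p : (Pos d × Pos d) × (Pos d × Pos d) =>
    symplDiff p.1 p.2 := by
  unfold symplDiff
  fun_prop

theorem continuous_wignerAtom : Continuous (wignerAtom (d := d)) := by
  have h1 : Continuous fun p : (Pos d × Pos d) × (Pos d × Pos d) =>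
      wignerConst d * character ((1 / 2 : ℝ) • (p.1.2 + p.2.2)) (p.2.1 - p.1.1) :=
    continuous_const.mul (continuous_character.comp
      (Continuous.prodMk (by fun_prop) (by fun_prop)))
  have h2 : Continuous fun p : (Pos d × Pos d) × (Pos d × Pos d) =>
      conjAtom (phaseWindow d) (midPoint p.1 p.2) (symplDiff p.1 p.2) := by
    exact continuous_conjAtom_comp _ continuous_midPoint continuous_symplDiff
  exact h1.smul h2

theorem norm_toLp_le (x y : Pos d) : ‖(WithLp.toLp 2 (x, y) : Phase d)‖ ≤ ‖x‖ + ‖y‖ := by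
  rw [WithLp.prod_norm_eq_of_L2]
  refine Real.sqrt_le_iff.2 ⟨by positivity, ?_⟩
  change ‖x‖ ^ 2 + ‖y‖ ^ 2 ≤ _
  nlinarith [norm_nonneg x, norm_nonneg y]

theorem one_add_sum_le_tfWeight (w z : Pos d × Pos d) :
    1 + (‖w.1‖ + ‖z.1‖ + (‖w.2‖ + ‖z.2‖)) ≤ tfWeight w * tfWeight z := by
  have h1 := norm_nonneg w.1
  have h2 := norm_nonneg w.2
  have h3 := norm_nonneg z.1
  have h4 := norm_nonneg z.2
  have e : tfWeight w * tfWeight z = 1 + (‖w.1‖ + ‖z.1‖ + (‖w.2‖ + ‖z.2‖)) +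
    (‖w.1‖ * ‖w.2‖ + ‖z.1‖ * ‖z.2‖ + (‖w.1‖ + ‖w.2‖ + ‖w.1‖ * ‖w.2‖) *
      (‖z.1‖ + ‖z.2‖ + ‖z.1‖ * ‖z.2‖)) := by
    rw [tfWeight, tfWeight]; ring
  rw [e]
  have : 0 ≤ ‖w.1‖ * ‖w.2‖ + ‖z.1‖ * ‖z.2‖ + (‖w.1‖ + ‖w.2‖ + ‖w.1‖ * ‖w.2‖) *
      (‖z.1‖ + ‖z.2‖ + ‖z.1‖ * ‖z.2‖) := by positivity
  linarith

/-- Centre and frequency are both bounded by the sum of the four norms. The quadratic loss is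
harmless, since the coefficients decay faster than any power. -/
theorem tfWeight_midPoint_le (w z : Pos d × Pos d) :
    tfWeight (midPoint w z, symplDiff w z) ≤ (tfWeight w * tfWeight z) ^ 2 := by
  have h := one_add_sum_le_tfWeight w z
  have h1 : ‖midPoint w z‖ ≤ ‖w.1‖ + ‖z.1‖ + (‖w.2‖ + ‖z.2‖) := by
    refine (norm_toLp_le _ _).trans (add_le_add ?_ ?_) <;>
    · rw [norm_smul]
      norm_num
      have := norm_add_le w.1 z.1
      have := norm_add_le w.2 z.2
      nlinarith [norm_nonneg w.1, norm_nonneg z.1, norm_nonneg w.2, norm_nonneg z.2]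
  have h2 : ‖symplDiff w z‖ ≤ ‖w.1‖ + ‖z.1‖ + (‖w.2‖ + ‖z.2‖) := by
    refine (norm_toLp_le _ _).trans ?_
    have := norm_sub_le z.2 w.2
    have := norm_sub_le w.1 z.1
    linarith
  rw [sq]
  change (1 + ‖midPoint w z‖) * (1 + ‖symplDiff w z‖) ≤ _
  exact mul_le_mul (by linarith) (by linarith) (by positivity)
    (mul_nonneg (tfWeight_pos w).le (tfWeight_pos z).le)

theorem exists_schwartzNorm_wignerAtom_le (K : ℕ) : ∃ (M : ℕ) (C : ℝ), 0 ≤ C ∧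
    ∀ p : (Pos d × Pos d) × (Pos d × Pos d), schwartzNorm (Phase d) ℂ K (wignerAtom p) ≤
      C * (tfWeight p.1 ^ M * tfWeight p.2 ^ M) := by
  obtain ⟨M, C, hC, h⟩ := exists_schwartzNorm_conjAtom_le (phaseWindow d) K
  refine ⟨2 * M, ‖wignerConst d‖ * C, by positivity, fun p => ?_⟩
  rw [wignerAtom, map_smul_eq_mul, norm_mul, norm_character, mul_one, mul_assoc]
  gcongr
  refine (h (midPoint p.1 p.2, symplDiff p.1 p.2)).trans ?_
  gcongr
  rw [← mul_pow, pow_mul]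
  exact pow_le_pow_left₀ (tfWeight_pos _).le (tfWeight_midPoint_le p.1 p.2) M

/-- The coefficients of the Wigner distribution of two Schwartz functions. -/
def wignerCoef (a b : 𝓢(Pos d, ℂ)) (p : (Pos d × Pos d) × (Pos d × Pos d)) : ℂ :=
  stft (stdWindow d) (a : 𝓢'(Pos d, ℂ)) p.1.1 p.1.2 * coef (stdWindow d) b p.2

theorem continuous_wignerCoef (a b : 𝓢(Pos d, ℂ)) : Continuous (wignerCoef a b) :=
  ((continuous_stft (stdWindow d) (a : 𝓢'(Pos d, ℂ))).comp continuous_fst).mul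
    ((continuous_coef _ b).comp continuous_snd)

theorem exists_norm_wignerCoef_le (K : ℕ) : ∃ (L : ℕ) (C : ℝ), 0 ≤ C ∧
    ∀ (a b : 𝓢(Pos d, ℂ)) (p : (Pos d × Pos d) × (Pos d × Pos d)),
      ‖wignerCoef a b p‖ ≤ C * schwartzNorm (Pos d) ℂ L a * schwartzNorm (Pos d) ℂ L b *
        (tfDecay K p.1 * tfDecay K p.2) := by
  obtain ⟨L₁, C₁, hC₁, h₁⟩ := exists_norm_stft_le (F := ℂ) (stdWindow d) K
  obtain ⟨L₂, C₂, hC₂, h₂⟩ := exists_norm_coef_le (stdWindow d) K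
  refine ⟨max L₁ L₂, C₁ * C₂, by positivity, fun a b p => ?_⟩
  have ha : schwartzNorm (Pos d) ℂ L₁ a ≤ schwartzNorm (Pos d) ℂ (max L₁ L₂) a :=
    schwartzNorm_mono (le_max_left _ _) a
  have hb : schwartzNorm (Pos d) ℂ L₂ b ≤ schwartzNorm (Pos d) ℂ (max L₁ L₂) b :=
    schwartzNorm_mono (le_max_right _ _) b
  rw [wignerCoef, norm_mul]
  have hd1 := (tfDecay_pos K p.1).le
  have hd2 := (tfDecay_pos K p.2).le
  calc _ ≤ (C₁ * schwartzNorm (Pos d) ℂ (max L₁ L₂) a * tfDecay K p.1) *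
        (C₂ * schwartzNorm (Pos d) ℂ (max L₁ L₂) b * tfDecay K p.2) := by
        refine mul_le_mul ((h₁ a p.1).trans ?_) ((h₂ b p.2).trans ?_) (norm_nonneg _)
          (by positivity) <;> gcongr
    _ = _ := by ring

theorem exists_schwartzNorm_smul_wignerAtom_le (K : ℕ) : ∃ (L : ℕ) (C : ℝ), 0 ≤ C ∧
    ∀ (a b : 𝓢(Pos d, ℂ)) (p : (Pos d × Pos d) × (Pos d × Pos d)),
      schwartzNorm (Phase d) ℂ K (wignerCoef a b p • wignerAtom p) ≤
        C * schwartzNorm (Pos d) ℂ L a * schwartzNorm (Pos d) ℂ L b *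
          (tfDecay (intPow (Pos d)) p.1 * tfDecay (intPow (Pos d)) p.2) := by
  obtain ⟨M, C₁, hC₁, h₁⟩ := exists_schwartzNorm_wignerAtom_le (d := d) K
  obtain ⟨L, C₂, hC₂, h₂⟩ := exists_norm_wignerCoef_le (d := d) (M + intPow (Pos d))
  refine ⟨L, C₂ * C₁, by positivity, fun a b p => ?_⟩
  rw [map_smul_eq_mul, ← tfWeight_pow_mul_tfDecay M (intPow (Pos d)) p.1,
    ← tfWeight_pow_mul_tfDecay M (intPow (Pos d)) p.2]
  have hd1 := (tfDecay_pos (M + intPow (Pos d)) p.1).le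
  have hd2 := (tfDecay_pos (M + intPow (Pos d)) p.2).le
  refine (mul_le_mul (h₂ a b p) (h₁ p) (apply_nonneg _ _) (by positivity)).trans (le_of_eq ?_)
  ring

theorem integrable_tfDecay_prod : Integrable fun p : (Pos d × Pos d) × (Pos d × Pos d) =>
    tfDecay (intPow (Pos d)) p.1 * tfDecay (intPow (Pos d)) p.2 :=
  integrable_tfDecay.mul_prod integrable_tfDecay

theorem continuous_smul_wignerAtom (a b : 𝓢(Pos d, ℂ)) :
    Continuous fun p => wignerCoef a b p • wignerAtom p :=
  (continuous_wignerCoef a b).smul continuous_wignerAtom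

theorem smul_wignerAtom_bound (a b : 𝓢(Pos d, ℂ)) (K : ℕ) :
    ∃ β : (Pos d × Pos d) × (Pos d × Pos d) → ℝ, Integrable β ∧
      ∀ p, schwartzNorm (Phase d) ℂ K (wignerCoef a b p • wignerAtom p) ≤ β p := by
  obtain ⟨L, C, -, h⟩ := exists_schwartzNorm_smul_wignerAtom_le (d := d) K
  exact ⟨_, integrable_tfDecay_prod.const_mul _, h a b⟩

/-- The Wigner distribution of two Schwartz functions, as a Schwartz function. -/
def wignerS (a b : 𝓢(Pos d, ℂ)) : 𝓢(Phase d, ℂ) :=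
  ((windowMass (stdWindow d))⁻¹ ^ 2) •
    schwartzIntegral (continuous_smul_wignerAtom a b) (smul_wignerAtom_bound a b)

theorem exists_schwartzNorm_wignerS_le (K : ℕ) : ∃ (L : ℕ) (C : ℝ), 0 ≤ C ∧
    ∀ a b : 𝓢(Pos d, ℂ), schwartzNorm (Phase d) ℂ K (wignerS a b) ≤
      C * schwartzNorm (Pos d) ℂ L a * schwartzNorm (Pos d) ℂ L b := by
  obtain ⟨L, C, hC, h⟩ := exists_schwartzNorm_smul_wignerAtom_le (d := d) K
  set I := ∫ p : (Pos d × Pos d) × (Pos d × Pos d),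
    tfDecay (intPow (Pos d)) p.1 * tfDecay (intPow (Pos d)) p.2
  have hI : 0 ≤ I := integral_nonneg fun p => mul_nonneg (tfDecay_pos _ _).le (tfDecay_pos _ _).le
  refine ⟨L, ‖(windowMass (stdWindow d))⁻¹ ^ 2‖ * (C * I), by positivity, fun a b => ?_⟩
  rw [wignerS, map_smul_eq_mul]
  have := seminorm_schwartzIntegral_le (continuous_smul_wignerAtom a b)
    (smul_wignerAtom_bound a b) (integrable_tfDecay_prod.const_mul _) (h a b)
  rw [integral_const_mul] at this
  calc _ ≤ ‖(windowMass (stdWindow d))⁻¹ ^ 2‖ *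
        (C * schwartzNorm (Pos d) ℂ L a * schwartzNorm (Pos d) ℂ L b * I) := by gcongr
    _ = _ := by ring

/-- The synthesis integral is a Schwartz function by construction; its values remain to be
identified. The Wigner distribution at a fixed point is a distribution in each argument separately,
so the two inversion formulas expand `a` and `b` into atoms, and Fubini's theorem joins the two
integrals. -/
theorem wignerS_apply (a b : 𝓢(Pos d, ℂ)) (Z : Phase d) : wignerS a b Z = wignerB a b Z := by
  have hm := windowMass_ne_zero (stdWindow_ne_zero (d := d))
  have h1 := integral_coef_smul_stft (stdWindow d) b (wignerRight a Z)
  have h2 : ∀ z : Pos d × Pos d, _ := fun z =>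
    integral_stft_smul_atom (stdWindow d) a (wignerLeft (conjAtom (stdWindow d) z.1 z.2) Z)
  simp only [stft, wignerRight_apply, wignerLeft_apply, wignerB_atom, smul_eq_mul] at h1 h2
  have hint : Integrable fun p : (Pos d × Pos d) × (Pos d × Pos d) =>
      wignerCoef a b p * wignerAtom p Z := by
    obtain ⟨β, hβ, h⟩ := smul_wignerAtom_bound a b 0
    refine hβ.mono' ?_ (ae_of_all _ fun p => ?_)
    · have hc : Continuous fun p => (wignerCoef a b p • wignerAtom p) Z :=
        (TemperedDistribution.delta Z : 𝓢(Phase d, ℂ) →L[ℂ] ℂ).continuous.comp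
          (continuous_smul_wignerAtom a b)
      exact hc.aestronglyMeasurable
    · exact (norm_le_schwartzNorm 0 (wignerCoef a b p • wignerAtom p) Z).trans (h p)
  rw [wignerS, smul_apply, schwartzIntegral_apply, smul_eq_mul]
  have h3 : ∫ p, (wignerCoef a b p • wignerAtom p) Z =
      windowMass (stdWindow d) ^ 2 * wignerB a b Z := by
    simp only [smul_apply, smul_eq_mul]
    rw [Measure.volume_eq_prod] at hint ⊢
    rw [integral_prod_symm _ hint, sq, mul_assoc, ← h1, ← integral_const_mul]
    refine integral_congr_ae (ae_of_all _ fun z => ?_)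
    simp only
    rw [mul_left_comm, ← h2 z, ← integral_const_mul]
    refine integral_congr_ae (ae_of_all _ fun w => ?_)
    simp only [wignerCoef, stft]
    ring
  rw [h3, ← mul_assoc, ← mul_pow, inv_mul_cancel₀ hm, one_pow, one_mul]

theorem apply_wignerS {F : Type*} [NormedAddCommGroup F] [NormedSpace ℂ F] [CompleteSpace F]
    (σ : 𝓢'(Phase d, F)) (a b : 𝓢(Pos d, ℂ)) :
    σ (wignerS a b) = ((windowMass (stdWindow d))⁻¹ ^ 2) •
      ∫ p, wignerCoef a b p • σ (wignerAtom p) := by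
  rw [wignerS, map_smul, apply_schwartzIntegral]
  simp only [map_smul]

end WignerSchwartz

end

/-! ### Weyl operators as matrices on phase space -/

section

section WeylDistribution

variable {d n : ℕ}

/-- The components of a `ℂ^n`-valued Schwartz function. -/
def component (j : Fin n) : 𝓢(Pos d, Spinor n) →L[ℂ] 𝓢(Pos d, ℂ) :=
  SchwartzMap.postcompCLM (𝕜 := ℂ) (EuclideanSpace.proj j : Spinor n →L[ℂ] ℂ)

theorem component_apply (j : Fin n) (f : 𝓢(Pos d, Spinor n)) (y : Pos d) :
    component j f y = f y j := rfl

theorem stft_eq_sum_component (g : 𝓢(Pos d, ℂ)) (f : 𝓢(Pos d, Spinor n)) (x ξ : Pos d) :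
    stft g (f : 𝓢'(Pos d, Spinor n)) x ξ =
      ∑ j, stft g (component j f : 𝓢'(Pos d, ℂ)) x ξ • EuclideanSpace.single j (1 : ℂ) := by
  have hint : Integrable fun y => conjAtom g x ξ y • f y := by
    have := (SchwartzMap.smulLeftCLM (Spinor n) (conjAtom g x ξ) f).integrable (μ := volume)
    refine this.congr (ae_of_all _ fun y => ?_)
    exact SchwartzMap.smulLeftCLM_apply_apply (conjAtom g x ξ).hasTemperateGrowth f y
  ext i
  rw [stft_coe]
  have h1 := (EuclideanSpace.proj i : Spinor n →L[ℂ] ℂ).integral_comp_comm hint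
  change _ = (∫ y, conjAtom g x ξ y • f y) i at h1
  rw [← h1]
  simp only [stft_coe, component_apply]
  simp [Pi.single_apply]

theorem wignerS_add_right (a b b' : 𝓢(Pos d, ℂ)) :
    wignerS a (b + b') = wignerS a b + wignerS a b' := by
  ext Z
  simp only [add_apply, wignerS_apply, wignerB_add_right]

theorem wignerS_smul_right (a b : 𝓢(Pos d, ℂ)) (c : ℂ) :
    wignerS a (c • b) = c • wignerS a b := by
  ext Z
  simp only [smul_apply, wignerS_apply, wignerB_smul_right, smul_eq_mul]

theorem wignerS_add_left (a a' b : 𝓢(Pos d, ℂ)) :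
    wignerS (a + a') b = wignerS a b + wignerS a' b := by
  ext Z
  simp only [add_apply, wignerS_apply, wignerB_add_left]

theorem wignerS_smul_left (a b : 𝓢(Pos d, ℂ)) (c : ℂ) :
    wignerS (c • a) b = c • wignerS a b := by
  ext Z
  simp only [smul_apply, wignerS_apply, wignerB_smul_left, smul_eq_mul]

/-- The linear form that defines the Weyl transform of a Schwartz function. -/
def weylForm (σ : 𝓢'(Phase d, SpinorOp n)) (f : 𝓢(Pos d, Spinor n)) :
    𝓢(Pos d, ℂ) →ₗ[ℂ] Spinor n where
  toFun φ := ∑ j, σ (wignerS (component j f) φ) (EuclideanSpace.single j 1)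
  map_add' φ χ := by
    simp only [wignerS_add_right, map_add, add_apply, Finset.sum_add_distrib]
  map_smul' c φ := by
    simp only [wignerS_smul_right, map_smul, smul_apply, Finset.smul_sum, RingHom.id_apply]

theorem exists_norm_weylForm_le (σ : 𝓢'(Phase d, SpinorOp n)) (f : 𝓢(Pos d, Spinor n)) :
    ∃ (L : ℕ) (C : ℝ), ∀ φ, ‖weylForm σ f φ‖ ≤ C * schwartzNorm (Pos d) ℂ L φ := by
  obtain ⟨K, C, hC, h⟩ := exists_bound_apply σ
  obtain ⟨L, C', hC', h'⟩ := exists_schwartzNorm_wignerS_le (d := d) K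
  refine ⟨L, ∑ j, C * (C' * schwartzNorm (Pos d) ℂ L (component j f)), fun φ => ?_⟩
  rw [Finset.sum_mul]
  refine (norm_sum_le Finset.univ fun j =>
    σ (wignerS (component j f) φ) (EuclideanSpace.single j 1)).trans
      (Finset.sum_le_sum fun j _ => ?_)
  refine ((σ (wignerS (component j f) φ)).le_opNorm _).trans ?_
  rw [PiLp.norm_single, norm_one, mul_one, mul_assoc]
  refine (h _).trans ?_
  gcongr
  exact h' _ _

/-- The Weyl transform of a Schwartz function. -/
def weylDist (σ : 𝓢'(Phase d, SpinorOp n)) (f : 𝓢(Pos d, Spinor n)) : 𝓢'(Pos d, Spinor n) :=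
  distributionOfBound (weylForm σ f) (exists_norm_weylForm_le σ f)

theorem weylDist_apply (σ : 𝓢'(Phase d, SpinorOp n)) (f : 𝓢(Pos d, Spinor n)) (φ : 𝓢(Pos d, ℂ)) :
    weylDist σ f φ = ∑ j, σ (wignerS (component j f) φ) (EuclideanSpace.single j 1) := rfl

theorem isWeylTransform_weylDist (σ : 𝓢'(Phase d, SpinorOp n)) (f : 𝓢(Pos d, Spinor n)) :
    IsWeylTransform σ f (weylDist σ f) := fun φ =>
  ⟨fun j => wignerS (component j f) φ, fun j z => by
    rw [wignerS_apply, ← wigner_conj]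
    rfl, rfl⟩

theorem weylDist_add (σ : 𝓢'(Phase d, SpinorOp n)) (f h : 𝓢(Pos d, Spinor n)) :
    weylDist σ (f + h) = weylDist σ f + weylDist σ h := by
  ext1 φ
  change weylDist σ (f + h) φ = weylDist σ f φ + weylDist σ h φ
  simp only [weylDist_apply, map_add, wignerS_add_left, add_apply, Finset.sum_add_distrib]

theorem weylDist_smul (σ : 𝓢'(Phase d, SpinorOp n)) (f : 𝓢(Pos d, Spinor n)) (c : ℂ) :
    weylDist σ (c • f) = c • weylDist σ f := by
  ext1 φ
  change weylDist σ (c • f) φ = c • weylDist σ f φ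
  simp only [weylDist_apply, map_smul, wignerS_smul_left, smul_apply, Finset.smul_sum]

/-- Expanding both `f` and `φ` into Gaussian atoms exhibits `σ (wignerAtom p)` as the matrix of the
Weyl operator with respect to these atoms. -/
theorem weylDist_apply_eq_integral (σ : 𝓢'(Phase d, SpinorOp n)) (f : 𝓢(Pos d, Spinor n))
    (φ : 𝓢(Pos d, ℂ)) : weylDist σ f φ = ((windowMass (stdWindow d))⁻¹ ^ 2) •
      ∫ p : (Pos d × Pos d) × (Pos d × Pos d), coef (stdWindow d) φ p.2 •
        σ (wignerAtom p) (stft (stdWindow d) (f : 𝓢'(Pos d, Spinor n)) p.1.1 p.1.2) := by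
  have hint : ∀ j, Integrable fun p => wignerCoef (component j f) φ p • σ (wignerAtom p) := by
    intro j
    refine (integrable_apply_family (continuous_smul_wignerAtom (component j f) φ)
      (smul_wignerAtom_bound (component j f) φ) σ).congr (ae_of_all _ fun p => ?_)
    simp only [map_smul]
  rw [weylDist_apply]
  have h1 : ∀ j : Fin n, σ (wignerS (component j f) φ) (EuclideanSpace.single j 1) =
      ((windowMass (stdWindow d))⁻¹ ^ 2) • ∫ p, wignerCoef (component j f) φ p •
        σ (wignerAtom p) (EuclideanSpace.single j 1) := by
    intro j
    rw [apply_wignerS, smul_apply, ContinuousLinearMap.integral_apply (hint j)]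
    rfl
  simp only [h1]
  rw [← Finset.smul_sum, ← integral_finsetSum _ fun j _ => ?_]
  · congr 1
    refine integral_congr_ae (ae_of_all _ fun p => ?_)
    simp only
    rw [stft_eq_sum_component, map_sum, Finset.smul_sum]
    refine Finset.sum_congr rfl fun j _ => ?_
    rw [map_smul, smul_smul, wignerCoef, mul_comm]
  · exact (hint j).apply_continuousLinearMap _

/-- Three functions of differences are composed: the transform of `f`, the matrix of the operator,
dominated by `H`, and the correlation of two atoms, dominated by `decayE K`. Such a composition is
an iterated convolution, and the constant contains the normalisation by the mass of the window. -/
theorem exists_stftE_weylDist_le (K : ℕ) : ∃ C : ℝ≥0∞, C ≠ ∞ ∧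
    ∀ (σ : 𝓢'(Phase d, SpinorOp n)) (H : Pos d × Pos d → ℝ≥0∞), Measurable H →
      (∀ p, ‖σ (wignerAtom p)‖ₑ ≤ H (p.2 - p.1)) → ∀ (f : 𝓢(Pos d, Spinor n)) z,
        stftE (stdWindow d) (weylDist σ f) z ≤
          ((fun z => C * (decayE K ⋆ₗ H) z) ⋆ₗ
            stftE (stdWindow d) (f : 𝓢'(Pos d, Spinor n))) z := by
  obtain ⟨C, hC, h⟩ := exists_norm_coef_conjAtom_le (stdWindow d) (stdWindow d) K
  refine ⟨‖(windowMass (stdWindow d))⁻¹ ^ 2‖ₑ * ENNReal.ofReal C,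
    ENNReal.mul_ne_top enorm_ne_top ENNReal.ofReal_ne_top, fun σ H hH hσ f z => ?_⟩
  set S := stftE (stdWindow d) (f : 𝓢'(Pos d, Spinor n)) with hS
  have hSm : Measurable S := measurable_stftE _ _
  have hdm := measurable_decayE (V := Pos d) K
  rw [lconvolution_const_mul _ (measurable_lconvolution _ hdm hH) hSm,
    ← lconvolution_assoc hdm hH hSm, lconvolution_comm, lconvolution_def, stftE, stft,
    weylDist_apply_eq_integral, enorm_smul, mul_assoc]
  gcongr
  refine (enorm_integral_le_lintegral_enorm _).trans ?_
  calc ∫⁻ p : (Pos d × Pos d) × (Pos d × Pos d),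
        ‖coef (stdWindow d) (conjAtom (stdWindow d) z.1 z.2) p.2 • σ (wignerAtom p)
          (stft (stdWindow d) (f : 𝓢'(Pos d, Spinor n)) p.1.1 p.1.2)‖ₑ
      ≤ ∫⁻ p : (Pos d × Pos d) × (Pos d × Pos d),
        ENNReal.ofReal C * (S p.1 * H (-p.1 + p.2) * decayE K (-p.2 + z)) := by
        refine lintegral_mono fun p => ?_
        rw [enorm_smul]
        have h1 : ‖coef (stdWindow d) (conjAtom (stdWindow d) z.1 z.2) p.2‖ₑ ≤
            ENNReal.ofReal C * decayE K (-p.2 + z) := by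
          rw [decayE, ← ENNReal.ofReal_mul hC, ← ofReal_norm, neg_add_eq_sub]
          exact ENNReal.ofReal_le_ofReal (h z p.2)
        have h2 : ‖σ (wignerAtom p)
            (stft (stdWindow d) (f : 𝓢'(Pos d, Spinor n)) p.1.1 p.1.2)‖ₑ ≤
            H (-p.1 + p.2) * S p.1 := by
          refine ((σ (wignerAtom p)).le_opENorm _).trans ?_
          gcongr
          · rw [neg_add_eq_sub]
            exact hσ p
          · rfl
        refine (mul_le_mul' h1 h2).trans (le_of_eq ?_)
        ring
    _ = ENNReal.ofReal C * ∫⁻ p : (Pos d × Pos d) × (Pos d × Pos d),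
        (S p.1 * H (-p.1 + p.2) * decayE K (-p.2 + z)) :=
        lintegral_const_mul' _ _ ENNReal.ofReal_ne_top
    _ = _ := by
        congr 1
        rw [Measure.volume_eq_prod, lintegral_prod_symm _ (by fun_prop)]
        refine lintegral_congr fun y => ?_
        rw [lconvolution_comm, lconvolution_def]
        exact lintegral_mul_const (μ := volume) (f := fun x => S x * H (-x + y))
          (decayE K (-y + z)) (by fun_prop)

end WeylDistribution

section KernelBound

variable {V : Type*} [NormedAddCommGroup V] [InnerProductSpace ℝ V] [FiniteDimensional ℝ V]
  [MeasurableSpace V] [BorelSpace V]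
  {F : Type*} [NormedAddCommGroup F] [NormedSpace ℂ F]

/-- Polynomial decay on `V`, with values in `[0, ∞]`. -/
def decay₁ (K : ℕ) (x : V) : ℝ≥0∞ := ENNReal.ofReal (((1 + ‖x‖) ^ K)⁻¹)

theorem measurable_decay₁ (K : ℕ) : Measurable (decay₁ K : V → ℝ≥0∞) := by
  unfold decay₁
  fun_prop

variable (V) in
theorem exists_lintegral_decay₁_lt_top (κ : ℝ) :
    ∃ K : ℕ, ∫⁻ x : V, decay₁ K x * ENNReal.ofReal ((1 + ‖x‖) ^ κ) < ∞ := by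
  refine ⟨⌈κ⌉₊ + intPow V, lt_of_le_of_lt (lintegral_mono fun x => ?_)
    (integrable_one_add_norm_inv (V := V)).lintegral_lt_top⟩
  simp only [decay₁]
  rw [← ENNReal.ofReal_mul (by positivity)]
  refine ENNReal.ofReal_le_ofReal ?_
  have h1 : (1 + ‖x‖) ^ κ ≤ (1 + ‖x‖) ^ ⌈κ⌉₊ := by
    rw [← Real.rpow_natCast]
    exact Real.rpow_le_rpow_of_exponent_le (by simp) (Nat.le_ceil κ)
  calc ((1 + ‖x‖) ^ (⌈κ⌉₊ + intPow V))⁻¹ * (1 + ‖x‖) ^ κ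
      ≤ ((1 + ‖x‖) ^ (⌈κ⌉₊ + intPow V))⁻¹ * (1 + ‖x‖) ^ ⌈κ⌉₊ := by gcongr
    _ = _ := by
      rw [pow_add]
      field_simp

theorem lintegral_conv_wt_le {κ : ℝ} (hκ : 0 ≤ κ) {H φ : V → ℝ≥0∞} (hH : Measurable H)
    (hφ : Measurable φ) : ∫⁻ x, (H ⋆ₗ φ) x * wt κ x ≤
      (∫⁻ x, H x * ENNReal.ofReal ((1 + ‖x‖) ^ κ)) * ∫⁻ x, φ x * wt κ x := by
  have hw := measurable_wt (V := V) κ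
  calc ∫⁻ z, (H ⋆ₗ φ) z * wt κ z
      = ∫⁻ z, ∫⁻ y, H y * φ (-y + z) * wt κ z := by
        refine lintegral_congr fun z => ?_
        rw [lconvolution_def, lintegral_mul_const]
        fun_prop
    _ = ∫⁻ y, ∫⁻ z, H y * φ (-y + z) * wt κ z := by
        rw [lintegral_lintegral_swap]
        fun_prop
    _ = ∫⁻ y, ∫⁻ z, H y * φ z * wt κ (y + z) := by
        refine lintegral_congr fun y => ?_
        rw [← lintegral_add_left_eq_self _ y]
        simp
    _ ≤ ∫⁻ y, ∫⁻ z, (H y * ENNReal.ofReal ((1 + ‖y‖) ^ κ)) * (φ z * wt κ z) := by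
        refine lintegral_mono fun y => lintegral_mono fun z => ?_
        have := wt_le (abs_of_nonneg hκ).le (y + z) z
        rw [add_sub_cancel_right] at this
        calc H y * φ z * wt κ (y + z) ≤
            H y * φ z * (ENNReal.ofReal ((1 + ‖y‖) ^ κ) * wt κ z) := by gcongr
          _ = _ := by ring
    _ = _ := by
        rw [← lintegral_mul_const _ (by fun_prop)]
        refine lintegral_congr fun y => ?_
        rw [lintegral_const_mul _ (by fun_prop)]

variable [CompleteSpace F]

/-- Domination of the short-time Fourier transform with respect to an arbitrary window. -/
theorem NarrowlyContinuousOn.exists_dominated {κ : ℝ} (hκ : 0 ≤ κ) {σ : ℝ → 𝓢'(V, F)} {Ω : Set ℝ}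
    (hσ : NarrowlyContinuousOn κ σ Ω) (Φ : 𝓢(V, ℂ)) : ∃ H : V → ℝ≥0∞, Measurable H ∧
      ∫⁻ ζ, H ζ * wt κ ζ < ∞ ∧ ∀ t ∈ Ω, ∀ P ζ, ‖stft Φ (σ t) P ζ‖ₑ ≤ H ζ := by
  obtain ⟨h, hint, g, hg, hdom⟩ := hσ.dominated
  -- Only the product of `h` with the weight is known to be almost everywhere measurable. The
  -- function `h` is therefore replaced by the measurable majorant `h₁`, the modulus of a
  -- representative of the product divided by the weight.
  set q := hint.1.mk _ with hq
  have hqm : Measurable q := hint.1.stronglyMeasurable_mk.measurable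
  set h₁ : V → ℝ≥0∞ := fun ζ => ‖q ζ‖ₑ * ENNReal.ofReal ((bracket ζ ^ κ)⁻¹) with hh₁
  have hbp : ∀ ζ : V, 0 < bracket ζ ^ κ := fun ζ => Real.rpow_pos_of_pos (bracket_pos ζ) κ
  have hbm : Measurable fun ζ : V => bracket ζ ^ κ :=
    (continuous_bracket.rpow_const fun x => Or.inl (bracket_pos x).ne').measurable
  have hh₁m : Measurable h₁ := hqm.enorm.mul (ENNReal.measurable_ofReal.comp hbm.inv)
  have hle : ∀ᵐ ζ : V, ENNReal.ofReal (h ζ) ≤ h₁ ζ := by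
    filter_upwards [hint.1.ae_eq_mk] with ζ hζ
    have e : q ζ = bracket ζ ^ κ * h ζ := hζ.symm
    rw [hh₁]
    simp only
    rw [e, Real.enorm_eq_ofReal_abs, ← ENNReal.ofReal_mul (abs_nonneg _), abs_mul,
      abs_of_pos (hbp ζ), mul_comm, inv_mul_cancel_left₀ (hbp ζ).ne']
    exact ENNReal.ofReal_le_ofReal (le_abs_self _)
  have hfin : ∫⁻ ζ, h₁ ζ * wt κ ζ < ∞ := by
    have e : ∀ ζ, h₁ ζ * wt κ ζ = ‖q ζ‖ₑ := fun ζ => by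
      rw [hh₁]
      simp only [wt]
      rw [mul_assoc, ← ENNReal.ofReal_mul (inv_nonneg.2 (hbp ζ).le), inv_mul_cancel₀ (hbp ζ).ne',
        ENNReal.ofReal_one, mul_one]
    simp only [e]
    exact (hint.congr hint.1.ae_eq_mk).2
  obtain ⟨K₁, hK₁⟩ := exists_lintegral_decay₁_lt_top V κ
  obtain ⟨C, hC, hwin⟩ := exists_stftE_le_conv (F := F) hg Φ K₁
  have hI : ∫⁻ x : V, decay₁ K₁ x < ∞ := by
    refine lt_of_le_of_lt (lintegral_mono fun x => ?_) hK₁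
    refine le_mul_of_one_le_right' ?_
    rw [ENNReal.one_le_ofReal]
    exact Real.one_le_rpow (by simp) hκ
  set I := ∫⁻ x : V, decay₁ K₁ x
  have hdm := measurable_decay₁ (V := V) K₁
  -- A change of window is a convolution in both variables. In the position, where the bound is
  -- uniform, it contributes only the constant `I`; in the frequency it convolves `h₁`. Since the
  -- original bound enters under an integral, the new one holds for every `ζ`.
  refine ⟨fun ζ => C * I * (decay₁ K₁ ⋆ₗ h₁) ζ, by fun_prop, ?_, fun t ht P ζ => ?_⟩
  · calc ∫⁻ ζ, C * I * (decay₁ K₁ ⋆ₗ h₁) ζ * wt κ ζ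
        = C * I * ∫⁻ ζ, (decay₁ K₁ ⋆ₗ h₁) ζ * wt κ ζ := by
          rw [← lintegral_const_mul' _ _ (ENNReal.mul_ne_top hC hI.ne)]
          simp only [mul_assoc]
      _ < ∞ := ENNReal.mul_lt_top (ENNReal.mul_lt_top hC.lt_top hI)
          ((lintegral_conv_wt_le hκ hdm hh₁m).trans_lt (ENNReal.mul_lt_top hK₁ hfin))
  · have hae : ∀ᵐ ζ' : V, ∀ P', stftE g (σ t) (P', ζ') ≤ h₁ ζ' := by
      filter_upwards [hdom t ht, hle] with ζ' h1 h2 P'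
      refine le_trans ?_ h2
      rw [stftE, ← ofReal_norm]
      exact ENNReal.ofReal_le_ofReal (h1 P')
    have hSm := measurable_stftE g (σ t)
    have hdE := measurable_decayE (V := V) K₁
    refine (hwin (σ t) (P, ζ)).trans ?_
    simp only
    rw [mul_assoc]
    gcongr
    rw [lconvolution_comm, lconvolution_def, Measure.volume_eq_prod,
      lintegral_prod_symm _ (by fun_prop), lconvolution_comm, lconvolution_def,
      ← lintegral_const_mul _ (by fun_prop)]
    refine lintegral_mono_ae ?_
    filter_upwards [hae] with ζ' hζ'
    calc ∫⁻ P', stftE g (σ t) (P', ζ') * decayE K₁ (-(P', ζ') + (P, ζ))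
        ≤ ∫⁻ P', h₁ ζ' * decay₁ K₁ (-ζ' + ζ) * decay₁ K₁ (-P' + P) := by
          refine lintegral_mono fun P' => ?_
          rw [decayE, ofReal_tfDecay, mul_assoc]
          exact mul_le_mul' (hζ' P') le_rfl
      _ = h₁ ζ' * decay₁ K₁ (-ζ' + ζ) * ∫⁻ P', decay₁ K₁ (-P' + P) := by
          rw [lintegral_const_mul _ (by fun_prop)]
      _ = _ := by
          have e : ∫⁻ P', decay₁ K₁ (-P' + P) = I := by
            have : ∀ P', decay₁ K₁ (-P' + P) = decay₁ K₁ (P' - P) := fun P' => by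
              rw [decay₁, decay₁, neg_add_eq_sub, norm_sub_rev]
            simp only [this]
            exact lintegral_sub_right_eq_self (fun x : V => decay₁ K₁ x) P
          rw [e, mul_comm]

end KernelBound

section PhaseBound

variable {d n : ℕ}

theorem measurePreserving_sympl : MeasurePreserving
    (fun v : Pos d × Pos d => (WithLp.toLp 2 (v.2, -v.1) : Phase d)) volume volume := by
  have h1 : MeasurePreserving (fun v : Pos d × Pos d => v.swap) volume volume :=
    Measure.measurePreserving_swap
  have h2 := measurePreserving_neg_snd (Pos d)
  exact (WithLp.volume_preserving_toLp (Pos d) (Pos d)).comp (h2.comp h1)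

/-- The inequality `(1 + a)(1 + b) ≤ 2(1 + a² + b²)` compares the product weight with the square of
the bracket; this square is the source of the exponent `2γ` required of the symbol. -/
theorem weightE_le_wt {γ : ℝ} (hγ : 0 ≤ γ) (v : Pos d × Pos d) :
    weightE γ v ≤ ENNReal.ofReal (2 ^ γ) * wt (2 * γ) (WithLp.toLp 2 (v.2, -v.1) : Phase d) := by
  rw [weightE, wt, ← ENNReal.ofReal_mul (by positivity)]
  refine ENNReal.ofReal_le_ofReal ?_
  have hb := bracket_pos (WithLp.toLp 2 (v.2, -v.1) : Phase d)
  rw [Real.rpow_mul hb.le, ← Real.mul_rpow (by norm_num) (by positivity)]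
  refine Real.rpow_le_rpow (tfWeight_pos v).le ?_ hγ
  have h1 : bracket (WithLp.toLp 2 (v.2, -v.1) : Phase d) ^ (2 : ℝ) =
      1 + (‖v.2‖ ^ 2 + ‖v.1‖ ^ 2) := by
    rw [Real.rpow_two, bracket, Real.sq_sqrt (by positivity), WithLp.prod_norm_sq_eq_of_L2]
    change 1 + (‖v.2‖ ^ 2 + ‖-v.1‖ ^ 2) = _
    rw [norm_neg]
  rw [h1, tfWeight]
  nlinarith [sq_nonneg (‖v.1‖ - 1), sq_nonneg (‖v.2‖ - 1), sq_nonneg (‖v.1‖ - ‖v.2‖)]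

/-- The matrix entry is a value of the transform of the symbol whose frequency is a symplectic image
of `p.2 - p.1`; only its position, the midpoint, depends on more. A bound uniform in the position is
thus a convolution bound, and the symplectic map preserves the integrals. -/
theorem NarrowlyContinuousOn.exists_kernel_bound {γ : ℝ} (hγ : 0 ≤ γ)
    {σ : ℝ → 𝓢'(Phase d, SpinorOp n)} {Ω : Set ℝ} (hσ : NarrowlyContinuousOn (2 * γ) σ Ω) :
    ∃ H : Pos d × Pos d → ℝ≥0∞, Measurable H ∧ ∫⁻ v, H v * weightE γ v < ∞ ∧
      ∀ t ∈ Ω, ∀ p, ‖σ t (wignerAtom p)‖ₑ ≤ H (p.2 - p.1) := by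
  obtain ⟨H, hH, hfin, hb⟩ := hσ.exists_dominated (by positivity) (phaseWindow d)
  have hJ := measurePreserving_sympl (d := d)
  have hwm := measurable_wt (V := Phase d) (2 * γ)
  refine ⟨fun v => ‖wignerConst d‖ₑ * H (WithLp.toLp 2 (v.2, -v.1)),
    (hH.comp hJ.measurable).const_mul _, ?_, fun t ht p => ?_⟩
  · have h1 : ∫⁻ v : Pos d × Pos d, H (WithLp.toLp 2 (v.2, -v.1)) *
        wt (2 * γ) (WithLp.toLp 2 (v.2, -v.1) : Phase d) = ∫⁻ ζ, H ζ * wt (2 * γ) ζ :=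
      hJ.lintegral_comp (hH.mul hwm)
    calc _ ≤ ∫⁻ v : Pos d × Pos d, (‖wignerConst d‖ₑ * ENNReal.ofReal (2 ^ γ)) *
          (H (WithLp.toLp 2 (v.2, -v.1)) * wt (2 * γ) (WithLp.toLp 2 (v.2, -v.1) : Phase d)) := by
          refine lintegral_mono fun v => ?_
          refine (mul_le_mul_right (weightE_le_wt hγ v) _).trans (le_of_eq ?_)
          ring
      _ = (‖wignerConst d‖ₑ * ENNReal.ofReal (2 ^ γ)) * ∫⁻ ζ, H ζ * wt (2 * γ) ζ := by
          rw [lintegral_const_mul' _ _ (ENNReal.mul_ne_top enorm_ne_top ENNReal.ofReal_ne_top), h1]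
      _ < ∞ := ENNReal.mul_lt_top (ENNReal.mul_lt_top enorm_lt_top ENNReal.ofReal_lt_top) hfin
  · have h1 := hb t ht (midPoint p.1 p.2) (symplDiff p.1 p.2)
    have h2 : ‖character ((1 / 2 : ℝ) • (p.1.2 + p.2.2)) (p.2.1 - p.1.1)‖ₑ = 1 := by
      rw [← ofReal_norm, norm_character, ENNReal.ofReal_one]
    have h3 : symplDiff p.1 p.2 = WithLp.toLp 2 ((p.2 - p.1).2, -(p.2 - p.1).1) := by
      simp [symplDiff]
    rw [wignerAtom, map_smul, enorm_smul, enorm_mul, h2, mul_one]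
    rw [h3] at h1
    exact mul_le_mul_right (by rw [h3]; exact h1) _

end PhaseBound

end

/-! ### Strongly continuous families of bounded operators -/

section

section StrongContinuity

/-- A uniformly bounded family of operators that is strongly continuous on a dense set is strongly
continuous. -/
theorem continuousOn_apply_of_denseRange {E G ι X : Type*} [NormedAddCommGroup E] [NormedSpace ℂ E]
    [NormedAddCommGroup G] [NormedSpace ℂ G] [TopologicalSpace X] {W : X → E →L[ℂ] G} {Ω : Set X}
    {C : ℝ} (hC : ∀ t ∈ Ω, ‖W t‖ ≤ C) {e : ι → E} (he : DenseRange e)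
    (h : ∀ i, ContinuousOn (fun t => W t (e i)) Ω) (x : E) : ContinuousOn (fun t => W t x) Ω := by
  have hx : x ∈ closure (range e) := he x
  obtain ⟨y, hy, hlim⟩ := mem_closure_iff_seq_limit.1 hx
  choose i hi using hy
  have hu : TendstoUniformlyOn (fun k t => W t (y k)) (fun t => W t x) atTop Ω := by
    rw [Metric.tendstoUniformlyOn_iff]
    intro ε hε
    have h1 : Tendsto (fun k => |C| * ‖x - y k‖) atTop (𝓝 0) := by
      have := ((tendsto_const_nhds (x := x)).sub hlim).norm.const_mul |C|
      simpa using this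
    filter_upwards [h1.eventually (gt_mem_nhds hε)] with k hk t ht
    rw [dist_eq_norm, ← map_sub]
    refine lt_of_le_of_lt ((W t).le_opNorm _) (lt_of_le_of_lt ?_ hk)
    gcongr
    exact (hC t ht).trans (le_abs_self C)
  refine hu.continuousOn (Frequently.of_forall fun k => ?_)
  simp only [← hi]
  exact h _

end StrongContinuity

section Operators

variable {V : Type*} [NormedAddCommGroup V] [InnerProductSpace ℝ V] [FiniteDimensional ℝ V]
  [MeasurableSpace V] [BorelSpace V]
  {F : Type*} [NormedAddCommGroup F] [NormedSpace ℂ F] [CompleteSpace F]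

theorem lintegral_stftE_coe_lt_top (γ : ℝ) (g : 𝓢(V, ℂ)) (b : 𝓢(V, F)) :
    ∫⁻ z, stftE g (b : 𝓢'(V, F)) z * weightE γ z < ∞ := by
  obtain ⟨K, hK⟩ := exists_lintegral_decayE_lt_top V γ
  obtain ⟨L, C, hC, h⟩ := exists_norm_stft_le (F := F) g K
  have hs : 0 ≤ schwartzNorm V F L b := apply_nonneg _ _
  calc ∫⁻ z, stftE g (b : 𝓢'(V, F)) z * weightE γ z
      ≤ ∫⁻ z, ENNReal.ofReal (C * schwartzNorm V F L b) * (decayE K z * weightE γ z) := by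
        refine lintegral_mono fun z => ?_
        rw [← mul_assoc]
        refine mul_le_mul_left ?_ _
        rw [decayE, ← ENNReal.ofReal_mul (by positivity), stftE, ← ofReal_norm]
        exact ENNReal.ofReal_le_ofReal (h b z)
    _ = ENNReal.ofReal (C * schwartzNorm V F L b) * ∫⁻ z : V × V, decayE K z * weightE γ z :=
        lintegral_const_mul' _ _ ENNReal.ofReal_ne_top
    _ < ∞ := ENNReal.mul_lt_top ENNReal.ofReal_lt_top hK

variable {γ : ℝ} {N : 𝓢'(V, F) → ℝ≥0∞} [hN : AdmissibleNorm N]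

/-- A weakly continuous family of operators from `𝓢` to `𝓢'` whose action on phase space is
dominated by a convolution extends to a strongly continuous family of bounded operators. -/
theorem TFBounds.exists_operators (hγ : 0 ≤ γ) (hB : TFBounds γ N) {g : 𝓢(V, ℂ)} (hg : g ≠ 0)
    {A : ℝ → 𝓢(V, F) →ₗ[ℂ] 𝓢'(V, F)} {Ω : Set ℝ} {H : V × V → ℝ≥0∞} (hH : Measurable H)
    (hfin : ∫⁻ z, H z * weightE γ z < ∞)
    (hle : ∀ t ∈ Ω, ∀ (f : 𝓢(V, F)) z, stftE g (A t f) z ≤ (H ⋆ₗ stftE g (f : 𝓢'(V, F))) z)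
    (hcont : ∀ (f : 𝓢(V, F)) φ, ContinuousOn (fun t => A t f φ) Ω) :
    ∃ W : ℝ → ClosureSpace N →L[ℂ] ClosureSpace N, (∃ C, ∀ t ∈ Ω, ‖W t‖ ≤ C) ∧
      (∀ t ∈ Ω, ∀ f, incl N (W t (ofSchwartz N f)) = A t f) ∧
      ∀ x, ContinuousOn (fun t => W t x) Ω := by
  have hSm : ∀ u : 𝓢'(V, F), Measurable (stftE g u) := measurable_stftE g
  have hint : ∀ f : 𝓢(V, F),
      ∫⁻ z, (H ⋆ₗ stftE g (f : 𝓢'(V, F))) z * weightE γ z < ∞ := fun f =>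
    (lintegral_conv_weightE_le hγ hH (hSm _)).trans_lt
      (ENNReal.mul_lt_top hfin (lintegral_stftE_coe_lt_top γ g f))
  have hmem : ∀ t ∈ Ω, ∀ f, A t f ∈ schwartzClosure N := fun t ht f =>
    hB.mem_schwartzClosure hγ hg (lt_of_le_of_lt (lintegral_mono fun z =>
      mul_le_mul_left (hle t ht f z) _) (hint f))
  obtain ⟨C₁, hC₁, h₁⟩ := hB.conv g hg
  set C := (C₁ * ∫⁻ z, H z * weightE γ z).toReal
  have hCtop : C₁ * ∫⁻ z, H z * weightE γ z ≠ ∞ := ENNReal.mul_ne_top hC₁ hfin.ne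
  have key : ∀ t, ∃ W : ClosureSpace N →L[ℂ] ClosureSpace N, t ∈ Ω → ‖W‖ ≤ C ∧
      ∀ f, incl N (W (ofSchwartz N f)) = A t f := by
    intro t
    by_cases ht : t ∈ Ω
    · let B : 𝓢(V, F) →ₗ[ℂ] ClosureSpace N :=
        { toFun := fun f => toClosure (A t f) (hmem t ht f)
          map_add' := fun f h => incl_injective (by simp only [map_add, incl_toClosure])
          map_smul' := fun c f => incl_injective (by
            simp only [map_smul, incl_toClosure, RingHom.id_apply]) }
      have hB' : ∀ f, ‖B f‖ ≤ C * ‖ofSchwartz N f‖ := by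
        intro f
        have h2 := h₁ H hH _ _ (hle t ht f)
        have h3 := ENNReal.toReal_mono (ENNReal.mul_ne_top hCtop
          (schwartzNorm_coe_lt_top (N := N) f).ne) h2
        rwa [ENNReal.toReal_mul] at h3
      refine ⟨B.extendOfNorm (ofSchwartz N), fun _ => ⟨?_, fun f => ?_⟩⟩
      · exact LinearMap.opNorm_extendOfNorm_le denseRange_ofSchwartz ENNReal.toReal_nonneg hB'
      · rw [LinearMap.extendOfNorm_eq denseRange_ofSchwartz ⟨C, hB'⟩]
        rfl
    · exact ⟨0, fun h => absurd h ht⟩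
  choose W hW using key
  refine ⟨W, ⟨C, fun t ht => (hW t ht).1⟩, fun t ht => (hW t ht).2, fun x => ?_⟩
  -- The uniform bound reduces strong continuity to Schwartz functions. There the weighted `L^1`
  -- norm of the transform of `A t f - A t₀ f` tends to zero by dominated convergence: weak
  -- continuity gives the pointwise limit, and twice the weighted convolution is a majorant.
  refine continuousOn_apply_of_denseRange (fun t ht => (hW t ht).1)
    (denseRange_ofSchwartz (N := N)) (fun f => ?_) x
  intro t₀ ht₀
  rw [ContinuousWithinAt, tendsto_iff_norm_sub_tendsto_zero]
  obtain ⟨C₂, hC₂, h₂⟩ := hB.l1 g hg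
  have hlim : Tendsto (fun t => C₂ * ∫⁻ z, stftE g (A t f - A t₀ f) z * weightE γ z) (𝓝[Ω] t₀)
      (𝓝 0) := by
    rw [← mul_zero C₂]
    refine ENNReal.Tendsto.const_mul ?_ (Or.inr hC₂)
    rw [← lintegral_zero (α := V × V) (μ := volume)]
    refine tendsto_lintegral_filter_of_dominated_convergence
      (fun z => 2 * ((H ⋆ₗ stftE g (f : 𝓢'(V, F))) z * weightE γ z))
      (Eventually.of_forall fun t => (hSm _).mul (measurable_weightE γ)) ?_ ?_ ?_
    · filter_upwards [self_mem_nhdsWithin] with t ht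
      refine ae_of_all _ fun z => ?_
      rw [← mul_assoc]
      refine mul_le_mul_left ?_ _
      rw [two_mul]
      refine (enorm_sub_le (E := F)).trans (add_le_add (hle t ht f z) (hle t₀ ht₀ f z))
    · rw [lintegral_const_mul' _ _ (by simp)]
      exact ENNReal.mul_ne_top (by simp) (hint f).ne
    · refine ae_of_all _ fun z => ?_
      have h3 : Tendsto (fun t => stftE g (A t f - A t₀ f) z) (𝓝[Ω] t₀) (𝓝 0) := by
        have h4 := (hcont f (conjAtom g z.1 z.2) t₀ ht₀).sub_const (A t₀ f (conjAtom g z.1 z.2))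
        have h5 := h4.enorm
        rw [sub_self, enorm_zero] at h5
        exact h5
      have h6 := ENNReal.Tendsto.mul_const (b := weightE γ z) h3 (Or.inr ENNReal.ofReal_ne_top)
      simpa using h6
  have hlim' := (ENNReal.tendsto_toReal ENNReal.zero_ne_top).comp hlim
  rw [ENNReal.toReal_zero] at hlim'
  have hev : ∀ᶠ t in 𝓝[Ω] t₀, C₂ * ∫⁻ z, stftE g (A t f - A t₀ f) z * weightE γ z < ∞ :=
    hlim.eventually (gt_mem_nhds ENNReal.zero_lt_top)
  refine squeeze_zero' (Eventually.of_forall fun t => norm_nonneg _) ?_ hlim'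
  filter_upwards [hev, self_mem_nhdsWithin] with t h3 ht
  rw [ClosureSpace.norm_def]
  refine ENNReal.toReal_mono h3.ne ?_
  have e : (W t (ofSchwartz N f) - W t₀ (ofSchwartz N f)).1 = A t f - A t₀ f := by
    rw [← incl_apply, map_sub, (hW t ht).2, (hW t₀ ht₀).2]
  rw [e]
  exact h₂ _

end Operators

section Weyl

variable {d n : ℕ} {γ : ℝ} {N : 𝓢'(Pos d, Spinor n) → ℝ≥0∞} [hN : AdmissibleNorm N]

/-- The kernel bound is uniform in time, and `t ↦ σ(t)^w f` is weakly continuous because the Wigner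
distributions in its definition are fixed test functions for the symbol. -/
theorem TFBounds.exists_weyl_operators (hγ : 0 ≤ γ) (hB : TFBounds γ N)
    {σ : ℝ → 𝓢'(Phase d, SpinorOp n)} {Ω : Set ℝ} (hσ : NarrowlyContinuousOn (2 * γ) σ Ω) :
    ∃ W : ℝ → ClosureSpace N →L[ℂ] ClosureSpace N, (∃ C, ∀ t ∈ Ω, ‖W t‖ ≤ C) ∧
      (∀ t ∈ Ω, ∀ f, incl N (W t (ofSchwartz N f)) = weylDist (σ t) f) ∧
      ∀ x, ContinuousOn (fun t => W t x) Ω := by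
  obtain ⟨H, hH, hfin, hb⟩ := hσ.exists_kernel_bound hγ
  obtain ⟨K, hK⟩ := exists_lintegral_decayE_lt_top (Pos d) γ
  obtain ⟨C, hC, h⟩ := exists_stftE_weylDist_le (d := d) (n := n) K
  have hdm := measurable_decayE (V := Pos d) K
  refine hB.exists_operators hγ (stdWindow_ne_zero (d := d))
    (A := fun t => { toFun := weylDist (σ t)
                     map_add' := weylDist_add (σ t)
                     map_smul' := fun c f => weylDist_smul (σ t) f c })
    (H := fun z => C * (decayE K ⋆ₗ H) z) (by fun_prop) ?_
    (fun t ht f z => h (σ t) H hH (hb t ht) f z) fun f φ => ?_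
  · calc ∫⁻ z, C * (decayE K ⋆ₗ H) z * weightE γ z
        = C * ∫⁻ z, (decayE K ⋆ₗ H) z * weightE γ z := by
          rw [← lintegral_const_mul' _ _ hC]
          simp only [mul_assoc]
      _ < ∞ := ENNReal.mul_lt_top hC.lt_top
          ((lintegral_conv_weightE_le hγ hdm hH).trans_lt (ENNReal.mul_lt_top hK hfin))
  · change ContinuousOn (fun t => weylDist (σ t) f φ) Ω
    simp only [weylDist_apply]
    refine continuousOn_finsetSum _ fun j _ => ?_
    have h1 : ContinuousOn (fun t => σ t (wignerS (component j f) φ)) Ω := fun t ht =>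
      PointwiseConvergenceCLM.tendsto_iff_forall_tendsto.1 (hσ.continuousOn t ht) _
    exact h1.clm_apply continuousOn_const

end Weyl

end

/-! ### Derivatives of operator exponentials -/

section

section ExpBounds

variable {E 𝒜 : Type*} [NormedAddCommGroup E] [NormedSpace ℝ E] [NormedRing 𝒜]
  [NormedAlgebra ℝ 𝒜]

/-- For bounds of the geometric form `a ^ l`, Leibniz's rule is the binomial theorem. The bases add
under products, so a high power of one function obeys a bound of the same form with no further
constants. -/
theorem norm_iteratedFDeriv_mul_le_pow {f g : E → 𝒜} (hf : ContDiff ℝ (⊤ : ℕ∞) f) (hg : ContDiff ℝ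
    (⊤ : ℕ∞) g)
    {ξ : E} {a b : ℝ} {L : ℕ} (ha : ∀ l ≤ L, ‖iteratedFDeriv ℝ l f ξ‖ ≤ a ^ l)
    (hb : ∀ l ≤ L, ‖iteratedFDeriv ℝ l g ξ‖ ≤ b ^ l) {l : ℕ} (hl : l ≤ L) :
    ‖iteratedFDeriv ℝ l (fun ξ => f ξ * g ξ) ξ‖ ≤ (a + b) ^ l := by
  refine (norm_iteratedFDeriv_mul_le hf hg ξ (n := l) (by exact_mod_cast le_top)).trans ?_
  rw [add_pow]
  refine Finset.sum_le_sum fun i hi => ?_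
  rw [mul_comm _ (l.choose i : ℝ), mul_assoc]
  have hi' : i ≤ l := Nat.lt_succ_iff.1 (Finset.mem_range.1 hi)
  gcongr
  · exact (norm_nonneg _).trans (ha i (hi'.trans hl))
  · exact ha i (hi'.trans hl)
  · exact hb _ ((Nat.sub_le _ _).trans hl)

theorem norm_iteratedFDeriv_pow_le_pow {f : E → 𝒜} (hf : ContDiff ℝ (⊤ : ℕ∞) f)
    {ξ : E} {a : ℝ} {L : ℕ} (ha : ∀ l ≤ L, ‖iteratedFDeriv ℝ l f ξ‖ ≤ a ^ l) (k : ℕ) :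
    ∀ l ≤ L, ‖iteratedFDeriv ℝ l (fun ξ => f ξ ^ (k + 1)) ξ‖ ≤ ((k + 1 : ℕ) * a) ^ l := by
  induction k with
  | zero => simpa using ha
  | succ k ih =>
    intro l hl
    have := norm_iteratedFDeriv_mul_le_pow (hf.pow (k + 1)) hf ih ha hl
    simp only [pow_succ _ (k + 1)]
    convert this using 2
    push_cast
    ring

variable [CompleteSpace 𝒜]

theorem contDiff_normedSpace_exp : ContDiff ℝ (⊤ : ℕ∞) (NormedSpace.exp : 𝒜 → 𝒜) :=
  contDiff_iff_contDiffAt.2 fun x => (NormedSpace.exp_analytic (𝕂 := ℝ) x).contDiffAt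

theorem contDiff_exp_affine (S : 𝒜) (Λ : E →L[ℝ] 𝒜) (t : ℝ) :
    ContDiff ℝ (⊤ : ℕ∞) fun ξ => NormedSpace.exp (t • (S + Λ ξ)) :=
  contDiff_normedSpace_exp.comp ((contDiff_const.add Λ.contDiff).const_smul t)

theorem norm_iteratedFDeriv_exp_affine_le (S : 𝒜) (Λ : E →L[ℝ] 𝒜) (t : ℝ) (ξ : E) (l : ℕ) :
    ‖iteratedFDeriv ℝ l (fun ξ => NormedSpace.exp (t • (S + Λ ξ))) ξ‖ ≤
      ‖iteratedFDeriv ℝ l (NormedSpace.exp : 𝒜 → 𝒜) (t • (S + Λ ξ))‖ * (|t| * ‖Λ‖) ^ l := by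
  have e : (fun ξ => NormedSpace.exp (t • (S + Λ ξ))) =
      (fun v => NormedSpace.exp (t • S + v)) ∘ (t • Λ) := by
    funext ξ
    simp [smul_add]
  have hc : ContDiff ℝ (⊤ : ℕ∞) fun v : 𝒜 => NormedSpace.exp (t • S + v) :=
    contDiff_normedSpace_exp.comp (contDiff_const.add contDiff_id)
  rw [e, ContinuousLinearMap.iteratedFDeriv_comp_right _ hc _ (by exact_mod_cast le_top)]
  refine (ContinuousMultilinearMap.norm_compContinuousLinearMap_le _ _).trans ?_
  rw [Finset.prod_const, Finset.card_fin, norm_smul, Real.norm_eq_abs,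
    iteratedFDeriv_comp_add_left, smul_add]
  rfl

/-- If all the exponentials `exp (t (S + Λ ξ))` are contractions, then their derivatives are bounded
uniformly with respect to `ξ`. -/
theorem exists_norm_iteratedFDeriv_exp_le (S : 𝒜) (Λ : E →L[ℝ] 𝒜)
    (h1 : ∀ (t : ℝ) ξ, ‖NormedSpace.exp (t • (S + Λ ξ))‖ ≤ 1) (L : ℕ) :
    ∃ C : ℝ, 0 ≤ C ∧ ∀ l ≤ L, ∀ (t : ℝ) ξ,
      ‖iteratedFDeriv ℝ l (fun ξ => NormedSpace.exp (t • (S + Λ ξ))) ξ‖ ≤ (C * |t|) ^ l := by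
  set B : ℝ := 1 + ∑ l ∈ Finset.range (L + 1),
    ‖iteratedFDeriv ℝ l (NormedSpace.exp : 𝒜 → 𝒜) 0‖
  have hB : 1 ≤ B := le_add_of_nonneg_right (Finset.sum_nonneg fun _ _ => norm_nonneg _)
  have hBl : ∀ l ≤ L, ‖iteratedFDeriv ℝ l (NormedSpace.exp : 𝒜 → 𝒜) 0‖ + 1 ≤ B := by
    intro l hl
    rw [add_comm]
    exact add_le_add_right (Finset.single_le_sum
      (f := fun l => ‖iteratedFDeriv ℝ l (NormedSpace.exp : 𝒜 → 𝒜) 0‖)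
      (fun _ _ => norm_nonneg _) (Finset.mem_range.2 (Nat.lt_succ_of_le hl))) _
  refine ⟨B * ‖Λ‖, by positivity, fun l hl t ξ => ?_⟩
  -- The exponential at `t` is the power `k + 1` of the one at `δ = t / (k + 1)`, where `k` depends
  -- on `ξ` and is so large that `δ • (S + Λ ξ)` lies where the derivatives of `exp` are below `B`.
  -- Each factor obeys `(B ‖Λ‖ |δ|)^l`, and the power turns `δ` back into `t`, so the final bound
  -- does not depend on `k`.
  have hev : ∀ᶠ δ : ℝ in 𝓝 0, ∀ l ∈ Finset.range (L + 1),
      ‖iteratedFDeriv ℝ l (NormedSpace.exp : 𝒜 → 𝒜) (δ • (S + Λ ξ))‖ < B := by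
    rw [Finset.eventually_all]
    intro l hl
    have hc : Continuous fun δ : ℝ =>
        ‖iteratedFDeriv ℝ l (NormedSpace.exp : 𝒜 → 𝒜) (δ • (S + Λ ξ))‖ :=
      (((contDiff_normedSpace_exp (𝒜 := 𝒜)).continuous_iteratedFDeriv
        (m := l) (by exact_mod_cast le_top)).comp (continuous_id.smul continuous_const)).norm
    refine (hc.tendsto 0).eventually (gt_mem_nhds ?_)
    rw [zero_smul]
    linarith [hBl l (Nat.lt_succ_iff.1 (Finset.mem_range.1 hl))]
  have hlim : Tendsto (fun k : ℕ => t / ((k : ℝ) + 1)) atTop (𝓝 0) :=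
    tendsto_const_div_atTop_nhds_zero_nat t |>.comp (tendsto_add_atTop_nat 1) |>.congr
      fun k => by simp
  obtain ⟨k, hk⟩ := (hlim.eventually hev).exists
  set δ : ℝ := t / ((k : ℝ) + 1)
  have hk0 : (0 : ℝ) < k + 1 := by positivity
  have hδ : ∀ l ≤ L, ‖iteratedFDeriv ℝ l (fun ξ => NormedSpace.exp (δ • (S + Λ ξ))) ξ‖ ≤
      (B * ‖Λ‖ * |δ|) ^ l := by
    intro l hl
    rcases Nat.eq_zero_or_pos l with rfl | hl0
    -- Here contractivity is essential: a constant larger than one in order zero would be raised to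
    -- the power `k + 1`.
    · simpa using h1 δ ξ
    · refine (norm_iteratedFDeriv_exp_affine_le S Λ δ ξ l).trans ?_
      rw [show B * ‖Λ‖ * |δ| = B * (|δ| * ‖Λ‖) by ring, mul_pow B]
      gcongr
      exact (hk l (Finset.mem_range.2 (Nat.lt_succ_of_le hl))).le.trans
        (le_self_pow₀ hB hl0.ne')
  have h := norm_iteratedFDeriv_pow_le_pow (contDiff_exp_affine S Λ δ) hδ k l hl
  have e : (fun ξ => NormedSpace.exp (t • (S + Λ ξ))) =
      fun ξ => NormedSpace.exp (δ • (S + Λ ξ)) ^ (k + 1) := by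
    funext ξ
    let _ : NormedAlgebra ℚ 𝒜 := .restrictScalars ℚ ℝ 𝒜
    rw [← NormedSpace.exp_nsmul, ← Nat.cast_smul_eq_nsmul ℝ, smul_smul]
    congr 2
    simp only [δ]
    push_cast
    field_simp
  rw [e]
  refine h.trans_eq ?_
  congr 1
  simp only [δ, abs_div, abs_of_pos hk0]
  push_cast
  field_simp

theorem exists_norm_iteratedFDeriv_exp_sub_one_le (S : 𝒜) (Λ : E →L[ℝ] 𝒜)
    (h1 : ∀ (t : ℝ) ξ, ‖NormedSpace.exp (t • (S + Λ ξ))‖ ≤ 1) (L : ℕ) (R : ℝ) :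
    ∃ C : ℝ, 0 ≤ C ∧ ∀ l ≤ L, ∀ (t : ℝ) ξ, |t| ≤ R →
      ‖iteratedFDeriv ℝ l (fun ξ => NormedSpace.exp (t • (S + Λ ξ)) - 1) ξ‖ ≤
        C * |t| * (1 + ‖ξ‖) := by
  obtain ⟨C, hC, h⟩ := exists_norm_iteratedFDeriv_exp_le S Λ h1 L
  refine ⟨‖S‖ + ‖Λ‖ + C * (1 + C * |R|) ^ L, by positivity, fun l hl t ξ ht => ?_⟩
  rcases Nat.eq_zero_or_pos l with rfl | hl0
  -- In order zero the mean value inequality in time is used, whose constant `‖S + Λ ξ‖` is the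
  -- origin of the factor `1 + ‖ξ‖`. In positive order a single factor `C * |t|` is split off the
  -- geometric bound.
  · rw [norm_iteratedFDeriv_zero]
    have hd : ∀ u : ℝ, HasDerivAt (fun u : ℝ => NormedSpace.exp (u • (S + Λ ξ)))
        (NormedSpace.exp (u • (S + Λ ξ)) * (S + Λ ξ)) u := fun u =>
      hasDerivAt_exp_smul_const (S + Λ ξ) u
    have hb := Convex.norm_image_sub_le_of_norm_hasDerivWithin_le (s := univ) (x := 0) (y := t)
      (C := ‖S + Λ ξ‖) (fun u _ => (hd u).hasDerivWithinAt) (fun u _ => (norm_mul_le _ _).trans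
        (mul_le_of_le_one_left (norm_nonneg _) (h1 u ξ))) convex_univ (mem_univ _) (mem_univ _)
    rw [zero_smul, NormedSpace.exp_zero, sub_zero, Real.norm_eq_abs] at hb
    refine hb.trans ?_
    have h2 : ‖S + Λ ξ‖ ≤ (‖S‖ + ‖Λ‖) * (1 + ‖ξ‖) := by
      have := (norm_add_le S (Λ ξ)).trans (add_le_add_right (Λ.le_opNorm ξ) _)
      nlinarith [norm_nonneg S, norm_nonneg Λ, norm_nonneg ξ, mul_nonneg (norm_nonneg S)
          (norm_nonneg ξ)]
    calc ‖S + Λ ξ‖ * |t| ≤ (‖S‖ + ‖Λ‖) * (1 + ‖ξ‖) * |t| := by gcongr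
      _ = (‖S‖ + ‖Λ‖) * |t| * (1 + ‖ξ‖) := by ring
      _ ≤ _ := by
        refine mul_le_mul_of_nonneg_right (mul_le_mul_of_nonneg_right ?_ (abs_nonneg t))
          (by positivity)
        exact le_add_of_nonneg_right (by positivity)
  · have e : iteratedFDeriv ℝ l (fun ξ => NormedSpace.exp (t • (S + Λ ξ)) - 1) ξ =
        iteratedFDeriv ℝ l (fun ξ => NormedSpace.exp (t • (S + Λ ξ))) ξ := by
      have := iteratedFDeriv_sub_apply (𝕜 := ℝ) (i := l) (x := ξ)
        (f := fun ξ => NormedSpace.exp (t • (S + Λ ξ))) (g := fun _ => (1 : 𝒜))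
        ((contDiff_exp_affine S Λ t).contDiffAt.of_le (by exact_mod_cast le_top))
        contDiff_const.contDiffAt
      rw [iteratedFDeriv_const_of_ne hl0.ne', Pi.zero_apply, sub_zero] at this
      exact this
    rw [e]
    refine (h l hl t ξ).trans ?_
    obtain ⟨k, rfl⟩ := Nat.exists_eq_succ_of_ne_zero hl0.ne'
    have h3 : (C * |t|) ^ k ≤ (1 + C * |R|) ^ L := by
      calc (C * |t|) ^ k ≤ (1 + C * |R|) ^ k := by
            gcongr
            have := mul_le_mul_of_nonneg_left (ht.trans (le_abs_self R)) hC
            linarith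
        _ ≤ _ := pow_le_pow_right₀ (le_add_of_nonneg_right (by positivity)) (by omega)
    calc (C * |t|) ^ (k + 1) = (C * |t|) ^ k * (C * |t|) := pow_succ _ _
      _ ≤ (1 + C * |R|) ^ L * (C * |t|) := by gcongr
      _ = C * (1 + C * |R|) ^ L * |t| * 1 := by ring
      _ ≤ _ := by
        gcongr
        · exact le_add_of_nonneg_left (by positivity)
        · exact le_add_of_nonneg_right (norm_nonneg _)

theorem exists_norm_iteratedFDeriv_exp_sub_le (S : 𝒜) (Λ : E →L[ℝ] 𝒜)
    (h1 : ∀ (t : ℝ) ξ, ‖NormedSpace.exp (t • (S + Λ ξ))‖ ≤ 1) (L : ℕ) (R : ℝ) :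
    ∃ C : ℝ, 0 ≤ C ∧ ∀ l ≤ L, ∀ (t s : ℝ) ξ, |t| ≤ R → |s| ≤ R →
      ‖iteratedFDeriv ℝ l
        (fun ξ => NormedSpace.exp (t • (S + Λ ξ)) - NormedSpace.exp (s • (S + Λ ξ))) ξ‖ ≤
        C * |t - s| * (1 + ‖ξ‖) := by
  obtain ⟨C, hC, h⟩ := exists_norm_iteratedFDeriv_exp_le S Λ h1 L
  obtain ⟨C', hC', h'⟩ := exists_norm_iteratedFDeriv_exp_sub_one_le S Λ h1 L (2 * R)
  refine ⟨2 ^ L * (1 + C * |R|) ^ L * C', by positivity, fun l hl t s ξ ht hs => ?_⟩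
  -- The group law reduces the difference of two exponentials to a difference from the identity at
  -- time `t - s`, which lies in `[-2R, 2R]`, multiplied by a factor with bounded derivatives.
  have e : (fun ξ => NormedSpace.exp (t • (S + Λ ξ)) - NormedSpace.exp (s • (S + Λ ξ))) =
      fun ξ => NormedSpace.exp (s • (S + Λ ξ)) * (NormedSpace.exp ((t - s) • (S + Λ ξ)) - 1) := by
    funext ξ
    let _ : NormedAlgebra ℚ 𝒜 := .restrictScalars ℚ ℝ 𝒜
    rw [mul_sub, mul_one, ← NormedSpace.exp_add_of_commute
      (((Commute.refl (S + Λ ξ)).smul_left s).smul_right (t - s)), ← add_smul, add_sub_cancel]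
  have hts : |t - s| ≤ 2 * R := (abs_sub t s).trans (by linarith)
  rw [e]
  refine (norm_iteratedFDeriv_mul_le (contDiff_exp_affine S Λ s)
    ((contDiff_exp_affine S Λ (t - s)).sub contDiff_const) ξ (n := l)
    (by exact_mod_cast le_top)).trans ?_
  calc _ ≤ ∑ i ∈ Finset.range (l + 1), (l.choose i : ℝ) *
        ((1 + C * |R|) ^ L * (C' * |t - s| * (1 + ‖ξ‖))) := by
        refine Finset.sum_le_sum fun i hi => ?_
        have hi' : i ≤ l := Nat.lt_succ_iff.1 (Finset.mem_range.1 hi)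
        rw [mul_assoc]
        gcongr
        · refine (h i (hi'.trans hl) s ξ).trans ?_
          calc (C * |s|) ^ i ≤ (1 + C * |R|) ^ i := by
                gcongr
                have := mul_le_mul_of_nonneg_left (hs.trans (le_abs_self R)) hC
                linarith
            _ ≤ _ := pow_le_pow_right₀ (le_add_of_nonneg_right (by positivity)) (by omega)
        · exact h' _ ((Nat.sub_le _ _).trans hl) _ ξ hts
    _ = 2 ^ l * ((1 + C * |R|) ^ L * (C' * |t - s| * (1 + ‖ξ‖))) := by
        rw [← Finset.sum_mul]
        congr 1
        exact_mod_cast Nat.sum_range_choose l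
    _ ≤ 2 ^ L * ((1 + C * |R|) ^ L * (C' * |t - s| * (1 + ‖ξ‖))) := by
        gcongr
        norm_num
    _ = _ := by ring

end ExpBounds

end

/-! ### The symbol of the free Dirac propagator -/

section

section FreeSymbol

variable {d n : ℕ} (m : ℝ) (α : Fin (d + 1) → Matrix (Fin n) (Fin n) ℂ)

/-- The matrix `-2πi (m α_0 + ∑_j ξ_j α_j)`, whose exponentials form the free symbol. -/
def freeGenerator (ξ : Pos d) : Matrix (Fin n) (Fin n) ℂ :=
  (-(2 * Real.pi * Complex.I) : ℂ) • ((m : ℂ) • α 0 + ∑ j : Fin d, (ξ j : ℂ) • α j.succ)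

/-- The part of order one of the generator, as an operator-valued linear map. -/
def freeGeneratorLin : Pos d →L[ℝ] SpinorOp n :=
  ∑ j : Fin d, (EuclideanSpace.proj j : Pos d →L[ℝ] ℝ).smulRight
    (Matrix.toEuclideanCLM (𝕜 := ℂ) ((-(2 * Real.pi * Complex.I) : ℂ) • α j.succ))

/-- The part of order zero of the generator. -/
def freeGeneratorConst : SpinorOp n :=
  Matrix.toEuclideanCLM (𝕜 := ℂ) ((-(2 * Real.pi * Complex.I) : ℂ) • (m : ℂ) • α 0)

theorem freeGenerator_eq (ξ : Pos d) : Matrix.toEuclideanCLM (𝕜 := ℂ) (freeGenerator m α ξ) =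
    freeGeneratorConst m α + freeGeneratorLin α ξ := by
  simp only [freeGenerator, freeGeneratorConst, freeGeneratorLin, smul_add, map_add,
    Finset.smul_sum, map_sum, sum_apply, ContinuousLinearMap.smulRight_apply,
    map_smul]
  congr 1
  refine Finset.sum_congr rfl fun j _ => ?_
  rw [smul_comm]
  ext v i
  simp

/-- The matrix entries of an operator on `ℂ^n`. -/
def entry (k j : Fin n) : SpinorOp n →L[ℝ] ℂ :=
  (((EuclideanSpace.proj k : Spinor n →L[ℂ] ℂ).comp
    (ContinuousLinearMap.apply ℂ (Spinor n) (EuclideanSpace.single j (1 : ℂ))))).restrictScalars ℝ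

theorem entry_toEuclideanCLM (A : Matrix (Fin n) (Fin n) ℂ) (k j : Fin n) :
    entry k j (Matrix.toEuclideanCLM (𝕜 := ℂ) A) = A k j := by
  simp [entry]

theorem norm_entry_le (k j : Fin n) : ‖(entry k j : SpinorOp n →L[ℝ] ℂ)‖ ≤ 1 := by
  refine ContinuousLinearMap.opNorm_le_bound _ zero_le_one fun A => ?_
  rw [one_mul]
  refine (PiLp.norm_apply_le (A (EuclideanSpace.single j (1 : ℂ))) k).trans ?_
  simpa using A.le_opNorm (EuclideanSpace.single j (1 : ℂ))

theorem real_smul_spinorOp (t : ℝ) (A : SpinorOp n) : t • A = (t : ℂ) • A := by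
  ext v i
  simp

theorem norm_iteratedFDeriv_entry_comp_le (k j : Fin n) {f : Pos d → SpinorOp n}
    (hf : ContDiff ℝ (⊤ : ℕ∞) f) (l : ℕ) (ξ : Pos d) :
    ‖iteratedFDeriv ℝ l (fun ξ => entry k j (f ξ)) ξ‖ ≤ ‖iteratedFDeriv ℝ l f ξ‖ := by
  have h := ContinuousLinearMap.norm_iteratedFDeriv_comp_left (entry k j) (n := l) (x := ξ)
    hf.contDiffAt (by exact_mod_cast le_top)
  exact h.trans (mul_le_of_le_one_left (norm_nonneg _) (norm_entry_le k j))

/-- The identification of matrices with operators is continuous in finite dimension and hence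
carries the exponential series. On the operator side the norm is a C*-norm, in which unitaries are
contractions. -/
theorem toEuclideanCLM_freeSymbol (t : ℝ) (ξ : Pos d) :
    Matrix.toEuclideanCLM (𝕜 := ℂ) (freeSymbol m α t ξ) =
      NormedSpace.exp (t • (freeGeneratorConst m α + freeGeneratorLin α ξ)) := by
  have hc : Continuous (Matrix.toEuclideanCLM (𝕜 := ℂ) (n := Fin n)).symm :=
    LinearMap.continuous_of_finiteDimensional
      ((Matrix.toEuclideanCLM (𝕜 := ℂ) (n := Fin n)).symm.toAlgEquiv.toLinearMap :
        SpinorOp n →ₗ[ℂ] Matrix (Fin n) (Fin n) ℂ)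
  have h : ∀ A : SpinorOp n, (Matrix.toEuclideanCLM (𝕜 := ℂ) (n := Fin n)).symm
      (NormedSpace.exp A) =
      NormedSpace.exp ((Matrix.toEuclideanCLM (𝕜 := ℂ) (n := Fin n)).symm A) := by
    intro A
    rw [NormedSpace.exp_eq_tsum ℂ, NormedSpace.exp_eq_tsum ℂ]
    refine ((NormedSpace.expSeries_summable' (𝕂 := ℂ) A).map_tsum _ hc).trans ?_
    simp only [map_smul, map_pow]
  replace h := h (t • (freeGeneratorConst m α + freeGeneratorLin α ξ))
  rw [← freeGenerator_eq, real_smul_spinorOp, map_smul, StarAlgEquiv.symm_apply_apply,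
    freeGenerator, smul_smul] at h
  rw [← freeGenerator_eq, real_smul_spinorOp, freeSymbol, freeGenerator,
    show (-(2 * Real.pi * Complex.I * t) : ℂ) = t * -(2 * Real.pi * Complex.I) by ring, ← h,
    StarAlgEquiv.apply_symm_apply]

theorem freeSymbol_entry (t : ℝ) (ξ : Pos d) (k j : Fin n) : freeSymbol m α t ξ k j =
    entry k j (NormedSpace.exp (t • (freeGeneratorConst m α + freeGeneratorLin α ξ))) := by
  rw [← toEuclideanCLM_freeSymbol, entry_toEuclideanCLM]

theorem freeSymbol_zero (ξ : Pos d) : freeSymbol m α 0 ξ = 1 := by simp [freeSymbol]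

theorem freeSymbol_add (t s : ℝ) (ξ : Pos d) :
    freeSymbol m α (t + s) ξ = freeSymbol m α t ξ * freeSymbol m α s ξ := by
  rw [freeSymbol, freeSymbol, freeSymbol, ← Matrix.exp_add_of_commute _ _
    (((Commute.refl _).smul_left _).smul_right _), ← add_smul]
  congr 2
  push_cast
  ring

theorem hasDerivAt_freeSymbol (t : ℝ) (ξ : Pos d) (k j : Fin n) :
    HasDerivAt (fun t => freeSymbol m α t ξ k j)
      (∑ l, freeGenerator m α ξ k l * freeSymbol m α t ξ l j) t := by
  have h := ((entry k j).hasFDerivAt.comp_hasDerivAt t (hasDerivAt_exp_smul_const' (𝕂 := ℝ)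
    (freeGeneratorConst m α + freeGeneratorLin α ξ) t))
  rw [← toEuclideanCLM_freeSymbol, ← freeGenerator_eq, ← map_mul, entry_toEuclideanCLM,
    Matrix.mul_apply] at h
  refine h.congr_of_eventuallyEq (Eventually.of_forall fun t => ?_)
  rw [freeGenerator_eq]
  exact freeSymbol_entry m α t ξ k j

variable {α}

/-- The generator is `-2πi` times a Hermitian matrix, hence skew-adjoint, and its exponential is
unitary. This is the hypothesis of the uniform bounds for the derivatives of exponentials. -/
theorem norm_exp_freeGenerator_le (hα : IsDiracMatrices α) (t : ℝ) (ξ : Pos d) :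
    ‖NormedSpace.exp (t • (freeGeneratorConst m α + freeGeneratorLin α ξ))‖ ≤ 1 := by
  let _ : NormedAlgebra ℚ (SpinorOp n) := .restrictScalars ℚ ℝ (SpinorOp n)
  have hskew : t • (freeGeneratorConst m α + freeGeneratorLin α ξ) ∈ skewAdjoint (SpinorOp n) := by
    rw [skewAdjoint.mem_iff, ← freeGenerator_eq, real_smul_spinorOp, ← map_smul, ← map_star,
      ← map_neg]
    congr 1
    have h0 : ∀ i, star (α i) = α i := fun i => hα.hermitian i
    simp only [freeGenerator, star_smul, star_add, star_sum, h0, Complex.star_def,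
      Complex.conj_ofReal, map_neg, map_mul, Complex.conj_I, map_ofNat]
    rw [← smul_neg]
    congr 1
    rw [← neg_smul]
    congr 1
    ring
  have hu := NormedSpace.exp_mem_unitary_of_mem_skewAdjoint hskew
  have h1 := CStarRing.norm_star_mul_self
    (x := NormedSpace.exp (t • (freeGeneratorConst m α + freeGeneratorLin α ξ)))
  rw [(Unitary.mem_iff.1 hu).1] at h1
  -- Only an inequality, since `n = 0` is allowed.
  have h2 : ‖(1 : SpinorOp n)‖ ≤ 1 := ContinuousLinearMap.norm_id_le
  nlinarith [norm_nonneg (NormedSpace.exp (t • (freeGeneratorConst m α + freeGeneratorLin α ξ)))]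

theorem exists_norm_iteratedFDeriv_freeSymbol_le (hα : IsDiracMatrices α) (L : ℕ) (R : ℝ) :
    ∃ C : ℝ, 0 ≤ C ∧ ∀ l ≤ L, ∀ (t : ℝ) (ξ : Pos d) (k j : Fin n), |t| ≤ R →
      ‖iteratedFDeriv ℝ l (fun ξ => freeSymbol m α t ξ k j) ξ‖ ≤ C := by
  obtain ⟨C, hC, h⟩ := exists_norm_iteratedFDeriv_exp_le (freeGeneratorConst m α)
    (freeGeneratorLin α) (norm_exp_freeGenerator_le m hα) L
  refine ⟨(1 + C * |R|) ^ L, by positivity, fun l hl t ξ k j ht => ?_⟩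
  simp only [freeSymbol_entry m α]
  refine (norm_iteratedFDeriv_entry_comp_le k j
    (contDiff_exp_affine (freeGeneratorConst m α) (freeGeneratorLin α) t) l ξ).trans ?_
  refine (h l hl t ξ).trans ?_
  calc (C * |t|) ^ l ≤ (1 + C * |R|) ^ l := by
        gcongr
        have := mul_le_mul_of_nonneg_left (ht.trans (le_abs_self R)) hC
        linarith
    _ ≤ _ := pow_le_pow_right₀ (le_add_of_nonneg_right (by positivity)) hl

theorem exists_norm_iteratedFDeriv_freeSymbol_sub_le (hα : IsDiracMatrices α) (L : ℕ) (R : ℝ) :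
    ∃ C : ℝ, 0 ≤ C ∧ ∀ l ≤ L, ∀ (t s : ℝ) (ξ : Pos d) (k j : Fin n), |t| ≤ R → |s| ≤ R →
      ‖iteratedFDeriv ℝ l (fun ξ => freeSymbol m α t ξ k j - freeSymbol m α s ξ k j) ξ‖ ≤
        C * |t - s| * (1 + ‖ξ‖) := by
  obtain ⟨C, hC, h⟩ := exists_norm_iteratedFDeriv_exp_sub_le (freeGeneratorConst m α)
    (freeGeneratorLin α) (norm_exp_freeGenerator_le m hα) L R
  refine ⟨C, hC, fun l hl t s ξ k j ht hs => ?_⟩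
  simp only [freeSymbol_entry m α, ← map_sub]
  exact (norm_iteratedFDeriv_entry_comp_le k j
    ((contDiff_exp_affine (freeGeneratorConst m α) (freeGeneratorLin α) t).sub
      (contDiff_exp_affine (freeGeneratorConst m α) (freeGeneratorLin α) s)) l ξ).trans
    (h l hl t s ξ ht hs)

theorem hasTemperateGrowth_freeSymbol (hα : IsDiracMatrices α) (t : ℝ) (k j : Fin n) :
    (fun ξ : Pos d => freeSymbol m α t ξ k j).HasTemperateGrowth := by
  refine ⟨?_, fun l => ?_⟩
  · simp only [freeSymbol_entry m α]
    exact (entry k j).contDiff.comp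
      (contDiff_exp_affine (freeGeneratorConst m α) (freeGeneratorLin α) t)
  · obtain ⟨C, -, h⟩ := exists_norm_iteratedFDeriv_freeSymbol_le m hα l |t|
    exact ⟨0, C, fun ξ => by simpa using h l le_rfl t ξ k j le_rfl⟩

variable (α) in
theorem hasTemperateGrowth_freeGenerator (k j : Fin n) :
    (fun ξ : Pos d => freeGenerator m α ξ k j).HasTemperateGrowth := by
  have e : (fun ξ : Pos d => freeGenerator m α ξ k j) = fun ξ =>
      entry k j (freeGeneratorConst m α) + (entry k j ∘L freeGeneratorLin α) ξ := by
    funext ξ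
    rw [← entry_toEuclideanCLM (freeGenerator m α ξ), freeGenerator_eq, map_add]
    rfl
  rw [e]
  exact (Function.HasTemperateGrowth.const _).add
    (ContinuousLinearMap.hasTemperateGrowth _)

end FreeSymbol

end

/-! ### Curves of Schwartz functions and Fourier multipliers -/

section

section Curves

variable {V : Type*} [NormedAddCommGroup V] [NormedSpace ℝ V]

/-- A curve of Schwartz functions that is pointwise differentiable, with a derivative that is
continuous in the Schwartz space, is differentiable in the Schwartz space. -/
theorem tendsto_slope_schwartz {c c' : ℝ → 𝓢(V, ℂ)} (hc' : Continuous c')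
    (h : ∀ t y, HasDerivAt (fun t => c t y) (c' t y) t) :
    Tendsto (fun h : ℝ => ((h : ℂ)⁻¹) • (c h - c 0)) (𝓝[≠] 0) (𝓝 (c' 0)) := by
  rw [tendsto_schwartz_iff]
  intro K
  -- The difference quotient minus `c' 0` is the average of `c' (δ w) - c' 0` over `w` in `[0, 1]`.
  -- Clamping `w` makes the integrand a continuous family on the whole line, small in each Schwartz
  -- norm when `δ` is small.
  set ν : Measure ℝ := volume.restrict (Icc 0 1)
  let clamp : ℝ → ℝ := fun w => (projIcc (0 : ℝ) 1 zero_le_one w : ℝ)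
  have hclamp : Continuous clamp := continuous_subtype_val.comp continuous_projIcc
  have hclamp1 : ∀ w, |clamp w| ≤ 1 := fun w => by
    have := (projIcc (0 : ℝ) 1 zero_le_one w).2
    exact abs_le.2 ⟨by linarith [this.1], this.2⟩
  let e : ℝ → ℝ → 𝓢(V, ℂ) := fun δ w => c' (δ * clamp w) - c' 0
  have he : ∀ δ, Continuous (e δ) := fun δ =>
    (hc'.comp (continuous_const.mul hclamp)).sub continuous_const
  have hint : ∀ δ K, ∃ b : ℝ → ℝ, Integrable b ν ∧ ∀ w, schwartzNorm V ℂ K (e δ w) ≤ b w :=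
    fun δ K => ⟨fun w => schwartzNorm V ℂ K (e δ w),
      (((continuous_schwartzNorm K).comp (he δ)).integrableOn_Icc), fun w => le_rfl⟩
  have key : ∀ δ : ℝ, δ ≠ 0 →
      ((δ : ℂ)⁻¹) • (c δ - c 0) - c' 0 = schwartzIntegral (he δ) (hint δ) := by
    intro δ hδ
    ext y
    have hδ' : (δ : ℂ) ≠ 0 := by exact_mod_cast hδ
    have hcy : Continuous fun t => c' t y :=
      (BoundedContinuousFunction.evalCLM ℝ (β := ℂ) y).continuous.comp
        ((SchwartzMap.toBoundedContinuousFunctionCLM ℝ V ℂ).continuous.comp hc')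
    have h1 : ∀ w : ℝ, HasDerivAt (fun w => (δ : ℂ)⁻¹ * c (δ * w) y - w * c' 0 y)
        (c' (δ * w) y - c' 0 y) w := by
      intro w
      have h2 := (h (δ * w) y).scomp w ((hasDerivAt_id w).const_mul δ)
      have h3 := (h2.const_mul ((δ : ℂ)⁻¹)).sub
        ((Complex.ofRealCLM.hasDerivAt (x := w)).mul_const (c' 0 y))
      refine h3.congr_deriv ?_
      rw [mul_one, Complex.real_smul, inv_mul_cancel_left₀ hδ', Complex.ofRealCLM_apply,
        Complex.ofReal_one, one_mul]
    have h4 := intervalIntegral.integral_eq_sub_of_hasDerivAt (a := 0) (b := 1)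
      (fun w _ => h1 w) (((hcy.comp (continuous_const.mul continuous_id)).sub
        continuous_const).intervalIntegrable _ _)
    have h5 : ∫ w, e δ w y ∂ν = ∫ w in (0 : ℝ)..1, (c' (δ * w) y - c' 0 y) := by
      rw [intervalIntegral.integral_of_le zero_le_one, ← integral_Icc_eq_integral_Ioc]
      refine setIntegral_congr_fun measurableSet_Icc fun w hw => ?_
      simp only [e, clamp, projIcc_of_mem zero_le_one hw]
      rfl
    rw [schwartzIntegral_apply, h5]
    refine Eq.trans ?_ h4.symm
    simp only [sub_apply, smul_apply, smul_eq_mul, mul_one, mul_zero, Complex.ofReal_zero,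
      Complex.ofReal_one, zero_mul, one_mul, sub_zero]
    ring
  have hcont : Tendsto (fun τ => schwartzNorm V ℂ K (c' τ - c' 0)) (𝓝 0) (𝓝 0) :=
    tendsto_schwartz_iff.1 (hc'.tendsto 0) K
  rw [Metric.tendsto_nhds]
  intro ε hε
  obtain ⟨ρ, hρ, hb⟩ := Metric.eventually_nhds_iff.1 (hcont.eventually (gt_mem_nhds (half_pos hε)))
  filter_upwards [self_mem_nhdsWithin, nhdsWithin_le_nhds (Metric.ball_mem_nhds (0 : ℝ) hρ)]
    with δ hδ hδρ
  rw [key δ hδ, Real.dist_eq, sub_zero, abs_of_nonneg (apply_nonneg _ _)]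
  have hbd : ∀ w, schwartzNorm V ℂ K (e δ w) ≤ ε / 2 := fun w => by
    refine (hb ?_).le
    rw [Real.dist_eq, sub_zero, abs_mul]
    rw [mem_ball_zero_iff, Real.norm_eq_abs] at hδρ
    exact (mul_le_of_le_one_right (abs_nonneg δ) (hclamp1 w)).trans_lt hδρ
  have := seminorm_schwartzIntegral_le (he δ) (hint δ) (b := fun _ => ε / 2)
    (integrable_const _) hbd
  refine this.trans_lt ?_
  simp [ν, hε]

end Curves

section Multiplier

variable {V : Type*} [NormedAddCommGroup V] [InnerProductSpace ℝ V]

/-- Multiplication by a function of polynomial growth is bounded on the Schwartz space, with a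
constant that depends only on the bounds for the derivatives. -/
theorem exists_schwartzNorm_smulLeft_le (L p : ℕ) : ∃ C : ℝ, 0 ≤ C ∧
    ∀ (a : V → ℂ) (B : ℝ), a.HasTemperateGrowth →
      (∀ l ≤ L, ∀ ξ, ‖iteratedFDeriv ℝ l a ξ‖ ≤ B * (1 + ‖ξ‖) ^ p) → ∀ φ : 𝓢(V, ℂ),
      schwartzNorm V ℂ L (SchwartzMap.smulLeftCLM ℂ a φ) ≤
        C * B * schwartzNorm V ℂ (L + p) φ := by
  refine ⟨2 ^ L * 2 ^ (L + p), by positivity, fun a B ha hB φ => ?_⟩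
  have hB0 : 0 ≤ B := by simpa using (norm_nonneg _).trans (hB 0 (Nat.zero_le _) 0)
  refine schwartzNorm_le (by positivity) _ fun k hk l hl y => ?_
  have e : ⇑(SchwartzMap.smulLeftCLM ℂ a φ) = fun y => a y • φ y :=
    SchwartzMap.smulLeftCLM_apply ha φ
  rw [e]
  have h1 := norm_iteratedFDeriv_smul_le (𝕜 := ℝ) ha.1 φ.smooth' y (n := l)
    (by exact_mod_cast le_top)
  have h2 : ∀ i ∈ Finset.range (l + 1), (l.choose i : ℝ) * ‖iteratedFDeriv ℝ i a y‖ *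
      ‖iteratedFDeriv ℝ (l - i) φ y‖ ≤ (l.choose i : ℝ) *
        (B * (1 + ‖y‖) ^ p * ‖iteratedFDeriv ℝ (l - i) φ y‖) := by
    intro i hi
    have hi' : i ≤ l := Nat.lt_succ_iff.1 (Finset.mem_range.1 hi)
    rw [mul_assoc]
    gcongr
    exact hB i (hi'.trans hl) y
  calc ‖y‖ ^ k * ‖iteratedFDeriv ℝ l (fun y => a y • φ y) y‖
      ≤ (1 + ‖y‖) ^ k * ∑ i ∈ Finset.range (l + 1), (l.choose i : ℝ) *
        (B * (1 + ‖y‖) ^ p * ‖iteratedFDeriv ℝ (l - i) φ y‖) := by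
        gcongr
        · linarith
        · exact h1.trans (Finset.sum_le_sum h2)
    _ = ∑ i ∈ Finset.range (l + 1), (l.choose i : ℝ) *
        (B * ((1 + ‖y‖) ^ (k + p) * ‖iteratedFDeriv ℝ (l - i) φ y‖)) := by
        rw [Finset.mul_sum]
        refine Finset.sum_congr rfl fun i _ => ?_
        rw [pow_add]
        ring
    _ ≤ ∑ i ∈ Finset.range (l + 1), (l.choose i : ℝ) *
        (B * (2 ^ (L + p) * schwartzNorm V ℂ (L + p) φ)) := by
        refine Finset.sum_le_sum fun i _ => ?_
        refine mul_le_mul_of_nonneg_left (mul_le_mul_of_nonneg_left ?_ hB0) (Nat.cast_nonneg _)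
        exact one_add_pow_mul_le_schwartzNorm (by omega) (by omega) φ y
    _ = 2 ^ l * (B * (2 ^ (L + p) * schwartzNorm V ℂ (L + p) φ)) := by
        rw [← Finset.sum_mul]
        congr 1
        exact_mod_cast Nat.sum_range_choose l
    _ ≤ 2 ^ L * (B * (2 ^ (L + p) * schwartzNorm V ℂ (L + p) φ)) := by
        gcongr
        norm_num
    _ = _ := by ring

variable [FiniteDimensional ℝ V] [MeasurableSpace V] [BorelSpace V]

/-- The transpose of a Fourier multiplier, acting on test functions. -/
def dualMultiplier (a : V → ℂ) : 𝓢(V, ℂ) →L[ℂ] 𝓢(V, ℂ) :=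
  FourierTransform.fourierCLM ℂ 𝓢(V, ℂ) ∘L SchwartzMap.smulLeftCLM ℂ a ∘L
    FourierTransform.fourierInvCLM ℂ 𝓢(V, ℂ)

theorem dualMultiplier_apply (a : V → ℂ) (φ : 𝓢(V, ℂ)) :
    dualMultiplier a φ = 𝓕 (SchwartzMap.smulLeftCLM ℂ a (𝓕⁻ φ)) := rfl

theorem exists_schwartzNorm_dualMultiplier_le (L : ℕ) : ∃ (K : ℕ) (C : ℝ), 0 ≤ C ∧
    ∀ (a : V → ℂ) (B : ℝ), a.HasTemperateGrowth →
      (∀ l ≤ K, ∀ ξ, ‖iteratedFDeriv ℝ l a ξ‖ ≤ B) → ∀ φ : 𝓢(V, ℂ),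
      schwartzNorm V ℂ L (dualMultiplier a φ) ≤ C * B * schwartzNorm V ℂ K φ := by
  obtain ⟨K₁, C₁, hC₁, h₁⟩ := exists_bound_clm (FourierTransform.fourierCLM ℂ 𝓢(V, ℂ)) L
  obtain ⟨C₂, hC₂, h₂⟩ := exists_schwartzNorm_smulLeft_le (V := V) K₁ 0
  obtain ⟨K₃, C₃, hC₃, h₃⟩ := exists_bound_clm (FourierTransform.fourierInvCLM ℂ 𝓢(V, ℂ)) K₁
  refine ⟨max K₁ K₃, C₁ * C₂ * C₃, by positivity, fun a B ha hB φ => ?_⟩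
  have hB0 : 0 ≤ B := (norm_nonneg _).trans (hB 0 (Nat.zero_le _) 0)
  have h4 := h₂ a B ha (fun l hl ξ => by simpa using hB l (hl.trans (le_max_left _ _)) ξ) (𝓕⁻ φ)
  calc schwartzNorm V ℂ L (dualMultiplier a φ)
      ≤ C₁ * schwartzNorm V ℂ K₁ (SchwartzMap.smulLeftCLM ℂ a (𝓕⁻ φ)) := h₁ _
    _ ≤ C₁ * (C₂ * B * schwartzNorm V ℂ K₁ (𝓕⁻ φ)) := by gcongr; exact h4
    _ ≤ C₁ * (C₂ * B * (C₃ * schwartzNorm V ℂ (max K₁ K₃) φ)) := by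
        gcongr
        refine (h₃ φ).trans ?_
        gcongr
        exact schwartzNorm_mono (le_max_right _ _) φ
    _ = _ := by ring

/-- A Fourier multiplier maps a time-frequency atom to an atom at the same place. -/
theorem dualMultiplier_conjAtom {a : V → ℂ} (ha : a.HasTemperateGrowth) (g : 𝓢(V, ℂ)) (x ξ : V) :
    dualMultiplier a (conjAtom g x ξ) =
      conjAtom (conjS (dualMultiplier (fun η => a (η + ξ)) (conjS g))) x ξ := by
  have ha' : (fun η => a (η + ξ)).HasTemperateGrowth :=
    ha.comp ((Function.HasTemperateGrowth.id).add (Function.HasTemperateGrowth.const ξ))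
  rw [conjAtom_eq_fourier, conjAtom_eq_fourier, conjS_conjS, dualMultiplier_apply,
    FourierTransform.fourierInv_fourier_eq]
  congr 1
  ext η
  rw [SchwartzMap.smulLeftCLM_apply_apply ha, translate_apply, translate_apply,
    fourierInv_translate, fourierInv_translate, dualMultiplier_apply,
    FourierTransform.fourierInv_fourier_eq, SchwartzMap.smulLeftCLM_apply_apply ha', smul_eq_mul,
    smul_eq_mul, sub_add_cancel]
  ring

/-- The Gabor matrix of a Fourier multiplier whose symbol has bounded derivatives is concentrated
on the diagonal. -/
theorem exists_enorm_apply_dualMultiplier_le {F : Type*} [NormedAddCommGroup F] [NormedSpace ℂ F]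
    [CompleteSpace F] {g : 𝓢(V, ℂ)} (hg : g ≠ 0) (K : ℕ) :
    ∃ (L : ℕ) (C : ℝ≥0∞), C ≠ ∞ ∧ ∀ (a : V → ℂ) (B : ℝ), a.HasTemperateGrowth →
      (∀ l ≤ L, ∀ ξ, ‖iteratedFDeriv ℝ l a ξ‖ ≤ B) → ∀ (f : 𝓢'(V, F)) (z : V × V),
      ‖f (dualMultiplier a (conjAtom g z.1 z.2))‖ₑ ≤
        C * ENNReal.ofReal B * (decayE K ⋆ₗ stftE g f) z := by
  obtain ⟨L₁, C₁, hC₁, h₁⟩ := exists_stftE_le_conv_uniform (F := F) hg K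
  obtain ⟨L, C₂, hC₂, h₂⟩ := exists_schwartzNorm_dualMultiplier_le (V := V) L₁
  have hs : 0 ≤ schwartzNorm V ℂ L (conjS g) := apply_nonneg _ _
  refine ⟨L, C₁ * ENNReal.ofReal (C₂ * schwartzNorm V ℂ L (conjS g)),
    ENNReal.mul_ne_top hC₁ ENNReal.ofReal_ne_top, fun a B ha hB f z => ?_⟩
  have ha' : (fun η => a (η + z.2)).HasTemperateGrowth :=
    ha.comp ((Function.HasTemperateGrowth.id).add (Function.HasTemperateGrowth.const z.2))
  rw [dualMultiplier_conjAtom ha]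
  -- On the atom at `z` the multiplier only changes the window, and the new window is produced by
  -- the symbol translated by `z.2`, whose derivative bounds do not depend on `z`. This is why the
  -- change of window had to be uniform in the new window.
  refine (h₁ _ f z).trans ?_
  refine mul_le_mul_left ?_ _
  rw [mul_assoc, ← ENNReal.ofReal_mul (by positivity), conjS_conjS]
  refine mul_le_mul_right (ENNReal.ofReal_le_ofReal ?_) _
  refine (h₂ _ B ha' (fun l hl ξ => ?_) (conjS g)).trans (le_of_eq (by ring))
  rw [iteratedFDeriv_comp_add_right]
  exact hB l hl _

end Multiplier

end

/-! ### The free Dirac propagator -/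

section

section FreePropagator

variable {d n : ℕ} {m : ℝ} {α : Fin (d + 1) → Matrix (Fin n) (Fin n) ℂ}

variable (m α) in
/-- The entries of the transpose of the free propagator, acting on test functions. -/
def freeDual (t : ℝ) (k j : Fin n) : 𝓢(Pos d, ℂ) →L[ℂ] 𝓢(Pos d, ℂ) :=
  dualMultiplier fun ξ => freeSymbol m α t ξ k j

variable (m α) in
/-- The entries of the transpose of `-i D_m`, acting on test functions. -/
def generatorDual (k j : Fin n) : 𝓢(Pos d, ℂ) →L[ℂ] 𝓢(Pos d, ℂ) :=
  dualMultiplier fun ξ => freeGenerator m α ξ k j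

theorem freePropagator_eq_sum (t : ℝ) (f : 𝓢'(Pos d, Spinor n)) (φ : 𝓢(Pos d, ℂ)) :
    freePropagator m α t f φ = ∑ k, ∑ j,
      Matrix.toEuclideanCLM (𝕜 := ℂ) (Matrix.single k j 1) (f (freeDual m α t k j φ)) := by
  simp only [freePropagator, sum_apply]
  rfl

theorem freePropagator_apply (t : ℝ) (f : 𝓢'(Pos d, Spinor n)) (φ : 𝓢(Pos d, ℂ)) (k : Fin n) :
    freePropagator m α t f φ k = ∑ j, f (freeDual m α t k j φ) j := by
  rw [freePropagator_eq_sum]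
  simp [Matrix.single_mulVec, Function.update_apply, Finset.sum_ite_eq]

theorem freeDual_zero (k j : Fin n) (φ : 𝓢(Pos d, ℂ)) :
    freeDual m α 0 k j φ = if k = j then φ else 0 := by
  simp only [freeDual, freeSymbol_zero, dualMultiplier_apply, SchwartzMap.smulLeftCLM_const,
    Matrix.one_apply]
  split_ifs with h
  · simp
  · simp

theorem freePropagator_zero (f : 𝓢'(Pos d, Spinor n)) : freePropagator m α 0 f = f := by
  ext φ k
  rw [freePropagator_apply]
  simp only [freeDual_zero]
  rw [Finset.sum_eq_single k (fun j _ hj => by simp [hj.symm]) (by simp), if_pos rfl]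

theorem freePropagator_map_add (t : ℝ) (f h : 𝓢'(Pos d, Spinor n)) :
    freePropagator m α t (f + h) = freePropagator m α t f + freePropagator m α t h := by
  ext φ k
  rw [add_apply, PiLp.add_apply]
  simp only [freePropagator_apply, add_apply, PiLp.add_apply, Finset.sum_add_distrib]

theorem freePropagator_map_smul (t : ℝ) (c : ℂ) (f : 𝓢'(Pos d, Spinor n)) :
    freePropagator m α t (c • f) = c • freePropagator m α t f := by
  ext φ k
  rw [smul_apply, PiLp.smul_apply]
  simp only [freePropagator_apply, smul_apply, PiLp.smul_apply, Finset.smul_sum]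

theorem freeDual_add (hα : IsDiracMatrices α) (t s : ℝ) (k j : Fin n) (φ : 𝓢(Pos d, ℂ)) :
    freeDual m α (t + s) k j φ = ∑ l, freeDual m α s l j (freeDual m α t k l φ) := by
  have hg := hasTemperateGrowth_freeSymbol m hα
  simp only [freeDual, dualMultiplier_apply, FourierTransform.fourierInv_fourier_eq]
  have h1 : SchwartzMap.smulLeftCLM ℂ (fun ξ => freeSymbol m α (t + s) ξ k j) (𝓕⁻ φ) =
      ∑ l, SchwartzMap.smulLeftCLM ℂ (fun ξ => freeSymbol m α s ξ l j)
        (SchwartzMap.smulLeftCLM ℂ (fun ξ => freeSymbol m α t ξ k l) (𝓕⁻ φ)) := by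
    ext ξ
    rw [SchwartzMap.smulLeftCLM_apply_apply (hg _ _ _), sum_apply, freeSymbol_add,
      Matrix.mul_apply, Finset.sum_smul]
    refine Finset.sum_congr rfl fun l _ => ?_
    rw [SchwartzMap.smulLeftCLM_apply_apply (hg _ _ _),
      SchwartzMap.smulLeftCLM_apply_apply (hg _ _ _), smul_smul, mul_comm]
  rw [h1]
  exact map_sum (FourierTransform.fourierCLM ℂ 𝓢(Pos d, ℂ)) _ _

theorem freePropagator_freePropagator (hα : IsDiracMatrices α) (t s : ℝ)
    (f : 𝓢'(Pos d, Spinor n)) :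
    freePropagator m α t (freePropagator m α s f) = freePropagator m α (t + s) f := by
  ext φ k
  simp only [freePropagator_apply, freeDual_add hα, map_sum]
  rw [Finset.sum_comm]
  refine Finset.sum_congr rfl fun j _ => ?_
  simp

/-- For times near `t₀` the symbols and their derivatives differ by a multiple of `|t - t₀|` times
`1 + ‖ξ‖`; the linear growth is absorbed by one more index of the Schwartz norm. -/
theorem continuous_freeDual (hα : IsDiracMatrices α) (k j : Fin n) (φ : 𝓢(Pos d, ℂ)) :
    Continuous fun t => freeDual m α t k j φ := by
  have hg := hasTemperateGrowth_freeSymbol m hα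
  refine (FourierTransform.continuous_fourier (E := 𝓢(Pos d, ℂ)) (F := 𝓢(Pos d, ℂ))).comp
    (continuous_schwartz_of fun t₀ K => ?_)
  obtain ⟨C, hC, h⟩ := exists_schwartzNorm_smulLeft_le (V := Pos d) K 1
  obtain ⟨C', hC', h'⟩ := exists_norm_iteratedFDeriv_freeSymbol_sub_le m hα K (|t₀| + 1)
  have hlim : Tendsto (fun t : ℝ => C * (C' * |t - t₀|) * schwartzNorm (Pos d) ℂ (K + 1) (𝓕⁻ φ))
      (𝓝 t₀) (𝓝 0) := by
    have : Continuous fun t : ℝ =>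
        C * (C' * |t - t₀|) * schwartzNorm (Pos d) ℂ (K + 1) (𝓕⁻ φ) := by fun_prop
    simpa using this.tendsto t₀
  refine squeeze_zero' (Eventually.of_forall fun t => apply_nonneg _ _) ?_ hlim
  filter_upwards [Metric.ball_mem_nhds t₀ one_pos] with t ht
  have ht1 : |t| ≤ |t₀| + 1 := by
    have h1 : |t - t₀| < 1 := by simpa [Real.dist_eq] using ht
    have h2 := abs_sub_abs_le_abs_sub t t₀
    linarith
  have e : SchwartzMap.smulLeftCLM ℂ (fun ξ => freeSymbol m α t ξ k j) (𝓕⁻ φ) -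
      SchwartzMap.smulLeftCLM ℂ (fun ξ => freeSymbol m α t₀ ξ k j) (𝓕⁻ φ) =
      SchwartzMap.smulLeftCLM ℂ (fun ξ => freeSymbol m α t ξ k j - freeSymbol m α t₀ ξ k j)
        (𝓕⁻ φ) := by
    have := SchwartzMap.smulLeftCLM_sub (F := ℂ) (hg t k j) (hg t₀ k j)
    exact (DFunLike.congr_fun this (𝓕⁻ φ)).symm
  refine (congrArg _ e).le.trans ?_
  refine h _ (C' * |t - t₀|) ((hg t k j).sub (hg t₀ k j)) (fun l hl ξ => ?_) _
  rw [pow_one]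
  exact h' l hl t t₀ ξ k j ht1 (by linarith)

/-- Differentiability at time zero of the transposed free propagator, in the Schwartz space. -/
theorem tendsto_slope_freeDual (hα : IsDiracMatrices α) (k j : Fin n) (φ : 𝓢(Pos d, ℂ)) :
    Tendsto (fun h : ℝ => ((h : ℂ)⁻¹) • (freeDual m α h k j φ - freeDual m α 0 k j φ)) (𝓝[≠] 0)
      (𝓝 (generatorDual m α k j φ)) := by
  have hg := hasTemperateGrowth_freeSymbol m hα
  have hX := hasTemperateGrowth_freeGenerator m α
  let c : Fin n → Fin n → ℝ → 𝓢(Pos d, ℂ) := fun k j t =>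
    SchwartzMap.smulLeftCLM ℂ (fun ξ => freeSymbol m α t ξ k j) (𝓕⁻ φ)
  have hc : ∀ k j, Continuous (c k j) := fun k j => by
    have := (FourierTransform.continuous_fourierInv (E := 𝓢(Pos d, ℂ)) (F := 𝓢(Pos d, ℂ))).comp
      (continuous_freeDual (m := m) hα k j φ)
    refine this.congr fun t => ?_
    exact FourierTransform.fourierInv_fourier_eq (c k j t)
  -- Before the Fourier transform the curve satisfies a linear matrix differential equation at each
  -- `ξ`. Its right-hand side is continuous in the Schwartz space, because multiplication by the
  -- affine function `freeGenerator` is, so the pointwise derivative is a derivative in the Schwartz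
  -- space.
  let c' : ℝ → 𝓢(Pos d, ℂ) := fun t =>
    ∑ l, SchwartzMap.smulLeftCLM ℂ (fun ξ => freeGenerator m α ξ k l) (c l j t)
  have hc' : Continuous c' := continuous_finsetSum _ fun l _ =>
    (SchwartzMap.smulLeftCLM ℂ (fun ξ => freeGenerator m α ξ k l)).continuous.comp (hc l j)
  have hd : ∀ t ξ, HasDerivAt (fun t => c k j t ξ) (c' t ξ) t := by
    intro t ξ
    have h := (hasDerivAt_freeSymbol m α t ξ k j).mul_const (𝓕⁻ φ ξ)
    refine (h.congr_deriv ?_).congr_of_eventuallyEq (Eventually.of_forall fun t => ?_)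
    · rw [sum_apply, Finset.sum_mul]
      refine Finset.sum_congr rfl fun l _ => ?_
      rw [SchwartzMap.smulLeftCLM_apply_apply (hX k l),
        SchwartzMap.smulLeftCLM_apply_apply (hg t l j), smul_eq_mul, smul_eq_mul, mul_assoc]
    · exact SchwartzMap.smulLeftCLM_apply_apply (hg t k j) _ _
  have h0 : c' 0 = SchwartzMap.smulLeftCLM ℂ (fun ξ => freeGenerator m α ξ k j) (𝓕⁻ φ) := by
    ext ξ
    rw [sum_apply, Finset.sum_eq_single j]
    · rw [SchwartzMap.smulLeftCLM_apply_apply (hX k j),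
        SchwartzMap.smulLeftCLM_apply_apply (hX k j),
        SchwartzMap.smulLeftCLM_apply_apply (hg 0 j j), freeSymbol_zero, Matrix.one_apply_eq,
        one_smul]
    · intro l _ hl
      rw [SchwartzMap.smulLeftCLM_apply_apply (hX k l),
        SchwartzMap.smulLeftCLM_apply_apply (hg 0 l j), freeSymbol_zero, Matrix.one_apply_ne hl,
        zero_smul, smul_zero]
    · simp
  have h := (((FourierTransform.continuous_fourier (E := 𝓢(Pos d, ℂ)) (F := 𝓢(Pos d, ℂ))).tendsto
    (c' 0)).comp (tendsto_slope_schwartz hc' hd))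
  rw [h0] at h
  refine h.congr fun δ => ?_
  rw [Function.comp_apply, FourierTransform.fourier_smul]
  exact congrArg _ (map_sub (FourierTransform.fourierCLM ℂ 𝓢(Pos d, ℂ)) _ _)

theorem generatorDual_eq (k j : Fin n) (φ : 𝓢(Pos d, ℂ)) : generatorDual m α k j φ =
    (-(2 * Real.pi * Complex.I) * (m * α 0 k j)) • φ +
      ∑ i : Fin d, α i.succ k j • ∂_{(EuclideanSpace.single i (1 : ℝ) : Pos d)} φ := by
  have hX := hasTemperateGrowth_freeGenerator m α k j
  have hin : ∀ i : Fin d, (fun ξ : Pos d =>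
      inner ℝ ξ (EuclideanSpace.single i (1 : ℝ) : Pos d)).HasTemperateGrowth := fun i =>
    Function.hasTemperateGrowth_inner_left _
  have h1 : SchwartzMap.smulLeftCLM ℂ (fun ξ => freeGenerator m α ξ k j) (𝓕⁻ φ) =
      (-(2 * Real.pi * Complex.I) * (m * α 0 k j)) • 𝓕⁻ φ + ∑ i : Fin d, α i.succ k j •
        (-(2 * Real.pi * Complex.I) • SchwartzMap.smulLeftCLM ℂ
          (fun ξ => inner ℝ ξ (EuclideanSpace.single i (1 : ℝ) : Pos d)) (𝓕⁻ φ)) := by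
    ext ξ
    rw [SchwartzMap.smulLeftCLM_apply_apply hX]
    simp only [add_apply, sum_apply, smul_apply, freeGenerator, Matrix.smul_apply,
      Matrix.add_apply, Matrix.sum_apply, smul_eq_mul]
    rw [mul_add, add_mul, Finset.mul_sum, Finset.sum_mul]
    congr 1
    refine Finset.sum_congr rfl fun i _ => ?_
    rw [SchwartzMap.smulLeftCLM_apply_apply (hin i), EuclideanSpace.inner_single_right]
    simp
    ring
  have h2 : ∀ i : Fin d, 𝓕 (-(2 * Real.pi * Complex.I) • SchwartzMap.smulLeftCLM ℂ
      (fun ξ => inner ℝ ξ (EuclideanSpace.single i (1 : ℝ) : Pos d)) (𝓕⁻ φ)) =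
      ∂_{(EuclideanSpace.single i (1 : ℝ) : Pos d)} φ := by
    intro i
    rw [← SchwartzMap.lineDerivOp_fourier_eq, FourierTransform.fourier_fourierInv_eq]
  have h3 : 𝓕 (𝓕⁻ φ) = φ := FourierTransform.fourier_fourierInv_eq φ
  rw [generatorDual, dualMultiplier_apply, h1]
  refine (map_add (FourierTransform.fourierCLM ℂ 𝓢(Pos d, ℂ)) _ _).trans ?_
  rw [map_smul, map_sum]
  congr 1
  · exact congrArg (fun χ => (-(2 * Real.pi * Complex.I) * (m * α 0 k j)) • χ) h3
  · refine Finset.sum_congr rfl fun i _ => ?_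
    rw [map_smul]
    exact congrArg _ (h2 i)

/-- Multiplication by `-2πi ξ_i` before the Fourier transform is `∂_i` after it, and the
distributional derivative contributes a sign. Hence the generator of the free propagator, transposed
to distributions, is `-i D_m`. -/
theorem diracOp_apply (f : 𝓢'(Pos d, Spinor n)) (φ : 𝓢(Pos d, ℂ)) (k : Fin n) :
    diracOp m α f φ k = Complex.I * ∑ j, f (generatorDual m α k j φ) j := by
  have hmat : ∀ (A : Matrix (Fin n) (Fin n) ℂ) (u : 𝓢'(Pos d, Spinor n)) (χ : 𝓢(Pos d, ℂ)),
      matAct A u χ k = ∑ j, A k j * u χ j := fun A u χ => rfl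
  simp only [diracOp, sub_apply, smul_apply, sum_apply, PiLp.sub_apply, PiLp.smul_apply,
      smul_eq_mul,
    generatorDual_eq, map_add, map_smul, map_sum, PiLp.add_apply, hmat]
  rw [Finset.sum_add_distrib, mul_add, sub_eq_add_neg]
  congr 1
  · rw [Finset.mul_sum, Finset.mul_sum]
    refine Finset.sum_congr rfl fun j _ => ?_
    linear_combination ((2 * Real.pi * m * α 0 k j * f φ j) : ℂ) * Complex.I_sq
  · have h1 : ∀ j, (∑ i : Fin d, α i.succ k j • f (∂_{(EuclideanSpace.single i (1 : ℝ) : Pos d)}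
        φ)) j
        = ∑ i : Fin d, α i.succ k j * f (∂_{(EuclideanSpace.single i (1 : ℝ) : Pos d)} φ) j := by
      intro j
      simp
    have h2 : (∑ i : Fin d, matAct (α i.succ)
        (∂_{(EuclideanSpace.single i (1 : ℝ) : Pos d)} f) φ) k = ∑ i : Fin d, ∑ j,
          α i.succ k j * -f (∂_{(EuclideanSpace.single i (1 : ℝ) : Pos d)} φ) j := by
      simp [hmat]
    rw [h2, Finset.sum_congr rfl fun j _ => h1 j, Finset.sum_comm]
    simp

/-- The Gabor matrix of the free propagator is concentrated on the diagonal, locally uniformly in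
time. -/
theorem exists_stftE_freePropagator_le (hα : IsDiracMatrices α) {g : 𝓢(Pos d, ℂ)} (hg : g ≠ 0)
    (K : ℕ) (R : ℝ) : ∃ C : ℝ≥0∞, C ≠ ∞ ∧ ∀ t : ℝ, |t| ≤ R →
      ∀ (f : 𝓢'(Pos d, Spinor n)) z,
      stftE g (freePropagator m α t f) z ≤ C * (decayE K ⋆ₗ stftE g f) z := by
  obtain ⟨L, C, hC, h⟩ := exists_enorm_apply_dualMultiplier_le (F := Spinor n) hg K
  obtain ⟨B, hB, hb⟩ := exists_norm_iteratedFDeriv_freeSymbol_le m hα L R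
  refine ⟨∑ k : Fin n, ∑ j : Fin n, ‖(Matrix.toEuclideanCLM (𝕜 := ℂ) (Matrix.single k j 1) :
    SpinorOp n)‖ₑ * (C * ENNReal.ofReal B), ?_, fun t ht f z => ?_⟩
  · exact ENNReal.sum_ne_top.2 fun k _ => ENNReal.sum_ne_top.2 fun j _ =>
      ENNReal.mul_ne_top enorm_ne_top (ENNReal.mul_ne_top hC ENNReal.ofReal_ne_top)
  · rw [stftE, stft, freePropagator_eq_sum, Finset.sum_mul]
    refine (enorm_sum_le _ _).trans (Finset.sum_le_sum fun k _ => ?_)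
    rw [Finset.sum_mul]
    refine (enorm_sum_le _ _).trans (Finset.sum_le_sum fun j _ => ?_)
    refine (ContinuousLinearMap.le_opENorm _ _).trans ?_
    rw [mul_assoc]
    refine mul_le_mul_right ?_ _
    exact h _ B (hasTemperateGrowth_freeSymbol m hα t k j)
      (fun l hl ξ => hb l hl t ξ k j ht) f z

variable {γ : ℝ} {N : 𝓢'(Pos d, Spinor n) → ℝ≥0∞} [hN : AdmissibleNorm N]

theorem continuous_incl_freePropagator (t : ℝ) (φ : 𝓢(Pos d, ℂ)) :
    Continuous fun x : ClosureSpace N => freePropagator m α t (incl N x) φ := by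
  simp only [freePropagator_eq_sum]
  exact continuous_finsetSum _ fun k _ => continuous_finsetSum _ fun j _ =>
    (ContinuousLinearMap.continuous _).comp (evalCLM N _).continuous

/-- Concentration on the diagonal provides the extension from Schwartz functions; agreement with
`freePropagator` on the whole space follows by density, since both sides are continuous after
testing. Negative times are included for the interaction picture. -/
theorem TFBounds.exists_free_operators (hγ : 0 ≤ γ) (hB : TFBounds γ N) {g : 𝓢(Pos d, ℂ)}
    (hg : g ≠ 0) (hα : IsDiracMatrices α) (R : ℝ) :
    ∃ W : ℝ → ClosureSpace N →L[ℂ] ClosureSpace N, (∃ C, ∀ t ∈ Icc (-R) R, ‖W t‖ ≤ C) ∧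
      (∀ t ∈ Icc (-R) R, ∀ x, incl N (W t x) = freePropagator m α t (incl N x)) ∧
      ∀ x, ContinuousOn (fun t => W t x) (Icc (-R) R) := by
  obtain ⟨K, hK⟩ := exists_lintegral_decayE_lt_top (Pos d) γ
  obtain ⟨C, hC, h⟩ := exists_stftE_freePropagator_le (m := m) hα hg K R
  let A : ℝ → 𝓢(Pos d, Spinor n) →ₗ[ℂ] 𝓢'(Pos d, Spinor n) := fun t =>
    { toFun := fun f => freePropagator m α t (f : 𝓢'(Pos d, Spinor n))
      map_add' := fun f h => by rw [← freePropagator_map_add, ← map_add]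
      map_smul' := fun c f => by
        rw [RingHom.id_apply, ← freePropagator_map_smul, ← map_smul] }
  obtain ⟨W, hW1, hW2, hW3⟩ := hB.exists_operators (A := A) (Ω := Icc (-R) R)
    (H := fun z => C * decayE K z) hγ hg ((measurable_decayE K).const_mul C)
    (by
      simp only [mul_assoc]
      rw [lintegral_const_mul' _ _ hC]
      exact ENNReal.mul_lt_top hC.lt_top hK)
    (fun t ht f z => by
      rw [lconvolution_const_mul C (measurable_decayE K) (measurable_stftE g _)]
      exact h t (abs_le.2 ht) _ z)
    (fun f φ => by
      refine Continuous.continuousOn ?_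
      change Continuous fun t => freePropagator m α t (f : 𝓢'(Pos d, Spinor n)) φ
      simp only [freePropagator_eq_sum]
      exact continuous_finsetSum _ fun k _ => continuous_finsetSum _ fun j _ =>
        (ContinuousLinearMap.continuous _).comp
          ((ContinuousLinearMap.continuous _).comp (continuous_freeDual hα k j φ)))
  refine ⟨W, hW1, fun t ht x => ?_, hW3⟩
  ext1 φ
  have h1 : Continuous fun x : ClosureSpace N => incl N (W t x) φ :=
    (evalCLM N φ).continuous.comp (W t).continuous
  refine congrFun ((denseRange_ofSchwartz (N := N)).equalizer h1
    (continuous_incl_freePropagator (m := m) (α := α) t φ) ?_) x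
  funext f
  simp only [Function.comp_apply, hW2 t ht, incl_ofSchwartz]
  rfl

end FreePropagator

end

/-! ### The Dyson series and uniqueness in a Banach space -/

section

section Dyson

variable {X : Type*} [NormedAddCommGroup X] [NormedSpace ℂ X]

/-- In `A t (y t) = A t (y t - y t₀) + A t (y t₀)` the uniform bound controls the first term and
strong continuity the second. -/
theorem continuousOn_apply_apply {A : ℝ → X →L[ℂ] X} {Ω : Set ℝ} {C : ℝ}
    (hC : ∀ t ∈ Ω, ‖A t‖ ≤ C) (hA : ∀ x, ContinuousOn (fun t => A t x) Ω) {y : ℝ → X}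
    (hy : ContinuousOn y Ω) : ContinuousOn (fun t => A t (y t)) Ω := by
  intro t₀ ht₀
  have h1 : Tendsto (fun t => A t (y t - y t₀)) (𝓝[Ω] t₀) (𝓝 0) := by
    have h2 : Tendsto (fun t => C * ‖y t - y t₀‖) (𝓝[Ω] t₀) (𝓝 0) := by
      have := (((hy t₀ ht₀).tendsto.sub_const (y t₀)).norm).const_mul C
      simpa using this
    refine squeeze_zero_norm' ?_ h2
    filter_upwards [self_mem_nhdsWithin] with t ht
    exact ((A t).le_opNorm _).trans (mul_le_mul_of_nonneg_right (hC t ht) (norm_nonneg _))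
  have h3 := h1.add (hA (y t₀) t₀ ht₀).tendsto
  rw [zero_add] at h3
  refine h3.congr fun t => ?_
  rw [← map_add, sub_add_cancel]

/-- The terms of the Dyson series of `i ∂_t y = W(t) y`, applied to the initial value `x`. -/
def dysonTerm (W : ℝ → X →L[ℂ] X) : ℕ → X → ℝ → X
  | 0, x, _ => x
  | k + 1, x, t => -(Complex.I • ∫ τ in (0 : ℝ)..t, W τ (dysonTerm W k x τ))

/-- The sum of the Dyson series. -/
def dysonSum (W : ℝ → X →L[ℂ] X) (x : X) (t : ℝ) : X := ∑' k, dysonTerm W k x t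

variable {W : ℝ → X →L[ℂ] X} {C T : ℝ}

theorem continuous_dysonTerm (hC : ∀ t, ‖W t‖ ≤ C) (hW : ∀ x, Continuous fun t => W t x) (k : ℕ)
    (x : X) : Continuous (dysonTerm W k x) ∧ Continuous fun t => W t (dysonTerm W k x t) := by
  have hWy : ∀ y : ℝ → X, Continuous y → Continuous fun t => W t (y t) := fun y hy =>
    continuousOn_univ.1 (continuousOn_apply_apply (fun t _ => hC t) (fun x => (hW x).continuousOn)
      hy.continuousOn)
  induction k with
  | zero => exact ⟨continuous_const, hW x⟩
  | succ k ih =>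
    have h : Continuous (dysonTerm W (k + 1) x) :=
      ((intervalIntegral.continuous_primitive
        (fun a b => ih.2.intervalIntegrable a b) 0).const_smul Complex.I).neg
    exact ⟨h, hWy _ h⟩

theorem dysonTerm_add (hC : ∀ t, ‖W t‖ ≤ C) (hW : ∀ x, Continuous fun t => W t x) (k : ℕ)
    (x y : X) (t : ℝ) : dysonTerm W k (x + y) t = dysonTerm W k x t + dysonTerm W k y t := by
  induction k generalizing t with
  | zero => rfl
  | succ k ih =>
    simp only [dysonTerm, ih, map_add]
    rw [intervalIntegral.integral_add
      ((continuous_dysonTerm hC hW k x).2.intervalIntegrable _ _)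
      ((continuous_dysonTerm hC hW k y).2.intervalIntegrable _ _), smul_add, neg_add]

theorem dysonTerm_smul (k : ℕ) (c : ℂ) (x : X) (t : ℝ) :
    dysonTerm W k (c • x) t = c • dysonTerm W k x t := by
  induction k generalizing t with
  | zero => rfl
  | succ k ih =>
    simp only [dysonTerm, ih, map_smul]
    rw [intervalIntegral.integral_smul, smul_comm, smul_neg]

/-- Each integration raises the power of the time by one and divides by the new exponent, which
builds up the factorial. -/
theorem norm_dysonTerm_le (hC : ∀ t, ‖W t‖ ≤ C) (k : ℕ)
    (x : X) {t : ℝ} (ht : 0 ≤ t) :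
    ‖dysonTerm W k x t‖ ≤ (C * t) ^ k / k.factorial * ‖x‖ := by
  have hC0 : 0 ≤ C := (norm_nonneg _).trans (hC 0)
  induction k generalizing t with
  | zero => simp [dysonTerm]
  | succ k ih =>
    simp only [dysonTerm, norm_neg, norm_smul, Complex.norm_I, one_mul]
    have hcont : Continuous fun τ : ℝ => C * ((C * τ) ^ k / k.factorial * ‖x‖) := by fun_prop
    have h1 := intervalIntegral.norm_integral_le_of_norm_le (μ := volume) ht
      (f := fun τ => W τ (dysonTerm W k x τ)) (g := fun τ => C * ((C * τ) ^ k / k.factorial * ‖x‖))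
      (ae_of_all _ fun τ hτ => ((W τ).le_opNorm _).trans
        (mul_le_mul (hC τ) (ih hτ.1.le) (norm_nonneg _) hC0)) (hcont.intervalIntegrable _ _)
    refine h1.trans (le_of_eq ?_)
    have e : (fun τ : ℝ => C * ((C * τ) ^ k / k.factorial * ‖x‖)) =
        fun τ => (C ^ (k + 1) / k.factorial * ‖x‖) * τ ^ k := by
      funext τ
      rw [mul_pow, pow_succ]
      ring
    rw [e, intervalIntegral.integral_const_mul, integral_pow, Nat.factorial_succ]
    have h2 : ((k : ℝ) + 1) ≠ 0 := by positivity
    have h3 : (k.factorial : ℝ) ≠ 0 := by positivity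
    push_cast
    field_simp
    ring

theorem norm_dysonTerm_le' (hC : ∀ t, ‖W t‖ ≤ C) (k : ℕ)
    (x : X) {t : ℝ} (ht : t ∈ Icc 0 T) :
    ‖dysonTerm W k x t‖ ≤ (C * T) ^ k / k.factorial * ‖x‖ := by
  have hC0 : 0 ≤ C := (norm_nonneg _).trans (hC 0)
  refine (norm_dysonTerm_le hC k x ht.1).trans ?_
  have := ht.1
  have := ht.2
  gcongr

variable [CompleteSpace X]

theorem summable_dysonTerm (hC : ∀ t, ‖W t‖ ≤ C)
    (x : X) {t : ℝ} (ht : t ∈ Icc 0 T) : Summable fun k => dysonTerm W k x t :=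
  Summable.of_norm_bounded ((Real.summable_pow_div_factorial (C * T)).mul_right ‖x‖)
    fun k => norm_dysonTerm_le' hC k x ht

theorem dysonSum_add (hC : ∀ t, ‖W t‖ ≤ C) (hW : ∀ x, Continuous fun t => W t x)
    (x y : X) {t : ℝ} (ht : t ∈ Icc 0 T) : dysonSum W (x + y) t = dysonSum W x t + dysonSum W y t
      := by
  simp only [dysonSum, dysonTerm_add hC hW]
  exact (summable_dysonTerm hC x ht).tsum_add (summable_dysonTerm hC y ht)

theorem dysonSum_smul (c : ℂ) (x : X) (t : ℝ) : dysonSum W (c • x) t = c • dysonSum W x t := by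
  simp only [dysonSum, dysonTerm_smul]
  exact tsum_const_smul'' c

theorem norm_dysonSum_sub_le (hC : ∀ t, ‖W t‖ ≤ C) (K : ℕ)
    (x : X) {t : ℝ} (ht : t ∈ Icc 0 T) :
    ‖dysonSum W x t - ∑ k ∈ Finset.range K, dysonTerm W k x t‖ ≤
      (∑' k : ℕ, (C * T) ^ (k + K) / (k + K).factorial) * ‖x‖ := by
  have hs := summable_dysonTerm hC x ht
  have hb := (summable_nat_add_iff K).2 (Real.summable_pow_div_factorial (C * T))
  rw [dysonSum, ← hs.sum_add_tsum_nat_add K, add_sub_cancel_left, ← tsum_mul_right]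
  exact tsum_of_norm_bounded (hb.mul_right ‖x‖).hasSum fun k => norm_dysonTerm_le' hC _ x ht

theorem dysonSum_zero (x : X) : dysonSum W x 0 = x := by
  rw [dysonSum, tsum_eq_single 0]
  · rfl
  · intro k hk
    obtain ⟨k, rfl⟩ := Nat.exists_eq_succ_of_ne_zero hk
    simp [dysonTerm]

theorem continuousOn_dysonSum (hC : ∀ t, ‖W t‖ ≤ C) (hW : ∀ x, Continuous fun t => W t x) (x : X) :
    ContinuousOn (dysonSum W x) (Icc 0 T) :=
  continuousOn_tsum (fun k => (continuous_dysonTerm hC hW k x).1.continuousOn)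
    ((Real.summable_pow_div_factorial (C * T)).mul_right ‖x‖)
    fun k _ ht => norm_dysonTerm_le' hC k x ht

/-- Term-by-term integration, dominated by the exponential series in `C * T`, shifts the index by
one; the missing zeroth term is `x`. -/
theorem dysonSum_eq_integral (hC : ∀ t, ‖W t‖ ≤ C) (hW : ∀ x, Continuous fun t => W t x) (x : X)
    {t : ℝ} (ht : t ∈ Icc 0 T) :
    dysonSum W x t = x - Complex.I • ∫ τ in (0 : ℝ)..t, W τ (dysonSum W x τ) := by
  have hC0 : 0 ≤ C := (norm_nonneg _).trans (hC 0)
  have hs := summable_dysonTerm hC x ht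
  have hI : HasSum (fun k => ∫ τ in (0 : ℝ)..t, W τ (dysonTerm W k x τ))
      (∫ τ in (0 : ℝ)..t, W τ (dysonSum W x τ)) := by
    have hsub : uIoc 0 t ⊆ Icc 0 T := by
      rw [uIoc_of_le ht.1]
      exact fun τ hτ => ⟨hτ.1.le, hτ.2.trans ht.2⟩
    refine intervalIntegral.hasSum_integral_of_dominated_convergence
      (fun k _ => C * ((C * T) ^ k / k.factorial * ‖x‖))
      (fun k => (continuous_dysonTerm hC hW k x).2.aestronglyMeasurable) ?_ ?_ ?_ ?_
    · exact fun k => ae_of_all _ fun τ hτ => ((W τ).le_opNorm _).trans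
        (mul_le_mul (hC τ) (norm_dysonTerm_le' hC k x (hsub hτ)) (norm_nonneg _) hC0)
    · exact ae_of_all _ fun τ _ =>
        ((Real.summable_pow_div_factorial (C * T)).mul_right ‖x‖).mul_left C
    · exact intervalIntegrable_const
    · exact ae_of_all _ fun τ hτ =>
        (W τ).hasSum (summable_dysonTerm hC x (hsub hτ)).hasSum
  rw [dysonSum, hs.tsum_eq_zero_add, sub_eq_add_neg]
  congr 1
  exact ((hI.const_smul Complex.I).neg).tsum_eq

/-- A continuous function on an interval that has the primitive `z` there in the integrated sense is
the derivative of `z`. -/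
theorem hasDerivWithinAt_of_eq_integral {z g : ℝ → X} {x : X} (hT : 0 ≤ T)
    (hg : ContinuousOn g (Icc 0 T)) (h : ∀ t ∈ Icc 0 T, z t = x + ∫ τ in (0 : ℝ)..t, g τ)
    {t : ℝ} (ht : t ∈ Icc 0 T) : HasDerivWithinAt z (g t) (Icc 0 T) t := by
  -- Constant continuation beyond the ends of the interval makes the two-sided fundamental theorem
  -- of calculus available at the end points as well.
  let g' : ℝ → X := fun τ => g (projIcc 0 T hT τ)
  have hg' : Continuous g' := hg.comp_continuous (continuous_subtype_val.comp continuous_projIcc)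
    fun τ => (projIcc 0 T hT τ).2
  have hgg : ∀ τ ∈ Icc 0 T, g' τ = g τ := fun τ hτ => by simp only [g', projIcc_of_mem hT hτ]
  have hz : ∀ t ∈ Icc 0 T, z t = x + ∫ τ in (0 : ℝ)..t, g' τ := fun t ht => by
    rw [h t ht]
    congr 1
    refine intervalIntegral.integral_congr fun τ hτ => ?_
    rw [uIcc_of_le ht.1] at hτ
    exact (hgg τ ⟨hτ.1, hτ.2.trans ht.2⟩).symm
  have hd := (intervalIntegral.integral_hasDerivAt_right (hg'.intervalIntegrable 0 t)
    (hg'.stronglyMeasurableAtFilter _ _) hg'.continuousAt).const_add x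
  rw [hgg t ht] at hd
  exact hd.hasDerivWithinAt.congr hz (hz t ht)

theorem hasDerivWithinAt_dysonSum (hC : ∀ t, ‖W t‖ ≤ C) (hW : ∀ x, Continuous fun t => W t x)
    (x : X) {t : ℝ} (ht : t ∈ Icc 0 T) :
    HasDerivWithinAt (dysonSum W x) (-(Complex.I • W t (dysonSum W x t))) (Icc 0 T) t := by
  have hT : 0 ≤ T := ht.1.trans ht.2
  refine hasDerivWithinAt_of_eq_integral (x := x)
    (g := fun t => -(Complex.I • W t (dysonSum W x t))) hT ?_ (fun t ht => ?_) ht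
  · exact ((continuousOn_apply_apply (fun t _ => hC t) (fun x => (hW x).continuousOn)
      (continuousOn_dysonSum hC hW x)).const_smul Complex.I).neg
  · rw [dysonSum_eq_integral hC hW x ht, intervalIntegral.integral_neg,
      intervalIntegral.integral_smul, sub_eq_add_neg]

/-- Uniqueness for a differential inequality in the weak sense. -/
theorem eq_zero_of_weak_deriv {F ι : Type*} [NormedAddCommGroup F] [NormedSpace ℂ F]
    [CompleteSpace F] (ev : ι → X →L[ℂ] F) (hev : ∀ x, (∀ i, ev i x = 0) → x = 0)
    {z g : ℝ → X} (hT : 0 ≤ T) (hz : ContinuousOn z (Icc 0 T)) (hg : ContinuousOn g (Icc 0 T))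
    (hz0 : z 0 = 0) (hd : ∀ i, ∀ t ∈ Icc 0 T,
      HasDerivWithinAt (fun t => ev i (z t)) (ev i (g t)) (Icc 0 T) t)
    {K : ℝ} (hK : ∀ t ∈ Icc 0 T, ‖g t‖ ≤ K * ‖z t‖) {t : ℝ} (ht : t ∈ Icc 0 T) : z t = 0 := by
  have hgi : ∀ t ∈ Icc 0 T, IntervalIntegrable g volume 0 t := fun t ht =>
    (hg.mono (by rw [uIcc_of_le ht.1]; exact Icc_subset_Icc_right ht.2)).intervalIntegrable
  -- The fundamental theorem of calculus holds after each `ev i`, and these maps separate points, so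
  -- `z` is the Bochner integral of `g`. A continuous weak derivative is therefore a strong one, as
  -- Gronwall's inequality requires.
  have hzi : ∀ t ∈ Icc 0 T, z t = 0 + ∫ τ in (0 : ℝ)..t, g τ := by
    intro t ht
    rw [zero_add, ← sub_eq_zero]
    refine hev _ fun i => ?_
    have h1 := intervalIntegral.integral_eq_sub_of_hasDerivAt_of_le ht.1
      (f := fun t => ev i (z t)) (f' := fun t => ev i (g t))
      (((ev i).continuous.comp_continuousOn hz).mono (Icc_subset_Icc_right ht.2))
      (fun τ hτ => (hd i τ ⟨hτ.1.le, hτ.2.le.trans ht.2⟩).hasDerivAt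
        (Icc_mem_nhds hτ.1 (hτ.2.trans_le ht.2)))
      (((ev i).continuous.comp_continuousOn hg).mono (by
        rw [uIcc_of_le ht.1]; exact Icc_subset_Icc_right ht.2)).intervalIntegrable
    rw [(ev i).intervalIntegral_comp_comm (hgi t ht)] at h1
    rw [map_sub, h1, hz0, map_zero, sub_zero, sub_self]
  have h2 := norm_le_gronwallBound_of_norm_deriv_right_le (f := z) (f' := g) (δ := 0) (K := K)
    (ε := 0) (a := 0) (b := T) hz
    (fun t ht => ((hasDerivWithinAt_of_eq_integral hT hg hzi ⟨ht.1, ht.2.le⟩).mono_of_mem_nhdsWithin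
      (mem_nhdsWithin.2 ⟨Iio T, isOpen_Iio, ht.2, fun τ hτ => ⟨ht.1.trans hτ.2, hτ.1.le⟩⟩)))
    (by simp [hz0]) (fun t ht => by simpa using hK t ⟨ht.1, ht.2.le⟩) t ht
  simpa [gronwallBound_ε0_δ0] using h2

end Dyson

end

/-! ### Product rules for the free propagator acting on curves -/

section

section Slopes

variable {d n : ℕ} {m : ℝ} {α : Fin (d + 1) → Matrix (Fin n) (Fin n) ℂ}

theorem tendsto_sub_punctured (t₀ : ℝ) : Tendsto (fun t : ℝ => t - t₀) (𝓝[≠] t₀) (𝓝[≠] 0) := by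
  refine tendsto_nhdsWithin_iff.2 ⟨?_, ?_⟩
  · have : Tendsto (fun t : ℝ => t - t₀) (𝓝 t₀) (𝓝 (t₀ - t₀)) :=
      (continuous_id.sub continuous_const).tendsto t₀
    rw [sub_self] at this
    exact this.mono_left nhdsWithin_le_nhds
  · filter_upwards [self_mem_nhdsWithin] with t ht
    exact sub_ne_zero.2 ht

/-- In the group law the increment `t - t₀` acts on the test function first; on distributions this
differentiates `U₀(t)` in the form `-i D_m U₀(t₀)`. -/
theorem tendsto_slope_freeDual_at (hα : IsDiracMatrices α) (k j : Fin n) (φ : 𝓢(Pos d, ℂ))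
    (t₀ : ℝ) :
    Tendsto (fun t : ℝ => (((t - t₀ : ℝ) : ℂ)⁻¹) • (freeDual m α t k j φ - freeDual m α t₀ k j φ))
      (𝓝[≠] t₀) (𝓝 (∑ l, freeDual m α t₀ l j (generatorDual m α k l φ))) := by
  have h : ∀ l, Tendsto (fun t : ℝ => freeDual m α t₀ l j ((((t - t₀ : ℝ) : ℂ)⁻¹) •
      (freeDual m α (t - t₀) k l φ - freeDual m α 0 k l φ))) (𝓝[≠] t₀)
      (𝓝 (freeDual m α t₀ l j (generatorDual m α k l φ))) := fun l =>
    (((freeDual m α t₀ l j).continuous.tendsto _).comp (tendsto_slope_freeDual hα k l φ)).comp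
      (tendsto_sub_punctured t₀)
  refine (tendsto_finsetSum _ fun l _ => h l).congr fun t => ?_
  have e1 := freeDual_add (m := m) hα (t - t₀) t₀ k j φ
  have e2 := freeDual_add (m := m) hα 0 t₀ k j φ
  rw [sub_add_cancel] at e1
  rw [zero_add] at e2
  rw [e1, e2, ← Finset.sum_sub_distrib, Finset.smul_sum]
  exact Finset.sum_congr rfl fun l _ => by rw [map_smul, map_sub]

/-- With the factors of the group law in the other order the derivative takes the form `-i U₀(t₀)
D_m`, the one in which the Dirac term of a solution cancels. -/
theorem tendsto_slope_freeDual_at' (hα : IsDiracMatrices α) (k j : Fin n) (φ : 𝓢(Pos d, ℂ))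
    (t₀ : ℝ) :
    Tendsto (fun t : ℝ => (((t - t₀ : ℝ) : ℂ)⁻¹) • (freeDual m α t k j φ - freeDual m α t₀ k j φ))
      (𝓝[≠] t₀) (𝓝 (∑ l, generatorDual m α l j (freeDual m α t₀ k l φ))) := by
  have h : ∀ l, Tendsto (fun t : ℝ => (((t - t₀ : ℝ) : ℂ)⁻¹) •
      (freeDual m α (t - t₀) l j (freeDual m α t₀ k l φ) -
        freeDual m α 0 l j (freeDual m α t₀ k l φ))) (𝓝[≠] t₀)
      (𝓝 (generatorDual m α l j (freeDual m α t₀ k l φ))) := fun l =>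
    (tendsto_slope_freeDual hα l j (freeDual m α t₀ k l φ)).comp (tendsto_sub_punctured t₀)
  refine (tendsto_finsetSum _ fun l _ => h l).congr fun t => ?_
  have e1 := freeDual_add (m := m) hα t₀ (t - t₀) k j φ
  have e2 := freeDual_add (m := m) hα t₀ 0 k j φ
  rw [add_sub_cancel] at e1
  rw [add_zero] at e2
  rw [← Finset.smul_sum, Finset.sum_sub_distrib, ← e1, ← e2]

end Slopes

section Bilinear

variable {V : Type*} [NormedAddCommGroup V] [InnerProductSpace ℝ V] [FiniteDimensional ℝ V]
  [MeasurableSpace V] [BorelSpace V]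
  {F : Type*} [NormedAddCommGroup F] [NormedSpace ℂ F] [CompleteSpace F]
  {N : 𝓢'(V, F) → ℝ≥0∞} [hN : AdmissibleNorm N]

/-- Evaluations on the Banach space are bounded by one fixed Schwartz norm of the test function, so
the pairing is jointly continuous. -/
theorem tendsto_incl_apply {ι : Type*} {l : Filter ι} {x : ι → ClosureSpace N} {x₀ : ClosureSpace N}
    {c : ι → 𝓢(V, ℂ)} {c₀ : 𝓢(V, ℂ)} (hx : Tendsto x l (𝓝 x₀)) (hc : Tendsto c l (𝓝 c₀)) :
    Tendsto (fun i => incl N (x i) (c i)) l (𝓝 (incl N x₀ c₀)) := by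
  obtain ⟨L, C, hC, h⟩ := exists_eval_bound N
  have h1 : Tendsto (fun i => incl N (x i - x₀) (c i)) l (𝓝 0) := by
    have h2 : Tendsto (fun i => C * schwartzNorm V ℂ L (c i) * ‖x i - x₀‖) l (𝓝 0) := by
      have := ((((continuous_schwartzNorm L).tendsto c₀).comp hc).const_mul C).mul
        (hx.sub_const x₀).norm
      simpa using this
    exact squeeze_zero_norm (fun i => h _ _) h2
  have h3 := h1.add (((ContinuousLinearMap.continuous (incl N x₀ : 𝓢(V, ℂ) →L[ℂ] F)).tendsto
    c₀).comp hc)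
  rw [zero_add] at h3
  refine h3.congr fun i => ?_
  rw [map_sub, sub_apply]
  exact sub_add_cancel _ _

/-- The product rule for the pairing of a curve in a space of distributions and a curve of test
functions. -/
theorem hasDerivWithinAt_incl_apply {y : ℝ → ClosureSpace N} {c : ℝ → 𝓢(V, ℂ)} {c' : 𝓢(V, ℂ)}
    {Ω : Set ℝ} {t₀ : ℝ} {w : F} (hy : ContinuousWithinAt y Ω t₀)
    (hw : HasDerivWithinAt (fun t => incl N (y t) (c t₀)) w Ω t₀)
    (hc : Tendsto (fun t : ℝ => (((t - t₀ : ℝ) : ℂ)⁻¹) • (c t - c t₀)) (𝓝[≠] t₀) (𝓝 c')) :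
    HasDerivWithinAt (fun t => incl N (y t) (c t)) (w + incl N (y t₀) c') Ω t₀ := by
  rw [hasDerivWithinAt_iff_tendsto_slope] at hw ⊢
  have h1 := tendsto_incl_apply (hy.tendsto.mono_left (nhdsWithin_mono t₀ sdiff_subset))
    (hc.mono_left (nhdsWithin_mono t₀ (fun t (ht : t ∈ Ω \ {t₀}) => ht.2)))
  refine (hw.add h1).congr fun t => ?_
  simp only [slope, vsub_eq_sub]
  rw [map_smul, map_sub, ← Complex.ofReal_inv, Complex.coe_smul, ← smul_add]
  congr 1
  abel

end Bilinear

section Evolution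

variable {d n : ℕ} {m : ℝ} {α : Fin (d + 1) → Matrix (Fin n) (Fin n) ℂ}
  {N : 𝓢'(Pos d, Spinor n) → ℝ≥0∞} [hN : AdmissibleNorm N]

theorem hasDerivWithinAt_spinor {f : ℝ → Spinor n} {w : Spinor n} {Ω : Set ℝ} {t₀ : ℝ} :
    HasDerivWithinAt f w Ω t₀ ↔ ∀ k, HasDerivWithinAt (fun t => f t k) (w k) Ω t₀ := by
  refine ⟨fun h k => ?_, fun h => ?_⟩
  · exact ((EuclideanSpace.proj k : Spinor n →L[ℂ] ℂ).restrictScalars ℝ).hasFDerivAt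
      |>.comp_hasDerivWithinAt t₀ h
  · exact (PiLp.continuousLinearEquiv 2 ℝ fun _ : Fin n => ℂ).symm.hasFDerivAt
      |>.comp_hasDerivWithinAt t₀ (hasDerivWithinAt_pi.2 h)

/-- The strong derivative of `y` is combined with the derivative of the transposed propagator in the
Schwartz space. The term with `D_m` is formed in distributions and need not belong to the Banach
space, so the derivative is taken after testing. -/
theorem hasDerivWithinAt_freePropagator (hα : IsDiracMatrices α) {y : ℝ → ClosureSpace N}
    {y' : ClosureSpace N} {Ω : Set ℝ} {t₀ : ℝ} (hy : HasDerivWithinAt y y' Ω t₀)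
    (φ : 𝓢(Pos d, ℂ)) :
    HasDerivWithinAt (fun t => freePropagator m α t (incl N (y t)) φ)
      (freePropagator m α t₀ (incl N y') φ -
        Complex.I • diracOp m α (freePropagator m α t₀ (incl N (y t₀))) φ) Ω t₀ := by
  rw [hasDerivWithinAt_spinor]
  intro k
  have h1 : ∀ j, HasDerivWithinAt (fun t => incl N (y t) (freeDual m α t k j φ) j)
      ((incl N y' (freeDual m α t₀ k j φ) + incl N (y t₀)
        (∑ l, freeDual m α t₀ l j (generatorDual m α k l φ))) j) Ω t₀ := fun j =>
    hasDerivWithinAt_spinor.1 (hasDerivWithinAt_incl_apply hy.continuousWithinAt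
      ((evalCLM N (freeDual m α t₀ k j φ)).restrictScalars ℝ |>.hasFDerivAt.comp_hasDerivWithinAt
        t₀ hy) (tendsto_slope_freeDual_at hα k j φ t₀)) j
  simp only [freePropagator_apply]
  refine (HasDerivWithinAt.fun_sum fun j _ => h1 j).congr_deriv ?_
  rw [PiLp.sub_apply, PiLp.smul_apply, diracOp_apply, freePropagator_apply, smul_eq_mul, ←
      mul_assoc,
    Complex.I_mul_I, neg_one_mul, sub_neg_eq_add]
  simp only [PiLp.add_apply, Finset.sum_add_distrib, map_sum, freePropagator_apply]
  congr 1
  rw [Finset.sum_comm]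
  refine Finset.sum_congr rfl fun j _ => ?_
  simp

/-- The curve is assumed differentiable only after testing. The derivative of `U₀(-t)` contributes
`i U₀(-t) D_m ψ`, which cancels the Dirac term of the equation and leaves the contribution of `v`.
-/
theorem hasDerivWithinAt_freePropagator_neg (hα : IsDiracMatrices α) {ψ : ℝ → ClosureSpace N}
    {v : 𝓢'(Pos d, Spinor n)} {Ω : Set ℝ} {t₀ : ℝ} (hψ : ContinuousWithinAt ψ Ω t₀)
    (h : ∀ φ, HasDerivWithinAt (fun t => incl N (ψ t) φ)
      (v φ - Complex.I • diracOp m α (incl N (ψ t₀)) φ) Ω t₀)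
    (φ : 𝓢(Pos d, ℂ)) :
    HasDerivWithinAt (fun t => freePropagator m α (-t) (incl N (ψ t)) φ)
      (freePropagator m α (-t₀) v φ) Ω t₀ := by
  rw [hasDerivWithinAt_spinor]
  intro k
  have hc : ∀ j, Tendsto (fun t : ℝ => (((t - t₀ : ℝ) : ℂ)⁻¹) •
      (freeDual m α (-t) k j φ - freeDual m α (-t₀) k j φ)) (𝓝[≠] t₀)
      (𝓝 (-∑ l, generatorDual m α l j (freeDual m α (-t₀) k l φ))) := by
    intro j
    have hneg : Tendsto (fun t : ℝ => -t) (𝓝[≠] t₀) (𝓝[≠] (-t₀)) :=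
      tendsto_nhdsWithin_iff.2 ⟨(continuous_neg.tendsto t₀).mono_left nhdsWithin_le_nhds, by
        filter_upwards [self_mem_nhdsWithin] with t ht
        exact fun h => ht (neg_injective h)⟩
    refine ((tendsto_slope_freeDual_at' (m := m) hα k j φ (-t₀)).comp hneg).neg.congr fun t => ?_
    rw [Function.comp_apply, ← neg_smul]
    congr 1
    rw [neg_sub_neg, ← neg_sub t t₀, Complex.ofReal_neg, inv_neg, neg_neg]
  have h1 : ∀ j, HasDerivWithinAt (fun t => incl N (ψ t) (freeDual m α (-t) k j φ) j)
      ((v (freeDual m α (-t₀) k j φ) -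
        Complex.I • diracOp m α (incl N (ψ t₀)) (freeDual m α (-t₀) k j φ) + incl N (ψ t₀)
        (-∑ l, generatorDual m α l j (freeDual m α (-t₀) k l φ))) j) Ω t₀ := fun j =>
    hasDerivWithinAt_spinor.1 (hasDerivWithinAt_incl_apply
      (c := fun t => freeDual m α (-t) k j φ) hψ (h _) (hc j)) j
  simp only [freePropagator_apply]
  refine (HasDerivWithinAt.fun_sum fun j _ => h1 j).congr_deriv ?_
  simp only [PiLp.add_apply, PiLp.sub_apply, PiLp.smul_apply, diracOp_apply, smul_eq_mul, ←
      mul_assoc,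
    Complex.I_mul_I, neg_one_mul, sub_neg_eq_add, map_neg, PiLp.neg_apply, map_sum]
  rw [Finset.sum_add_distrib, Finset.sum_add_distrib, Finset.sum_neg_distrib, add_assoc,
    add_eq_left, Finset.sum_comm, add_neg_eq_zero]
  refine Finset.sum_congr rfl fun j _ => ?_
  simp

end Evolution

end

/-! ### The Dirac evolution in the interaction picture -/

section

section Evolution

variable {d n : ℕ} {N : 𝓢'(Pos d, Spinor n) → ℝ≥0∞} [hN : AdmissibleNorm N]

/-- The free propagators `U₀(t)`, `|t| ≤ T`, and the potentials `V(t)`, `0 ≤ t ≤ T`, form strongly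
continuous and bounded families of operators. -/
structure EvolutionFamilies (m : ℝ) (α : Fin (d + 1) → Matrix (Fin n) (Fin n) ℂ) (T : ℝ)
    (U₀ V : ℝ → ClosureSpace N →L[ℂ] ClosureSpace N) : Prop where
  pos : 0 < T
  dirac : IsDiracMatrices α
  free_bound : ∃ C, ∀ t ∈ Icc (-T) T, ‖U₀ t‖ ≤ C
  free_eq : ∀ t ∈ Icc (-T) T, ∀ x, incl N (U₀ t x) = freePropagator m α t (incl N x)
  free_cont : ∀ x, ContinuousOn (fun t => U₀ t x) (Icc (-T) T)
  pot_bound : ∃ C, ∀ t ∈ Icc 0 T, ‖V t‖ ≤ C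
  pot_cont : ∀ x, ContinuousOn (fun t => V t x) (Icc 0 T)

/-- The potential in the interaction picture, extended to all times by constants. -/
def interaction {T : ℝ} (hT : 0 ≤ T) (U₀ V : ℝ → ClosureSpace N →L[ℂ] ClosureSpace N) (t : ℝ) :
    ClosureSpace N →L[ℂ] ClosureSpace N :=
  U₀ (-(projIcc 0 T hT t : ℝ)) ∘L V (projIcc 0 T hT t) ∘L U₀ (projIcc 0 T hT t)

namespace EvolutionFamilies

variable {m T : ℝ} {α : Fin (d + 1) → Matrix (Fin n) (Fin n) ℂ}
  {U₀ V : ℝ → ClosureSpace N →L[ℂ] ClosureSpace N}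

theorem mem_of_nonneg (E : EvolutionFamilies m α T U₀ V)
    {t : ℝ} (ht : t ∈ Icc 0 T) : t ∈ Icc (-T) T :=
  ⟨by linarith [E.pos, ht.1], ht.2⟩

theorem neg_mem_of_nonneg (E : EvolutionFamilies m α T U₀ V)
    {t : ℝ} (ht : t ∈ Icc 0 T) : -t ∈ Icc (-T) T :=
  ⟨by linarith [ht.2], by linarith [E.pos, ht.1]⟩

theorem interaction_eq (E : EvolutionFamilies m α T U₀ V)
    {t : ℝ} (ht : t ∈ Icc 0 T) (x : ClosureSpace N) :
    interaction E.pos.le U₀ V t x = U₀ (-t) (V t (U₀ t x)) := by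
  simp only [interaction, projIcc_of_mem E.pos.le ht, ContinuousLinearMap.comp_apply]

theorem exists_norm_interaction_le (E : EvolutionFamilies m α T U₀ V)
    : ∃ C, ∀ t, ‖interaction E.pos.le U₀ V t‖ ≤ C := by
  obtain ⟨C, hC⟩ := E.free_bound
  obtain ⟨C', hC'⟩ := E.pot_bound
  refine ⟨C * (C' * C), fun t => ?_⟩
  have ht := (projIcc 0 T E.pos.le t).2
  have h1 := hC _ (E.neg_mem_of_nonneg ht)
  have h2 := hC' _ ht
  have h3 := hC _ (E.mem_of_nonneg ht)
  have hC0 : 0 ≤ C := (norm_nonneg _).trans h1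
  have hC0' : 0 ≤ C' := (norm_nonneg _).trans h2
  refine (ContinuousLinearMap.opNorm_comp_le _ _).trans ?_
  refine mul_le_mul h1 ((ContinuousLinearMap.opNorm_comp_le _ _).trans ?_) (norm_nonneg _) hC0
  exact mul_le_mul h2 h3 (norm_nonneg _) hC0'

theorem continuousOn_free_apply (E : EvolutionFamilies m α T U₀ V)
    {y : ℝ → ClosureSpace N} (hy : ContinuousOn y (Icc 0 T)) :
    ContinuousOn (fun t => U₀ t (y t)) (Icc 0 T) := by
  obtain ⟨C, hC⟩ := E.free_bound
  exact continuousOn_apply_apply (fun t ht => hC t (E.mem_of_nonneg ht))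
    (fun x => (E.free_cont x).mono fun t ht => E.mem_of_nonneg ht) hy

theorem continuousOn_free_neg_apply (E : EvolutionFamilies m α T U₀ V)
    {y : ℝ → ClosureSpace N} (hy : ContinuousOn y (Icc 0 T)) :
    ContinuousOn (fun t => U₀ (-t) (y t)) (Icc 0 T) := by
  obtain ⟨C, hC⟩ := E.free_bound
  exact continuousOn_apply_apply (A := fun t => U₀ (-t))
    (fun t ht => hC _ (E.neg_mem_of_nonneg ht))
    (fun x => (E.free_cont x).comp continuous_neg.continuousOn
      fun t ht => E.neg_mem_of_nonneg ht) hy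

theorem continuous_interaction (E : EvolutionFamilies m α T U₀ V) (x : ClosureSpace N) :
    Continuous fun t => interaction E.pos.le U₀ V t x := by
  obtain ⟨C, hC⟩ := E.pot_bound
  have h : ContinuousOn (fun t => U₀ (-t) (V t (U₀ t x))) (Icc 0 T) :=
    E.continuousOn_free_neg_apply (continuousOn_apply_apply hC E.pot_cont
      (E.continuousOn_free_apply continuousOn_const))
  exact h.comp_continuous (continuous_subtype_val.comp continuous_projIcc)
    fun t => (projIcc 0 T E.pos.le t).2

/-- The group law `U₀(t) U₀(-τ) = U₀(t - τ)` converts the integrand of the Dyson series into that of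
the Dyson–Phillips series. -/
theorem incl_free_interaction (E : EvolutionFamilies m α T U₀ V)
    {t τ : ℝ} (ht : t ∈ Icc 0 T) (hτ : τ ∈ Icc 0 T)
    (x : ClosureSpace N) : incl N (U₀ t (interaction E.pos.le U₀ V τ x)) =
      freePropagator m α (t - τ) (incl N (V τ (U₀ τ x))) := by
  rw [E.interaction_eq hτ, E.free_eq t (E.mem_of_nonneg ht), E.free_eq _ (E.neg_mem_of_nonneg hτ),
    freePropagator_freePropagator E.dirac, ← sub_eq_add_neg]

theorem free_free_neg (E : EvolutionFamilies m α T U₀ V)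
    {t : ℝ} (ht : t ∈ Icc 0 T) (x : ClosureSpace N) : U₀ t (U₀ (-t) x) = x := by
  apply incl_injective
  rw [E.free_eq t (E.mem_of_nonneg ht), E.free_eq _ (E.neg_mem_of_nonneg ht),
    freePropagator_freePropagator E.dirac, add_neg_cancel, freePropagator_zero]

theorem free_zero (E : EvolutionFamilies m α T U₀ V) (x : ClosureSpace N) : U₀ 0 x = x := by
  apply incl_injective
  rw [E.free_eq 0 (E.mem_of_nonneg (left_mem_Icc.2 E.pos.le)), freePropagator_zero]

/-- The Dyson series solves the Dirac equation. -/
theorem hasDerivWithinAt_propagator (E : EvolutionFamilies m α T U₀ V)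
    (x : ClosureSpace N) {t : ℝ} (ht : t ∈ Icc 0 T)
    (φ : 𝓢(Pos d, ℂ)) :
    HasDerivWithinAt
      (fun τ => incl N (U₀ τ (dysonSum (interaction E.pos.le U₀ V) x τ)) φ)
      (-(Complex.I • (diracOp m α (incl N (U₀ t (dysonSum (interaction E.pos.le U₀ V) x t))) +
        incl N (V t (U₀ t (dysonSum (interaction E.pos.le U₀ V) x t)))) φ)) (Icc 0 T) t := by
  obtain ⟨C, hC⟩ := E.exists_norm_interaction_le
  have h := hasDerivWithinAt_freePropagator (m := m) E.dirac
    (hasDerivWithinAt_dysonSum hC E.continuous_interaction x ht) φ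
  have e : ∀ τ ∈ Icc 0 T, incl N (U₀ τ (dysonSum (interaction E.pos.le U₀ V) x τ)) φ =
      freePropagator m α τ (incl N (dysonSum (interaction E.pos.le U₀ V) x τ)) φ :=
    fun τ hτ => by rw [E.free_eq τ (E.mem_of_nonneg hτ)]
  refine (h.congr e (e t ht)).congr_deriv ?_
  have e2 := E.incl_free_interaction ht ht (dysonSum (interaction E.pos.le U₀ V) x t)
  rw [sub_self, freePropagator_zero] at e2
  rw [← E.free_eq t (E.mem_of_nonneg ht), ← E.free_eq t (E.mem_of_nonneg ht), map_neg, map_smul,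
    map_neg, map_smul, e2, add_apply, smul_add, neg_apply, smul_apply]
  abel

/-- Uniqueness of the solution of the Dirac equation. -/
theorem eq_propagator (E : EvolutionFamilies m α T U₀ V)
    {ψ : ℝ → ClosureSpace N} (hψ : ContinuousOn ψ (Icc 0 T))
    (h : ∀ t ∈ Icc 0 T, ∀ φ, HasDerivWithinAt (fun τ => incl N (ψ τ) φ)
      (-(Complex.I • (diracOp m α (incl N (ψ t)) + incl N (V t (ψ t))) φ)) (Icc 0 T) t)
    {t : ℝ} (ht : t ∈ Icc 0 T) :
    ψ t = U₀ t (dysonSum (interaction E.pos.le U₀ V) (ψ 0) t) := by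
  obtain ⟨C, hC⟩ := E.exists_norm_interaction_le
  set W := interaction E.pos.le U₀ V
  have hS := fun t ht =>
    hasDerivWithinAt_dysonSum (T := T) (t := t) hC E.continuous_interaction (ψ 0) ht
  have hSc := continuousOn_dysonSum (T := T) hC E.continuous_interaction (ψ 0)
  have hy := E.continuousOn_free_neg_apply hψ
  have hWy : ∀ t ∈ Icc 0 T, W t (U₀ (-t) (ψ t)) = U₀ (-t) (V t (ψ t)) := fun t ht => by
    rw [E.interaction_eq ht, E.free_free_neg ht]
  have hyd : ∀ φ, ∀ t ∈ Icc 0 T, HasDerivWithinAt (fun t => evalCLM N φ (U₀ (-t) (ψ t)))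
      (evalCLM N φ (-(Complex.I • W t (U₀ (-t) (ψ t))))) (Icc 0 T) t := by
    intro φ t ht
    have h1 := hasDerivWithinAt_freePropagator_neg (m := m) (α := α)
      (v := -(Complex.I • incl N (V t (ψ t)))) E.dirac (hψ t ht)
      (fun χ => (h t ht χ).congr_deriv (by
        rw [add_apply, smul_add, neg_apply, smul_apply]
        abel)) φ
    have e : ∀ τ ∈ Icc 0 T, evalCLM N φ (U₀ (-τ) (ψ τ)) =
        freePropagator m α (-τ) (incl N (ψ τ)) φ := fun τ hτ => by
      rw [evalCLM_apply, E.free_eq _ (E.neg_mem_of_nonneg hτ)]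
    refine (h1.congr e (e t ht)).congr_deriv ?_
    have e2 : -(Complex.I • U₀ (-t) (V t (ψ t))) = U₀ (-t) (-(Complex.I • V t (ψ t))) := by
      rw [map_neg, map_smul]
    rw [evalCLM_apply, hWy t ht, e2, E.free_eq _ (E.neg_mem_of_nonneg ht), map_neg, map_smul]
  -- The curve `U₀(-t) ψ(t)` is known to be differentiable only after testing, the Dyson sum
  -- strongly. Their difference starts at zero and solves `i z' = W(t) z` weakly, hence vanishes.
  have hz := eq_zero_of_weak_deriv (evalCLM N)
    (fun x hx => incl_injective (by ext1 φ; rw [map_zero]; exact hx φ))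
    (z := fun t => U₀ (-t) (ψ t) - dysonSum W (ψ 0) t)
    (g := fun t => -(Complex.I • W t (U₀ (-t) (ψ t) - dysonSum W (ψ 0) t))) (K := C)
    E.pos.le (hy.sub hSc)
    ((continuousOn_apply_apply (fun t _ => hC t)
      (fun x => (E.continuous_interaction x).continuousOn) (hy.sub hSc)).const_smul
        Complex.I).neg
    (by simp only [neg_zero]; rw [E.free_zero, dysonSum_zero, sub_self])
    (fun φ t ht => by
      have h1 := (hyd φ t ht).sub (((evalCLM N φ).restrictScalars ℝ).hasFDerivAt
        |>.comp_hasDerivWithinAt t (hS t ht))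
      refine (h1.congr_of_mem (fun τ _ => ?_) ht).congr_deriv ?_
      · exact map_sub _ _ _
      · change evalCLM N φ _ - evalCLM N φ _ = _
        rw [← map_sub, map_sub (W t), smul_sub]
        congr 1
        abel)
    (fun t _ => by
      rw [norm_neg, norm_smul, Complex.norm_I, one_mul]
      exact ((W t).le_opNorm _).trans (mul_le_mul_of_nonneg_right (hC t) (norm_nonneg _))) ht
  have hz' : U₀ (-t) (ψ t) = dysonSum W (ψ 0) t := sub_eq_zero.1 hz
  rw [← hz', E.free_free_neg ht]

/-- The map `U₀ t` followed by evaluation at `φ` is continuous and passes under the Bochner integral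
of the recursion, which also gives the integrability of the tested integrand. -/
theorem dysonTerm_succ_apply (E : EvolutionFamilies m α T U₀ V)
    (k : ℕ) (x : ClosureSpace N) {t : ℝ} (ht : t ∈ Icc 0 T)
    (φ : 𝓢(Pos d, ℂ)) :
    IntervalIntegrable (fun τ => freePropagator m α (t - τ) (incl N (V τ (U₀ τ
      (dysonTerm (interaction E.pos.le U₀ V) k x τ)))) φ) volume 0 t ∧
    incl N (U₀ t (dysonTerm (interaction E.pos.le U₀ V) (k + 1) x t)) φ =
      -(Complex.I • ∫ τ in (0 : ℝ)..t, freePropagator m α (t - τ) (incl N (V τ (U₀ τ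
        (dysonTerm (interaction E.pos.le U₀ V) k x τ)))) φ) := by
  obtain ⟨C, hC⟩ := E.exists_norm_interaction_le
  have hc := (continuous_dysonTerm hC E.continuous_interaction k x).2
  have e : ∀ τ ∈ uIcc 0 t, freePropagator m α (t - τ) (incl N (V τ (U₀ τ
      (dysonTerm (interaction E.pos.le U₀ V) k x τ)))) φ = (evalCLM N φ ∘L U₀ t)
        (interaction E.pos.le U₀ V τ (dysonTerm (interaction E.pos.le U₀ V) k x τ)) := by
    intro τ hτ
    rw [uIcc_of_le ht.1] at hτ
    rw [ContinuousLinearMap.comp_apply, evalCLM_apply,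
      E.incl_free_interaction ht ⟨hτ.1, hτ.2.trans ht.2⟩]
  constructor
  · refine IntervalIntegrable.congr (fun τ hτ => (e τ (uIoc_subset_uIcc hτ)).symm)
      (((evalCLM N φ ∘L U₀ t).continuous.comp hc).intervalIntegrable 0 t)
  · rw [intervalIntegral.integral_congr e, ContinuousLinearMap.intervalIntegral_comp_comm _
      (hc.intervalIntegrable 0 t), dysonTerm, map_neg, map_smul, map_neg, map_smul, neg_apply,
      smul_apply]
    rfl

end EvolutionFamilies

end Evolution

end

/-! ### Transfer to distributions and proof of the theorem -/

section

section Transfer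

variable {V : Type*} [NormedAddCommGroup V] [InnerProductSpace ℝ V] [FiniteDimensional ℝ V]
  [MeasurableSpace V] [BorelSpace V]
  {F : Type*} [NormedAddCommGroup F] [NormedSpace ℂ F] [CompleteSpace F]
  {N : 𝓢'(V, F) → ℝ≥0∞} [hN : AdmissibleNorm N]

open Classical in
/-- A map of the closure of the Schwartz class to itself, regarded as a map on distributions. -/
def onDistributions (A : ClosureSpace N → ClosureSpace N) (f : 𝓢'(V, F)) : 𝓢'(V, F) :=
  if h : f ∈ schwartzClosure N then incl N (A (toClosure f h)) else 0

theorem onDistributions_incl (A : ClosureSpace N → ClosureSpace N) (x : ClosureSpace N) :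
    onDistributions A (incl N x) = incl N (A x) := by
  rw [onDistributions, dif_pos (incl_mem x), toClosure_incl]

theorem exists_incl_eq {f : 𝓢'(V, F)} (hf : f ∈ schwartzClosure N) : ∃ x, incl N x = f :=
  ⟨toClosure f hf, rfl⟩

theorem norm_incl_le_iff {C : ℝ≥0} {x y : ClosureSpace N} :
    N (incl N x) ≤ C * N (incl N y) ↔ ‖x‖ ≤ C * ‖y‖ := by
  have e : ∀ x : ClosureSpace N, N (incl N x) = ENNReal.ofReal ‖x‖ := fun x =>
    (ClosureSpace.ofReal_norm x).symm
  rw [e, e, ← ENNReal.ofReal_coe_nnreal, ← ENNReal.ofReal_mul C.coe_nonneg,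
    ENNReal.ofReal_le_ofReal_iff (by positivity)]

theorem isBoundedOn_onDistributions {A : ClosureSpace N → ClosureSpace N}
    (hadd : ∀ x y, A (x + y) = A x + A y) (hsmul : ∀ (c : ℂ) x, A (c • x) = c • A x)
    {C : ℝ} (hC : ∀ x, ‖A x‖ ≤ C * ‖x‖) :
    IsBoundedOn N (schwartzClosure N) (onDistributions A) where
  mapsTo f hf := by
    obtain ⟨x, rfl⟩ := exists_incl_eq hf
    rw [onDistributions_incl]
    exact incl_mem _
  map_add f hf g hg := by
    obtain ⟨x, rfl⟩ := exists_incl_eq hf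
    obtain ⟨y, rfl⟩ := exists_incl_eq hg
    rw [← map_add, onDistributions_incl, onDistributions_incl, onDistributions_incl, hadd, map_add]
  map_smul c f hf := by
    obtain ⟨x, rfl⟩ := exists_incl_eq hf
    rw [← map_smul, onDistributions_incl, onDistributions_incl, hsmul, map_smul]
  bound := by
    refine ⟨C.toNNReal, fun f hf => ?_⟩
    obtain ⟨x, rfl⟩ := exists_incl_eq hf
    rw [onDistributions_incl, norm_incl_le_iff]
    exact (hC x).trans (mul_le_mul_of_nonneg_right (Real.le_coe_toNNReal C) (norm_nonneg _))

theorem isContinuousCurve_incl_iff {T : ℝ} {y : ℝ → ClosureSpace N} :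
    IsContinuousCurve N (schwartzClosure N) T (fun t => incl N (y t)) ↔
      ContinuousOn y (Icc 0 T) := by
  have e : ∀ t t₀, N (incl N (y t) - incl N (y t₀)) = ENNReal.ofReal ‖y t - y t₀‖ := fun t t₀ => by
    rw [ClosureSpace.ofReal_norm, ← map_sub]
    rfl
  constructor
  · intro h t₀ ht₀
    rw [ContinuousWithinAt, tendsto_iff_norm_sub_tendsto_zero]
    have h1 := (ENNReal.tendsto_toReal ENNReal.zero_ne_top).comp (h.tendsto t₀ ht₀)
    refine h1.congr fun t => ?_
    rw [Function.comp_apply, e, ENNReal.toReal_ofReal (norm_nonneg _)]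
  · intro h
    refine ⟨fun t _ => incl_mem _, fun t₀ ht₀ => ?_⟩
    have h1 := tendsto_iff_norm_sub_tendsto_zero.1 (h t₀ ht₀)
    have h2 := ENNReal.tendsto_ofReal h1
    rw [ENNReal.ofReal_zero] at h2
    simpa only [e] using h2

end Transfer

section Main

variable {d n : ℕ} {N : 𝓢'(Pos d, Spinor n) → ℝ≥0∞} [hN : AdmissibleNorm N]
  {m T : ℝ} {α : Fin (d + 1) → Matrix (Fin n) (Fin n) ℂ}
  {U₀ V : ℝ → ClosureSpace N →L[ℂ] ClosureSpace N}

theorem smul_I_eq_iff {v w : Spinor n} : Complex.I • w = v ↔ w = -(Complex.I • v) := by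
  constructor
  · rintro rfl
    rw [smul_smul, Complex.I_mul_I, neg_one_smul, neg_neg]
  · rintro rfl
    rw [smul_neg, smul_smul, Complex.I_mul_I, neg_one_smul, neg_neg]

/-- The propagator of the Dirac equation, as an operator on the closure of the Schwartz class. -/
def propagator (hT : 0 ≤ T) (U₀ V : ℝ → ClosureSpace N →L[ℂ] ClosureSpace N) (t : ℝ)
    (x : ClosureSpace N) : ClosureSpace N :=
  U₀ t (dysonSum (interaction hT U₀ V) x t)

/-- The terms of the Dyson–Phillips series, as operators on the closure of the Schwartz class. -/
def propagatorTerm (hT : 0 ≤ T) (U₀ V : ℝ → ClosureSpace N →L[ℂ] ClosureSpace N) (k : ℕ) (t : ℝ)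
    (x : ClosureSpace N) : ClosureSpace N :=
  U₀ t (dysonTerm (interaction hT U₀ V) k x t)

namespace EvolutionFamilies

theorem isSolution (E : EvolutionFamilies m α T U₀ V) (x : ClosureSpace N) :
    IsSolution m α N (schwartzClosure N) T (fun t => onDistributions (V t)) (incl N x)
      (fun t => onDistributions (propagator E.pos.le U₀ V t) (incl N x)) := by
  obtain ⟨C, hC⟩ := E.exists_norm_interaction_le
  simp only [onDistributions_incl]
  refine ⟨?_, ?_, fun t ht φ => ⟨_, E.hasDerivWithinAt_propagator x ht φ, ?_⟩⟩
  · exact isContinuousCurve_incl_iff.2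
      (E.continuousOn_free_apply (continuousOn_dysonSum hC E.continuous_interaction x))
  · rw [propagator, dysonSum_zero, E.free_zero]
  · rw [smul_I_eq_iff, onDistributions_incl]
    rfl

theorem eq_of_isSolution (E : EvolutionFamilies m α T U₀ V) {x : ClosureSpace N}
    {ψ : ℝ → 𝓢'(Pos d, Spinor n)}
    (h : IsSolution m α N (schwartzClosure N) T (fun t => onDistributions (V t)) (incl N x) ψ)
    {t : ℝ} (ht : t ∈ Icc 0 T) :
    ψ t = onDistributions (propagator E.pos.le U₀ V t) (incl N x) := by
  have h0 : (0 : ℝ) ∈ Icc 0 T := left_mem_Icc.2 E.pos.le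
  -- The curve is lifted to the Banach space. Values of `y` outside `[0, T]` are arbitrary, so
  -- continuity and derivatives are transferred within the interval only.
  choose! y hy using fun t (ht : t ∈ Icc 0 T) => exists_incl_eq (h.curve.mem t ht)
  have hyc : ContinuousOn y (Icc 0 T) := by
    refine isContinuousCurve_incl_iff.1 ⟨fun t _ => incl_mem _, fun t₀ ht₀ => ?_⟩
    refine (h.curve.tendsto t₀ ht₀).congr' ?_
    filter_upwards [self_mem_nhdsWithin] with t ht
    rw [hy t ht, hy t₀ ht₀]
  have hy0 : y 0 = x := incl_injective (by rw [hy 0 h0, h.initial])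
  have key := E.eq_propagator hyc (fun t ht φ => by
    obtain ⟨w, hw, hw'⟩ := h.equation t ht φ
    rw [smul_I_eq_iff, ← hy t ht, onDistributions_incl] at hw'
    rw [← hw']
    exact hw.congr (fun τ hτ => by rw [hy τ hτ]) (by rw [hy t ht])) ht
  rw [onDistributions_incl, propagator, ← hy t ht, key, hy0]

theorem exists_norm_propagator_le (E : EvolutionFamilies m α T U₀ V) :
    ∃ C : ℝ≥0, ∀ t ∈ Icc 0 T, ∀ x, ‖propagator E.pos.le U₀ V t x‖ ≤ C * ‖x‖ := by
  obtain ⟨C, hC⟩ := E.exists_norm_interaction_le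
  obtain ⟨B, hB⟩ := E.free_bound
  -- The tail estimate is used with `K = 0`, which leaves the full exponential series.
  refine ⟨(B * ∑' k : ℕ, (C * T) ^ (k + 0) / (k + 0).factorial).toNNReal, fun t ht x => ?_⟩
  have h1 := norm_dysonSum_sub_le hC 0 x ht
  rw [Finset.sum_range_zero, sub_zero] at h1
  have h2 := hB t (E.mem_of_nonneg ht)
  refine ((U₀ t).le_opNorm _).trans ((mul_le_mul h2 h1 (norm_nonneg _)
    ((norm_nonneg _).trans h2)).trans ?_)
  rw [← mul_assoc]
  exact mul_le_mul_of_nonneg_right (Real.le_coe_toNNReal _) (norm_nonneg _)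

theorem isBoundedOn_propagator (E : EvolutionFamilies m α T U₀ V) {t : ℝ} (ht : t ∈ Icc 0 T) :
    IsBoundedOn N (schwartzClosure N) (onDistributions (propagator E.pos.le U₀ V t)) := by
  obtain ⟨C, hC⟩ := E.exists_norm_interaction_le
  obtain ⟨B, hB⟩ := E.exists_norm_propagator_le
  refine isBoundedOn_onDistributions (fun x y => ?_) (fun c x => ?_) (hB t ht)
  · rw [propagator, dysonSum_add hC E.continuous_interaction x y ht, map_add]
    rfl
  · rw [propagator, dysonSum_smul, map_smul]
    rfl

theorem isDysonPhillips (E : EvolutionFamilies m α T U₀ V) :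
    IsDysonPhillips m α N (schwartzClosure N) T (fun t => onDistributions (V t))
      (fun k t => onDistributions (propagatorTerm E.pos.le U₀ V k t)) := by
  obtain ⟨C, hC⟩ := E.exists_norm_interaction_le
  refine ⟨fun k t ht => ?_, fun t ht f hf => ?_, fun k t ht f hf φ => ?_⟩
  · refine isBoundedOn_onDistributions (fun x y => ?_) (fun c x => ?_)
      (C := ‖U₀ t‖ * ((C * T) ^ k / k.factorial)) (fun x => ?_)
    · rw [propagatorTerm, dysonTerm_add hC E.continuous_interaction, map_add]
      rfl
    · rw [propagatorTerm, dysonTerm_smul, map_smul]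
      rfl
    · rw [mul_assoc]
      exact ((U₀ t).le_opNorm _).trans
        (mul_le_mul_of_nonneg_left (norm_dysonTerm_le' hC k x ht) (norm_nonneg _))
  · obtain ⟨x, rfl⟩ := exists_incl_eq hf
    rw [onDistributions_incl]
    exact E.free_eq t (E.mem_of_nonneg ht) x
  · obtain ⟨x, rfl⟩ := exists_incl_eq hf
    simp only [onDistributions_incl]
    exact E.dysonTerm_succ_apply k x ht φ

/-- The Dyson–Phillips series converges in operator norm, uniformly in time. -/
theorem exists_norm_sub_sum_le (E : EvolutionFamilies m α T U₀ V) {ε : ℝ≥0} (hε : 0 < ε) :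
    ∃ K₀ : ℕ, ∀ K ≥ K₀, ∀ t ∈ Icc 0 T, ∀ f ∈ schwartzClosure N,
      N (onDistributions (propagator E.pos.le U₀ V t) f - ∑ k ∈ Finset.range K,
        onDistributions (propagatorTerm E.pos.le U₀ V k t) f) ≤ ε * N f := by
  obtain ⟨C, hC⟩ := E.exists_norm_interaction_le
  obtain ⟨B, hB⟩ := E.free_bound
  have hlim : Tendsto (fun K : ℕ => B * ∑' k : ℕ, (C * T) ^ (k + K) / (k + K).factorial) atTop
      (𝓝 0) := by
    have := (tendsto_sum_nat_add fun k : ℕ => (C * T) ^ k / k.factorial).const_mul B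
    rwa [mul_zero] at this
  obtain ⟨K₀, hK₀⟩ := eventually_atTop.1 (hlim.eventually (gt_mem_nhds (NNReal.coe_pos.2 hε)))
  refine ⟨K₀, fun K hK t ht f hf => ?_⟩
  obtain ⟨x, rfl⟩ := exists_incl_eq hf
  simp only [onDistributions_incl]
  rw [← map_sum, ← map_sub, norm_incl_le_iff]
  have e : propagator E.pos.le U₀ V t x - ∑ k ∈ Finset.range K, propagatorTerm E.pos.le U₀ V k t x =
      U₀ t (dysonSum (interaction E.pos.le U₀ V) x t -
        ∑ k ∈ Finset.range K, dysonTerm (interaction E.pos.le U₀ V) k x t) := by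
    rw [map_sub, map_sum]
    rfl
  have h2 := hB t (E.mem_of_nonneg ht)
  rw [e]
  refine ((U₀ t).le_opNorm _).trans ((mul_le_mul h2 (norm_dysonSum_sub_le hC K x ht)
    (norm_nonneg _) ((norm_nonneg _).trans h2)).trans ?_)
  rw [← mul_assoc]
  exact mul_le_mul_of_nonneg_right (hK₀ K hK).le (norm_nonneg _)

end EvolutionFamilies

end Main

/-- The weight of Young's inequality carries the exponent `γ` in position and in frequency
separately, so `|r| ≤ γ` and `|s| ≤ γ` are the bounds drawn from `hrs`. The amalgam case is the
modulation case with the variables exchanged. -/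
theorem exists_solidNorm {d n : ℕ} {p q : ℝ≥0∞} (hp : 1 ≤ p) (hq : 1 ≤ q) {γ r s : ℝ}
    (hrs : |r| + |s| ≤ γ) (g : 𝓢(Pos d, ℂ)) {N : 𝓢'(Pos d, Spinor n) → ℝ≥0∞}
    (hN : N = modulationNorm p q r s g ∨ N = amalgamNorm p q r s g) :
    ∃ M : (Pos d × Pos d → ℝ≥0∞) → ℝ≥0∞, SolidNorm γ M ∧ N = solidTF M g := by
  have hr : |r| ≤ γ := by linarith [abs_nonneg s]
  have hs : |s| ≤ γ := by linarith [abs_nonneg r]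
  have hM := solidNorm_mixedFun (V := Pos d) hp hq hr hs
  rcases hN with rfl | rfl
  · exact ⟨_, hM, funext fun f => modulationNorm_eq g f⟩
  · exact ⟨_, hM.swap, funext fun f => amalgamNorm_eq g f⟩

end

end DiracTF

end

theorem theorem1p2 {d n : ℕ} (m : ℝ) (hm : 0 ≤ m)
    (α : Fin (d + 1) → Matrix (Fin n) (Fin n) ℂ) (hα : IsDiracMatrices α)
    (p q : ℝ≥0∞) (hp : 1 ≤ p) (hq : 1 ≤ q)
    (γ r s : ℝ) (hγ : 0 ≤ γ) (hrs : |r| + |s| ≤ γ)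
    (g : 𝓢(Pos d, ℂ)) (hg : g ≠ 0)
    (N : 𝓢'(Pos d, Spinor n) → ℝ≥0∞)
    (hN : N = modulationNorm p q r s g ∨ N = amalgamNorm p q r s g)
    (X : Set 𝓢'(Pos d, Spinor n)) (hX : X = schwartzClosure N)
    (T : ℝ) (hT : 0 < T)
    (σ : ℝ → 𝓢'(Phase d, SpinorOp n))
    (hσ : NarrowlyContinuousOn (2 * γ) σ (Icc 0 T)) :
    ∃ V : ℝ → 𝓢'(Pos d, Spinor n) → 𝓢'(Pos d, Spinor n),
      (∀ t ∈ Icc 0 T, IsWeylOperatorOn N X (σ t) (V t)) ∧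
      ∃ U : ℝ → 𝓢'(Pos d, Spinor n) → 𝓢'(Pos d, Spinor n),
        (∀ ψ₀ ∈ X, IsSolution m α N X T V ψ₀ (fun t => U t ψ₀) ∧
          ∀ ψ, IsSolution m α N X T V ψ₀ ψ → ∀ t ∈ Icc 0 T, ψ t = U t ψ₀) ∧
        (∀ t ∈ Icc 0 T, IsBoundedOn N X (U t)) ∧
        (∃ C : ℝ≥0, ∀ t ∈ Icc 0 T, ∀ ψ₀ ∈ X, N (U t ψ₀) ≤ C * N ψ₀) ∧
        ∃ D : ℕ → ℝ → 𝓢'(Pos d, Spinor n) → 𝓢'(Pos d, Spinor n),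
          IsDysonPhillips m α N X T V D ∧
          ∀ ε : ℝ≥0, 0 < ε → ∃ K₀ : ℕ, ∀ K ≥ K₀, ∀ t ∈ Icc 0 T, ∀ ψ₀ ∈ X,
            N (U t ψ₀ - ∑ k ∈ Finset.range K, D k t ψ₀) ≤ ε * N ψ₀ := by
  obtain ⟨M, hM, rfl⟩ := exists_solidNorm (γ := γ) hp hq hrs g hN
  have hadm := hM.admissible (F := Spinor n) hg
  have hB := hM.tfBounds (F := Spinor n) hg
  obtain ⟨U₀, hU₁, hU₂, hU₃⟩ := hB.exists_free_operators (m := m) hγ hg hα T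
  obtain ⟨V, hV₁, hV₂, hV₃⟩ := hB.exists_weyl_operators hγ hσ
  -- The time-frequency analysis ends here: what follows needs only the Banach space, the two
  -- strongly continuous families and the evaluations at test functions.
  have E : EvolutionFamilies m α T U₀ V := ⟨hT, hα, hU₁, hU₂, hU₃, hV₁, hV₃⟩
  subst hX
  refine ⟨fun t => onDistributions (V t), fun t ht => ⟨?_, fun f => ?_⟩,
    fun t => onDistributions (propagator E.pos.le U₀ V t), fun ψ₀ hψ₀ => ?_,
    fun t ht => E.isBoundedOn_propagator ht, ?_,
    fun k t => onDistributions (propagatorTerm E.pos.le U₀ V k t), E.isDysonPhillips,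
    fun ε hε => E.exists_norm_sub_sum_le hε⟩
  · exact isBoundedOn_onDistributions (map_add (V t)) (map_smul (V t)) (V t).le_opNorm
  · have e : onDistributions (V t) (f : 𝓢'(Pos d, Spinor n)) = weylDist (σ t) f := by
      rw [← hV₂ t ht f, ← onDistributions_incl]
      rfl
    change IsWeylTransform (σ t) f (onDistributions (V t) (f : 𝓢'(Pos d, Spinor n)))
    rw [e]
    exact isWeylTransform_weylDist (σ t) f
  · obtain ⟨x, rfl⟩ := exists_incl_eq hψ₀
    exact ⟨E.isSolution x, fun ψ hψ t ht => E.eq_of_isSolution hψ ht⟩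
  · obtain ⟨C, hC⟩ := E.exists_norm_propagator_le
    refine ⟨C, fun t ht ψ₀ hψ₀ => ?_⟩
    obtain ⟨x, rfl⟩ := exists_incl_eq hψ₀
    beta_reduce
    rw [onDistributions_incl, norm_incl_le_iff]
    exact hC t ht x
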